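/- Let $F$ be a local field (a nonarchimedean local field of any characteristic, $\mathbb R$, or $\mathbb C$), $|\cdot|$ its normalized absolute value (so $|z|=z\bar z$ on $\mathbb C$), and $\psi:F\to\mathbb C^\times$ a nontrivial continuous unitary additive character; if $F$ is nonarchimedean with ring of integers $\mathfrak o$ and residue cardinality $q$, assume that the conductor of $\psi$ (the largest fractional ideal on which it is trivial) is $\mathfrak o$. Let $dx$ be the Haar measure on $F$ that is self-dual for $\psi$ and $d^\times x=dx/|x|$ on $F^\times$. *Local factors.* For a continuous character $\omega:F^\times\to\mathbb C^\times$ and $s\in\mathbb C$ put $\gamma(\omega,s,\psi)=\epsilon(\omega,s,\psi)L(\omega^{-1},1-s)/L(\omega,s)$, where: (i) for $F$ nonarchimedean with uniformizer $\varpi$, $L(\omega,s)=(1-\omega(\varpi)q^{-s})^{-1}$ and $\epsilon=1$ if $\omega$ is unramified, while $L(\omega,s)=1$ and $\epsilon(\omega,s,\psi)=\int_{\varpi^{-a}\mathfrak o^\times}\omega^{-1}(x)|x|^{-s}\psi(x)\,dx$ if $\omega$ is ramified of conductor exponent $a$; (ii) for $F=\mathbb R$, $\omega=\mathrm{sgn}^N|\cdot|^w$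 with $N\in\{0,1\}$ and $\psi(x)=e^{2\pi i bx}$, $L(\omega,s)=\pi^{-(s+w+N)/2}\,\Gamma\big(\tfrac{s+w+N}{2}\big)$ and $\epsilon(\omega,s,\psi)=\omega(b)|b|^{s-1/2}i^N$; (iii) for $F=\mathbb C$, $\omega(z)=(z/\sqrt{z\bar z})^n(z\bar z)^w$ with $n\in\mathbb Z$ and $\psi(z)=e^{2\pi i\,\mathrm{Tr}_{\mathbb C/\mathbb R}(bz)}$, $L(\omega,s)=2(2\pi)^{-(s+w+|n|/2)}\,\Gamma\big(s+w+\tfrac{|n|}2\big)$ and $\epsilon(\omega,s,\psi)=\omega(b)|b|^{s-1/2}i^{|n|}$. *Transforms.* Let $T$ be an algebraic torus over $F$ (not necessarily split), $dt$ a Haar measure on $T(F)$, and $\check\lambda:\mathbb G_m\to T$ a nontrivial cocharacter defined over $F$. Let $f=\Phi\,dt$ be a Schwartz measure on $T(F)$: $\Phi$ is locally constant of compact support if $F$ is nonarchimedean, and the restriction of a Schwartz function on $F^n$ along a closed embedding $T\hookrightarrow\mathbb A^n$ if $F$ is archimedean. For $s\in\mathbb C$ let $\mathscr F_{\check\lambda,s}f$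 be the convolution of $f$ with the push-forward along $\check\lambda$ of $|x|^s\psi(x)\,d^\times x$, that is, the measure with density $t\mapsto\int_{F^\times}|x|^s\psi(x)\Phi(\check\lambda(x)^{-1}t)\,d^\times x$ with respect to $dt$. The Mellin transform $\check g(\chi)$ of a measure $g$ on $T(F)$, for $\chi$ in the complex manifold of continuous characters $T(F)\to\mathbb C^\times$, is the meromorphic continuation, on each connected component, of the integral $\int_{T(F)}\chi^{-1}(t)\,g(t)$ from the characters where it converges absolutely. *Claim.* The convolution integral converges absolutely for every $t\in T(F)$; the integral defining $\check f(\chi)$ converges absolutely for every $\chi$; the integral defining the Mellin transform of $\mathscr F_{\check\lambda,s}f$ converges absolutely on a nonempty open subset of each component of the character group and has a meromorphic continuation to the whole component; and this continuation satisfies $$\widecheck{(\mathscr F_{\check\lambda,s}f)}(\chi)=\gamma(\chi,\check\lambda,1-s,\psi)\,\check f(\chi),\qquad \gamma(\chi,\check\lambda,1-s,\psi):=\gamma(\chi\circ\check\lambda,1-s,\psi),$$ being regular at every $\chi$ which is not a pole of the gamma factor, i.e. not a pole of $L((\chi\circ\check\lambda)^{-1},s)$. -/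

import Mathlib

open MeasureTheory Topology ValuativeRel
open scoped TensorProduct SchwartzMap ENNReal

universe u v

noncomputable section

/-! ### Tori and their rational points

An affine algebraic group over `F` is given by its coordinate Hopf algebra `A`. -/

/-- The affine group with coordinate Hopf algebra `A` is a torus: over some finite Galois extension
`E / F` it becomes isomorphic to `𝔾ₘⁿ`, whose coordinate Hopf algebra is the group algebra
`E[ℤⁿ]`. -/
def IsTorus (F : Type u) (A : Type v) [Field F] [CommRing A] [HopfAlgebra F A] : Prop :=
  ∃ (E : Type u) (_ : Field E) (_ : Algebra F E) (_ : FiniteDimensional F E) (_ : IsGalois F E)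
    (n : ℕ), Nonempty ((E ⊗[F] A) ≃ₐc[E] AddMonoidAlgebra E (Fin n → ℤ))

/-- The group `T(F)` of rational points, with Mathlib's convolution group structure. -/
abbrev RatPoints (F A : Type*) [Field F] [CommRing A] [HopfAlgebra F A] : Type _ :=
  WithConv (A →ₐ[F] F)

section Points

variable {F A : Type*} [Field F] [CommRing A] [HopfAlgebra F A]

/-- The topology of `T(F)`: the coarsest one for which all regular functions are continuous. -/
instance RatPoints.instTopologicalSpace [TopologicalSpace F] : TopologicalSpace (RatPoints F A) :=
  TopologicalSpace.induced (fun t (a : A) => t.ofConv a) inferInstance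

instance RatPoints.instMeasurableSpace [TopologicalSpace F] : MeasurableSpace (RatPoints F A) :=
  borel _

instance RatPoints.instBorelSpace [TopologicalSpace F] : BorelSpace (RatPoints F A) := ⟨rfl⟩

/-- The point of `𝔾ₘ(F)` given by `x ∈ Fˣ`, that is, evaluation of Laurent polynomials at `x`. -/
def gmPoint (x : Fˣ) : AddMonoidAlgebra F ℤ →ₐ[F] F :=
  AddMonoidAlgebra.lift F F ℤ ((Units.coeHom F).comp (zpowersHom Fˣ x))

theorem gmPoint_single (x : Fˣ) (n : ℤ) (c : F) :
    gmPoint x (AddMonoidAlgebra.single n c) = c * (x : F) ^ n := by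
  simp [gmPoint, AddMonoidAlgebra.lift_single, -LaurentPolynomial.single_eq_C_mul_T]

/-- The continuous homomorphism `Fˣ → T(F)` induced by a cocharacter `𝔾ₘ → T`; the cocharacter is
given by the corresponding homomorphism `A → F[ℤ]` of coordinate Hopf algebras. -/
def cocharPoints [TopologicalSpace F] [IsTopologicalRing F]
    (lam : A →ₐc[F] AddMonoidAlgebra F ℤ) : Fˣ →ₜ* RatPoints F A where
  toFun x := WithConv.toConv ((gmPoint x).comp (lam : A →ₐ[F] AddMonoidAlgebra F ℤ))
  map_one' := by
    have h : gmPoint (1 : Fˣ) = (1 : WithConv (AddMonoidAlgebra F ℤ →ₐ[F] F)).ofConv := by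
      refine AddMonoidAlgebra.algHom_ext (fun n => ?_) (Subsingleton.elim _ _)
      rw [gmPoint_single]
      simp [-LaurentPolynomial.single_eq_C_mul_T, AlgHom.convOne_def]
    rw [h]
    apply WithConv.ofConv_injective
    ext a
    simp [AlgHom.convOne_def]
  map_mul' x y := by
    have h : gmPoint (x * y) = (WithConv.toConv (gmPoint x) * WithConv.toConv (gmPoint y) :
        WithConv (AddMonoidAlgebra F ℤ →ₐ[F] F)).ofConv := by
      refine AddMonoidAlgebra.algHom_ext (fun n => ?_) (Subsingleton.elim _ _)
      rw [gmPoint_single]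
      have := AddMonoidAlgebra.convMul_algHom_single_one (WithConv.toConv (gmPoint x))
        (WithConv.toConv (gmPoint y)) n
      refine Eq.trans ?_ this.symm
      change _ = gmPoint x _ * gmPoint y _
      rw [gmPoint_single, gmPoint_single]
      simp [mul_zpow]
    rw [h]
    exact congrArg WithConv.toConv (AlgHom.convMul_comp_bialgHom_distrib _ _ lam)
  continuous_toFun := by
    refine continuous_induced_rng.2 (continuous_pi fun a => ?_)
    change Continuous fun x : Fˣ => gmPoint x (lam a)
    induction lam a using AddMonoidAlgebra.induction_linear with
    | zero => simpa using continuous_const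
    | add f g hf hg => simpa [Pi.add_def] using hf.add hg
    | single n c =>
      simp only [gmPoint_single, ← Units.val_zpow_eq_zpow_val]
      exact continuous_const.mul (Units.continuous_val.comp (continuous_zpow n))

/-- The cocharacter is not the trivial homomorphism `𝔾ₘ → T`. -/
def IsNontrivialCochar (lam : A →ₐc[F] AddMonoidAlgebra F ℤ) : Prop :=
  ∃ a : A, lam a ≠ algebraMap F (AddMonoidAlgebra F ℤ) (Coalgebra.counit a)

end Points

/-! ### Mellin transforms -/

section Mellin

variable {T : Type*} [Group T] [TopologicalSpace T]

variable (T) in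
/-- The complex vector space `Hom(T, ℂ)` of continuous additive characters, with the topology of
pointwise convergence. The connected component of `χ` in the character group of `T` consists of the
characters `χ · exp ν` with `ν` in this space. -/
def LogChar : Submodule ℂ (T → ℂ) where
  carrier := {ν | Continuous ν ∧ ∀ a b, ν (a * b) = ν a + ν b}
  add_mem' := by
    rintro a b ⟨ha, ha'⟩ ⟨hb, hb'⟩
    exact ⟨ha.add hb, fun x y => by simp [ha', hb']; ring⟩
  zero_mem' := ⟨continuous_const, by simp⟩
  smul_mem' := by
    rintro c a ⟨ha, ha'⟩
    exact ⟨ha.const_smul c, fun x y => by simp [ha']; ring⟩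

/-- The character `χ · exp ν`. -/
def twist (χ : T →ₜ* ℂˣ) (ν : LogChar T) : T →ₜ* ℂˣ where
  toFun t := χ t * Units.mk0 (Complex.exp (ν.1 t)) (Complex.exp_ne_zero _)
  map_one' := by
    have h : ν.1 1 = 0 := by simpa using ν.2.2 1 1
    ext; simp [h]
  map_mul' x y := by
    ext; simp [ν.2.2 x y, Complex.exp_add]; ring
  continuous_toFun := by
    refine (map_continuous χ).mul (Units.continuous_iff.2 ⟨?_, ?_⟩)
    · exact Complex.continuous_exp.comp ν.2.1
    · have : Continuous fun t => Complex.exp (-(ν.1 t)) := Complex.continuous_exp.comp ν.2.1.neg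
      simpa [Function.comp_def, Complex.exp_neg] using this

/-- A function on `Hom(T, ℂ)` is holomorphic: it is so along all finite-dimensional affine
subspaces. -/
def IsHolomorphic (H : LogChar T → ℂ) : Prop :=
  ∀ (k : ℕ) (ν₀ : LogChar T) (ν : Fin k → LogChar T),
    Differentiable ℂ fun z : Fin k → ℂ => H (ν₀ + ∑ i, z i • ν i)

variable [MeasurableSpace T]

/-- Absolute convergence of the Mellin integral of the measure `g μ` at `χ`. -/
def MellinConverges (μ : Measure T) (g : T → ℂ) (χ : T →ₜ* ℂˣ) : Prop :=
  Integrable (fun t => g t * ((χ t)⁻¹ : ℂˣ)) μ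

/-- The Mellin integral `∫ χ⁻¹(t) g(t) dμ(t)` of the measure `g μ` at `χ`. -/
def mellinIntegral (μ : Measure T) (g : T → ℂ) (χ : T →ₜ* ℂˣ) : ℂ :=
  ∫ t, g t * ((χ t)⁻¹ : ℂˣ) ∂μ

/-- The Mellin transform of the measure `g μ`, defined by meromorphic continuation of the Mellin
integral, is regular at `χ` and takes the value `c` there: on the component of `χ` the integral
converges absolutely in some nonempty open set, and there are holomorphic functions `P`, `Q` on this
component such that `P / Q` equals the integral wherever this converges absolutely, `Q(χ) ≠ 0`, and
`P(χ) / Q(χ) = c`. -/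
def HasMellinValue (μ : Measure T) (g : T → ℂ) (χ : T →ₜ* ℂˣ) (c : ℂ) : Prop :=
  (∃ ν₀ : LogChar T, ∀ᶠ ν in 𝓝 ν₀, MellinConverges μ g (twist χ ν)) ∧
  ∃ P Q : LogChar T → ℂ, IsHolomorphic P ∧ IsHolomorphic Q ∧
    (∀ ν, MellinConverges μ g (twist χ ν) → Q ν * mellinIntegral μ g (twist χ ν) = P ν) ∧
    Q 0 ≠ 0 ∧ P 0 / Q 0 = c

end Mellin

/-! ### The equivariant Fourier transform -/

section Fourier

variable {F : Type*} [Field F] [TopologicalSpace F] [IsTopologicalRing F] [LocallyCompactSpace F]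
  [MeasurableSpace F] [BorelSpace F]

/-- The normalized absolute value of a locally compact field: the factor by which multiplication
by `x` scales additive Haar measures (so `|z| = z z̄` on `ℂ`). -/
def absF (x : Fˣ) : ℝ := distribHaarChar F x

/-- `dx` is self-dual with respect to `ψ`: with `φ̂(y) = ∫ φ(x) ψ(xy) dx`, the Fourier inversion
formula reads `φ̂̂(x) = φ(-x)`. -/
def IsSelfDual (ψ : AddChar F Circle) (dx : Measure F) : Prop :=
  ∀ φ : F → ℂ, Continuous φ → Integrable φ dx →
    Integrable (fun y => ∫ x, φ x * (ψ (x * y) : ℂ) ∂dx) dx →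
    ∀ z, ∫ y, (∫ x, φ x * (ψ (x * y) : ℂ) ∂dx) * (ψ (y * z) : ℂ) ∂dx = φ (-z)

/-- The measure `d^×x = dx / |x|` on `Fˣ`. -/
def mulMeasure (dx : Measure F) : Measure Fˣ :=
  (dx.comap Units.val).withDensity fun x => ENNReal.ofReal (absF x)⁻¹

/-- The density `|x|ˢ ψ(x)` of `D_s` with respect to `d^×x`. -/
def kernelD (ψ : AddChar F Circle) (s : ℂ) (x : Fˣ) : ℂ := (absF x : ℂ) ^ s * (ψ (x : F) : ℂ)

/-- The push-forward to `T(F)` of `D_s = |x|ˢ ψ(x) d^×x` along a cocharacter, as a functional on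
functions on `T(F)`. -/
def pushD {T : Type*} [Group T] [TopologicalSpace T] (ψ : AddChar F Circle) (dx : Measure F)
    (l : Fˣ →ₜ* T) (s : ℂ) (h : T → ℂ) : ℂ :=
  ∫ x, kernelD ψ s x * h (l x) ∂(mulMeasure dx)

/-- The equivariant Fourier transform: convolution with the push-forward of `D_s`. It sends the
measure `Φ dt` (with `dt` Haar) to the measure with density
`t ↦ ∫ |x|ˢ ψ(x) Φ(λ(x)⁻¹ t) d^×x`. -/
def equivFourier {T : Type*} [Group T] [TopologicalSpace T] (ψ : AddChar F Circle)
    (dx : Measure F) (l : Fˣ →ₜ* T) (s : ℂ) (Φ : T → ℂ) (t : T) : ℂ :=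
  pushD ψ dx l s fun y => Φ (y⁻¹ * t)

/-- The gamma factor `γ(χ, s) = ε(χ, s) L(χ⁻¹, 1 - s) / L(χ, s)`. -/
def gammaFactor (L ε : (Fˣ →ₜ* ℂˣ) → ℂ → ℂ) (χ : Fˣ →ₜ* ℂˣ) (s : ℂ) : ℂ :=
  ε χ s * L χ⁻¹ (1 - s) / L χ s

end Fourier

/-! ### Local factors -/

section Nonarchimedean

variable {F : Type*} [Field F] [ValuativeRel F] [TopologicalSpace F] [IsNonarchimedeanLocalField F]

/-- `ϖ` generates the maximal ideal of the ring of integers. -/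
def IsUnif (ϖ : Fˣ) : Prop := ∀ x : F, valuation F x < 1 ↔ valuation F x ≤ valuation F (ϖ : F)

variable (F) in
/-- A choice of uniformizer. -/
def unif : Fˣ := Classical.epsilon IsUnif

/-- `χ` is trivial on the unit group of the ring of integers. -/
def IsUnramified (χ : Fˣ →ₜ* ℂˣ) : Prop := ∀ u : Fˣ, valuation F (u : F) = 1 → χ u = 1

/-- The exponent of the conductor: the least `n` such that `χ` is trivial on those units of the ring
of integers which are congruent to `1` modulo `𝔭ⁿ`. -/
def condExp (χ : Fˣ →ₜ* ℂˣ) : ℕ :=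
  sInf {n : ℕ | ∀ u : Fˣ, valuation F (u : F) = 1 →
    valuation F ((u : F) - 1) ≤ valuation F (unif F : F) ^ n → χ u = 1}

open Classical in
/-- `L(χ, s) = (1 - χ(ϖ) q⁻ˢ)⁻¹` for unramified `χ`, and `1` otherwise. -/
def nonarchL (χ : Fˣ →ₜ* ℂˣ) (s : ℂ) : ℂ :=
  if IsUnramified χ then
    (1 - (χ (unif F) : ℂ) * (Nat.card 𝓀[F] : ℂ) ^ (-s))⁻¹
  else 1

open Classical in
/-- Tate's `ε(χ, s, ψ, dx)` for `ψ` of conductor `𝔬` and `dx` self-dual: it is `1` for unramified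
`χ`, and `∫ χ⁻¹(x) |x|⁻ˢ ψ(x) dx` over the `x` of valuation `- a(χ)` otherwise. -/
def nonarchEps [MeasurableSpace F] [BorelSpace F] (ψ : AddChar F Circle) (dx : Measure F)
    (χ : Fˣ →ₜ* ℂˣ) (s : ℂ) : ℂ :=
  if IsUnramified χ then 1
  else ∫ x in {x : Fˣ | valuation F (x : F) * valuation F (unif F : F) ^ condExp χ = 1},
    ((χ x)⁻¹ : ℂˣ) * (absF x : ℂ) ^ (-s) * (ψ (x : F) : ℂ) ∂(dx.comap Units.val)

/-- The largest fractional ideal on which `ψ` is trivial is the ring of integers. -/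
def HasConductorIntegers (ψ : AddChar F Circle) : Prop :=
  ∀ x : F, (∀ y : F, valuation F y ≤ 1 → ψ (x * y) = 1) ↔ valuation F x ≤ 1

end Nonarchimedean

section Real

/-- The unique `w` with `χ(r) = r ^ w` for all `r > 0`. -/
def realExponent (χ : ℝˣ →ₜ* ℂˣ) : ℂ :=
  Classical.epsilon fun w : ℂ => ∀ r : ℝˣ, 0 < (r : ℝ) → (χ r : ℂ) = ((r : ℝ) : ℂ) ^ w

open Classical in
/-- The parity `N ∈ {0, 1}` with `χ(-1) = (-1) ^ N`. -/
def realParity (χ : ℝˣ →ₜ* ℂˣ) : ℕ := if χ (-1) = 1 then 0 else 1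

/-- `L(χ, s) = Γ_ℝ(s + w + N)` for `χ = sgn ^ N |·| ^ w`, where `Γ_ℝ(s) = π ^ (-s/2) Γ(s/2)`. -/
def realL (χ : ℝˣ →ₜ* ℂˣ) (s : ℂ) : ℂ :=
  Complex.Gammaℝ (s + realExponent χ + realParity χ)

/-- The unique `a ≠ 0` with `ψ(x) = exp(2πi a x)`. -/
def realFreq (ψ : AddChar ℝ Circle) : ℝˣ :=
  Classical.epsilon fun a : ℝˣ => ∀ x : ℝ, ψ x = Circle.exp (2 * Real.pi * (a * x))

/-- Tate's `ε(χ, s, ψ)` for the self-dual measure: it is `i ^ N` for `ψ(x) = exp(2πi x)`, and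
passing to `ψ(a x)` multiplies it by `χ(a) |a| ^ (s - 1/2)`. -/
def realEps (ψ : AddChar ℝ Circle) (χ : ℝˣ →ₜ* ℂˣ) (s : ℂ) : ℂ :=
  χ (realFreq ψ) * (absF (realFreq ψ) : ℂ) ^ (s - 1 / 2) * Complex.I ^ realParity χ

end Real

section Complex

/-- The unique `w` with `χ(r) = |r| ^ w` for all real `r > 0`, where `|r| = r²`. -/
def complexExponent (χ : ℂˣ →ₜ* ℂˣ) : ℂ :=
  Classical.epsilon fun w : ℂ => ∀ (z : ℂˣ) (r : ℝ), 0 < r → (z : ℂ) = r →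
    (χ z : ℂ) = ((r ^ 2 : ℝ) : ℂ) ^ w

/-- The unique `n ∈ ℤ` with `χ(z) = z ^ n` on the unit circle. -/
def complexWeight (χ : ℂˣ →ₜ* ℂˣ) : ℤ :=
  Classical.epsilon fun n : ℤ => ∀ z : ℂˣ, ‖(z : ℂ)‖ = 1 → χ z = z ^ n

/-- `L(χ, s) = Γ_ℂ(s + w + |n| / 2)` for `χ(z) = (z / √(z z̄)) ^ n (z z̄) ^ w`, where
`Γ_ℂ(s) = 2 (2π) ^ (-s) Γ(s)`. -/
def complexL (χ : ℂˣ →ₜ* ℂˣ) (s : ℂ) : ℂ :=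
  Complex.Gammaℂ (s + complexExponent χ + ((complexWeight χ).natAbs : ℂ) / 2)

/-- The unique `a ≠ 0` with `ψ(z) = exp(2πi Tr(a z))`, where `Tr(z) = 2 Re z`. -/
def complexFreq (ψ : AddChar ℂ Circle) : ℂˣ :=
  Classical.epsilon fun a : ℂˣ => ∀ z : ℂ, ψ z = Circle.exp (2 * Real.pi * (2 * (a * z).re))

/-- Tate's `ε(χ, s, ψ)` for the self-dual measure: it is `i ^ |n|` for `ψ(z) = exp(2πi Tr z)`, and
passing to `ψ(a z)` multiplies it by `χ(a) |a| ^ (s - 1/2)`. -/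
def complexEps (ψ : AddChar ℂ Circle) (χ : ℂˣ →ₜ* ℂˣ) (s : ℂ) : ℂ :=
  χ (complexFreq ψ) * (absF (complexFreq ψ) : ℂ) ^ (s - 1 / 2) *
    Complex.I ^ (complexWeight χ).natAbs

end Complex

/-! ### Schwartz functions on `T(F)` -/

/-- Schwartz functions over a nonarchimedean field: locally constant of compact support. -/
def IsSchwartzNonarch {T : Type*} [TopologicalSpace T] (Φ : T → ℂ) : Prop :=
  IsLocallyConstant Φ ∧ HasCompactSupport Φ

/-- Schwartz functions over `ℝ` and `ℂ`: restrictions of Schwartz functions on `Fⁿ` along a closed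
embedding of the affine variety `T` in affine `n`-space. -/
def IsSchwartzArch {F A : Type*} [RCLike F] [CommRing A] [HopfAlgebra F A]
    (Φ : RatPoints F A → ℂ) : Prop :=
  ∃ (n : ℕ) (x : Fin n → A), Algebra.adjoin F (Set.range x) = ⊤ ∧
    ∃ h : 𝓢(Fin n → F, ℂ), ∀ t : RatPoints F A, Φ t = h fun i => t.ofConv (x i)

/-! ### The functional equation -/

section Identity

variable {F A : Type*} [Field F] [TopologicalSpace F] [IsTopologicalRing F] [LocallyCompactSpace F]
  [MeasurableSpace F] [BorelSpace F] [CommRing A] [HopfAlgebra F A]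

/-- The functional equation for the measure `f = Φ μ` on `T(F)`, where `μ` is a Haar measure, with
`L` and `ε` the local factors of characters of `Fˣ`:
the convolution defining the equivariant Fourier transform of `f` converges absolutely, the Mellin
transform of `f` converges absolutely everywhere, and the Mellin transform of the equivariant
Fourier transform of `f` is the Mellin transform of `f` times the gamma factor
`γ(χ, λ, 1 - s, ψ) = γ(χ ∘ λ, 1 - s, ψ)`, at every `χ` which is not a pole of the gamma factor.
The poles are those of `L((χ ∘ λ)⁻¹, s)`; since local `L`-factors have no zeros and the functions
`z⁻¹` and `Γ` take the value `0` at their poles, these are the `χ` where this expression is `0`. -/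
def MellinGammaIdentity (L ε : (Fˣ →ₜ* ℂˣ) → ℂ → ℂ) (ψ : AddChar F Circle) (dx : Measure F)
    (lam : A →ₐc[F] AddMonoidAlgebra F ℤ) (μ : Measure (RatPoints F A)) (s : ℂ)
    (Φ : RatPoints F A → ℂ) : Prop :=
  (∀ t, Integrable (fun x => kernelD ψ s x * Φ ((cocharPoints lam x)⁻¹ * t)) (mulMeasure dx)) ∧
  (∀ χ, MellinConverges μ Φ χ) ∧
  ∀ χ : RatPoints F A →ₜ* ℂˣ, L (χ.comp (cocharPoints lam))⁻¹ s ≠ 0 →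
    HasMellinValue μ (equivFourier ψ dx (cocharPoints lam) s Φ) χ
      (gammaFactor L ε (χ.comp (cocharPoints lam)) (1 - s) * mellinIntegral μ Φ χ)

end Identity

end

set_option linter.unusedSectionVars false

/-! ### The multiplicative Haar measure -/

section MulMeasure

variable {F : Type*} [Field F] [TopologicalSpace F] [IsTopologicalRing F] [LocallyCompactSpace F]
  [MeasurableSpace F] [BorelSpace F]

/-! Write `ω = χ ∘ λ`, `FΦ` for the transform, `M` for Mellin integrals and `Z` for zeta integrals
on `Fˣ`. The substitution `x = yv` gives `FΦ(λ(y)t) = |y|^s ∫ ψ(yv) |v|^s Φ(λ(v)⁻¹t) d^×v`. Pairing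
this in `y` with `g(y)|y|^(1-s)`, for a test function `g` on `F`, moves `ψ` onto `g` and produces
its Fourier transform `ĝ`. By Fubini and invariance of Haar measure, `M(FΦ)(χ) · Z(g, ω, 1-s) = Z(ĝ,
ω⁻¹, s) · M(Φ)(χ)` wherever everything converges absolutely (`mellinIntegral_equivFourier_mul`). The
torus has left the constant: the factor is Tate's ratio on `F`, and one explicit `g` per character
computes it. For nonarchimedean `F` this `g` is the indicator of `𝔬` or of `1 + 𝔭ⁿ`
(`hasZetaRatio_unramified`, `hasZetaRatio_ramified`); for `ℝ` and `ℂ` it is a Gaussian times a power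
of `x`, `z` or `z̄` (`hasZetaRatio_gaussian`).

The relation needs a region where `M(FΦ)` converges. If `|ω| = |x|^r`, this is a strip `0 < Re s - r
< e`. The lower bound handles the kernel near `0`; at infinity oscillation of `ψ` is indispensable.
Over a nonarchimedean field `Φ` is invariant under `λ(1 + 𝔭ⁿ)`, and averaging over this group cuts
the kernel off outside `𝔭⁻ⁿ` (`integral_kernelD_eq_indicator`). Over `ℝ` and `ℂ` a translation by
`w` with `ψ(w) = -1` replaces the integrand by half of a difference, which gains a factor `1/‖x‖`
(`IsLogMap.norm_equivFourier_le`). This uses that Schwartz functions on `T(F)`, and their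
differences along `λ`, decay faster than every exponential of the logarithmic coordinates, and that
volumes grow at most exponentially in them (`IsLogMap.exists_measure_le`).

For the continuation, a component of the character group is a translate of the space of additive
characters `ν`, and `χ exp ν` restricts along `λ` to `ω|x|^κ(ν)` with `κ` linear. Since `M(Φ)` is
entire, the Mellin transform is the quotient of `a(κ(ν)) M(Φ)` by `b(κ(ν))` with entire `a`, `b`. A
nontrivial cocharacter pairs nontrivially with the norm of some character defined over a splitting
field (`IsTorus.exists_logChar`), so `κ` takes arbitrary real parts and the strip meets every
component. The relation is then carried from the strip to every point of convergence by analyticity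
along real lines (`mul_integral_eq_of_strip`, `hasMellinValue_of_open`). -/

theorem absF_pos (x : Fˣ) : 0 < absF x := distribHaarChar_pos

theorem absF_mul (x y : Fˣ) : absF (x * y) = absF x * absF y := by
  simp [absF, map_mul]

theorem absF_one : absF (1 : Fˣ) = 1 := by
  simp [absF]

theorem absF_inv (x : Fˣ) : absF x⁻¹ = (absF x)⁻¹ := by
  simp [absF, map_inv]

theorem absF_ne_zero (x : Fˣ) : (absF x : ℂ) ≠ 0 := by
  exact_mod_cast (absF_pos x).ne'

/-- The normalized absolute value is continuous on the unit group. -/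
class ContinuousAbsF (F : Type*) [Field F] [TopologicalSpace F] [IsTopologicalRing F]
    [LocallyCompactSpace F] [MeasurableSpace F] [BorelSpace F] : Prop where
  continuous_absF : Continuous (absF : Fˣ → ℝ)

theorem continuous_absF [ContinuousAbsF F] : Continuous (absF : Fˣ → ℝ) :=
  ContinuousAbsF.continuous_absF

theorem absF_mul_cpow (x y : Fˣ) (s : ℂ) :
    (absF (x * y) : ℂ) ^ s = (absF x : ℂ) ^ s * (absF y : ℂ) ^ s := by
  rw [absF_mul, Complex.ofReal_mul, Complex.mul_cpow_ofReal_nonneg (absF_pos x).le (absF_pos y).le]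

theorem norm_absF_cpow (x : Fˣ) (s : ℂ) : ‖(absF x : ℂ) ^ s‖ = absF x ^ s.re :=
  Complex.norm_cpow_eq_rpow_re_of_pos (absF_pos x) s

theorem continuous_absF_cpow [ContinuousAbsF F] (s : ℂ) :
    Continuous fun x : Fˣ => (absF x : ℂ) ^ s :=
  (Complex.continuous_ofReal.comp continuous_absF).cpow continuous_const
    fun x => Or.inl (by simpa using absF_pos x)

variable [ContinuousInv₀ F] [T2Space F]

instance Units.instBorelSpaceOfField : BorelSpace Fˣ := by
  refine ⟨?_⟩
  rw [Units.isEmbedding_val₀.isInducing.eq_induced, borel_comap, ← BorelSpace.measurable_eq (α := F)]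
  rfl

theorem measurableEmbedding_unitsVal : MeasurableEmbedding (Units.val : Fˣ → F) :=
  IsOpenUnits.isOpenEmbedding_unitsVal.measurableEmbedding

variable [SecondCountableTopology F]

instance Units.instSecondCountableOfField : SecondCountableTopology Fˣ :=
  Units.isEmbedding_val₀.secondCountableTopology

variable (dx : Measure F) [dx.IsAddHaarMeasure]

open scoped Pointwise in
theorem addHaar_smul_set (a : Fˣ) (s : Set F) :
    dx (a • s) = ENNReal.ofReal (absF a) * dx s := by
  have : dx.Regular := inferInstance
  rw [← distribHaarChar_mul dx a s, absF, ENNReal.ofReal_coe_nnreal]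

open scoped Pointwise in
theorem comap_val_mul_left (a : Fˣ) (s : Set Fˣ) :
    dx.comap Units.val ((fun x => a * x) ⁻¹' s) =
      ENNReal.ofReal (absF a)⁻¹ * dx.comap Units.val s := by
  rw [measurableEmbedding_unitsVal.comap_apply, measurableEmbedding_unitsVal.comap_apply,
    ← absF_inv, ← addHaar_smul_set]
  congr 1
  ext y
  simp only [Set.mem_image, Set.mem_preimage, Set.mem_smul_set]
  constructor
  · rintro ⟨x, hx, rfl⟩
    exact ⟨_, ⟨_, hx, rfl⟩, by simp [Units.smul_def]⟩
  · rintro ⟨_, ⟨x, hx, rfl⟩, rfl⟩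
    exact ⟨a⁻¹ * x, by simpa using hx, by simp [Units.smul_def]⟩

theorem map_comap_val_mul_left (a : Fˣ) :
    (dx.comap Units.val).map (fun x => a * x) =
      ENNReal.ofReal (absF a)⁻¹ • dx.comap Units.val := by
  ext s hs
  rw [Measure.map_apply (measurable_const_mul a) hs, comap_val_mul_left, Measure.smul_apply,
    smul_eq_mul]

variable [ContinuousAbsF F]

theorem lintegral_mulMeasure {f : Fˣ → ℝ≥0∞} (hf : Measurable f) :
    ∫⁻ x, f x ∂(mulMeasure dx) =
      ∫⁻ x, ENNReal.ofReal (absF x)⁻¹ * f x ∂(dx.comap Units.val) := by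
  rw [mulMeasure, lintegral_withDensity_eq_lintegral_mul₀ _ hf.aemeasurable]
  · rfl
  · exact (ENNReal.measurable_ofReal.comp (continuous_absF.measurable.inv)).aemeasurable

/-- Multiplication by `a` scales `dx` by `|a|`, and the density `1/|x|` compensates exactly. -/
instance mulMeasure.instIsMulLeftInvariant : (mulMeasure dx).IsMulLeftInvariant := by
  refine ⟨fun a => ?_⟩
  refine Measure.ext_of_lintegral _ fun f hf => ?_
  have hm : Measurable fun x : Fˣ => ENNReal.ofReal (absF x)⁻¹ :=
    ENNReal.measurable_ofReal.comp (continuous_absF.measurable.inv)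
  rw [lintegral_map hf (measurable_const_mul a),
    lintegral_mulMeasure dx (f := fun x => f (a * x)) (hf.comp (measurable_const_mul a)), lintegral_mulMeasure dx hf]
  have h1 : ∀ x : Fˣ, ENNReal.ofReal (absF x)⁻¹ * f (a * x) =
      ENNReal.ofReal (absF a) * (ENNReal.ofReal (absF (a * x))⁻¹ * f (a * x)) := by
    intro x
    rw [← mul_assoc, ← ENNReal.ofReal_mul (absF_pos a).le, absF_mul]
    congr 2
    have := (absF_pos a).ne'
    field_simp
  have hmf : Measurable fun x : Fˣ => ENNReal.ofReal (absF x)⁻¹ * f x := hm.mul hf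
  have hmf' : Measurable fun x : Fˣ => ENNReal.ofReal (absF (a * x))⁻¹ * f (a * x) :=
    hmf.comp (measurable_const_mul a)
  simp_rw [h1]
  rw [lintegral_const_mul _ hmf',
    ← lintegral_map (f := fun x => ENNReal.ofReal (absF x)⁻¹ * f x) hmf
      (measurable_const_mul a), map_comap_val_mul_left, lintegral_smul_measure, smul_eq_mul,
    ← mul_assoc, ← ENNReal.ofReal_mul (absF_pos a).le, mul_inv_cancel₀ (absF_pos a).ne']
  simp

instance comap_val.instSigmaFinite : SigmaFinite (dx.comap (Units.val : Fˣ → F)) :=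
  SigmaFinite.of_map _ measurableEmbedding_unitsVal.measurable.aemeasurable
    (by rw [measurableEmbedding_unitsVal.map_comap]; infer_instance)

instance mulMeasure.instSigmaFinite : SigmaFinite (mulMeasure dx) := by
  rw [mulMeasure]
  exact SigmaFinite.withDensity_ofReal (f := fun x : Fˣ => (absF x)⁻¹)

theorem map_val_comap_val [NullSingletonClass dx] : (dx.comap (Units.val : Fˣ → F)).map Units.val = dx := by
  rw [measurableEmbedding_unitsVal.map_comap]
  have : Set.range (Units.val : Fˣ → F) = {0}ᶜ := by
    ext x
    exact ⟨by rintro ⟨u, rfl⟩; simp, fun hx => ⟨Units.mk0 x hx, rfl⟩⟩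
  rw [this]
  refine Measure.restrict_eq_self_of_ae_mem ?_
  simp [ae_iff]

theorem integrable_mulMeasure_iff {f : Fˣ → ℂ} :
    Integrable f (mulMeasure dx) ↔
      Integrable (fun x => ((absF x)⁻¹ : ℝ) * f x) (dx.comap Units.val) := by
  rw [mulMeasure, integrable_withDensity_iff_integrable_smul']
  · refine integrable_congr (ae_of_all _ fun x => ?_)
    simp [ENNReal.toReal_ofReal (inv_nonneg.2 (absF_pos x).le)]
  · exact ENNReal.measurable_ofReal.comp (continuous_absF.measurable.inv)
  · simp

theorem integral_mulMeasure (f : Fˣ → ℂ) :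
    ∫ x, f x ∂(mulMeasure dx) = ∫ x, ((absF x)⁻¹ : ℝ) * f x ∂(dx.comap Units.val) := by
  rw [mulMeasure, integral_withDensity_eq_integral_toReal_smul]
  · refine integral_congr_ae (ae_of_all _ fun x => ?_)
    simp [ENNReal.toReal_ofReal (inv_nonneg.2 (absF_pos x).le)]
  · exact ENNReal.measurable_ofReal.comp (continuous_absF.measurable.inv)
  · simp

/-- The bridge between additive and multiplicative integrals: `|x| d^×x = dx`, and the missing point
`0` is a null set. -/
theorem integrable_abs_mul_iff [NullSingletonClass dx] {G : F → ℂ} :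
    Integrable (fun x : Fˣ => (absF x : ℂ) * G x) (mulMeasure dx) ↔ Integrable G dx := by
  rw [integrable_mulMeasure_iff]
  conv_rhs => rw [← map_val_comap_val dx, measurableEmbedding_unitsVal.integrable_map_iff]
  refine integrable_congr (ae_of_all _ fun x => ?_)
  have := absF_ne_zero x
  simp [this]

theorem integral_abs_mul [NullSingletonClass dx] (G : F → ℂ) :
    ∫ x : Fˣ, (absF x : ℂ) * G x ∂(mulMeasure dx) = ∫ x, G x ∂dx := by
  rw [integral_mulMeasure]
  conv_rhs => rw [← map_val_comap_val dx, measurableEmbedding_unitsVal.integral_map]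
  refine integral_congr_ae (ae_of_all _ fun x => ?_)
  have := absF_ne_zero x
  simp [this]

end MulMeasure

/-! ### The functional equation in the domain of absolute convergence -/

section Unfolding

variable {F : Type*} [Field F] [TopologicalSpace F] [IsTopologicalRing F] [LocallyCompactSpace F]
  [MeasurableSpace F] [BorelSpace F] [ContinuousInv₀ F] [T2Space F] [SecondCountableTopology F]
  [ContinuousAbsF F] {ψ : AddChar F Circle} {dx : Measure F} [dx.IsAddHaarMeasure]
  {T : Type*} [Group T] [TopologicalSpace T] [IsTopologicalGroup T]
  [SecondCountableTopology T] [MeasurableSpace T] [BorelSpace T]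
  {μ : Measure T} [μ.IsMulLeftInvariant] [SigmaFinite μ]

theorem kernelD_mul (s : ℂ) (x y : Fˣ) :
    kernelD ψ s (x * y) = (absF x : ℂ) ^ s * ((absF y : ℂ) ^ s * (ψ ((x : F) * y) : ℂ)) := by
  rw [kernelD, absF_mul_cpow, Units.val_mul, mul_assoc]

/-- Substitute `x = yv` in the convolution; the two translations by `λ(y)` cancel. -/
theorem equivFourier_mul (l : Fˣ →ₜ* T) (s : ℂ) (Φ : T → ℂ) (y : Fˣ) (t : T) :
    equivFourier ψ dx l s Φ (l y * t) =
      (absF y : ℂ) ^ s * ∫ v : Fˣ, (ψ ((y : F) * v) : ℂ) * ((absF v : ℂ) ^ s * Φ ((l v)⁻¹ * t))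
        ∂(mulMeasure dx) := by
  rw [equivFourier, pushD, ← integral_mul_left_eq_self _ y, ← integral_const_mul]
  refine integral_congr_ae (ae_of_all _ fun v => ?_)
  simp only [kernelD_mul, map_mul, mul_inv_rev]
  have : (l v)⁻¹ * (l y)⁻¹ * (l y * t) = (l v)⁻¹ * t := by group
  rw [this]
  ring

theorem continuous_circle_coe : Continuous fun z : Circle => (z : ℂ) := by fun_prop

theorem continuous_circle_mul (hψ : Continuous ψ) :
    Continuous fun p : Fˣ × Fˣ => ((ψ ((p.1 : F) * p.2) : Circle) : ℂ) :=
  continuous_circle_coe.comp (hψ.comp ((Units.continuous_val.comp continuous_fst).mul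
    (Units.continuous_val.comp continuous_snd)))

/-- Since `ψ` has modulus one, multiplying by `ψ(-x)` removes it and preserves integrability. -/
theorem integrable_absF_cpow_mul (hψ : Continuous ψ) {s : ℂ} {φ : Fˣ → ℂ}
    (h : Integrable (fun x => kernelD ψ s x * φ x) (mulMeasure dx)) :
    Integrable (fun x => (absF x : ℂ) ^ s * φ x) (mulMeasure dx) := by
  have hc : Continuous fun x : Fˣ => ((ψ (-(x : F)) : Circle) : ℂ) :=
    continuous_circle_coe.comp (hψ.comp Units.continuous_val.neg)
  refine (h.bdd_mul (c := 1) hc.aestronglyMeasurable (ae_of_all _ fun x => ?_)).congr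
    (ae_of_all _ fun x => ?_)
  · exact (Circle.norm_coe _).le
  · have : ((ψ (-(x : F)) : Circle) : ℂ) * (ψ (x : F) : ℂ) = 1 := by
      rw [← Circle.coe_mul, ← AddChar.map_add_eq_mul]; simp
    simp only [kernelD]
    linear_combination (absF x : ℂ) ^ s * φ x * this

/-- The map `(y, t) ↦ (y, k(y) t)` preserves the product of a measure and a Haar measure. -/
theorem measurePreserving_shear (dx : Measure F) [dx.IsAddHaarMeasure] (k : Fˣ → T)
    (hk : Continuous k) :
    MeasurePreserving (fun p : Fˣ × T => (p.1, k p.1 * p.2)) ((mulMeasure dx).prod μ)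
      ((mulMeasure dx).prod μ) := by
  refine (MeasurePreserving.id (mulMeasure dx)).skew_product (g := fun y t => k y * t) ?_ ?_
  · exact ((hk.comp continuous_fst).mul continuous_snd).measurable
  · exact ae_of_all _ fun y => map_mul_left_eq_self μ (k y)

/-- Fubini on `Fˣ × Fˣ`, legitimate because `ψ(yv)` is bounded. The exchange transfers `ψ(yv)` to
`g`; as `|y| d^×y = dy`, the new inner integral is `ĝ(v)`. -/
theorem integral_unit_pairing_swap (hψ : Continuous ψ) [NullSingletonClass dx] {s : ℂ}
    {φ : Fˣ → ℂ} (hφ : Integrable (fun v => (absF v : ℂ) ^ s * φ v) (mulMeasure dx)) {g : F → ℂ}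
    (hg : Integrable g dx) :
    ∫ y : Fˣ, ((absF y : ℂ) * g y) *
        ∫ v : Fˣ, (ψ ((y : F) * v) : ℂ) * ((absF v : ℂ) ^ s * φ v) ∂(mulMeasure dx)
          ∂(mulMeasure dx) =
      ∫ v : Fˣ, ((absF v : ℂ) ^ s * φ v) * ∫ x, g x * (ψ (x * v) : ℂ) ∂dx ∂(mulMeasure dx) := by
  have hg' := (integrable_abs_mul_iff dx).2 hg
  have hint_g : Integrable (fun p : Fˣ × Fˣ => (ψ ((p.1 : F) * p.2) : ℂ) *
      (((absF p.1 : ℂ) * g p.1) * ((absF p.2 : ℂ) ^ s * φ p.2)))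
      ((mulMeasure dx).prod (mulMeasure dx)) :=
    (hg'.mul_prod hφ).bdd_mul (c := 1) (continuous_circle_mul hψ).aestronglyMeasurable
      (ae_of_all _ fun p => (Circle.norm_coe _).le)
  calc _ = ∫ y : Fˣ, ∫ v : Fˣ, (ψ ((y : F) * v) : ℂ) *
      (((absF y : ℂ) * g y) * ((absF v : ℂ) ^ s * φ v)) ∂(mulMeasure dx) ∂(mulMeasure dx) := by
        refine integral_congr_ae (ae_of_all _ fun y => ?_)
        simp only [← integral_const_mul]
        refine integral_congr_ae (ae_of_all _ fun v => ?_)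
        simp only
        ring
    _ = ∫ v : Fˣ, ∫ y : Fˣ, (ψ ((y : F) * v) : ℂ) *
      (((absF y : ℂ) * g y) * ((absF v : ℂ) ^ s * φ v)) ∂(mulMeasure dx) ∂(mulMeasure dx) :=
        integral_integral_swap hint_g
    _ = _ := by
        refine integral_congr_ae (ae_of_all _ fun v => ?_)
        simp only
        rw [← integral_abs_mul dx fun x => g x * (ψ (x * v) : ℂ), ← integral_const_mul]
        refine integral_congr_ae (ae_of_all _ fun y => ?_)
        simp only
        ring

/-- In the domain of absolute convergence, the Mellin transforms of `Φ` and of its equivariant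
Fourier transform are proportional; the factor is the ratio of the zeta integrals of an arbitrary
test function `g` and of its Fourier transform. -/
theorem mellinIntegral_equivFourier_mul (hψ : Continuous ψ) [NullSingletonClass dx]
    (l : Fˣ →ₜ* T) (s : ℂ) (Φ : T → ℂ) (χ : T →ₜ* ℂˣ) (g : F → ℂ)
    (hconv : ∀ t, Integrable (fun x => kernelD ψ s x * Φ ((l x)⁻¹ * t)) (mulMeasure dx))
    (hΦ : MellinConverges μ Φ χ) (hFΦ : MellinConverges μ (equivFourier ψ dx l s Φ) χ)
    (hg : Integrable g dx)
    (hZ : Integrable (fun y : Fˣ => g y * (χ (l y) : ℂ) * (absF y : ℂ) ^ (1 - s)) (mulMeasure dx))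
    (hZ' : Integrable (fun y : Fˣ => (∫ x, g x * (ψ (x * y) : ℂ) ∂dx) * ((χ (l y))⁻¹ : ℂˣ) *
      (absF y : ℂ) ^ s) (mulMeasure dx)) :
    mellinIntegral μ (equivFourier ψ dx l s Φ) χ *
        ∫ y : Fˣ, g y * (χ (l y) : ℂ) * (absF y : ℂ) ^ (1 - s) ∂(mulMeasure dx) =
      (∫ y : Fˣ, (∫ x, g x * (ψ (x * y) : ℂ) ∂dx) * ((χ (l y))⁻¹ : ℂˣ) *
        (absF y : ℂ) ^ s ∂(mulMeasure dx)) * mellinIntegral μ Φ χ := by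
  set Ψ := equivFourier ψ dx l s Φ with hΨ
  have hl : Continuous l := map_continuous l
  have hm1 := measurePreserving_shear (μ := μ) dx l hl
  have hm2 := measurePreserving_shear (μ := μ) dx (fun y => (l y)⁻¹) hl.inv
  -- A product of two integrable functions, pulled back along the measure-preserving shear `(y, t) ↦
  -- (y, λ(y)t)`, which absorbs the factor `χ(λ(y))`.
  have e1 : Integrable (fun p : Fˣ × T => (Ψ (l p.1 * p.2) * ((χ p.2)⁻¹ : ℂˣ)) *
      (g p.1 * (absF p.1 : ℂ) ^ (1 - s))) ((mulMeasure dx).prod μ) := by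
    refine (hm1.integrable_comp_of_integrable (hZ.mul_prod hFΦ)).congr (ae_of_all _ fun p => ?_)
    have : (χ (l p.1) : ℂ) ≠ 0 := Units.ne_zero _
    simp only [Function.comp, map_mul, mul_inv, Units.val_mul, Units.val_inv_eq_inv_val]
    field_simp
  have e2 : Integrable (fun p : Fˣ × T => ((∫ x, g x * (ψ (x * p.1) : ℂ) ∂dx) * (absF p.1 : ℂ) ^ s) *
      (Φ ((l p.1)⁻¹ * p.2) * ((χ p.2)⁻¹ : ℂˣ))) ((mulMeasure dx).prod μ) := by
    refine (hm2.integrable_comp_of_integrable (hZ'.mul_prod hΦ)).congr (ae_of_all _ fun p => ?_)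
    have : (χ (l p.1) : ℂ) ≠ 0 := Units.ne_zero _
    simp only [Function.comp, map_mul, map_inv, mul_inv, inv_inv, Units.val_mul,
      Units.val_inv_eq_inv_val]
    generalize ∫ x, g x * (ψ (x * p.1) : ℂ) ∂dx = c
    field_simp
  calc _ = ∫ y : Fˣ, ∫ t, (Ψ (l y * t) * ((χ t)⁻¹ : ℂˣ)) * (g y * (absF y : ℂ) ^ (1 - s)) ∂μ
        ∂(mulMeasure dx) := by
        rw [← integral_const_mul]
        refine integral_congr_ae (ae_of_all _ fun y => ?_)
        simp only
        rw [mellinIntegral, ← integral_mul_left_eq_self _ (l y), ← integral_mul_const]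
        refine integral_congr_ae (ae_of_all _ fun t => ?_)
        have : (χ (l y) : ℂ) ≠ 0 := Units.ne_zero _
        simp only [map_mul, mul_inv, Units.val_mul, Units.val_inv_eq_inv_val]
        field_simp
    _ = ∫ t, ∫ y : Fˣ, (Ψ (l y * t) * ((χ t)⁻¹ : ℂˣ)) * (g y * (absF y : ℂ) ^ (1 - s))
        ∂(mulMeasure dx) ∂μ := integral_integral_swap e1
    _ = ∫ t, ∫ y : Fˣ, ((∫ x, g x * (ψ (x * y) : ℂ) ∂dx) * (absF y : ℂ) ^ s) *
      (Φ ((l y)⁻¹ * t) * ((χ t)⁻¹ : ℂˣ)) ∂(mulMeasure dx) ∂μ := by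
        refine integral_congr_ae (ae_of_all _ fun t => ?_)
        have key := integral_unit_pairing_swap hψ (integrable_absF_cpow_mul hψ (hconv t)) hg
        calc _ = ((χ t)⁻¹ : ℂˣ) * ∫ y : Fˣ, ((absF y : ℂ) * g y) *
              ∫ v : Fˣ, (ψ ((y : F) * v) : ℂ) * ((absF v : ℂ) ^ s * Φ ((l v)⁻¹ * t))
                ∂(mulMeasure dx) ∂(mulMeasure dx) := by
              rw [← integral_const_mul]
              refine integral_congr_ae (ae_of_all _ fun y => ?_)
              simp only [hΨ, equivFourier_mul]
              -- This forces the exponent `1 - s`: with the `|y|^s` from equivariance it leaves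
              -- precisely the `|y|` that turns `d^×y` into `dy`.
              have : (absF y : ℂ) ^ s * (absF y : ℂ) ^ (1 - s) = absF y := by
                rw [← Complex.cpow_add _ _ (absF_ne_zero y)]; simp
              linear_combination (∫ v : Fˣ, (ψ ((y : F) * v) : ℂ) *
                ((absF v : ℂ) ^ s * Φ ((l v)⁻¹ * t)) ∂(mulMeasure dx)) * g y *
                  ((χ t)⁻¹ : ℂˣ) * this
          _ = _ := by
              rw [key, ← integral_const_mul]
              refine integral_congr_ae (ae_of_all _ fun y => ?_)
              simp only
              ring
    _ = ∫ y : Fˣ, ∫ t, ((∫ x, g x * (ψ (x * y) : ℂ) ∂dx) * (absF y : ℂ) ^ s) *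
      (Φ ((l y)⁻¹ * t) * ((χ t)⁻¹ : ℂˣ)) ∂μ ∂(mulMeasure dx) := (integral_integral_swap e2).symm
    _ = _ := by
        rw [← integral_mul_const]
        refine integral_congr_ae (ae_of_all _ fun y => ?_)
        simp only
        rw [mellinIntegral, ← integral_mul_left_eq_self (fun t => Φ t * (((χ t)⁻¹ : ℂˣ) : ℂ)) (l y)⁻¹,
          ← integral_const_mul]
        refine integral_congr_ae (ae_of_all _ fun t => ?_)
        have : (χ (l y) : ℂ) ≠ 0 := Units.ne_zero _
        simp only [map_mul, map_inv, mul_inv, inv_inv, Units.val_mul, Units.val_inv_eq_inv_val]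
        generalize ∫ x, g x * (ψ (x * y) : ℂ) ∂dx = c
        field_simp

/-- If the equivariant Fourier transform is dominated by the convolutions of functions `Ψ i` with
kernels `K i`, then its Mellin integral converges absolutely wherever these do. -/
theorem mellinConverges_of_dominated {l : Fˣ →ₜ* T} {χ : T →ₜ* ℂˣ} {G : T → ℂ}
    (hG : AEStronglyMeasurable G μ) {ι : Type*} (I : Finset ι) (K : ι → Fˣ → ℂ) (Ψ : ι → T → ℂ)
    (hK : ∀ i ∈ I, Integrable (fun x => K i x * ((χ (l x))⁻¹ : ℂˣ)) (mulMeasure dx))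
    (hΨ : ∀ i ∈ I, MellinConverges μ (Ψ i) χ)
    (hb : ∀ t, ‖G t‖ ≤ ∑ i ∈ I, ∫ x, ‖K i x‖ * ‖Ψ i ((l x)⁻¹ * t)‖ ∂(mulMeasure dx)) :
    MellinConverges μ G χ := by
  have hl : Continuous l := map_continuous l
  have hχ : Continuous fun t => (((χ t)⁻¹ : ℂˣ) : ℂ) :=
    Units.continuous_val.comp (map_continuous χ).inv
  have hm2 := measurePreserving_shear (μ := μ) dx (fun y => (l y)⁻¹) hl.inv
  have e : ∀ i ∈ I, Integrable (fun t => ∫ x, ‖K i x‖ * ‖Ψ i ((l x)⁻¹ * t)‖ * ‖(((χ t)⁻¹ : ℂˣ) : ℂ)‖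
      ∂(mulMeasure dx)) μ := by
    intro i hi
    have e2 : Integrable (fun p : Fˣ × T => ‖K i p.1‖ * ‖Ψ i ((l p.1)⁻¹ * p.2)‖ *
        ‖(((χ p.2)⁻¹ : ℂˣ) : ℂ)‖) ((mulMeasure dx).prod μ) := by
      refine (hm2.integrable_comp_of_integrable ((hK i hi).norm.mul_prod (hΨ i hi).norm)).congr
        (ae_of_all _ fun p => ?_)
      have : ‖(χ (l p.1) : ℂ)‖ ≠ 0 := norm_ne_zero_iff.2 (Units.ne_zero _)
      simp only [Function.comp, map_mul, map_inv, mul_inv, inv_inv, Units.val_mul,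
        Units.val_inv_eq_inv_val, norm_mul, norm_inv]
      field_simp
    exact e2.integral_prod_right
  refine (integrable_finsetSum I e).mono' (hG.mul hχ.aestronglyMeasurable) (ae_of_all _ fun t => ?_)
  rw [norm_mul]
  refine (mul_le_mul_of_nonneg_right (hb t) (norm_nonneg _)).trans_eq ?_
  rw [Finset.sum_mul]
  exact Finset.sum_congr rfl fun i _ => (integral_mul_const _ _).symm

end Unfolding

/-! ### Holomorphy and continuation of Mellin integrals -/

section ParametricExponential

variable {X : Type*} [MeasurableSpace X] {μ : Measure X}

/-- Trades absolute values in an exponent for finitely many linear exponents, at which integrability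
is available. -/
theorem Real.exp_two_abs_add_le (a b : ℝ) :
    Real.exp (2 * (|a| + |b|)) ≤ ∑ ε : Bool × Bool,
      Real.exp ((if ε.1 then 2 else -2) * a + (if ε.2 then 2 else -2) * b) := by
  have h : ∃ ε : Bool × Bool, 2 * (|a| + |b|) =
      (if ε.1 then 2 else -2) * a + (if ε.2 then 2 else -2) * b := by
    rcases abs_choice a with ha | ha <;> rcases abs_choice b with hb | hb <;> rw [ha, hb]
    · exact ⟨(true, true), by simp; ring⟩
    · exact ⟨(true, false), by simp; ring⟩
    · exact ⟨(false, true), by simp; ring⟩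
    · exact ⟨(false, false), by simp; ring⟩
  obtain ⟨ε, hε⟩ := h
  rw [hε]
  exact Finset.single_le_sum (f := fun ε : Bool × Bool =>
    Real.exp ((if ε.1 then 2 else -2) * a + (if ε.2 then 2 else -2) * b))
    (fun _ _ => (Real.exp_pos _).le) (Finset.mem_univ ε)

/-- Integrability at all parameters gives an exponential margin at each one: the growth factor is
dominated by a finite sum of the exponentials at shifted parameters `z₀ + w`, one shift for each
choice of signs. -/
theorem integrable_norm_mul_exp_sum_norm {k : ℕ} {G : X → ℂ} {a : Fin k → X → ℂ}
    (ha : ∀ i, Measurable (a i))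
    (h : ∀ z : Fin k → ℂ, Integrable (fun t => G t * Complex.exp (∑ i, z i * a i t)) μ)
    (z₀ : Fin k → ℂ) :
    Integrable (fun t => ‖G t * Complex.exp (∑ i, z₀ i * a i t)‖ *
      Real.exp (2 * ∑ i, ‖a i t‖)) μ := by
  -- The imaginary part is negated because `Re(wa) = Re w · Re a - Im w · Im a`; hence `Re(wa) = ±2
  -- Re a ± 2 Im a`.
  let w : (Fin k → Bool × Bool) → Fin k → ℂ := fun ε i =>
    ⟨if (ε i).1 then 2 else -2, -(if (ε i).2 then 2 else -2)⟩
  have hint_g : Integrable (fun t => ∑ ε : Fin k → Bool × Bool,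
      ‖G t * Complex.exp (∑ i, (z₀ + w ε) i * a i t)‖) μ :=
    integrable_finsetSum _ fun ε _ => (h (z₀ + w ε)).norm
  refine hint_g.mono' ((h z₀).1.norm.mul ?_) (ae_of_all _ fun t => ?_)
  · refine (Measurable.aestronglyMeasurable ?_)
    fun_prop
  · rw [Real.norm_of_nonneg (by positivity)]
    have h1 : Real.exp (2 * ∑ i, ‖a i t‖) ≤ ∑ ε : Fin k → Bool × Bool,
        ‖Complex.exp (∑ i, w ε i * a i t)‖ := by
      calc Real.exp (2 * ∑ i, ‖a i t‖) = ∏ i, Real.exp (2 * ‖a i t‖) := by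
            rw [Finset.mul_sum, Real.exp_sum]
        _ ≤ ∏ i, ∑ ε : Bool × Bool, Real.exp ((if ε.1 then 2 else -2) * (a i t).re +
            (if ε.2 then 2 else -2) * (a i t).im) := by
            refine Finset.prod_le_prod (fun i _ => (Real.exp_pos _).le) fun i _ => ?_
            refine le_trans (Real.exp_le_exp.2 ?_) (Real.exp_two_abs_add_le _ _)
            have := Complex.norm_le_abs_re_add_abs_im (a i t)
            linarith
        _ = _ := by
            rw [Finset.prod_univ_sum]
            simp only [Fintype.piFinset_univ]
            refine Finset.sum_congr rfl fun ε _ => ?_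
            rw [Complex.norm_exp, ← Real.exp_sum]
            congr 1
            simp only [Complex.re_sum, Complex.mul_re, w]
            refine Finset.sum_congr rfl fun i _ => ?_
            ring
    refine (mul_le_mul_of_nonneg_left h1 (norm_nonneg _)).trans_eq ?_
    rw [Finset.mul_sum]
    refine Finset.sum_congr rfl fun ε _ => ?_
    rw [← norm_mul, mul_assoc, ← Complex.exp_add, ← Finset.sum_add_distrib]
    simp only [Pi.add_apply, add_mul]

/-- Differentiation under the integral sign on a unit ball, dominated by the margin from
`integrable_norm_mul_exp_sum_norm`. -/
theorem differentiable_integral_mul_exp_sum {k : ℕ} {G : X → ℂ} {a : Fin k → X → ℂ}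
    (ha : ∀ i, Measurable (a i))
    (h : ∀ z : Fin k → ℂ, Integrable (fun t => G t * Complex.exp (∑ i, z i * a i t)) μ) :
    Differentiable ℂ fun z : Fin k → ℂ => ∫ t, G t * Complex.exp (∑ i, z i * a i t) ∂μ := by
  intro z₀
  let L : X → (Fin k → ℂ) →L[ℂ] ℂ := fun t => ∑ i, a i t • ContinuousLinearMap.proj i
  have hL : ∀ t z, L t z = ∑ i, z i * a i t := fun t z => by
    simp [L, mul_comm]
  have hLm : Measurable L := by
    refine Finset.measurable_sum _ fun i _ => ?_
    exact (ha i).smul_const _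
  have hLn : ∀ t, ‖L t‖ ≤ ∑ i, ‖a i t‖ := fun t => by
    refine ContinuousLinearMap.opNorm_le_bound _ (by positivity) fun z => ?_
    rw [hL, Finset.sum_mul]
    refine (norm_sum_le _ _).trans (Finset.sum_le_sum fun i _ => ?_)
    rw [norm_mul, mul_comm]
    exact mul_le_mul_of_nonneg_left (norm_le_pi_norm z i) (norm_nonneg _)
  have key := hasFDerivAt_integral_of_dominated_of_fderiv_le (𝕜 := ℂ) (μ := μ)
    (F := fun (z : Fin k → ℂ) t => G t * Complex.exp (∑ i, z i * a i t))
    (F' := fun z t => (G t * Complex.exp (∑ i, z i * a i t)) • L t) (x₀ := z₀)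
    (s := Metric.ball z₀ 1)
    (bound := fun t => ‖G t * Complex.exp (∑ i, z₀ i * a i t)‖ * Real.exp (2 * ∑ i, ‖a i t‖))
    (Metric.ball_mem_nhds z₀ one_pos) (Filter.Eventually.of_forall fun z => (h z).1) (h z₀)
    ((h z₀).1.smul hLm.aestronglyMeasurable) (ae_of_all _ fun t z hz => ?_)
    (integrable_norm_mul_exp_sum_norm ha h z₀) (ae_of_all _ fun t z _ => ?_)
  · exact key.differentiableAt
  · rw [norm_smul]
    have e1 : ∑ i, z i * a i t = ∑ i, z₀ i * a i t + L t (z - z₀) := by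
      rw [hL, ← Finset.sum_add_distrib]
      refine Finset.sum_congr rfl fun i _ => ?_
      simp only [Pi.sub_apply]; ring
    have e2 : ‖L t (z - z₀)‖ ≤ ∑ i, ‖a i t‖ := by
      refine ((L t).le_opNorm _).trans ?_
      have : ‖z - z₀‖ ≤ 1 := (mem_ball_iff_norm.1 hz).le
      calc ‖L t‖ * ‖z - z₀‖ ≤ ‖L t‖ * 1 := by gcongr
        _ ≤ _ := by simpa using hLn t
    rw [e1, Complex.exp_add, ← mul_assoc, norm_mul, mul_assoc]
    refine mul_le_mul_of_nonneg_left ?_ (norm_nonneg _)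
    -- One half of the exponent pays for moving the parameter by at most `1`, the other for the
    -- linear factor `‖L t‖`.
    rw [two_mul, Real.exp_add]
    refine mul_le_mul ?_ ?_ (norm_nonneg _) (Real.exp_pos _).le
    · rw [Complex.norm_exp]
      exact Real.exp_le_exp.2 ((Complex.re_le_norm _).trans e2)
    · refine (hLn t).trans ?_
      have := Real.add_one_le_exp (∑ i, ‖a i t‖)
      linarith
  · have h1 : HasFDerivAt (fun z : Fin k → ℂ => Complex.exp (L t z))
        (Complex.exp (L t z) • L t) z := (L t).hasFDerivAt.cexp
    have h2 := h1.const_mul (G t)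
    simp only [hL] at h2
    rwa [smul_smul] at h2

theorem Real.exp_mul_le_one_add_exp {x : ℝ} (h0 : 0 ≤ x) (h1 : x ≤ 1) (a : ℝ) :
    Real.exp (x * a) ≤ 1 + Real.exp a := by
  rcases le_total a 0 with ha | ha
  · have : Real.exp (x * a) ≤ 1 := Real.exp_le_one_iff.2 (mul_nonpos_of_nonneg_of_nonpos h0 ha)
    linarith [Real.exp_pos a]
  · have : Real.exp (x * a) ≤ Real.exp a := Real.exp_le_exp.2 (by nlinarith)
    linarith

theorem integrable_mul_one_add_exp {G : X → ℂ} {a : X → ℝ} (h0 : Integrable G μ)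
    (h1 : Integrable (fun t => G t * Complex.exp (a t)) μ) :
    Integrable (fun t => ‖G t‖ * (1 + Real.exp (a t))) μ := by
  refine (h0.norm.add h1.norm).congr (ae_of_all _ fun t => ?_)
  simp only [Pi.add_apply, norm_mul, Complex.norm_exp, Complex.ofReal_re]
  ring

theorem differentiableAt_integral_mul_exp_strip {G : X → ℂ} {a : X → ℝ} (ha : Measurable a)
    (h0 : Integrable G μ) (h1 : Integrable (fun t => G t * Complex.exp (a t)) μ) {z₀ : ℂ}
    (hz0 : 0 < z₀.re) (hz1 : z₀.re < 1) :
    DifferentiableAt ℂ (fun z : ℂ => ∫ t, G t * Complex.exp (z * a t) ∂μ) z₀ := by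
  -- Room for two shifts by `ε` inside the strip: one for `z` in the ball, one for the derivative's
  -- factor `a t`, bounded through `ε|a| ≤ exp(εa) + exp(-εa)`.
  obtain ⟨ε, hε, hε0, hε1⟩ : ∃ ε : ℝ, 0 < ε ∧ 2 * ε ≤ z₀.re ∧ z₀.re + 2 * ε ≤ 1 := by
    refine ⟨min z₀.re (1 - z₀.re) / 2, by have := lt_min hz0 (sub_pos.2 hz1); positivity, ?_, ?_⟩
    · linarith [min_le_left z₀.re (1 - z₀.re)]
    · linarith [min_le_right z₀.re (1 - z₀.re)]
  have hb := integrable_mul_one_add_exp h0 h1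
  have hmeas : ∀ z : ℂ, AEStronglyMeasurable (fun t => G t * Complex.exp (z * a t)) μ := fun z =>
    h0.1.mul (Measurable.aestronglyMeasurable (by fun_prop))
  have hnorm : ∀ (z : ℂ) t, ‖G t * Complex.exp (z * a t)‖ = ‖G t‖ * Real.exp (z.re * a t) := by
    intro z t
    rw [norm_mul, Complex.norm_exp]; simp
  have hF := hasDerivAt_integral_of_dominated_loc_of_deriv_le (𝕜 := ℂ) (μ := μ)
    (F := fun (z : ℂ) t => G t * Complex.exp (z * a t))
    (F' := fun z t => G t * Complex.exp (z * a t) * a t) (x₀ := z₀) (s := Metric.ball z₀ ε)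
    (bound := fun t => ε⁻¹ * 2 * (‖G t‖ * (1 + Real.exp (a t))))
    (Metric.ball_mem_nhds z₀ hε) (Filter.Eventually.of_forall hmeas) ?_
    ((hmeas z₀).mul (Measurable.aestronglyMeasurable (by fun_prop))) (ae_of_all _ fun t z hz => ?_)
    (hb.const_mul _) (ae_of_all _ fun t z _ => ?_)
  · exact hF.2.differentiableAt
  · refine hb.mono' (hmeas z₀) (ae_of_all _ fun t => ?_)
    rw [hnorm]
    exact mul_le_mul_of_nonneg_left (Real.exp_mul_le_one_add_exp hz0.le hz1.le _) (norm_nonneg _)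
  · have hzre : |z.re - z₀.re| < ε := by
      refine lt_of_le_of_lt ?_ (mem_ball_iff_norm.1 hz)
      simpa using Complex.abs_re_le_norm (z - z₀)
    rw [abs_lt] at hzre
    rw [norm_mul, hnorm]
    have e1 : ε * |a t| ≤ Real.exp (ε * a t) + Real.exp (-(ε * a t)) := by
      rcases abs_choice (a t) with h | h <;> rw [h]
      · linarith [Real.add_one_le_exp (ε * a t), Real.exp_pos (-(ε * a t))]
      · linarith [Real.add_one_le_exp (-(ε * a t)), Real.exp_pos (ε * a t)]
    have e2 : Real.exp (z.re * a t) * (ε * |a t|) ≤ 2 * (1 + Real.exp (a t)) := by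
      refine (mul_le_mul_of_nonneg_left e1 (Real.exp_pos _).le).trans ?_
      rw [mul_add, ← Real.exp_add, ← Real.exp_add, ← add_mul, ← sub_eq_add_neg, ← sub_mul]
      have := Real.exp_mul_le_one_add_exp (x := z.re + ε) (by linarith) (by linarith) (a t)
      have := Real.exp_mul_le_one_add_exp (x := z.re - ε) (by linarith) (by linarith) (a t)
      linarith
    have e3 : Real.exp (z.re * a t) * |a t| ≤ ε⁻¹ * 2 * (1 + Real.exp (a t)) := by
      rw [mul_assoc, inv_mul_eq_div, le_div_iff₀ hε]
      linarith
    simp only [Complex.norm_real, Real.norm_eq_abs]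
    calc ‖G t‖ * Real.exp (z.re * a t) * |a t| = ‖G t‖ * (Real.exp (z.re * a t) * |a t|) := by ring
      _ ≤ ‖G t‖ * (ε⁻¹ * 2 * (1 + Real.exp (a t))) := by gcongr
      _ = _ := by ring
  · have h2 := ((hasDerivAt_mul_const (x := z) (a t : ℂ)).cexp).const_mul (G t)
    simpa [mul_assoc] using h2

theorem continuousWithinAt_integral_mul_exp {G : X → ℂ} {a : X → ℝ} (ha : Measurable a)
    (h0 : Integrable G μ) (h1 : Integrable (fun t => G t * Complex.exp (a t)) μ) :
    ContinuousWithinAt (fun x : ℝ => ∫ t, G t * Complex.exp (x * a t) ∂μ) (Set.Icc 0 1) 0 := by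
  refine continuousWithinAt_of_dominated (bound := fun t => ‖G t‖ * (1 + Real.exp (a t))) ?_ ?_
    (integrable_mul_one_add_exp h0 h1) ?_
  · exact Filter.Eventually.of_forall fun x =>
      h0.1.mul (Measurable.aestronglyMeasurable (by fun_prop))
  · refine eventually_nhdsWithin_of_forall fun x hx => ae_of_all _ fun t => ?_
    rw [norm_mul, Complex.norm_exp]
    refine mul_le_mul_of_nonneg_left ?_ (norm_nonneg _)
    simpa using Real.exp_mul_le_one_add_exp hx.1 hx.2 (a t)
  · refine ae_of_all _ fun t => Continuous.continuousWithinAt (by fun_prop)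

/-- A relation between entire functions and an exponential integral, valid at the right end of the
strip of convergence, holds at the left end as well. -/
theorem mul_integral_eq_of_strip {G : X → ℂ} {a : X → ℝ} (ha : Measurable a)
    (h0 : Integrable G μ) (h1 : Integrable (fun t => G t * Complex.exp (a t)) μ) {P Q : ℂ → ℂ}
    (hP : Differentiable ℂ P) (hQ : Differentiable ℂ Q)
    (h : ∀ᶠ x : ℝ in 𝓝 1, Q x * ∫ t, G t * Complex.exp (x * a t) ∂μ = P x) :
    Q 0 * ∫ t, G t ∂μ = P 0 := by
  let H : ℂ → ℂ := fun z => Q z * (∫ t, G t * Complex.exp (z * a t) ∂μ) - P z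
  let S : Set ℂ := Complex.re ⁻¹' Set.Ioo 0 1
  have hSo : IsOpen S := isOpen_Ioo.preimage Complex.continuous_re
  have hSc : IsPreconnected S :=
    ((convex_Ioo (0 : ℝ) 1).is_linear_preimage Complex.reLm.isLinear).isPreconnected
  have hH : AnalyticOnNhd ℂ H S := by
    refine DifferentiableOn.analyticOnNhd (fun z hz => ?_) hSo
    exact (((hQ z).mul (differentiableAt_integral_mul_exp_strip ha h0 h1 hz.1 hz.2)).sub
      (hP z)).differentiableWithinAt
  obtain ⟨δ, hδ, hball⟩ := Metric.eventually_nhds_iff.1 h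
  -- A point inside the open strip, yet close enough to `1` that the relation is known on a real
  -- interval around it; the identity theorem applies there.
  set x₀ : ℝ := max (1 / 2) (1 - δ / 2) with hx₀
  have hx₀1 : x₀ < 1 := max_lt (by norm_num) (by linarith)
  have hx₀0 : 0 < x₀ := lt_of_lt_of_le (by norm_num) (le_max_left _ _)
  have hx₀δ : 1 - δ < x₀ := lt_of_lt_of_le (by linarith) (le_max_right _ _)
  have hfreq : ∃ᶠ z in 𝓝[≠] (x₀ : ℂ), H z = 0 := by
    have h2 : ∀ᶠ x : ℝ in 𝓝[≠] x₀, H x = 0 := by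
      refine Filter.Eventually.filter_mono nhdsWithin_le_nhds ?_
      filter_upwards [Ioo_mem_nhds hx₀δ (hx₀1.trans (lt_add_of_pos_right 1 hδ))] with x hx
      refine sub_eq_zero.2 (hball ?_)
      rw [Real.dist_eq, abs_lt]
      constructor <;> linarith [hx.1, hx.2]
    have h3 : Filter.Tendsto (fun x : ℝ => (x : ℂ)) (𝓝[≠] x₀) (𝓝[≠] (x₀ : ℂ)) :=
      tendsto_nhdsWithin_of_tendsto_nhds_of_eventually_within _
        (Complex.continuous_ofReal.continuousAt.tendsto.mono_left nhdsWithin_le_nhds)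
        (eventually_nhdsWithin_of_forall fun x hx => by simpa using hx)
    exact h3.frequently h2.frequently
  have hzero : Set.EqOn H 0 S :=
    hH.eqOn_zero_of_preconnected_of_frequently_eq_zero hSc (z₀ := (x₀ : ℂ)) ⟨hx₀0, hx₀1⟩ hfreq
  -- The point `0` lies on the edge of the strip, where analyticity is not available; one-sided
  -- continuity along the real axis suffices.
  have hcont : ContinuousWithinAt (fun x : ℝ => H x) (Set.Icc 0 1) 0 := by
    have hc := Complex.continuous_ofReal
    exact ((hQ.continuous.comp hc).continuousWithinAt.mul
      (continuousWithinAt_integral_mul_exp ha h0 h1)).sub (hP.continuous.comp hc).continuousWithinAt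
  have hlim : Filter.Tendsto (fun x : ℝ => H x) (𝓝[Set.Ioo 0 1] 0) (𝓝 (H (0 : ℝ))) :=
    hcont.tendsto.mono_left (nhdsWithin_mono _ Set.Ioo_subset_Icc_self)
  have hne : (𝓝[Set.Ioo (0 : ℝ) 1] 0).NeBot := by
    rw [← mem_closure_iff_nhdsWithin_neBot, closure_Ioo (by norm_num)]
    simp
  have hlim' : Filter.Tendsto (fun x : ℝ => H x) (𝓝[Set.Ioo 0 1] 0) (𝓝 0) :=
    tendsto_const_nhds.congr' (eventually_nhdsWithin_of_forall fun x hx =>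
      (hzero (show (x : ℂ) ∈ S from ⟨by simpa using hx.1, by simpa using hx.2⟩)).symm)
  have := tendsto_nhds_unique hlim hlim'
  simpa [H, sub_eq_zero] using this

end ParametricExponential

/-! ### Spreading a Mellin relation from an open set to all points of convergence -/

section Continuation

variable {T : Type*} [Group T] [TopologicalSpace T]

theorem coe_twist (χ : T →ₜ* ℂˣ) (ν : LogChar T) (t : T) :
    (twist χ ν t : ℂ) = χ t * Complex.exp (ν.1 t) := rfl

theorem coe_inv_twist (χ : T →ₜ* ℂˣ) (ν : LogChar T) (t : T) :
    (((twist χ ν t)⁻¹ : ℂˣ) : ℂ) = ((χ t)⁻¹ : ℂˣ) * Complex.exp (-ν.1 t) := by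
  rw [Units.val_inv_eq_inv_val, coe_twist, mul_inv, Units.val_inv_eq_inv_val, Complex.exp_neg]

theorem twist_zero (χ : T →ₜ* ℂˣ) : twist χ 0 = χ := by
  ext t
  simp [coe_twist]

theorem IsHolomorphic.mul {P Q : LogChar T → ℂ} (hP : IsHolomorphic P) (hQ : IsHolomorphic Q) :
    IsHolomorphic fun ν => P ν * Q ν := fun k ν₀ ν => (hP k ν₀ ν).mul (hQ k ν₀ ν)

theorem isHolomorphic_comp_linear {h : ℂ → ℂ} (hh : Differentiable ℂ h) (κ : LogChar T →ₗ[ℂ] ℂ) :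
    IsHolomorphic fun ν => h (κ ν) := by
  intro k ν₀ ν
  refine hh.comp ?_
  simp only [map_add, map_sum, map_smul, smul_eq_mul]
  fun_prop

theorem IsHolomorphic.differentiable_line {P : LogChar T → ℂ} (hP : IsHolomorphic P)
    (ν₀ ν : LogChar T) : Differentiable ℂ fun z : ℂ => P (ν₀ + z • ν) := by
  have h := hP 1 ν₀ fun _ => ν
  have h2 : Differentiable ℂ fun z : ℂ => (fun _ : Fin 1 => z) := by fun_prop
  simpa [Function.comp_def] using h.comp h2

variable [MeasurableSpace T] [BorelSpace T] {μ : Measure T}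

theorem isHolomorphic_mellinIntegral {f : T → ℂ} {χ : T →ₜ* ℂˣ}
    (h : ∀ ν, MellinConverges μ f (twist χ ν)) :
    IsHolomorphic fun ν => mellinIntegral μ f (twist χ ν) := by
  intro k ν₀ ν
  have e : ∀ (z : Fin k → ℂ) t, f t * (((twist χ (ν₀ + ∑ i, z i • ν i) t)⁻¹ : ℂˣ) : ℂ) =
      (f t * (((twist χ ν₀ t)⁻¹ : ℂˣ) : ℂ)) * Complex.exp (∑ i, z i * (-(ν i).1 t)) := by
    intro z t
    simp only [coe_inv_twist, mul_assoc, ← Complex.exp_add]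
    congr 3
    simp [Finset.sum_apply]
    ring
  unfold mellinIntegral
  simp_rw [e]
  refine differentiable_integral_mul_exp_sum (fun i => ((ν i).2.1.neg).measurable) fun z => ?_
  simpa only [MellinConverges, e] using h (ν₀ + ∑ i, z i • ν i)

/-- `HasMellinValue` requires the relation at every point of convergence, not only on `U`. From any
such point the direction `θ` leads into `U`. As `θ` is real, twisting along it multiplies the
integrand by real exponentials, so the integral converges on the whole segment and
`mul_integral_eq_of_strip` brings the relation back. -/
theorem hasMellinValue_of_open {g : T → ℂ} {χ : T →ₜ* ℂˣ} {U : Set (LogChar T)} (hU : IsOpen U)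
    (hconv : ∀ ν ∈ U, MellinConverges μ g (twist χ ν)) (θ : LogChar T) (hθ : ∀ t, (θ.1 t).im = 0)
    (hmeet : ∀ ν, ∃ c : ℝ, ν + (c : ℂ) • θ ∈ U) {P Q : LogChar T → ℂ} (hP : IsHolomorphic P)
    (hQ : IsHolomorphic Q) (hPQ : ∀ ν ∈ U, Q ν * mellinIntegral μ g (twist χ ν) = P ν)
    (hQ0 : Q 0 ≠ 0) : HasMellinValue μ g χ (P 0 / Q 0) := by
  refine ⟨?_, P, Q, hP, hQ, fun ν hν => ?_, hQ0, rfl⟩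
  · obtain ⟨c, hc⟩ := hmeet 0
    exact ⟨_, Filter.eventually_of_mem (hU.mem_nhds hc) hconv⟩
  · obtain ⟨c, hc⟩ := hmeet ν
    have e : ∀ (z : ℂ) t, g t * (((twist χ (ν + z • ((c : ℂ) • θ)) t)⁻¹ : ℂˣ) : ℂ) =
        (g t * (((twist χ ν t)⁻¹ : ℂˣ) : ℂ)) * Complex.exp (z * ((-c * (θ.1 t).re : ℝ) : ℂ)) := by
      intro z t
      have h1 : θ.1 t = ((θ.1 t).re : ℂ) := by
        apply Complex.ext <;> simp [hθ]
      simp only [coe_inv_twist, mul_assoc, ← Complex.exp_add]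
      congr 3
      simp only [Submodule.coe_add, Submodule.coe_smul, Pi.add_apply, Pi.smul_apply, smul_eq_mul]
      rw [h1]
      push_cast
      simp
      ring
    have hm : Measurable fun t => -c * (θ.1 t).re :=
      ((Complex.continuous_re.comp θ.2.1).measurable).const_mul _
    have h1 := hconv _ hc
    have h1' : Integrable (fun t => (g t * (((twist χ ν t)⁻¹ : ℂˣ) : ℂ)) *
        Complex.exp ((-c * (θ.1 t).re : ℝ) : ℂ)) μ := by
      have e1 := e 1
      simp only [one_smul, one_mul] at e1
      simpa only [MellinConverges, e1] using h1
    have hev : ∀ᶠ x : ℝ in 𝓝 1, ν + (x : ℂ) • ((c : ℂ) • θ) ∈ U := by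
      have hcont : Continuous fun x : ℝ => ν + (x : ℂ) • ((c : ℂ) • θ) :=
        continuous_const.add (Complex.continuous_ofReal.smul continuous_const)
      exact hcont.continuousAt.eventually_mem (hU.mem_nhds (by simpa using hc))
    have key := mul_integral_eq_of_strip (μ := μ) hm hν h1'
      (hP.differentiable_line ν ((c : ℂ) • θ)) (hQ.differentiable_line ν ((c : ℂ) • θ)) ?_
    · simpa [mellinIntegral] using key
    · filter_upwards [hev] with x hx
      have := hPQ _ hx
      rw [mellinIntegral] at this
      simpa only [e] using this

end Continuation

/-! ### Reduction of the functional equation to zeta integrals on the field -/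

section Reduction

variable {F : Type*} [Field F] [TopologicalSpace F] [IsTopologicalRing F] [LocallyCompactSpace F]
  [MeasurableSpace F] [BorelSpace F]

/-- The absolute value of the character `ω` is `|x| ^ r`. -/
def HasRealExponent (ω : Fˣ →ₜ* ℂˣ) (r : ℝ) : Prop := ∀ x, ‖(ω x : ℂ)‖ = absF x ^ r

/-- For the twists `ω |·| ^ κ` in a strip to the left of `s`, the ratio of the zeta integrals of
`ĝ` and `g`, for suitable test functions `g`, is a quotient `a / b` of entire functions of `κ`,
which at `κ = 0` is regular and has the value `c`. -/
def HasZetaRatio (ψ : AddChar F Circle) (dx : Measure F) (s : ℂ) (ω : Fˣ →ₜ* ℂˣ) (e : ℝ)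
    (c : ℂ) : Prop :=
  ∃ a b : ℂ → ℂ, Differentiable ℂ a ∧ Differentiable ℂ b ∧ b 0 ≠ 0 ∧ a 0 / b 0 = c ∧
    ∀ (r : ℝ) (κ : ℂ), HasRealExponent ω r → 0 < s.re - r - κ.re → s.re - r - κ.re < e →
      ∃ g : F → ℂ, Integrable g dx ∧
        Integrable (fun y : Fˣ => g y * ((ω y : ℂ) * (absF y : ℂ) ^ κ) * (absF y : ℂ) ^ (1 - s))
          (mulMeasure dx) ∧
        Integrable (fun y : Fˣ => (∫ x, g x * (ψ (x * y) : ℂ) ∂dx) *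
          ((ω y : ℂ) * (absF y : ℂ) ^ κ)⁻¹ * (absF y : ℂ) ^ s) (mulMeasure dx) ∧
        ∫ y : Fˣ, g y * ((ω y : ℂ) * (absF y : ℂ) ^ κ) * (absF y : ℂ) ^ (1 - s)
          ∂(mulMeasure dx) ≠ 0 ∧
        b κ * (∫ y : Fˣ, (∫ x, g x * (ψ (x * y) : ℂ) ∂dx) *
          ((ω y : ℂ) * (absF y : ℂ) ^ κ)⁻¹ * (absF y : ℂ) ^ s ∂(mulMeasure dx)) =
        a κ * ∫ y : Fˣ, g y * ((ω y : ℂ) * (absF y : ℂ) ^ κ) * (absF y : ℂ) ^ (1 - s)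
          ∂(mulMeasure dx)

variable {T : Type*} [Group T] [TopologicalSpace T]

/-- Restriction of additive characters along a continuous homomorphism. -/
def LogChar.comp {G : Type*} [Group G] [TopologicalSpace G] (ν : LogChar T) (l : G →ₜ* T) :
    LogChar G :=
  ⟨fun x => ν.1 (l x), ν.2.1.comp (map_continuous l), fun a b => by simp [ν.2.2]⟩

/-- The logarithm of the absolute value of a character. -/
noncomputable def logAbs (χ : T →ₜ* ℂˣ) : LogChar T :=
  ⟨fun t => (Real.log ‖(χ t : ℂ)‖ : ℂ), by
    refine Complex.continuous_ofReal.comp (Continuous.log ?_ fun t => ?_)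
    · exact (Units.continuous_val.comp (map_continuous χ)).norm
    · simp, fun a b => by
    simp only [map_mul, Units.val_mul, norm_mul]
    rw [Real.log_mul (by simp) (by simp)]
    push_cast
    rfl⟩

/-- The function `log|ω|` is itself an additive character, hence a multiple of `log|x|`. -/
theorem exists_hasRealExponent
    (hlog : ∀ ν : LogChar Fˣ, ∃ k : ℂ, ∀ x, ν.1 x = k * Real.log (absF x)) (ω : Fˣ →ₜ* ℂˣ) :
    ∃ r, HasRealExponent ω r := by
  obtain ⟨k, hk⟩ := hlog (logAbs ω)
  refine ⟨k.re, fun x => ?_⟩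
  have h1 : Real.log ‖(ω x : ℂ)‖ = k.re * Real.log (absF x) := by
    have := congrArg Complex.re (hk x)
    simpa [logAbs] using this
  rw [Real.rpow_def_of_pos (absF_pos x), mul_comm, ← h1, Real.exp_log (by simp)]

theorem absF_cpow_eq_exp (x : Fˣ) (k : ℂ) :
    (absF x : ℂ) ^ k = Complex.exp (k * Real.log (absF x)) := by
  rw [Complex.cpow_def_of_ne_zero (absF_ne_zero x), Complex.ofReal_log (absF_pos x).le, mul_comm]

variable [ContinuousInv₀ F] [T2Space F] [SecondCountableTopology F]
  [ContinuousAbsF F] {ψ : AddChar F Circle} {dx : Measure F} [dx.IsAddHaarMeasure]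
  [IsTopologicalGroup T]
  [SecondCountableTopology T] [MeasurableSpace T] [BorelSpace T]
  {μ : Measure T} [μ.IsMulLeftInvariant] [SigmaFinite μ]

/-- Twisting `χ` by `ν` changes `χ ∘ λ` by `|x|^κ(ν)` with `κ` linear, and both the strip and the
zeta ratio depend on `ν` only through `κ(ν)`. Thus the torus enters only through convergence and
through `θ`, whose nonzero value on the image of `λ` makes the strip reachable from everywhere. -/
theorem hasMellinValue_equivFourier (hψ : Continuous ψ) [NullSingletonClass dx]
    (hlog : ∀ ν : LogChar Fˣ, ∃ k : ℂ, ∀ x, ν.1 x = k * Real.log (absF x))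
    (l : Fˣ →ₜ* T) (s : ℂ) (Φ : T → ℂ)
    (hconv : ∀ t, Integrable (fun x => kernelD ψ s x * Φ ((l x)⁻¹ * t)) (mulMeasure dx))
    (hΦ : ∀ χ, MellinConverges μ Φ χ) {e : ℝ} (he : 0 < e)
    (hFΦ : ∀ (χ : T →ₜ* ℂˣ) (r : ℝ), HasRealExponent (χ.comp l) r → 0 < s.re - r → s.re - r < e →
      MellinConverges μ (equivFourier ψ dx l s Φ) χ)
    (θ : LogChar T) (hθ : ∀ t, (θ.1 t).im = 0) (x₀ : Fˣ) (hθ₀ : θ.1 (l x₀) ≠ 0)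
    (χ : T →ₜ* ℂˣ) {c : ℂ} (hZ : HasZetaRatio ψ dx s (χ.comp l) e c) :
    HasMellinValue μ (equivFourier ψ dx l s Φ) χ (c * mellinIntegral μ Φ χ) := by
  have hx₀ : Real.log (absF x₀) ≠ 0 := by
    intro h0
    obtain ⟨k, hk⟩ := hlog (LogChar.comp θ l)
    exact hθ₀ ((hk x₀).trans (by simp [h0]))
  have hx₀' : (Real.log (absF x₀) : ℂ) ≠ 0 := by exact_mod_cast hx₀
  -- Additive characters of `Fˣ` are multiples of `log|x|`, so one point `x₀` determines the
  -- coefficient. Evaluation at a point is continuous for pointwise convergence.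
  let κ : LogChar T →ₗ[ℂ] ℂ :=
    { toFun := fun ν => ν.1 (l x₀) / Real.log (absF x₀)
      map_add' := fun a b => by simp [add_div]
      map_smul' := fun a b => by simp [mul_div_assoc] }
  have hκ : ∀ ν x, ν.1 (l x) = κ ν * Real.log (absF x) := by
    intro ν x
    obtain ⟨k, hk⟩ := hlog (LogChar.comp ν l)
    have h0 : ν.1 (l x₀) = k * Real.log (absF x₀) := hk x₀
    have h1 : κ ν = k := by
      change ν.1 (l x₀) / _ = k
      rw [h0, mul_div_cancel_right₀ _ hx₀']
    rw [h1]
    exact hk x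
  have hκc : Continuous κ := by
    refine Continuous.div_const ?_ _
    exact (continuous_apply (l x₀)).comp continuous_subtype_val
  have htw : ∀ ν x, (twist χ ν (l x) : ℂ) = (χ (l x) : ℂ) * (absF x : ℂ) ^ κ ν := by
    intro ν x
    rw [coe_twist, hκ, absF_cpow_eq_exp]
  obtain ⟨r, hr⟩ := exists_hasRealExponent hlog (χ.comp l)
  obtain ⟨a, b, ha, hb, hb0, hab, hzeta⟩ := hZ
  have hr' : ∀ ν, HasRealExponent ((twist χ ν).comp l) (r + (κ ν).re) := by
    intro ν x
    change ‖(twist χ ν (l x) : ℂ)‖ = _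
    rw [htw, norm_mul, norm_absF_cpow, Real.rpow_add (absF_pos x), ← hr x]
    rfl
  let U : Set (LogChar T) := {ν | 0 < s.re - r - (κ ν).re ∧ s.re - r - (κ ν).re < e}
  have hcre : Continuous fun ν => s.re - r - (κ ν).re :=
    continuous_const.sub (Complex.continuous_re.comp hκc)
  have hU : IsOpen U :=
    (isOpen_lt continuous_const hcre).inter (isOpen_lt hcre continuous_const)
  have hUc : ∀ ν ∈ U, MellinConverges μ (equivFourier ψ dx l s Φ) (twist χ ν) := fun ν hν =>
    hFΦ _ _ (hr' ν) (by linarith [hν.1]) (by linarith [hν.2])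
  have hκθ : ∃ k : ℝ, k ≠ 0 ∧ κ θ = k := by
    have h1 : θ.1 (l x₀) = ((θ.1 (l x₀)).re : ℂ) := by apply Complex.ext <;> simp [hθ]
    refine ⟨(θ.1 (l x₀)).re / Real.log (absF x₀), div_ne_zero (fun h => hθ₀ ?_) hx₀, ?_⟩
    · rw [h1, h]; simp
    · change θ.1 (l x₀) / _ = _
      rw [Complex.ofReal_div, ← h1]
  have hmeet : ∀ ν, ∃ c : ℝ, ν + (c : ℂ) • θ ∈ U := by
    intro ν
    obtain ⟨k, hk, hk'⟩ := hκθ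
    -- Chosen to land on the middle line of the strip, at distance `e / 2` from its edge.
    refine ⟨(s.re - r - (κ ν).re - e / 2) / k, ?_⟩
    have : (κ (ν + (((s.re - r - (κ ν).re - e / 2) / k : ℝ) : ℂ) • θ)).re =
        s.re - r - e / 2 := by
      rw [map_add, map_smul, hk', smul_eq_mul, ← Complex.ofReal_mul, div_mul_cancel₀ _ hk,
        Complex.add_re, Complex.ofReal_re]
      ring
    change 0 < s.re - r - _ ∧ s.re - r - _ < e
    rw [this]
    constructor <;> linarith
  have hmain := hasMellinValue_of_open hU hUc θ hθ hmeet
    (P := fun ν => a (κ ν) * mellinIntegral μ Φ (twist χ ν)) (Q := fun ν => b (κ ν))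
    ((isHolomorphic_comp_linear ha κ).mul (isHolomorphic_mellinIntegral fun ν => hΦ _))
    (isHolomorphic_comp_linear hb κ) (fun ν hν => ?_) (by simpa using hb0)
  · simp only [map_zero, twist_zero] at hmain
    rw [mul_div_right_comm, hab] at hmain
    exact hmain
  · obtain ⟨g, hg, hg1, hg2, hg3, hg4⟩ := hzeta r (κ ν) hr hν.1 hν.2
    have hcomp : ∀ y, (χ.comp l) y = χ (l y) := fun _ => rfl
    simp only [hcomp] at hg1 hg2 hg3 hg4
    have key := mellinIntegral_equivFourier_mul hψ l s Φ (twist χ ν) g hconv (hΦ _) (hUc ν hν) hg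
      (by simpa only [htw] using hg1)
      (by simpa only [Units.val_inv_eq_inv_val, htw] using hg2)
    simp only [Units.val_inv_eq_inv_val, htw] at key
    change b (κ ν) * _ = a (κ ν) * _
    -- The test function varies with `κ(ν)`, but its zeta integral is nonzero and cancels, leaving a
    -- relation free of `g`.
    refine mul_right_cancel₀ hg3 ?_
    linear_combination b (κ ν) * key + mellinIntegral μ Φ (twist χ ν) * hg4

end Reduction

/-! ### Rational points of tori -/

section PointsTopology

variable {F A : Type*} [Field F] [CommRing A] [HopfAlgebra F A]

theorem RatPoints.mul_apply (t t' : RatPoints F A) (a : A) :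
    (t * t').ofConv a = Algebra.TensorProduct.lift t.ofConv t'.ofConv (fun _ _ => .all ..)
      (Coalgebra.comul (R := F) a) :=
  AlgHom.convMul_apply t t' a

variable [TopologicalSpace F]

theorem RatPoints.continuous_eval (a : A) : Continuous fun t : RatPoints F A => t.ofConv a :=
  (continuous_apply a).comp continuous_induced_dom

theorem RatPoints.continuous_iff {X : Type*} [TopologicalSpace X] {f : X → RatPoints F A} :
    Continuous f ↔ ∀ a, Continuous fun x => (f x).ofConv a :=
  continuous_induced_rng.trans continuous_pi_iff

instance RatPoints.instIsTopologicalGroup [IsTopologicalRing F] :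
    IsTopologicalGroup (RatPoints F A) where
  continuous_mul := by
    refine RatPoints.continuous_iff.2 fun a => ?_
    simp only [RatPoints.mul_apply]
    induction Coalgebra.comul (R := F) a using TensorProduct.induction_on with
    | zero => simpa using continuous_const
    | add x y hx hy => simpa [Pi.add_def] using hx.add hy
    | tmul x y =>
      simp only [Algebra.TensorProduct.lift_tmul]
      exact ((RatPoints.continuous_eval x).comp continuous_fst).mul
        ((RatPoints.continuous_eval y).comp continuous_snd)
  continuous_inv := by
    refine RatPoints.continuous_iff.2 fun a => ?_
    exact RatPoints.continuous_eval _

/-- Every regular function is a polynomial in the generators, so these already induce the topology;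
the image is the zero set of the ideal of relations, hence closed. Local compactness, countability
and properness all come from here. -/
theorem RatPoints.isClosedEmbedding [IsTopologicalRing F] [T2Space F] {n : ℕ} {x : Fin n → A}
    (hx : Algebra.adjoin F (Set.range x) = ⊤) :
    IsClosedEmbedding fun (t : RatPoints F A) i => t.ofConv (x i) := by
  have hsurj : Function.Surjective (MvPolynomial.aeval (R := F) x) := by
    rw [← AlgHom.range_eq_top, ← Algebra.adjoin_range_eq_range_aeval, hx]
  have hpoly : ∀ (t : RatPoints F A) (p : MvPolynomial (Fin n) F),
      t.ofConv (MvPolynomial.aeval x p) = MvPolynomial.eval (fun i => t.ofConv (x i)) p := by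
    intro t p
    rw [← AlgHom.comp_apply, MvPolynomial.comp_aeval]
    rfl
  refine ⟨⟨⟨?_⟩, fun t t' h => ?_⟩, ?_⟩
  · refine le_antisymm ?_ ?_
    · exact Continuous.le_induced (continuous_pi fun i => RatPoints.continuous_eval (x i))
    · choose p hp using hsurj
      have hG : Continuous fun (v : Fin n → F) (a : A) => MvPolynomial.eval v (p a) :=
        continuous_pi fun a => MvPolynomial.continuous_eval (p a)
      have hbig : (fun (t : RatPoints F A) (a : A) => t.ofConv a) =
          (fun (v : Fin n → F) (a : A) => MvPolynomial.eval v (p a)) ∘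
            fun (t : RatPoints F A) i => t.ofConv (x i) := by
        funext t a
        simp only [Function.comp]
        rw [← hpoly, hp]
      unfold RatPoints.instTopologicalSpace
      rw [hbig, ← induced_compose]
      exact induced_mono (continuous_iff_le_induced.1 hG)
  · refine WithConv.ofConv_injective (AlgHom.ext fun a => ?_)
    obtain ⟨p, rfl⟩ := hsurj a
    rw [hpoly, hpoly]
    exact congrArg (fun v => MvPolynomial.eval v p) h
  · have : Set.range (fun (t : RatPoints F A) i => t.ofConv (x i)) =
        ⋂ p ∈ RingHom.ker (MvPolynomial.aeval (R := F) x), {v | MvPolynomial.eval v p = 0} := by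
      ext v
      simp only [Set.mem_range, Set.mem_iInter, Set.mem_ofPred_eq]
      constructor
      · rintro ⟨t, rfl⟩ p hp
        rw [← hpoly, (RingHom.mem_ker).1 hp, map_zero]
      · intro hv
        let f : A →ₐ[F] F := (Ideal.Quotient.liftₐ (RingHom.ker (MvPolynomial.aeval (R := F) x))
          (MvPolynomial.aeval v) (fun p hp => hv p hp)).comp
            (Ideal.quotientKerAlgEquivOfSurjective hsurj).symm.toAlgHom
        refine ⟨WithConv.toConv f, funext fun i => ?_⟩
        have h1 : (Ideal.quotientKerAlgEquivOfSurjective hsurj).symm (x i) =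
            Ideal.Quotient.mk _ (MvPolynomial.X i) := by
          rw [AlgEquiv.symm_apply_eq]
          simp
        change f (x i) = v i
        refine (congrArg (Ideal.Quotient.liftₐ (RingHom.ker (MvPolynomial.aeval (R := F) x))
          (MvPolynomial.aeval v) (fun p hp => hv p hp)) h1).trans ?_
        exact MvPolynomial.aeval_X v i
    rw [this]
    exact isClosed_biInter fun p _ => isClosed_eq (MvPolynomial.continuous_eval p) continuous_const

end PointsTopology

/-! ### Coordinates over a splitting field -/

section Splitting

variable {F A : Type*} [Field F] [CommRing A] [HopfAlgebra F A]

variable (E : Type*) [Field E] [Algebra F E]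

/-- The extension of scalars of a rational point. -/
noncomputable def pointExt (t : RatPoints F A) : E ⊗[F] A →ₐ[E] E :=
  Algebra.TensorProduct.lift (AlgHom.id E E) ((Algebra.ofId F E).comp t.ofConv)
    (fun _ _ => .all ..)

theorem pointExt_tmul (t : RatPoints F A) (x : E) (a : A) :
    pointExt E t (x ⊗ₜ a) = x * algebraMap F E (t.ofConv a) := by
  simp [pointExt, Algebra.ofId_apply]

theorem pointExt_mul_eq (t t' : RatPoints F A) :
    pointExt E (t * t') = (Algebra.TensorProduct.lift (pointExt E t) (pointExt E t')
      (fun _ _ => .all ..)).comp (Bialgebra.comulAlgHom E (E ⊗[F] A)) := by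
  refine Algebra.TensorProduct.ext (Subsingleton.elim _ _) (AlgHom.ext fun a => ?_)
  simp only [AlgHom.coe_comp, AlgHom.coe_restrictScalars', Function.comp_apply,
    Algebra.TensorProduct.includeRight_apply, pointExt_tmul, Bialgebra.comulAlgHom_apply,
    TensorProduct.comul_tmul, RatPoints.mul_apply, one_mul]
  induction Coalgebra.comul (R := F) a using TensorProduct.induction_on with
  | zero => simp
  | add x y hx hy => simp only [map_add, TensorProduct.tmul_add, hx, hy]
  | tmul x y =>
    rw [CommSemiring.comul_apply, TensorProduct.AlgebraTensorModule.tensorTensorTensorComm_tmul]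
    simp [pointExt_tmul]

/-- Group-like elements are the characters of the group, which makes the coordinates `z`
multiplicative in the point. -/
theorem pointExt_mul (t t' : RatPoints F A) {y : E ⊗[F] A} (hy : IsGroupLikeElem E y) :
    pointExt E (t * t') y = pointExt E t y * pointExt E t' y := by
  rw [pointExt_mul_eq]
  simp [hy.comul_eq_tmul_self]

/-- Coordinates on the rational points of a group which becomes `𝔾ₘⁿ` over `E`. -/
structure SplitCoords (F A E : Type*) [Field F] [CommRing A] [HopfAlgebra F A] [Field E]
    [Algebra F E] (n : ℕ) where
  /-- The value of the character `η` of `𝔾ₘⁿ` at a point. -/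
  z : (Fin n → ℤ) → RatPoints F A → E
  /-- The expansion of a regular function into characters. -/
  expand : A → (Fin n → ℤ) →₀ E
  z_zero : ∀ t, z 0 t = 1
  z_add : ∀ η η' t, z (η + η') t = z η t * z η' t
  z_mul : ∀ η t t', z η (t * t') = z η t * z η t'
  eval_eq : ∀ (t : RatPoints F A) a,
    algebraMap F E (t.ofConv a) = (expand a).sum fun η c => c * z η t
  z_eq : ∀ η, ∃ (k : ℕ) (m : Fin k → E) (a : Fin k → A), ∀ t : RatPoints F A,
    z η t = ∑ j, m j * algebraMap F E (t.ofConv (a j))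
  exists_point : ∀ ζ : Multiplicative (Fin n → ℤ) →* E,
    (∀ a, (expand a).sum (fun η c => c * ζ (Multiplicative.ofAdd η)) ∈ (algebraMap F E).range) →
      ∃ p : RatPoints F A, ∀ η, z η p = ζ (Multiplicative.ofAdd η)

variable {E}

/-- One coefficient function serves all homomorphisms simultaneously, which allows `expand` to
depend on the regular function alone. -/
theorem exists_algHom_apply_eq_sum {G : Type*} [AddCommMonoid G] (p : AddMonoidAlgebra E G) :
    ∃ c : G →₀ E, ∀ f : AddMonoidAlgebra E G →ₐ[E] E,
      f p = c.sum fun η c => c * f (AddMonoidAlgebra.single η 1) := by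
  induction p using AddMonoidAlgebra.induction_linear with
  | zero => exact ⟨0, fun f => by simp⟩
  | add p q hp hq =>
    obtain ⟨c, hc⟩ := hp
    obtain ⟨d, hd⟩ := hq
    refine ⟨c + d, fun f => ?_⟩
    rw [map_add, hc, hd]
    refine (Finsupp.sum_add_index' ?_ ?_).symm <;> intros <;> simp [add_mul]
  | single η c =>
    refine ⟨Finsupp.single η c, fun f => ?_⟩
    have h : AddMonoidAlgebra.single η c =
        c • (AddMonoidAlgebra.single η 1 : AddMonoidAlgebra E G) := by
      rw [AddMonoidAlgebra.smul_single, smul_eq_mul, mul_one]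
    rw [Finsupp.sum_single_index (by simp), h, map_smul, smul_eq_mul]

/-- The coordinates given by an isomorphism with `𝔾ₘⁿ` over `E`. -/
noncomputable def SplitCoords.ofEquiv {n : ℕ}
    (e : (E ⊗[F] A) ≃ₐc[E] AddMonoidAlgebra E (Fin n → ℤ)) : SplitCoords F A E n where
  z η t := pointExt E t (e.symm (AddMonoidAlgebra.single η 1))
  expand a := (exists_algHom_apply_eq_sum (e (1 ⊗ₜ a))).choose
  z_zero t := by
    have : (AddMonoidAlgebra.single 0 1 : AddMonoidAlgebra E (Fin n → ℤ)) = 1 := rfl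
    rw [this, map_one, map_one]
  z_add η η' t := by
    have : (AddMonoidAlgebra.single (η + η') 1 : AddMonoidAlgebra E (Fin n → ℤ)) =
        AddMonoidAlgebra.single η 1 * AddMonoidAlgebra.single η' 1 := by
      simp [AddMonoidAlgebra.single_mul_single]
    rw [this, map_mul, map_mul]
  z_mul η t t' := pointExt_mul E t t' (by
    exact (AddMonoidAlgebra.isGroupLikeElem_single_one (R := E) η).map e.symm)
  eval_eq t a := by
    have h := (exists_algHom_apply_eq_sum (e (1 ⊗ₜ a))).choose_spec
      ((pointExt E t).comp (e.symm : AddMonoidAlgebra E (Fin n → ℤ) →ₐ[E] (E ⊗[F] A)))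
    have h2 : e.symm (e ((1 : E) ⊗ₜ[F] a)) = 1 ⊗ₜ a := e.symm_apply_apply _
    have h3 : pointExt E t (e.symm (e ((1 : E) ⊗ₜ[F] a))) = algebraMap F E (t.ofConv a) := by
      rw [h2, pointExt_tmul, one_mul]
    exact h3.symm.trans h
  z_eq η := by
    obtain ⟨k, m, a, h⟩ := TensorProduct.exists_sum_tmul_eq (e.symm (AddMonoidAlgebra.single η 1))
    refine ⟨k, m, a, fun t => ?_⟩
    rw [h, map_sum]
    simp [pointExt_tmul]
  exists_point ζ hζ := by
    let f : AddMonoidAlgebra E (Fin n → ℤ) →ₐ[E] E := AddMonoidAlgebra.lift E E _ ζ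
    have hf : ∀ a : A, f (e (1 ⊗ₜ a)) ∈ (algebraMap F E).range := by
      intro a
      rw [(exists_algHom_apply_eq_sum (e (1 ⊗ₜ a))).choose_spec f]
      refine (congrArg (· ∈ (algebraMap F E).range) ?_).mp (hζ a)
      refine Finset.sum_congr rfl fun η _ => ?_
      simp [f]
    let g : A →ₐ[F] E := (f.restrictScalars F).comp
      (((e : (E ⊗[F] A) →ₐ[E] _).restrictScalars F).comp Algebra.TensorProduct.includeRight)
    have hg : ∀ a, g a ∈ (⊥ : Subalgebra F E) := fun a => by
      obtain ⟨x, hx⟩ := hf a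
      exact Algebra.mem_bot.2 ⟨x, hx⟩
    -- The point defined by `ζ` is a priori only `E`-valued; by `hζ` its values on `A` lie in `F`,
    -- so it descends to a rational point.
    let p : A →ₐ[F] F := ((Algebra.botEquivOfInjective (algebraMap F E).injective :
      (⊥ : Subalgebra F E) ≃ₐ[F] F) : (⊥ : Subalgebra F E) →ₐ[F] F).comp (g.codRestrict ⊥ hg)
    have hp : ∀ a, algebraMap F E (p a) = f (e (1 ⊗ₜ a)) := by
      intro a
      have : algebraMap F (⊥ : Subalgebra F E) (p a) = g.codRestrict ⊥ hg a :=
        (Algebra.botEquivOfInjective (algebraMap F E).injective).symm_apply_apply _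
      exact congrArg Subtype.val this
    refine ⟨WithConv.toConv p, fun η => ?_⟩
    have h1 : pointExt E (WithConv.toConv p) = f.comp (e : (E ⊗[F] A) →ₐ[E] _) := by
      refine Algebra.TensorProduct.ext (Subsingleton.elim _ _) (AlgHom.ext fun a => ?_)
      simpa [pointExt_tmul] using hp a
    rw [h1]
    have h2 : e (e.symm (AddMonoidAlgebra.single η 1)) = AddMonoidAlgebra.single η 1 :=
      e.apply_symm_apply _
    change f (e (e.symm (AddMonoidAlgebra.single η 1))) = _
    rw [h2]
    simp [f]

/-- Finite generation holds for `E[ℤⁿ]` and descends along the faithfully flat extension `E / F`. -/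
theorem IsTorus.finiteType {F : Type u} {A : Type v} [Field F] [CommRing A] [HopfAlgebra F A]
    (h : IsTorus F A) : Algebra.FiniteType F A := by
  obtain ⟨E, _, _, _, _, n, ⟨e⟩⟩ := h
  have : Algebra.FiniteType E (E ⊗[F] A) :=
    Algebra.FiniteType.equiv (inferInstance : Algebra.FiniteType E (AddMonoidAlgebra E (Fin n → ℤ)))
      (e.symm : AddMonoidAlgebra E (Fin n → ℤ) ≃ₐ[E] (E ⊗[F] A))
  exact Algebra.FiniteType.of_finiteType_tensorProduct_of_faithfullyFlat E

end Splitting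

/-! ### Cocharacters in split coordinates -/

section Cocharacter

variable {F A E : Type*} [Field F] [CommRing A] [HopfAlgebra F A] [Field E] [Algebra F E] {n : ℕ}

/-- The character `x ↦ x ^ k` of `Fˣ` with values in an extension. -/
noncomputable def zpowChar (F E : Type*) [Field F] [Field E] [Algebra F E] (k : ℤ) : Fˣ →* E :=
  ((algebraMap F E : F →* E).comp (Units.coeHom F)).comp (zpowGroupHom k)

theorem zpowChar_apply (k : ℤ) (x : Fˣ) : zpowChar F E k x = algebraMap F E x ^ k := by
  simp [zpowChar]

/-- Prepares the use of Dedekind's independence of characters. -/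
theorem gmPoint_mem_span (f : AddMonoidAlgebra F ℤ) :
    (fun x : Fˣ => algebraMap F E (gmPoint x f)) ∈
      Submodule.span E (Set.range fun k : ℤ => (zpowChar F E k : Fˣ → E)) := by
  induction f using AddMonoidAlgebra.induction_linear with
  | zero =>
    have : (fun x : Fˣ => algebraMap F E (gmPoint x 0)) = 0 := by funext x; simp
    rw [this]
    exact Submodule.zero_mem _
  | add f g hf hg => simpa [Pi.add_def] using Submodule.add_mem _ hf hg
  | single k c =>
    have : (fun x : Fˣ => algebraMap F E (gmPoint x (AddMonoidAlgebra.single k c))) =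
        algebraMap F E c • (zpowChar F E k : Fˣ → E) := by
      funext x
      simp only [gmPoint_single, Pi.smul_apply, zpowChar_apply, smul_eq_mul, map_mul, map_zpow₀]
    rw [this]
    exact Submodule.smul_mem _ _ (Submodule.subset_span ⟨k, rfl⟩)

/-- An element of infinite order makes the characters `x ↦ x ^ k` pairwise distinct, hence linearly
independent; this is the density of `Fˣ` in `𝔾ₘ`. -/
theorem eq_zero_of_gmPoint_eq_zero (hF : ∃ x : Fˣ, ∀ k : ℤ, x ^ k = 1 → k = 0)
    {f : AddMonoidAlgebra F ℤ} (hf : ∀ x, gmPoint x f = 0) : f = 0 := by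
  obtain ⟨x₀, hx₀⟩ := hF
  have hinj : Function.Injective fun k : ℤ => zpowChar F F k := by
    intro k m h
    have h1 : zpowChar F F k x₀ = zpowChar F F m x₀ := DFunLike.congr_fun h x₀
    simp only [zpowChar_apply, Algebra.algebraMap_self, RingHom.id_apply] at h1
    have h2 : x₀ ^ k = x₀ ^ m := by
      ext; simpa using h1
    have h3 := hx₀ (k - m) (by rw [zpow_sub, h2, mul_inv_cancel])
    omega
  have hli : LinearIndependent F fun k : ℤ => (zpowChar F F k : Fˣ → F) :=
    (linearIndependent_monoidHom Fˣ F).comp _ hinj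
  obtain ⟨c, rfl⟩ : ∃ c : ℤ →₀ F, f = c.sum fun k c => AddMonoidAlgebra.single k c := by
    clear hf
    induction f using AddMonoidAlgebra.induction_linear with
    | zero => exact ⟨0, by simp⟩
    | add p q hp hq =>
      obtain ⟨c, hc⟩ := hp
      obtain ⟨d, hd⟩ := hq
      refine ⟨c + d, ?_⟩
      rw [hc, hd]
      refine (Finsupp.sum_add_index' ?_ ?_).symm <;> intros <;> simp [AddMonoidAlgebra.single_add]
    | single k c => exact ⟨Finsupp.single k c, by rw [Finsupp.sum_single_index (by simp)]⟩
  suffices c = 0 by rw [this]; simp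
  refine (linearIndependent_iff.1 hli) c (funext fun x => ?_)
  have h2 : c.sum (fun k c => c * (x : F) ^ k) = 0 := by
    rw [← hf x, Finsupp.sum, Finsupp.sum, map_sum]
    exact Finset.sum_congr rfl fun k _ => (gmPoint_single x k _).symm
  rw [Finsupp.linearCombination_apply, Finsupp.sum, Finset.sum_apply]
  simpa [Finsupp.sum, zpowChar_apply] using h2

namespace SplitCoords

variable (S : SplitCoords F A E n)

theorem z_one (η : Fin n → ℤ) : S.z η 1 = 1 := by
  have h0 : S.z η 1 * S.z (-η) 1 = 1 := by rw [← S.z_add, add_neg_cancel, S.z_zero]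
  have h1 : S.z η 1 * S.z η 1 = S.z η 1 := by rw [← S.z_mul, one_mul]
  exact (mul_eq_left₀ (left_ne_zero_of_mul_eq_one h0)).1 h1

theorem z_mul_neg (η : Fin n → ℤ) (t : RatPoints F A) : S.z η t * S.z (-η) t = 1 := by
  rw [← S.z_add, add_neg_cancel, S.z_zero]

theorem z_ne_zero (η : Fin n → ℤ) (t : RatPoints F A) : S.z η t ≠ 0 :=
  left_ne_zero_of_mul_eq_one (S.z_mul_neg η t)

/-- The character `η` as a homomorphism. -/
noncomputable def zHom (η : Fin n → ℤ) : RatPoints F A →* E where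
  toFun := S.z η
  map_one' := S.z_one η
  map_mul' := S.z_mul η

variable [TopologicalSpace F] [IsTopologicalRing F]

/-- The composite with `λ` is a homomorphism `Fˣ → E` lying in the span of the characters `x ↦ x ^
k`; by independence of characters it is one of them. -/
theorem exists_z_cochar (lam : A →ₐc[F] AddMonoidAlgebra F ℤ) (η : Fin n → ℤ) :
    ∃ m : ℤ, ∀ x, S.z η (cocharPoints lam x) = algebraMap F E x ^ m := by
  let f : Fˣ →* E := (S.zHom η).comp (cocharPoints lam : Fˣ →* RatPoints F A)
  have hspan : (f : Fˣ → E) ∈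
      Submodule.span E (Set.range fun k : ℤ => (zpowChar F E k : Fˣ → E)) := by
    obtain ⟨k, m, a, h⟩ := S.z_eq η
    have : (f : Fˣ → E) = ∑ j, m j • fun x : Fˣ => algebraMap F E (gmPoint x (lam (a j))) := by
      funext x
      rw [Finset.sum_apply]
      exact h (cocharPoints lam x)
    rw [this]
    exact Submodule.sum_mem _ fun j _ => Submodule.smul_mem _ _ (gmPoint_mem_span _)
  by_contra hne
  have hf : f ∉ Set.range fun k : ℤ => zpowChar F E k := by
    rintro ⟨k, hk⟩
    refine hne ⟨k, fun x => ?_⟩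
    have := DFunLike.congr_fun hk x
    rw [zpowChar_apply] at this
    exact this.symm
  have := (linearIndependent_monoidHom Fˣ E).notMem_span_image hf
  rw [← Set.range_comp] at this
  exact this hspan

/-- If all exponents vanished, every regular function would be constant on `λ(Fˣ)`, and density of
`Fˣ` in `𝔾ₘ` would make `λ` trivial. -/
theorem exists_ne_zero_cochar (hF : ∃ x : Fˣ, ∀ k : ℤ, x ^ k = 1 → k = 0)
    {lam : A →ₐc[F] AddMonoidAlgebra F ℤ} (hlam : IsNontrivialCochar lam) :
    ∃ η, ∃ m : ℤ, m ≠ 0 ∧ ∀ x, S.z η (cocharPoints lam x) = algebraMap F E x ^ m := by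
  by_contra! hcon
  have h1 : ∀ η x, S.z η (cocharPoints lam x) = S.z η 1 := by
    intro η x
    obtain ⟨m, hm⟩ := S.exists_z_cochar lam η
    have hm0 : m = 0 := by
      by_contra hm0
      obtain ⟨y, hy⟩ := hcon η m hm0
      exact hy (hm y)
    rw [hm, hm0, zpow_zero, S.z_one]
  obtain ⟨a, ha⟩ := hlam
  refine ha (sub_eq_zero.1 (eq_zero_of_gmPoint_eq_zero hF fun x => ?_))
  have h2 : algebraMap F E ((cocharPoints lam x).ofConv a) =
      algebraMap F E ((1 : RatPoints F A).ofConv a) := by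
    rw [S.eval_eq, S.eval_eq]
    simp only [h1]
  have h3 : gmPoint x (lam a) = Coalgebra.counit (R := F) a := (algebraMap F E).injective h2
  rw [map_sub, h3, AlgHom.commutes]
  simp

end SplitCoords

end Cocharacter

/-! ### Nonarchimedean local fields -/

section NonarchBasics

variable {F : Type*} [Field F] [ValuativeRel F] [TopologicalSpace F] [IsNonarchimedeanLocalField F]

open IsNonarchimedeanLocalField

theorem isUnif_unif : IsUnif (unif F) := by
  refine Classical.epsilon_spec (p := IsUnif) ?_
  let φ := valueGroupWithZeroIsoInt F
  have hlt : ∀ {a b}, φ a < φ b ↔ a < b := φ.strictMono.lt_iff_lt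
  have hle : ∀ {a b}, φ a ≤ φ b ↔ a ≤ b := φ.strictMono.le_iff_le
  obtain ⟨y, hy⟩ := valuation_surjective (K := F) (φ.symm (WithZero.exp (-1)))
  have hφ : φ (valuation F y) = WithZero.exp (-1) := by rw [hy]; simp
  have hy0 : y ≠ 0 := by
    rintro rfl
    rw [map_zero, map_zero] at hφ
    exact WithZero.exp_ne_zero hφ.symm
  refine ⟨Units.mk0 y hy0, fun x => ?_⟩
  rw [← hlt, ← hle, Units.val_mk0, hφ, map_one]
  by_cases hx : φ (valuation F x) = 0
  · simp [hx]
  · obtain ⟨k, hk⟩ : ∃ k : ℤ, φ (valuation F x) = WithZero.exp k :=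
      ⟨_, (WithZero.exp_log hx).symm⟩
    rw [hk, ← WithZero.exp_zero, WithZero.exp_lt_exp, WithZero.exp_le_exp]
    omega

theorem valuation_unif_lt_one : valuation F (unif F : F) < 1 :=
  (isUnif_unif _).2 le_rfl

theorem valuation_unif_ne_zero : valuation F (unif F : F) ≠ 0 := by simp

theorem valuation_unif_pos : 0 < valuation F (unif F : F) :=
  zero_lt_iff.2 valuation_unif_ne_zero

theorem valuation_unit_pos (x : Fˣ) : 0 < valuation F (x : F) :=
  zero_lt_iff.2 (by simp)

theorem exists_valuation_eq_zpow (x : Fˣ) :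
    ∃ k : ℤ, valuation F (x : F) = valuation F (unif F : F) ^ k := by
  let φ := valueGroupWithZeroIsoInt F
  have hlt : ∀ {a b}, φ a < φ b ↔ a < b := φ.strictMono.lt_iff_lt
  have hle : ∀ {a b}, φ a ≤ φ b ↔ a ≤ b := φ.strictMono.le_iff_le
  have h0 : ∀ x : Fˣ, ∃ k : ℤ, φ (valuation F (x : F)) = WithZero.exp k := fun x =>
    ⟨_, (WithZero.exp_log (by simp)).symm⟩
  obtain ⟨m, hm⟩ := h0 (unif F)
  -- Compare with an element of value `exp(-1)`, the largest value below `1`; the criterion `IsUnif`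
  -- bounds it by the value of the uniformizer.
  have hm1 : m = -1 := by
    have h1 : m < 0 := by
      have := hlt.2 (valuation_unif_lt_one (F := F))
      rwa [map_one, hm, ← WithZero.exp_zero, WithZero.exp_lt_exp] at this
    obtain ⟨y, hy⟩ := valuation_surjective (K := F) (φ.symm (WithZero.exp (-1)))
    have hφ : φ (valuation F y) = WithZero.exp (-1) := by rw [hy]; simp
    have h2 : valuation F y < 1 := by
      rw [← hlt, hφ, map_one, ← WithZero.exp_zero, WithZero.exp_lt_exp]
      norm_num
    have h3 := hle.2 ((isUnif_unif y).1 h2)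
    rw [hφ, hm, WithZero.exp_le_exp] at h3
    omega
  obtain ⟨k, hk⟩ := h0 x
  refine ⟨-k, φ.strictMono.injective ?_⟩
  rw [hk, map_zpow₀, hm, hm1, ← WithZero.exp_zsmul]
  simp

theorem zpow_unif_le_iff {k m : ℤ} :
    valuation F (unif F : F) ^ k ≤ valuation F (unif F : F) ^ m ↔ m ≤ k :=
  zpow_le_zpow_iff_right_of_lt_one₀ valuation_unif_pos valuation_unif_lt_one

theorem zpow_unif_inj {k m : ℤ} :
    valuation F (unif F : F) ^ k = valuation F (unif F : F) ^ m ↔ k = m := by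
  rw [le_antisymm_iff, zpow_unif_le_iff, zpow_unif_le_iff, ← le_antisymm_iff, eq_comm]

/-- The fractional ideal `ϖ ^ k 𝔬`. -/
def fracIdeal (F : Type*) [Field F] [ValuativeRel F] [TopologicalSpace F]
    [IsNonarchimedeanLocalField F] (k : ℤ) : Set F :=
  {x | valuation F x ≤ valuation F (unif F : F) ^ k}

theorem mem_fracIdeal {k : ℤ} {x : F} :
    x ∈ fracIdeal F k ↔ valuation F x ≤ valuation F (unif F : F) ^ k := Iff.rfl

theorem isCompact_fracIdeal (k : ℤ) : IsCompact (fracIdeal F k) := isCompact_closedBall F _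

theorem fracIdeal_mem_nhds_zero (k : ℤ) : fracIdeal F k ∈ 𝓝 (0 : F) := by
  rw [(IsValuativeTopology.hasBasis_nhds_zero' F).mem_iff]
  exact ⟨_, zpow_ne_zero k valuation_unif_ne_zero, fun x hx => mem_fracIdeal.2 (le_of_lt hx)⟩

theorem exists_fracIdeal_subset {s : Set F} (hs : s ∈ 𝓝 (0 : F)) :
    ∃ k : ℕ, fracIdeal F k ⊆ s := by
  obtain ⟨γ, hγ, hs⟩ := (IsValuativeTopology.hasBasis_nhds_zero' F).mem_iff.1 hs
  obtain ⟨y, rfl⟩ := valuation_surjective (K := F) γ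
  have hy : y ≠ 0 := by simpa using hγ
  obtain ⟨k, hk⟩ := exists_valuation_eq_zpow (Units.mk0 y hy)
  rw [Units.val_mk0] at hk
  refine ⟨(k + 1).toNat, fun x hx => hs ?_⟩
  refine lt_of_le_of_lt (mem_fracIdeal.1 hx) ?_
  rw [hk]
  refine lt_of_le_of_ne (zpow_unif_le_iff.2 (by omega)) fun h => ?_
  have := zpow_unif_inj.1 h
  omega

theorem zero_mem_fracIdeal (k : ℤ) : (0 : F) ∈ fracIdeal F k := by simp [fracIdeal]

theorem add_mem_fracIdeal {k : ℤ} {x y : F} (hx : x ∈ fracIdeal F k) (hy : y ∈ fracIdeal F k) :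
    x + y ∈ fracIdeal F k := (valuation F).map_add_le hx hy

theorem neg_mem_fracIdeal {k : ℤ} {x : F} (hx : x ∈ fracIdeal F k) : -x ∈ fracIdeal F k := by
  simpa [fracIdeal, Valuation.map_neg] using hx

theorem mul_mem_fracIdeal {k m : ℤ} {x y : F} (hx : x ∈ fracIdeal F k) (hy : y ∈ fracIdeal F m) :
    x * y ∈ fracIdeal F (k + m) := by
  simp only [fracIdeal, Set.mem_ofPred_eq, map_mul] at *
  rw [zpow_add₀ valuation_unif_ne_zero]
  exact mul_le_mul' hx hy

theorem fracIdeal_anti {k m : ℤ} (h : k ≤ m) : fracIdeal F m ⊆ fracIdeal F k :=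
  fun _ hx => mem_fracIdeal.2 <| le_trans (mem_fracIdeal.1 hx) (zpow_unif_le_iff.2 h)

theorem isOpen_fracIdeal (k : ℤ) : IsOpen (fracIdeal F k) := by
  rw [isOpen_iff_mem_nhds]
  intro x hx
  have h := (continuous_sub_right x).continuousAt.preimage_mem_nhds (x := x)
    (t := fracIdeal F k) (by simpa using fracIdeal_mem_nhds_zero k)
  filter_upwards [h] with y hy
  simpa using add_mem_fracIdeal hy hx

theorem isClosed_fracIdeal (k : ℤ) : IsClosed (fracIdeal F k) := by
  rw [← isOpen_compl_iff, isOpen_iff_mem_nhds]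
  intro x hx
  have h := (continuous_sub_right x).continuousAt.preimage_mem_nhds (x := x)
    (t := fracIdeal F k) (by simpa using fracIdeal_mem_nhds_zero k)
  filter_upwards [h] with y hy hy'
  exact hx (by simpa using add_mem_fracIdeal hy' (neg_mem_fracIdeal hy))

theorem iUnion_fracIdeal : ⋃ k : ℕ, fracIdeal F (-(k : ℤ)) = Set.univ := by
  refine Set.eq_univ_of_forall fun x => Set.mem_iUnion.2 ?_
  by_cases hx : x = 0
  · exact ⟨0, hx ▸ zero_mem_fracIdeal _⟩
  · obtain ⟨k, hk⟩ := exists_valuation_eq_zpow (Units.mk0 x hx)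
    rw [Units.val_mk0] at hk
    refine ⟨(-k).toNat, ?_⟩
    rw [fracIdeal, Set.mem_ofPred_eq, hk, zpow_unif_le_iff]
    omega

instance IsNonarchimedeanLocalField.instT2Space : T2Space F := by
  refine IsTopologicalAddGroup.t2Space_of_zero_sep fun x hx => ?_
  refine ⟨{y | valuation F y < valuation F x}, ?_, by simp⟩
  exact (IsValuativeTopology.hasBasis_nhds_zero' F).mem_of_mem (by simpa using hx)

instance IsNonarchimedeanLocalField.instSigmaCompactSpace : SigmaCompactSpace F :=
  ⟨⟨fun k => fracIdeal F (-(k : ℤ)), fun _ => isCompact_fracIdeal _, iUnion_fracIdeal⟩⟩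

/-- The ideals `𝔭ᵏ` form a countable basis at `0`, so the uniform structure is pseudometrizable, and
a σ-compact pseudometric space is second countable. -/
instance IsNonarchimedeanLocalField.instSecondCountableTopology : SecondCountableTopology F := by
  let := IsTopologicalAddGroup.rightUniformSpace F
  have := isUniformAddGroup_of_addCommGroup (G := F)
  have : (𝓝 (0 : F)).IsCountablyGenerated := by
    refine Filter.HasCountableBasis.isCountablyGenerated (ι := ℕ) (p := fun _ => True)
      (s := fun k => fracIdeal F (k : ℤ)) ⟨⟨fun t => ⟨fun ht => ?_, ?_⟩⟩, Set.to_countable _⟩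
    · obtain ⟨k, hk⟩ := exists_fracIdeal_subset ht
      exact ⟨k, trivial, hk⟩
    · rintro ⟨k, -, hk⟩
      exact Filter.mem_of_superset (fracIdeal_mem_nhds_zero _) hk
  have := IsUniformAddGroup.uniformity_countably_generated (α := F)
  let := UniformSpace.pseudoMetricSpace F
  infer_instance

theorem mem_maximalIdeal_iff_valuation {x : 𝒪[F]} : x ∈ 𝓂[F] ↔ valuation F (x : F) < 1 := by
  rw [IsLocalRing.mem_maximalIdeal, mem_nonunits_iff,
    (Valuation.integer.integers (valuation F)).isUnit_iff_valuation_eq_one]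
  exact ⟨fun h => lt_of_le_of_ne x.2 h, fun h => h.ne⟩

variable [MeasurableSpace F] [BorelSpace F]

section Volume

variable (dx : Measure F) [dx.IsAddHaarMeasure]

theorem measure_fracIdeal_pos (k : ℤ) : 0 < dx (fracIdeal F k) :=
  (isOpen_fracIdeal k).measure_pos dx ⟨0, zero_mem_fracIdeal k⟩

theorem measure_fracIdeal_lt_top (k : ℤ) : dx (fracIdeal F k) < ∞ :=
  (isCompact_fracIdeal k).measure_lt_top

open scoped Pointwise in
theorem unit_smul_fracIdeal (a : Fˣ) {m : ℤ}
    (ha : valuation F (a : F) = valuation F (unif F : F) ^ m) (k : ℤ) :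
    a • fracIdeal F k = fracIdeal F (m + k) := by
  ext x
  rw [Set.mem_smul_set_iff_inv_smul_mem, Units.smul_def, smul_eq_mul, fracIdeal, fracIdeal,
    Set.mem_ofPred_eq, Set.mem_ofPred_eq, map_mul, Units.val_inv_eq_inv_val, map_inv₀, ha,
    zpow_add₀ valuation_unif_ne_zero, inv_mul_le_iff₀ (zpow_pos valuation_unif_pos _)]

theorem measure_fracIdeal_add (a : Fˣ) {m : ℤ}
    (ha : valuation F (a : F) = valuation F (unif F : F) ^ m) (k : ℤ) :
    dx (fracIdeal F (m + k)) = ENNReal.ofReal (absF a) * dx (fracIdeal F k) := by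
  rw [← addHaar_smul_set, unit_smul_fracIdeal a ha]

/-- The ring `𝔬` is the union of `q` translates of `𝔭`. The measure is pulled back to `𝔬`, where the
index formula for subgroups applies. -/
theorem card_mul_measure_maximalIdeal :
    (Nat.card 𝓀[F] : ℝ≥0∞) * dx (fracIdeal F 1) = dx (fracIdeal F 0) := by
  have hO : MeasurableSet {x : F | x ∈ 𝒪[F]} := by
    have : {x : F | x ∈ 𝒪[F]} = fracIdeal F 0 := by
      ext x; simp [fracIdeal, Valuation.mem_integer_iff]
    rw [this]
    exact (isOpen_fracIdeal 0).measurableSet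
  have hemb : MeasurableEmbedding (Subtype.val : 𝒪[F] → F) := MeasurableEmbedding.subtype_coe hO
  let ν : Measure 𝒪[F] := dx.comap Subtype.val
  have : ν.IsAddLeftInvariant := by
    refine ⟨fun a => Measure.ext fun s hs => ?_⟩
    rw [Measure.map_apply (measurable_const_add a) hs, hemb.comap_apply, hemb.comap_apply]
    refine Eq.trans ?_ (measure_preimage_add dx (a : F) (Subtype.val '' s))
    congr 1
    ext x
    simp only [Set.mem_image, Set.mem_preimage]
    constructor
    · rintro ⟨y, hy, rfl⟩
      exact ⟨_, hy, rfl⟩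
    · rintro ⟨y, hy, hyx⟩
      refine ⟨y - a, by simpa using hy, ?_⟩
      have h : ((y - a : 𝒪[F]) : F) = y - a := rfl
      rw [h, hyx]
      ring
  let H : AddSubgroup 𝒪[F] := Submodule.toAddSubgroup 𝓂[F]
  have hcard : Nat.card 𝓀[F] = H.index := rfl
  have : H.FiniteIndex := by
    refine ⟨?_⟩
    rw [← hcard]
    exact Nat.card_ne_zero.2 ⟨inferInstance, inferInstance⟩
  have hHimage : Subtype.val '' (H : Set 𝒪[F]) = fracIdeal F 1 := by
    ext x
    rw [fracIdeal, Set.mem_ofPred_eq, zpow_one, ← isUnif_unif]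
    constructor
    · rintro ⟨y, hy, rfl⟩
      exact mem_maximalIdeal_iff_valuation.1 hy
    · intro hx
      exact ⟨⟨x, hx.le⟩, mem_maximalIdeal_iff_valuation.2 hx, rfl⟩
  have hHm : MeasurableSet (H : Set 𝒪[F]) := by
    have := hemb.measurable ((isOpen_fracIdeal (F := F) 1).measurableSet)
    rwa [← hHimage, Set.preimage_image_eq _ Subtype.val_injective] at this
  have key := AddSubgroup.index_mul_measure H hHm ν
  rw [← hcard, hemb.comap_apply, hemb.comap_apply, hHimage, Set.image_univ, Subtype.range_coe]
    at key
  rw [key]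
  exact congrArg dx (by ext x; simp [fracIdeal, Valuation.mem_integer_iff])

end Volume

theorem one_lt_card_residue : 1 < (Nat.card 𝓀[F] : ℝ) := by
  exact_mod_cast Finite.one_lt_card

theorem card_residue_pos : 0 < (Nat.card 𝓀[F] : ℝ) := one_pos.trans one_lt_card_residue

theorem absF_of_valuation_eq_one {a : Fˣ} (ha : valuation F (a : F) = 1) : absF a = 1 := by
  have h := measure_fracIdeal_add Measure.addHaar a (m := 0) (by simpa using ha) 0
  rw [add_zero] at h
  have h2 := (ENNReal.mul_eq_right (measure_fracIdeal_pos Measure.addHaar 0).ne'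
    (measure_fracIdeal_lt_top Measure.addHaar 0).ne).1 h.symm
  simpa using h2

theorem absF_unif : absF (unif F) = (Nat.card 𝓀[F] : ℝ)⁻¹ := by
  have h := measure_fracIdeal_add Measure.addHaar (unif F) (m := 1) (by simp) 0
  have h2 := card_mul_measure_maximalIdeal (F := F) Measure.addHaar
  rw [add_zero] at h
  rw [h, ← mul_assoc, ENNReal.mul_eq_right (measure_fracIdeal_pos Measure.addHaar 0).ne'
    (measure_fracIdeal_lt_top Measure.addHaar 0).ne] at h2
  have h3 := congrArg ENNReal.toReal h2
  rw [ENNReal.toReal_mul, ENNReal.toReal_ofReal (absF_pos _).le] at h3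
  refine eq_inv_of_mul_eq_one_right ?_
  simpa using h3

theorem absF_zpow (a : Fˣ) (k : ℤ) : absF (a ^ k) = absF a ^ k := by
  simp [absF, map_zpow]

theorem absF_of_valuation_eq_zpow {a : Fˣ} {k : ℤ}
    (ha : valuation F (a : F) = valuation F (unif F : F) ^ k) :
    absF a = (Nat.card 𝓀[F] : ℝ) ^ (-k) := by
  have h1 : absF (a * unif F ^ (-k)) = 1 := by
    refine absF_of_valuation_eq_one ?_
    rw [Units.val_mul, Units.val_zpow_eq_zpow_val, map_mul, ha, map_zpow₀,
      ← zpow_add₀ valuation_unif_ne_zero]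
    simp
  rw [absF_mul, absF_zpow, absF_unif, inv_zpow', neg_neg] at h1
  rw [zpow_neg]
  exact eq_inv_of_mul_eq_one_left h1

/-- The open subgroup `𝔬ˣ` has absolute value `1`, so `|x|` is locally constant. -/
instance IsNonarchimedeanLocalField.instContinuousAbsF : ContinuousAbsF F := by
  refine ⟨?_⟩
  have hU : IsOpen {u : Fˣ | valuation F (u : F) = 1} := by
    have : {u : Fˣ | valuation F (u : F) = 1} =
        Units.val ⁻¹' fracIdeal F 0 ∩ (fun u : Fˣ => ((u⁻¹ : Fˣ) : F)) ⁻¹' fracIdeal F 0 := by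
      ext u
      simp only [fracIdeal, Set.mem_ofPred_eq, Set.mem_inter_iff, Set.mem_preimage, zpow_zero,
        Units.val_inv_eq_inv_val, map_inv₀, inv_le_one₀ (valuation_unit_pos u)]
      exact le_antisymm_iff
    rw [this]
    exact ((isOpen_fracIdeal 0).preimage Units.continuous_val).inter
      ((isOpen_fracIdeal 0).preimage (Units.continuous_val.comp continuous_inv))
  refine IsLocallyConstant.continuous ((IsLocallyConstant.iff_eventually_eq _).2 fun x => ?_)
  have h1 : (fun y : Fˣ => y * x⁻¹) ⁻¹' {u : Fˣ | valuation F (u : F) = 1} ∈ 𝓝 x :=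
    (hU.preimage (continuous_mul_const _)).mem_nhds (by simp)
  filter_upwards [h1] with y hy
  have := absF_of_valuation_eq_one hy
  rw [absF_mul, absF_inv] at this
  exact eq_of_mul_inv_eq_one this

theorem IsNonarchimedeanLocalField.nullSingletonClass (dx : Measure F) [dx.IsAddHaarMeasure] :
    NullSingletonClass dx := by
  have : (𝓝[≠] (0 : F)).NeBot := by
    rw [← mem_closure_iff_nhdsWithin_neBot, mem_closure_iff_nhds]
    intro t ht
    obtain ⟨k, hk⟩ := exists_fracIdeal_subset ht
    exact ⟨(unif F : F) ^ k, hk (by simp [fracIdeal]), by simp⟩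
  infer_instance

end NonarchBasics

/-! ### Local finiteness of `d^×x` and measurability of the transform -/

section MulMeasureCompact

variable {F : Type*} [Field F] [TopologicalSpace F] [IsTopologicalRing F] [LocallyCompactSpace F]
  [MeasurableSpace F] [BorelSpace F] [ContinuousInv₀ F] [T2Space F] [SecondCountableTopology F]
  [ContinuousAbsF F] (dx : Measure F) [dx.IsAddHaarMeasure]

instance mulMeasure.instIsFiniteMeasureOnCompacts : IsFiniteMeasureOnCompacts (mulMeasure dx) := by
  refine ⟨fun K hK => ?_⟩
  have hc : Continuous fun x : Fˣ => (absF x)⁻¹ :=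
    continuous_absF.inv₀ fun x => (absF_pos x).ne'
  obtain ⟨C, hC⟩ := hK.bddAbove_image hc.continuousOn
  have hlt : dx.comap Units.val K < ∞ := by
    rw [measurableEmbedding_unitsVal.comap_apply]
    exact (hK.image Units.continuous_val).measure_lt_top
  rw [mulMeasure, withDensity_apply _ hK.measurableSet]
  calc ∫⁻ x in K, ENNReal.ofReal (absF x)⁻¹ ∂(dx.comap Units.val)
      ≤ ∫⁻ _ in K, ENNReal.ofReal C ∂(dx.comap Units.val) :=
        setLIntegral_mono' hK.measurableSet fun x hx =>
          ENNReal.ofReal_le_ofReal (hC ⟨x, hx, rfl⟩)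
    _ = ENNReal.ofReal C * dx.comap Units.val K := by simp
    _ < ∞ := ENNReal.mul_lt_top ENNReal.ofReal_lt_top hlt

variable {dx} {ψ : AddChar F Circle} {T : Type*} [Group T] [TopologicalSpace T]
  [IsTopologicalGroup T] [SecondCountableTopology T] [MeasurableSpace T] [BorelSpace T]

theorem continuous_kernelD (hψ : Continuous ψ) (s : ℂ) : Continuous (kernelD ψ s : Fˣ → ℂ) :=
  (continuous_absF_cpow s).mul
    (continuous_circle_coe.comp (hψ.comp Units.continuous_val))

theorem stronglyMeasurable_equivFourier (hψ : Continuous ψ) (l : Fˣ →ₜ* T) (s : ℂ) {Φ : T → ℂ}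
    (hΦ : Continuous Φ) : StronglyMeasurable (equivFourier ψ dx l s Φ) := by
  have hl : Continuous l := map_continuous l
  have h : Continuous fun p : T × Fˣ => kernelD ψ s p.2 * Φ ((l p.2)⁻¹ * p.1) :=
    ((continuous_kernelD hψ s).comp continuous_snd).mul
      (hΦ.comp ((hl.comp continuous_snd).inv.mul continuous_fst))
  exact h.stronglyMeasurable.integral_prod_right

end MulMeasureCompact

/-! ### Elementary properties of additive characters -/

theorem LogChar.map_one {T : Type*} [Group T] [TopologicalSpace T] (ν : LogChar T) :
    ν.1 1 = 0 := by
  simpa using ν.2.2 1 1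

theorem LogChar.map_inv {T : Type*} [Group T] [TopologicalSpace T] (ν : LogChar T) (t : T) :
    ν.1 t⁻¹ = -ν.1 t := by
  have h := ν.2.2 t⁻¹ t
  rw [inv_mul_cancel, LogChar.map_one] at h
  linear_combination -h

theorem LogChar.map_pow {T : Type*} [Group T] [TopologicalSpace T] (ν : LogChar T) (t : T)
    (n : ℕ) : ν.1 (t ^ n) = n * ν.1 t := by
  induction n with
  | zero => simp [LogChar.map_one]
  | succ n ih => rw [pow_succ, ν.2.2, ih]; push_cast; ring

theorem LogChar.map_zpow {T : Type*} [Group T] [TopologicalSpace T] (ν : LogChar T) (t : T)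
    (n : ℤ) : ν.1 (t ^ n) = n * ν.1 t := by
  obtain ⟨m, rfl | rfl⟩ := n.eq_nat_or_neg
  · simp [LogChar.map_pow]
  · rw [zpow_neg, LogChar.map_inv, zpow_natCast, LogChar.map_pow]; simp

/-- Additive characters vanish on elements with relatively compact powers. -/
theorem LogChar.eq_zero_of_pow_mem {T : Type*} [Group T] [TopologicalSpace T] (ν : LogChar T)
    {K : Set T} (hK : IsCompact K) {t : T} (ht : ∀ n : ℕ, t ^ n ∈ K) : ν.1 t = 0 := by
  obtain ⟨C, hC⟩ := hK.exists_bound_of_continuousOn ν.2.1.continuousOn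
  by_contra hne
  obtain ⟨n, hn⟩ := exists_nat_gt (C / ‖ν.1 t‖)
  have h1 := hC _ (ht n)
  rw [LogChar.map_pow, norm_mul, Complex.norm_natCast] at h1
  rw [div_lt_iff₀ (norm_pos_iff.2 hne)] at hn
  linarith

/-! ### Integration over ideals and shells of a nonarchimedean field -/

section NonarchIntegrals

variable {F : Type*} [Field F] [ValuativeRel F] [TopologicalSpace F] [IsNonarchimedeanLocalField F]

/-- The units `x` with `x ∈ ϖ ^ k 𝔬`. -/
def unitIdeal (F : Type*) [Field F] [ValuativeRel F] [TopologicalSpace F]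
    [IsNonarchimedeanLocalField F] (k : ℤ) : Set Fˣ := {x | (x : F) ∈ fracIdeal F k}

theorem mem_unitIdeal {k : ℤ} {x : Fˣ} : x ∈ unitIdeal F k ↔ (x : F) ∈ fracIdeal F k := Iff.rfl

/-- The units of valuation exactly `k`. -/
def shell (F : Type*) [Field F] [ValuativeRel F] [TopologicalSpace F]
    [IsNonarchimedeanLocalField F] (k : ℤ) : Set Fˣ :=
  {x | valuation F (x : F) = valuation F (unif F : F) ^ k}

theorem mem_shell {k : ℤ} {x : Fˣ} :
    x ∈ shell F k ↔ valuation F (x : F) = valuation F (unif F : F) ^ k := Iff.rfl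

theorem mem_unitIdeal_of_mem_shell {j k : ℤ} {x : Fˣ} (hx : x ∈ shell F j) :
    x ∈ unitIdeal F k ↔ k ≤ j := by
  rw [mem_unitIdeal, mem_fracIdeal, mem_shell.1 hx, zpow_unif_le_iff]

theorem shell_eq_diff (k : ℤ) : shell F k = unitIdeal F k \ unitIdeal F (k + 1) := by
  ext x
  obtain ⟨j, hj⟩ := exists_valuation_eq_zpow x
  have hj' : x ∈ shell F j := hj
  rw [Set.mem_sdiff, mem_unitIdeal_of_mem_shell hj', mem_unitIdeal_of_mem_shell hj', mem_shell, hj,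
    zpow_unif_inj]
  omega

theorem isClopen_unitIdeal (k : ℤ) : IsClopen (unitIdeal F k) :=
  ⟨(isClosed_fracIdeal k).preimage Units.continuous_val,
    (isOpen_fracIdeal k).preimage Units.continuous_val⟩

theorem isClopen_shell (k : ℤ) : IsClopen (shell F k) := by
  rw [shell_eq_diff]
  exact (isClopen_unitIdeal k).diff (isClopen_unitIdeal (k + 1))

theorem isCompact_unitIdeal_diff (j k : ℤ) : IsCompact (unitIdeal F j \ unitIdeal F k) := by
  rw [Units.isEmbedding_val₀.isCompact_iff]
  have : Units.val '' (unitIdeal F j \ unitIdeal F k) = fracIdeal F j ∩ (fracIdeal F k)ᶜ := by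
    ext x
    constructor
    · rintro ⟨y, hy, rfl⟩
      exact ⟨hy.1, hy.2⟩
    · rintro ⟨h1, h2⟩
      have hx : x ≠ 0 := fun h => h2 (h ▸ zero_mem_fracIdeal k)
      exact ⟨Units.mk0 x hx, ⟨h1, h2⟩, rfl⟩
  rw [this]
  exact (isCompact_fracIdeal j).inter_right (isOpen_fracIdeal k).isClosed_compl

theorem isCompact_shell (k : ℤ) : IsCompact (shell F k) := by
  rw [shell_eq_diff]
  exact isCompact_unitIdeal_diff _ _

theorem mul_mem_unitIdeal_iff {u : Fˣ} (hu : valuation F (u : F) = 1) {k : ℤ} {x : Fˣ} :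
    x * u ∈ unitIdeal F k ↔ x ∈ unitIdeal F k := by
  simp [mem_unitIdeal, mem_fracIdeal, hu]

theorem unif_mul_mem_unitIdeal_iff {k : ℤ} {x : Fˣ} :
    unif F * x ∈ unitIdeal F (k + 1) ↔ x ∈ unitIdeal F k := by
  rw [mem_unitIdeal, mem_fracIdeal, mem_unitIdeal, mem_fracIdeal, Units.val_mul, map_mul, add_comm,
    zpow_add₀ valuation_unif_ne_zero, zpow_one, mul_le_mul_iff_right₀ valuation_unif_pos]

theorem valuation_one_add {k : ℤ} (hk : 1 ≤ k) {z : F} (hz : z ∈ fracIdeal F k) :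
    valuation F (1 + z) = 1 := by
  have h1 : valuation F z < 1 :=
    (isUnif_unif z).2 (by simpa using mem_fracIdeal.1 (fracIdeal_anti hk hz))
  rw [add_comm]
  exact Valuation.map_one_add_of_lt (v := valuation F) (x := z) h1 ▸ by rw [add_comm]

variable [MeasurableSpace F] [BorelSpace F]

theorem absF_of_mem_shell {k : ℤ} {x : Fˣ} (hx : x ∈ shell F k) :
    absF x = (Nat.card 𝓀[F] : ℝ) ^ (-k) := absF_of_valuation_eq_zpow hx

/-- The compact group `𝔬ˣ` is killed by `ν`, so `ν` is determined by its value at the uniformizer.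
-/
theorem nonarch_logChar (ν : LogChar Fˣ) : ∃ k : ℂ, ∀ x, ν.1 x = k * Real.log (absF x) := by
  have hq := one_lt_card_residue (F := F)
  have hlog : (Real.log (Nat.card 𝓀[F]) : ℂ) ≠ 0 := by
    exact_mod_cast (Real.log_pos hq).ne'
  refine ⟨-ν.1 (unif F) / Real.log (Nat.card 𝓀[F]), fun x => ?_⟩
  obtain ⟨k, hk⟩ := exists_valuation_eq_zpow x
  have hu : ∀ u : Fˣ, u ∈ shell F 0 → ν.1 u = 0 := fun u hu =>
    LogChar.eq_zero_of_pow_mem ν (isCompact_shell 0) fun n => by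
      have : valuation F (u : F) = 1 := by simpa using mem_shell.1 hu
      simp [mem_shell, this]
  have hx : ν.1 x = k * ν.1 (unif F) := by
    have h1 : x * unif F ^ (-k) ∈ shell F 0 := by
      rw [mem_shell, Units.val_mul, Units.val_zpow_eq_zpow_val, map_mul, hk, map_zpow₀,
        ← zpow_add₀ valuation_unif_ne_zero, add_neg_cancel]
    have h2 := hu _ h1
    rw [ν.2.2, LogChar.map_zpow] at h2
    push_cast at h2
    linear_combination h2
  rw [hx, absF_of_valuation_eq_zpow hk, Real.log_zpow]
  rw [Complex.ofReal_mul]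
  field_simp
  push_cast
  ring

section Integrals

variable (dx : Measure F) [dx.IsAddHaarMeasure]

theorem mulMeasure_shell (k : ℤ) : mulMeasure dx (shell F k) = mulMeasure dx (shell F 0) := by
  rw [← measure_preimage_mul (mulMeasure dx) (unif F ^ k) (shell F k)]
  congr 1
  ext x
  rw [Set.mem_preimage, mem_shell, mem_shell, Units.val_mul, Units.val_zpow_eq_zpow_val, map_mul,
    map_zpow₀, zpow_zero]
  constructor
  · intro h
    exact mul_left_cancel₀ (zpow_ne_zero k valuation_unif_ne_zero) (h.trans (mul_one _).symm)
  · intro h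
    rw [h, mul_one]

theorem mulMeasure_shell_zero_lt_top : mulMeasure dx (shell F 0) < ∞ :=
  (isCompact_shell 0).measure_lt_top

/-- All shells have the same finite volume, so the integral is bounded by a geometric series of
ratio `q ^ (-e)`. -/
theorem integrable_indicator_unitIdeal {f : Fˣ → ℂ} (hf : Continuous f) {e : ℝ} (he : 0 < e)
    (hfe : ∀ x, ‖f x‖ ≤ absF x ^ e) (k : ℤ) :
    Integrable ((unitIdeal F k).indicator f) (mulMeasure dx) := by
  rw [integrable_indicator_iff (isClopen_unitIdeal k).isOpen.measurableSet]
  refine ⟨hf.aestronglyMeasurable, ?_⟩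
  have hsub : unitIdeal F k ⊆ ⋃ j : ℕ, shell F (k + j) := by
    intro x hx
    obtain ⟨m, hm⟩ := exists_valuation_eq_zpow x
    have hm' : x ∈ shell F m := hm
    have := (mem_unitIdeal_of_mem_shell hm').1 hx
    refine Set.mem_iUnion.2 ⟨(m - k).toNat, ?_⟩
    rwa [Int.toNat_of_nonneg (by omega), add_sub_cancel]
  have hq := one_lt_card_residue (F := F)
  set q : ℝ := (Nat.card 𝓀[F] : ℝ)
  have hq0 : 0 < q := one_pos.trans hq
  have hterm : ∀ j : ℕ, ∫⁻ x in shell F (k + j), ‖f x‖ₑ ∂(mulMeasure dx) ≤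
      ENNReal.ofReal (q ^ (-(k : ℝ) * e)) * mulMeasure dx (shell F 0) *
        ENNReal.ofReal (q ^ (-e)) ^ j := by
    intro j
    calc ∫⁻ x in shell F (k + j), ‖f x‖ₑ ∂(mulMeasure dx)
        ≤ ∫⁻ _ in shell F (k + j), ENNReal.ofReal (q ^ (-((k : ℝ) + j) * e)) ∂(mulMeasure dx) := by
          refine setLIntegral_mono' (isClopen_shell _).isOpen.measurableSet fun x hx => ?_
          rw [← ofReal_norm]
          refine ENNReal.ofReal_le_ofReal ((hfe x).trans_eq ?_)
          rw [absF_of_mem_shell hx, ← Real.rpow_intCast, ← Real.rpow_mul hq0.le]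
          push_cast
          rfl
      _ = ENNReal.ofReal (q ^ (-((k : ℝ) + j) * e)) * mulMeasure dx (shell F 0) := by
          simp [mulMeasure_shell dx (k + j)]
      _ = _ := by
          have : q ^ (-((k : ℝ) + j) * e) = q ^ (-(k : ℝ) * e) * (q ^ (-e)) ^ j := by
            rw [← Real.rpow_natCast, ← Real.rpow_mul hq0.le, ← Real.rpow_add hq0]
            ring_nf
          rw [this, ENNReal.ofReal_mul (by positivity), ENNReal.ofReal_pow (by positivity)]
          ring
  calc ∫⁻ x in unitIdeal F k, ‖f x‖ₑ ∂(mulMeasure dx)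
      ≤ ∫⁻ x in ⋃ j : ℕ, shell F (k + j), ‖f x‖ₑ ∂(mulMeasure dx) := lintegral_mono_set hsub
    _ ≤ ∑' j : ℕ, ∫⁻ x in shell F (k + j), ‖f x‖ₑ ∂(mulMeasure dx) := lintegral_iUnion_le _ _
    _ ≤ ∑' j : ℕ, ENNReal.ofReal (q ^ (-(k : ℝ) * e)) * mulMeasure dx (shell F 0) *
        ENNReal.ofReal (q ^ (-e)) ^ j := ENNReal.tsum_le_tsum hterm
    _ = ENNReal.ofReal (q ^ (-(k : ℝ) * e)) * mulMeasure dx (shell F 0) *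
        (1 - ENNReal.ofReal (q ^ (-e)))⁻¹ := by rw [ENNReal.tsum_mul_left, ENNReal.tsum_geometric]
    _ < ∞ := by
        refine ENNReal.mul_lt_top (ENNReal.mul_lt_top ENNReal.ofReal_lt_top
          (mulMeasure_shell_zero_lt_top dx)) ?_
        rw [ENNReal.inv_lt_top, tsub_pos_iff_lt, ENNReal.ofReal_lt_one]
        exact Real.rpow_lt_one_of_one_lt_of_neg hq (by linarith)

variable {ψ : AddChar F Circle}

/-- Orthogonality of characters: a translation by `z₀` with `ψ(x z₀) ≠ 1` forces the integral to
vanish, and the conductor being `𝔬` makes `𝔭⁻ᵏ` the exact annihilator of `𝔭ᵏ`. -/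
theorem integral_fracIdeal_char (hcond : HasConductorIntegers ψ) (k : ℤ)
    (x : F) : ∫ z in fracIdeal F k, (ψ (x * z) : ℂ) ∂dx =
      (fracIdeal F (-k)).indicator (fun _ => (dx.real (fracIdeal F k) : ℂ)) x := by
  by_cases hx : x ∈ fracIdeal F (-k)
  · rw [Set.indicator_of_mem hx]
    have h1 : ∀ z ∈ fracIdeal F k, (ψ (x * z) : ℂ) = 1 := by
      intro z hz
      have h2 : valuation F (x * z) ≤ 1 := by
        simpa using mem_fracIdeal.1 (mul_mem_fracIdeal hx hz)
      have h3 := (hcond (x * z)).2 h2 1 (by simp)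
      rw [mul_one] at h3
      simp [h3]
    rw [setIntegral_congr_fun (isOpen_fracIdeal k).measurableSet h1]
    simp
  · rw [Set.indicator_of_notMem hx]
    obtain ⟨z₀, hz₀, hne⟩ : ∃ z₀ ∈ fracIdeal F k, ψ (x * z₀) ≠ 1 := by
      by_contra! hcon
      refine hx ?_
      have h1 : valuation F (x * ((unif F ^ k : Fˣ) : F)) ≤ 1 := by
        refine (hcond _).1 fun y hy => ?_
        rw [mul_assoc]
        refine hcon _ ?_
        rw [mem_fracIdeal, map_mul, Units.val_zpow_eq_zpow_val, map_zpow₀]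
        exact mul_le_of_le_one_right' hy
      rw [map_mul, Units.val_zpow_eq_zpow_val, map_zpow₀] at h1
      rw [mem_fracIdeal, zpow_neg]
      rwa [← one_div, le_div_iff₀ (zpow_pos valuation_unif_pos k)]
    have h1 : ∫ z in fracIdeal F k, (ψ (x * z) : ℂ) ∂dx =
        (ψ (x * z₀) : ℂ) * ∫ z in fracIdeal F k, (ψ (x * z) : ℂ) ∂dx := by
      have hm := (isOpen_fracIdeal (F := F) k).measurableSet
      conv_lhs => rw [← integral_indicator hm, ← integral_add_right_eq_self _ z₀]
      rw [← integral_const_mul, ← integral_indicator hm]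
      congr 1
      funext z
      have hiff : z + z₀ ∈ fracIdeal F k ↔ z ∈ fracIdeal F k :=
        ⟨fun h => by simpa using add_mem_fracIdeal h (neg_mem_fracIdeal hz₀),
          fun h => add_mem_fracIdeal h hz₀⟩
      by_cases hz : z ∈ fracIdeal F k
      · rw [Set.indicator_of_mem (hiff.2 hz), Set.indicator_of_mem hz, mul_add,
          AddChar.map_add_eq_mul, Circle.coe_mul, mul_comm]
      · rw [Set.indicator_of_notMem (mt hiff.1 hz), Set.indicator_of_notMem hz]
    have h2 : (1 - (ψ (x * z₀) : ℂ)) * ∫ z in fracIdeal F k, (ψ (x * z) : ℂ) ∂dx = 0 := by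
      linear_combination h1
    refine (mul_eq_zero.1 h2).resolve_left fun h => hne ?_
    exact Circle.ext (by simpa using (sub_eq_zero.1 h).symm)

end Integrals

end NonarchIntegrals

/-! ### Truncation of the convolution over nonarchimedean fields -/

section NonarchTruncation

variable {F : Type*} [Field F] [ValuativeRel F] [TopologicalSpace F] [IsNonarchimedeanLocalField F]

theorem exists_one_add_subset {S : Set Fˣ} (hS : S ∈ 𝓝 (1 : Fˣ)) :
    ∃ n : ℕ, 1 ≤ n ∧ ∀ u : Fˣ, (u : F) - 1 ∈ fracIdeal F n → u ∈ S := by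
  rw [Units.isEmbedding_val₀.isInducing.nhds_eq_comap, Filter.mem_comap] at hS
  obtain ⟨s, hs, hsS⟩ := hS
  have hs0 : (fun z : F => z + 1) ⁻¹' s ∈ 𝓝 (0 : F) :=
    (continuous_add_const (1 : F)).continuousAt.preimage_mem_nhds (by simpa using hs)
  obtain ⟨k, hk⟩ := exists_fracIdeal_subset hs0
  -- The shift by one guarantees a positive exponent, so that `1 + 𝔭ⁿ` consists of units.
  refine ⟨k + 1, by omega, fun u hu => hsS ?_⟩
  have := hk (fracIdeal_anti (by push_cast; omega) hu)
  simpa using this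

theorem valuation_eq_one_of_sub_one_mem {k : ℤ} (hk : 1 ≤ k) {u : F}
    (hu : u - 1 ∈ fracIdeal F k) : valuation F u = 1 := by
  simpa using valuation_one_add hk hu

theorem isUnit_one_add {k : ℤ} (hk : 1 ≤ k) {z : F} (hz : z ∈ fracIdeal F k) : 1 + z ≠ 0 := by
  intro h
  have := valuation_one_add hk hz
  simp [h] at this

variable [MeasurableSpace F] [BorelSpace F] {dx : Measure F} [dx.IsAddHaarMeasure]
  {ψ : AddChar F Circle}

/-- Against functions invariant under `1 + 𝔭ⁿ`, the kernel `D_s` may be restricted to `𝔭⁻ⁿ`. -/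
theorem integral_kernelD_eq_indicator (hψ : Continuous ψ) (hcond : HasConductorIntegers ψ) (s : ℂ)
    {n : ℕ} (hn : 1 ≤ n) {φ : Fˣ → ℂ}
    (hφ : ∀ x u : Fˣ, (u : F) - 1 ∈ fracIdeal F n → φ (x * u) = φ x)
    (hint_g : Integrable (fun x => kernelD ψ s x * φ x) (mulMeasure dx)) :
    ∫ x, kernelD ψ s x * φ x ∂(mulMeasure dx) =
      ∫ x, (unitIdeal F (-n)).indicator (fun x => kernelD ψ s x * φ x) x ∂(mulMeasure dx) := by
  set f : Fˣ → ℂ := fun x => kernelD ψ s x * φ x with hf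
  have hn' : (1 : ℤ) ≤ n := by exact_mod_cast hn
  -- The substitution `x ↦ (1 + z)x` preserves `φ`, `|x|` and `d^×x`; its only effect is to multiply
  -- `ψ(x)` by `ψ(xz)`.
  have hshift : ∀ z ∈ fracIdeal F (n : ℤ),
      ∫ x : Fˣ, f x * (ψ ((x : F) * z) : ℂ) ∂(mulMeasure dx) = ∫ x, f x ∂(mulMeasure dx) := by
    intro z hz
    let u : Fˣ := Units.mk0 (1 + z) (isUnit_one_add hn' hz)
    have hu : absF u = 1 := absF_of_valuation_eq_one (valuation_one_add hn' hz)
    rw [← integral_mul_left_eq_self f u]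
    refine integral_congr_ae (ae_of_all _ fun x => ?_)
    have h1 : φ (u * x) = φ x := by
      rw [mul_comm]
      exact hφ x u (by simpa [u] using hz)
    have h2 : (((u * x : Fˣ)) : F) = x + x * z := by
      simp [u]; ring
    simp only [hf, kernelD, h1, absF_mul, hu, one_mul, h2, AddChar.map_add_eq_mul, Circle.coe_mul]
    ring
  have hfin : IsFiniteMeasure (dx.restrict (fracIdeal F (n : ℤ))) :=
    ⟨by simpa using measure_fracIdeal_lt_top dx n⟩
  have hprod : Integrable (fun p : Fˣ × F => f p.1 * (ψ ((p.1 : F) * p.2) : ℂ))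
      ((mulMeasure dx).prod (dx.restrict (fracIdeal F (n : ℤ)))) := by
    have h1 : Integrable (fun p : Fˣ × F => f p.1 * (1 : ℂ))
        ((mulMeasure dx).prod (dx.restrict (fracIdeal F (n : ℤ)))) :=
      hint_g.mul_prod (integrable_const _)
    refine h1.mono ?_ (ae_of_all _ fun p => ?_)
    · refine (hint_g.aestronglyMeasurable.comp_fst).mul (Continuous.aestronglyMeasurable ?_)
      exact continuous_circle_coe.comp (hψ.comp
        ((Units.continuous_val.comp continuous_fst).mul continuous_snd))
    · simp only [norm_mul, Circle.norm_coe, norm_one, le_refl]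
  have hV : (dx.real (fracIdeal F (n : ℤ)) : ℂ) ≠ 0 := by
    have := ENNReal.toReal_pos (measure_fracIdeal_pos dx n).ne' (measure_fracIdeal_lt_top dx n).ne
    exact_mod_cast this.ne'
  -- Average over `z ∈ 𝔭ⁿ`: by orthogonality the mean of `ψ(xz)` is the indicator of `𝔭⁻ⁿ` at `x`.
  refine mul_left_cancel₀ hV ?_
  have hswap := integral_integral_swap (f := fun (x : Fˣ) (z : F) => f x * (ψ ((x : F) * z) : ℂ)) hprod
  have hR : ∫ z in fracIdeal F (n : ℤ), ∫ x : Fˣ, f x * (ψ ((x : F) * z) : ℂ) ∂(mulMeasure dx) ∂dx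
      = dx.real (fracIdeal F (n : ℤ)) * ∫ x, f x ∂(mulMeasure dx) := by
    rw [setIntegral_congr_fun (isOpen_fracIdeal (n : ℤ)).measurableSet hshift]
    simp
  rw [← hR, ← hswap, ← integral_const_mul]
  refine integral_congr_ae (ae_of_all _ fun x => ?_)
  simp only
  rw [integral_const_mul, integral_fracIdeal_char dx hcond]
  by_cases hx : x ∈ unitIdeal F (-n)
  · rw [Set.indicator_of_mem hx, Set.indicator_of_mem (mem_unitIdeal.1 hx), mul_comm]
  · rw [Set.indicator_of_notMem hx, Set.indicator_of_notMem (mt mem_unitIdeal.2 hx)]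
    simp

end NonarchTruncation

/-- Locally constant functions of compact support on a topological group are uniformly locally
constant. -/
theorem IsSchwartzNonarch.exists_invariant {T : Type*} [Group T] [TopologicalSpace T]
    [IsTopologicalGroup T] {Φ : T → ℂ} (hΦ : IsSchwartzNonarch Φ) :
    ∃ V ∈ 𝓝 (1 : T), ∀ v ∈ V, ∀ t, Φ (v * t) = Φ t := by
  have hopen : IsOpen {p : T × T | Φ (p.1 * p.2) = Φ p.2} := by
    have hlc : IsLocallyConstant fun p : T × T => (Φ (p.1 * p.2), Φ p.2) :=
      (hΦ.1.comp_continuous continuous_mul).prodMk (hΦ.1.comp_continuous continuous_snd)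
    exact hlc {q | q.1 = q.2}
  obtain ⟨U, W, hU, -, h1U, hKW, hUW⟩ := generalized_tube_lemma (isCompact_singleton (x := (1 : T)))
    hΦ.2 hopen (by
      rintro ⟨a, b⟩ ⟨ha, -⟩
      obtain rfl : a = 1 := ha
      simp)
  have hU1 : U ∈ 𝓝 (1 : T) := hU.mem_nhds (h1U rfl)
  have hK : ∀ v ∈ U, ∀ t ∈ tsupport Φ, Φ (v * t) = Φ t := fun v hv t ht =>
    hUW (Set.mk_mem_prod hv (hKW ht))
  -- The tube lemma handles `t` in the support only; symmetry of the neighbourhood covers the case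
  -- where `v * t` is in the support and `t` is not.
  refine ⟨U ∩ U⁻¹, Filter.inter_mem hU1 (inv_mem_nhds_one T hU1), fun v hv t => ?_⟩
  by_cases ht : t ∈ tsupport Φ
  · exact hK v hv.1 t ht
  by_cases ht' : v * t ∈ tsupport Φ
  · have := hK v⁻¹ hv.2 _ ht'
    rw [inv_mul_cancel_left] at this
    exact this.symm
  · rw [image_eq_zero_of_notMem_tsupport ht, image_eq_zero_of_notMem_tsupport ht']

/-! ### Convergence of the transform over nonarchimedean fields -/

section NonarchConvergence

variable {F : Type*} [Field F] [ValuativeRel F] [TopologicalSpace F] [IsNonarchimedeanLocalField F]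
  [MeasurableSpace F] [BorelSpace F] {dx : Measure F} [dx.IsAddHaarMeasure]
  {ψ : AddChar F Circle} {T : Type*} [Group T] [TopologicalSpace T] [IsTopologicalGroup T]
  [SecondCountableTopology T] [MeasurableSpace T] [BorelSpace T]

theorem IsSchwartzNonarch.mellinConverges {μ : Measure T} [IsFiniteMeasureOnCompacts μ]
    {Φ : T → ℂ} (hΦ : IsSchwartzNonarch Φ) (χ : T →ₜ* ℂˣ) : MellinConverges μ Φ χ := by
  have hχ : Continuous fun t => (((χ t)⁻¹ : ℂˣ) : ℂ) :=
    Units.continuous_val.comp (map_continuous χ).inv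
  exact (hΦ.1.continuous.mul hχ).integrable_of_hasCompactSupport hΦ.2.mul_right

/-- On the compact support `θ` is bounded, while along `λ` it grows linearly in the valuation. Hence
only finitely many shells contribute and the integrand has compact support. -/
theorem IsSchwartzNonarch.integrable_convolution (hψ : Continuous ψ) {Φ : T → ℂ}
    (hΦ : IsSchwartzNonarch Φ) (l : Fˣ →ₜ* T) {θ : LogChar T} (hθ₀ : θ.1 (l (unif F)) ≠ 0) (s : ℂ)
    (t : T) : Integrable (fun x => kernelD ψ s x * Φ ((l x)⁻¹ * t)) (mulMeasure dx) := by
  have hl : Continuous l := map_continuous l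
  have hcont : Continuous fun x => kernelD ψ s x * Φ ((l x)⁻¹ * t) :=
    (continuous_kernelD hψ s).mul (hΦ.1.continuous.comp (hl.inv.mul continuous_const))
  refine hcont.integrable_of_hasCompactSupport ?_
  obtain ⟨C, hC⟩ := IsCompact.exists_bound_of_continuousOn hΦ.2 θ.2.1.continuousOn
  obtain ⟨N, hN⟩ := exists_nat_gt ((C + ‖θ.1 t‖) / ‖θ.1 (l (unif F))‖)
  obtain ⟨k, hk⟩ := nonarch_logChar (LogChar.comp θ l)
  refine HasCompactSupport.intro (isCompact_unitIdeal_diff (-N) (N + 1)) fun x hx => ?_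
  obtain ⟨j, hj⟩ := exists_valuation_eq_zpow x
  have hj' : x ∈ shell F j := hj
  have hxj : θ.1 (l x) = j * θ.1 (l (unif F)) := by
    have h1 : θ.1 (l x) = k * Real.log (absF x) := hk x
    have h2 : θ.1 (l (unif F)) = k * Real.log (absF (unif F)) := hk (unif F)
    rw [h1, h2, absF_of_mem_shell hj', absF_unif, Real.log_zpow, Real.log_inv]
    push_cast
    ring
  rw [Set.mem_sdiff, mem_unitIdeal_of_mem_shell hj', mem_unitIdeal_of_mem_shell hj'] at hx
  have hNj : (N : ℝ) ≤ |(j : ℝ)| := by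
    have : (N : ℤ) ≤ |j| := by
      by_cases h : -(N : ℤ) ≤ j
      · have := not_and_not_right.1 hx h
        exact le_trans (by omega) (le_abs_self j)
      · rw [not_le] at h
        exact le_trans (by omega) (neg_le_abs j)
    exact_mod_cast this
  suffices h : (l x)⁻¹ * t ∉ tsupport Φ by rw [image_eq_zero_of_notMem_tsupport h, mul_zero]
  intro hmem
  have h1 := hC _ hmem
  rw [θ.2.2, LogChar.map_inv, hxj] at h1
  have h2 : ‖(j : ℂ) * θ.1 (l (unif F))‖ ≤ C + ‖θ.1 t‖ := by
    have := norm_sub_le (θ.1 t) (-((j : ℂ) * θ.1 (l (unif F))) + θ.1 t)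
    rw [show θ.1 t - (-((j : ℂ) * θ.1 (l (unif F))) + θ.1 t) = j * θ.1 (l (unif F)) by ring] at this
    linarith
  rw [norm_mul, Complex.norm_intCast] at h2
  rw [div_lt_iff₀ (norm_pos_iff.2 hθ₀)] at hN
  have := mul_le_mul_of_nonneg_right hNj (norm_nonneg (θ.1 (l (unif F))))
  linarith

/-- Once the kernel is truncated to `𝔭⁻ⁿ`, only its behaviour near `0` matters, so no upper bound on
`Re s - r` is required. -/
theorem IsSchwartzNonarch.mellinConverges_equivFourier {μ : Measure T} [μ.IsMulLeftInvariant]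
    [SigmaFinite μ] [IsFiniteMeasureOnCompacts μ]
    (hψ : Continuous ψ) (hcond : HasConductorIntegers ψ) {Φ : T → ℂ}
    (hΦ : IsSchwartzNonarch Φ) (l : Fˣ →ₜ* T) {θ : LogChar T} (hθ₀ : θ.1 (l (unif F)) ≠ 0) (s : ℂ)
    (χ : T →ₜ* ℂˣ) (r : ℝ) (hr : HasRealExponent (χ.comp l) r) (hsr : 0 < s.re - r) :
    MellinConverges μ (equivFourier ψ dx l s Φ) χ := by
  have hl : Continuous l := map_continuous l
  obtain ⟨V, hV, hVΦ⟩ := hΦ.exists_invariant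
  have hV' : (fun u : Fˣ => (l u)⁻¹) ⁻¹' V ∈ 𝓝 (1 : Fˣ) :=
    hl.inv.continuousAt.preimage_mem_nhds (by simpa using hV)
  obtain ⟨n, hn, hnV⟩ := exists_one_add_subset hV'
  have hχ : Continuous fun x => (((χ (l x))⁻¹ : ℂˣ) : ℂ) :=
    Units.continuous_val.comp ((map_continuous χ).comp hl).inv
  refine mellinConverges_of_dominated (dx := dx) (l := l)
    (stronglyMeasurable_equivFourier hψ l s hΦ.1.continuous).aestronglyMeasurable
    {()} (fun _ => (unitIdeal F (-n)).indicator fun x => (absF x : ℂ) ^ s) (fun _ => Φ)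
    (fun _ _ => ?_) (fun _ _ => hΦ.mellinConverges χ) fun t => ?_
  · have := integrable_indicator_unitIdeal dx (f := fun x => (absF x : ℂ) ^ s *
      (((χ (l x))⁻¹ : ℂˣ) : ℂ)) ((continuous_absF_cpow s).mul hχ) hsr (fun x => ?_) (-n)
    · refine this.congr (ae_of_all _ fun x => ?_)
      by_cases hx : x ∈ unitIdeal F (-n)
      · simp only [Set.indicator_of_mem hx]
      · simp only [Set.indicator_of_notMem hx, zero_mul]
    · have h1 : ‖(χ (l x) : ℂ)‖ = absF x ^ r := hr x
      rw [norm_mul, norm_absF_cpow, Units.val_inv_eq_inv_val, norm_inv, h1, ← Real.rpow_neg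
        (absF_pos x).le, ← Real.rpow_add (absF_pos x), sub_eq_add_neg]
  · have h1 : equivFourier ψ dx l s Φ t = ∫ x, (unitIdeal F (-n)).indicator
        (fun x => kernelD ψ s x * Φ ((l x)⁻¹ * t)) x ∂(mulMeasure dx) := by
      refine integral_kernelD_eq_indicator hψ hcond s hn (fun x u hu => ?_)
        (hΦ.integrable_convolution hψ l hθ₀ s t)
      simp only [map_mul, mul_inv_rev, mul_assoc]
      exact hVΦ _ (hnV u hu) _
    rw [h1, Finset.sum_singleton]
    refine (norm_integral_le_integral_norm _).trans_eq (integral_congr_ae (ae_of_all _ fun x => ?_))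
    by_cases hx : x ∈ unitIdeal F (-n)
    · simp only [Set.indicator_of_mem hx, kernelD, norm_mul, Circle.norm_coe, mul_one]
    · simp only [Set.indicator_of_notMem hx, norm_zero, zero_mul]

end NonarchConvergence

/-! ### Zeta integrals over nonarchimedean fields -/

/-- The group `ℂˣ` has no small subgroups: as long as powers stay near `1`, each squaring increases
the distance to `1` by a factor at least `3/2`. -/
theorem Complex.eq_one_of_norm_pow_sub_one_le {z : ℂ} (hz : ∀ k : ℕ, ‖z ^ k - 1‖ ≤ 1 / 2) :
    z = 1 := by
  have h : ∀ m : ℕ, (3 / 2 : ℝ) ^ m * ‖z - 1‖ ≤ ‖z ^ 2 ^ m - 1‖ := by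
    intro m
    induction m with
    | zero => simp
    | succ m ih =>
      have h1 : z ^ 2 ^ (m + 1) - 1 = (z ^ 2 ^ m + 1) * (z ^ 2 ^ m - 1) := by ring
      have h2 : 3 / 2 ≤ ‖z ^ 2 ^ m + 1‖ := by
        have := norm_sub_le (z ^ 2 ^ m + 1) (z ^ 2 ^ m - 1)
        rw [show z ^ 2 ^ m + 1 - (z ^ 2 ^ m - 1) = 2 by ring, Complex.norm_two] at this
        linarith [hz (2 ^ m)]
      rw [h1, norm_mul, pow_succ']
      calc 3 / 2 * (3 / 2) ^ m * ‖z - 1‖ = 3 / 2 * ((3 / 2) ^ m * ‖z - 1‖) := by ring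
        _ ≤ _ := mul_le_mul h2 ih (by positivity) (norm_nonneg _)
  by_contra hne
  have hpos : 0 < ‖z - 1‖ := norm_pos_iff.2 (sub_ne_zero.2 hne)
  obtain ⟨m, hm⟩ := pow_unbounded_of_one_lt (1 / ‖z - 1‖) (by norm_num : (1 : ℝ) < 3 / 2)
  rw [div_lt_iff₀ hpos] at hm
  linarith [h m, hz (2 ^ m)]

section NonarchZeta

variable {F : Type*} [Field F] [ValuativeRel F] [TopologicalSpace F] [IsNonarchimedeanLocalField F]

/-- Characters are trivial on `1 + 𝔭ⁿ` for large `n`. -/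
theorem exists_conductor (ω : Fˣ →ₜ* ℂˣ) : ∃ n : ℕ, ∀ u : Fˣ, valuation F (u : F) = 1 →
    valuation F ((u : F) - 1) ≤ valuation F (unif F : F) ^ n → ω u = 1 := by
  have hc : Continuous fun u => (ω u : ℂ) := Units.continuous_val.comp (map_continuous ω)
  have hS : (fun u => (ω u : ℂ)) ⁻¹' Metric.closedBall 1 (1 / 2) ∈ 𝓝 (1 : Fˣ) :=
    hc.continuousAt.preimage_mem_nhds (by
      simpa using Metric.closedBall_mem_nhds (1 : ℂ) (by norm_num : (0 : ℝ) < 1 / 2))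
  obtain ⟨n, -, hn⟩ := exists_one_add_subset hS
  refine ⟨n, fun u hu1 hu => Units.ext (Complex.eq_one_of_norm_pow_sub_one_le fun k => ?_)⟩
  have hpow : ∀ k : ℕ, ((u ^ k : Fˣ) : F) - 1 ∈ fracIdeal F n := by
    intro k
    induction k with
    | zero => simpa using zero_mem_fracIdeal _
    | succ k ih =>
      have h1 : ((u ^ (k + 1) : Fˣ) : F) - 1 = (((u ^ k : Fˣ) : F) - 1) * u + (u - 1) := by
        push_cast; ring
      rw [h1]
      refine add_mem_fracIdeal ?_ (by simpa [mem_fracIdeal] using hu)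
      rw [mem_fracIdeal, map_mul, hu1, mul_one]
      exact ih
  have := hn _ (hpow k)
  rw [Set.mem_preimage, mem_closedBall_iff_norm] at this
  simpa using this

theorem eq_one_of_condExp (ω : Fˣ →ₜ* ℂˣ) {u : Fˣ} (hu : valuation F (u : F) = 1)
    (hu' : (u : F) - 1 ∈ fracIdeal F (condExp ω)) : ω u = 1 := by
  have := Nat.sInf_mem (s := {n : ℕ | ∀ u : Fˣ, valuation F (u : F) = 1 →
    valuation F ((u : F) - 1) ≤ valuation F (unif F : F) ^ n → ω u = 1}) (exists_conductor ω)
  refine this u hu ?_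
  rw [mem_fracIdeal, zpow_natCast] at hu'
  exact hu'

theorem condExp_pos {ω : Fˣ →ₜ* ℂˣ} (hω : ¬ IsUnramified ω) : 0 < condExp ω := by
  refine Nat.pos_of_ne_zero fun h0 => hω fun u hu => eq_one_of_condExp ω hu ?_
  rw [h0, mem_fracIdeal]
  have := (valuation F).map_sub (u : F) 1
  simpa [hu] using this

theorem exists_ne_one_of_condExp {ω : Fˣ →ₜ* ℂˣ} (hω : ¬ IsUnramified ω) :
    ∃ u : Fˣ, valuation F (u : F) = 1 ∧ (u : F) - 1 ∈ fracIdeal F ((condExp ω : ℤ) - 1) ∧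
      ω u ≠ 1 := by
  have hpos := condExp_pos hω
  have h := Nat.notMem_of_lt_sInf (s := {n : ℕ | ∀ u : Fˣ, valuation F (u : F) = 1 →
    valuation F ((u : F) - 1) ≤ valuation F (unif F : F) ^ n → ω u = 1})
    (m := condExp ω - 1) (by change _ < condExp ω; omega)
  simp only [Set.mem_ofPred_eq, not_forall] at h
  obtain ⟨u, hu, hu', hne⟩ := h
  refine ⟨u, hu, ?_, hne⟩
  rw [mem_fracIdeal]
  have : (condExp ω : ℤ) - 1 = ((condExp ω - 1 : ℕ) : ℤ) := by omega
  rw [this, zpow_natCast]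
  exact hu'

theorem isUnramified_inv {ω : Fˣ →ₜ* ℂˣ} : IsUnramified ω⁻¹ ↔ IsUnramified ω := by
  refine forall₂_congr fun u _ => ?_
  change (ω u)⁻¹ = 1 ↔ _
  simp

variable [MeasurableSpace F] [BorelSpace F] {dx : Measure F} [dx.IsAddHaarMeasure]
  {ψ : AddChar F Circle}

theorem integral_fracIdeal_indicator_char (hcond : HasConductorIntegers ψ) (k : ℤ) (y : F) :
    ∫ x, (fracIdeal F k).indicator 1 x * (ψ (x * y) : ℂ) ∂dx =
      (fracIdeal F (-k)).indicator (fun _ => (dx.real (fracIdeal F k) : ℂ)) y := by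
  rw [← integral_fracIdeal_char dx hcond, ← integral_indicator (isOpen_fracIdeal k).measurableSet]
  refine integral_congr_ae (ae_of_all _ fun x => ?_)
  by_cases hx : x ∈ fracIdeal F k
  · simp [hx, mul_comm]
  · simp [hx]

theorem integrable_indicator_fracIdeal (k : ℤ) :
    Integrable ((fracIdeal F k).indicator (1 : F → ℂ)) dx :=
  (integrable_indicator_iff (isOpen_fracIdeal k).measurableSet).2
    (integrableOn_const (measure_fracIdeal_lt_top dx k).ne)

theorem dx_real_fracIdeal_pos (k : ℤ) : 0 < dx.real (fracIdeal F k) :=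
  ENNReal.toReal_pos (measure_fracIdeal_pos dx k).ne' (measure_fracIdeal_lt_top dx k).ne

/-- The self-dual measure gives the ring of integers volume `1`. -/
theorem IsSelfDual.real_integers (hcond : HasConductorIntegers ψ) (hdual : IsSelfDual ψ dx) :
    dx.real (fracIdeal F 0) = 1 := by
  -- The indicator of `𝔬` is its own Fourier transform up to the volume of `𝔬`; inversion at `0`
  -- then says that the square of this volume is `1`.
  have hF : ∀ y, ∫ x, (fracIdeal F 0).indicator 1 x * (ψ (x * y) : ℂ) ∂dx =
      (dx.real (fracIdeal F 0) : ℂ) * (fracIdeal F 0).indicator 1 y := by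
    intro y
    rw [integral_fracIdeal_indicator_char hcond]
    by_cases hy : y ∈ fracIdeal F 0 <;> simp [hy]
  have hc : Continuous ((fracIdeal F 0).indicator (1 : F → ℂ)) :=
    IsClopen.continuous_indicator ⟨isClosed_fracIdeal 0, isOpen_fracIdeal 0⟩ continuous_one
  have h := hdual ((fracIdeal F 0).indicator 1) hc (integrable_indicator_fracIdeal 0) (by
    simp only [hF]
    exact (integrable_indicator_fracIdeal 0).const_mul _) 0
  simp only [hF, mul_assoc, integral_const_mul] at h
  have h0 : (fracIdeal F 0).indicator (1 : F → ℂ) 0 = 1 := by simp [zero_mem_fracIdeal]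
  rw [neg_zero, h0, mul_one] at h
  have h2 : dx.real (fracIdeal F 0) * dx.real (fracIdeal F 0) = 1 := by exact_mod_cast h
  nlinarith [dx_real_fracIdeal_pos (dx := dx) (F := F) 0]

/-- Since `𝔬 ∖ {0}` is the disjoint union of `𝔬ˣ` and `ϖ(𝔬 ∖ {0})`, the integral satisfies `I =
vol(𝔬ˣ) + cI`: the geometric series without summation. -/
theorem integral_indicator_unitIdeal_mul {f : Fˣ → ℂ} {c : ℂ}
    (hmul : ∀ x, f (unif F * x) = c * f x)
    (hone : ∀ x ∈ shell F 0, f x = 1)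
    (hint_g : Integrable ((unitIdeal F 0).indicator f) (mulMeasure dx)) :
    (1 - c) * ∫ x, (unitIdeal F 0).indicator f x ∂(mulMeasure dx) =
      (mulMeasure dx).real (shell F 0) := by
  have hm0 := (isClopen_unitIdeal (F := F) 0).isOpen.measurableSet
  have hm1 := (isClopen_unitIdeal (F := F) 1).isOpen.measurableSet
  have hms := (isClopen_shell (F := F) 0).isOpen.measurableSet
  have hI : IntegrableOn f (unitIdeal F 0) (mulMeasure dx) := (integrable_indicator_iff hm0).1 hint_g
  have hunion : unitIdeal F 0 = shell F 0 ∪ unitIdeal F 1 := by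
    ext x
    obtain ⟨j, hj⟩ := exists_valuation_eq_zpow x
    have hj' : x ∈ shell F j := hj
    rw [Set.mem_union, mem_unitIdeal_of_mem_shell hj', mem_unitIdeal_of_mem_shell hj', mem_shell,
      hj, zpow_unif_inj]
    omega
  have hdisj : Disjoint (shell F 0) (unitIdeal F 1) := by
    rw [shell_eq_diff]
    exact Set.disjoint_sdiff_left
  have h1 : ∫ x in unitIdeal F 1, f x ∂(mulMeasure dx) =
      c * ∫ x in unitIdeal F 0, f x ∂(mulMeasure dx) := by
    rw [← integral_indicator hm1, ← integral_indicator hm0, ← integral_const_mul,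
      ← integral_mul_left_eq_self _ (unif F)]
    refine integral_congr_ae (ae_of_all _ fun x => ?_)
    have := unif_mul_mem_unitIdeal_iff (F := F) (k := 0) (x := x)
    rw [zero_add] at this
    by_cases hx : x ∈ unitIdeal F 0
    · simp only [Set.indicator_of_mem hx, Set.indicator_of_mem (this.2 hx), hmul]
    · simp only [Set.indicator_of_notMem hx, Set.indicator_of_notMem (mt this.1 hx), mul_zero]
  have h2 : ∫ x in shell F 0, f x ∂(mulMeasure dx) = (mulMeasure dx).real (shell F 0) := by
    rw [setIntegral_congr_fun hms hone]
    simp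
  have h3 : ∫ x in unitIdeal F 0, f x ∂(mulMeasure dx) =
      ∫ x in shell F 0, f x ∂(mulMeasure dx) + ∫ x in unitIdeal F 1, f x ∂(mulMeasure dx) := by
    have h4 := hI
    rw [hunion] at h4 ⊢
    exact setIntegral_union hdisj hm1 (h4.mono_set Set.subset_union_left)
      (h4.mono_set Set.subset_union_right)
  rw [integral_indicator hm0]
  rw [h1, h2] at h3
  linear_combination h3

/-- The unit ball around `1` of radius `q⁻ⁿ`. -/
def oneAdd (F : Type*) [Field F] [ValuativeRel F] [TopologicalSpace F]
    [IsNonarchimedeanLocalField F] (n : ℤ) : Set F := {x | x - 1 ∈ fracIdeal F n}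

theorem integral_oneAdd_mul {f : F → ℂ} (n : ℤ) :
    ∫ x, (oneAdd F n).indicator 1 x * f x ∂dx = ∫ z in fracIdeal F n, f (1 + z) ∂dx := by
  rw [← integral_indicator (isOpen_fracIdeal n).measurableSet, ← integral_add_left_eq_self _ (1 : F)]
  refine integral_congr_ae (ae_of_all _ fun z => ?_)
  have : 1 + z ∈ oneAdd F n ↔ z ∈ fracIdeal F n := by simp [oneAdd]
  by_cases hz : z ∈ fracIdeal F n
  · simp [hz, this.2 hz]
  · simp [hz, this]

theorem integrable_indicator_oneAdd (n : ℤ) :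
    Integrable ((oneAdd F n).indicator (1 : F → ℂ)) dx := by
  have := (integrable_indicator_fracIdeal (dx := dx) n).comp_sub_right (1 : F)
  refine this.congr (ae_of_all _ fun x => ?_)
  by_cases hx : x - 1 ∈ fracIdeal F n
  · have hx' : x ∈ oneAdd F n := hx
    simp [hx, hx']
  · have hx' : x ∉ oneAdd F n := hx
    simp [hx, hx']

theorem integral_oneAdd (n : ℤ) :
    ∫ x, (oneAdd F n).indicator (1 : F → ℂ) x ∂dx = dx.real (fracIdeal F n) := by
  have := integral_oneAdd_mul (dx := dx) (f := fun _ => 1) n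
  simpa using this

theorem integral_oneAdd_char (hcond : HasConductorIntegers ψ) (n : ℤ) (y : F) :
    ∫ x, (oneAdd F n).indicator 1 x * (ψ (x * y) : ℂ) ∂dx =
      dx.real (fracIdeal F n) * (fracIdeal F (-n)).indicator (fun y => (ψ y : ℂ)) y := by
  rw [integral_oneAdd_mul (f := fun x => (ψ (x * y) : ℂ))]
  have h : ∀ z, (ψ ((1 + z) * y) : ℂ) = ψ y * ψ (y * z) := fun z => by
    rw [add_mul, one_mul, mul_comm z y, AddChar.map_add_eq_mul, Circle.coe_mul]
  simp only [h, integral_const_mul, integral_fracIdeal_char dx hcond]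
  by_cases hy : y ∈ fracIdeal F (-n)
  · simp [hy, mul_comm]
  · simp [hy]

/-- The shell contains `1 + 𝔭`, whose additive volume is positive. -/
theorem mulMeasure_shell_zero_pos : 0 < (mulMeasure dx).real (shell F 0) := by
  have : NullSingletonClass dx := IsNonarchimedeanLocalField.nullSingletonClass dx
  have h := integral_abs_mul dx ((oneAdd F 1).indicator 1)
  rw [integral_oneAdd] at h
  refine ENNReal.toReal_pos (fun h0 => ?_) (mulMeasure_shell_zero_lt_top dx).ne
  have hz : ∫ x : Fˣ, (absF x : ℂ) * (oneAdd F 1).indicator 1 (x : F) ∂(mulMeasure dx) = 0 := by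
    refine integral_eq_zero_of_ae ?_
    have : ∀ᵐ x ∂(mulMeasure dx), x ∉ shell F 0 := measure_eq_zero_iff_ae_notMem.1 h0
    filter_upwards [this] with x hx
    have hx' : (x : F) ∉ oneAdd F 1 := fun h => hx (by
      simpa [mem_shell] using valuation_eq_one_of_sub_one_mem le_rfl h)
    simp [hx']
  rw [hz] at h
  have := dx_real_fracIdeal_pos (dx := dx) (F := F) 1
  have h' : (0 : ℝ) = dx.real (fracIdeal F 1) := by exact_mod_cast h
  linarith

theorem absF_unif_cpow (z : ℂ) : (absF (unif F) : ℂ) ^ z = (Nat.card 𝓀[F] : ℂ) ^ (-z) := by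
  rw [absF_unif, Complex.cpow_neg, Complex.ofReal_inv, Complex.ofReal_natCast, Complex.inv_cpow]
  rw [Complex.natCast_arg]
  exact Real.pi_pos.ne

end NonarchZeta

/-! ### Zeta ratios of unramified and ramified characters -/

section NonarchRatio

variable {F : Type*} [Field F] [ValuativeRel F] [TopologicalSpace F] [IsNonarchimedeanLocalField F]
  [MeasurableSpace F] [BorelSpace F] {dx : Measure F} [dx.IsAddHaarMeasure]
  {ψ : AddChar F Circle}

theorem card_residue_ne_zero : (Nat.card 𝓀[F] : ℂ) ≠ 0 := by
  exact_mod_cast (card_residue_pos (F := F)).ne'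

theorem continuous_coe_char (ω : Fˣ →ₜ* ℂˣ) : Continuous fun y => (ω y : ℂ) :=
  Units.continuous_val.comp (map_continuous ω)

theorem absF_cpow_ne_zero (y : Fˣ) (κ : ℂ) : (absF y : ℂ) ^ κ ≠ 0 := by
  rw [absF_cpow_eq_exp]
  exact Complex.exp_ne_zero _

theorem norm_zeta_left {ω : Fˣ →ₜ* ℂˣ} {r : ℝ} (hr : HasRealExponent ω r) (κ s : ℂ) (y : Fˣ) :
    ‖(ω y : ℂ) * (absF y : ℂ) ^ κ * (absF y : ℂ) ^ (1 - s)‖ =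
      absF y ^ (1 - (s.re - r - κ.re)) := by
  rw [norm_mul, norm_mul, hr y, norm_absF_cpow, norm_absF_cpow, ← Real.rpow_add (absF_pos y),
    ← Real.rpow_add (absF_pos y)]
  congr 1
  simp
  ring

theorem norm_zeta_right {ω : Fˣ →ₜ* ℂˣ} {r : ℝ} (hr : HasRealExponent ω r) (κ s : ℂ) (y : Fˣ) :
    ‖((ω y : ℂ) * (absF y : ℂ) ^ κ)⁻¹ * (absF y : ℂ) ^ s‖ = absF y ^ (s.re - r - κ.re) := by
  rw [norm_mul, norm_inv, norm_mul, hr y, norm_absF_cpow, norm_absF_cpow,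
    ← Real.rpow_add (absF_pos y), ← Real.rpow_neg (absF_pos y).le, ← Real.rpow_add (absF_pos y)]
  congr 1
  ring

/-- The indicator of `𝔬` equals its Fourier transform, and each of its two zeta integrals is
`vol(𝔬ˣ)` times an `L`-factor. The functions `a`, `b` are the inverse `L`-factors at `1 - s + κ` and
`s - κ`, which are entire. -/
theorem hasZetaRatio_unramified (hcond : HasConductorIntegers ψ) (hdual : IsSelfDual ψ dx) (s : ℂ)
    {ω : Fˣ →ₜ* ℂˣ} (hω : IsUnramified ω) (hL : nonarchL ω⁻¹ s ≠ 0) :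
    HasZetaRatio ψ dx s ω 1 (gammaFactor nonarchL (nonarchEps ψ dx) ω (1 - s)) := by
  have hV := hdual.real_integers hcond
  have hq := card_residue_ne_zero (F := F)
  have hinv : (ω⁻¹ (unif F) : ℂ) = (ω (unif F) : ℂ)⁻¹ := by
    change (((ω (unif F))⁻¹ : ℂˣ) : ℂ) = _
    simp
  have hL1 : nonarchL ω⁻¹ s = (1 - (ω (unif F) : ℂ)⁻¹ * (Nat.card 𝓀[F] : ℂ) ^ (-s))⁻¹ := by
    rw [nonarchL, if_pos (isUnramified_inv.2 hω), hinv]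
  refine ⟨fun κ => 1 - (ω (unif F) : ℂ) * (Nat.card 𝓀[F] : ℂ) ^ (-(κ + (1 - s))),
    fun κ => 1 - (ω (unif F) : ℂ)⁻¹ * (Nat.card 𝓀[F] : ℂ) ^ (-(s - κ)), ?_, ?_, ?_, ?_, ?_⟩
  · refine (differentiable_const _).sub ((differentiable_const _).mul ?_)
    exact Differentiable.const_cpow (by fun_prop) (Or.inl hq)
  · refine (differentiable_const _).sub ((differentiable_const _).mul ?_)
    exact Differentiable.const_cpow (by fun_prop) (Or.inl hq)
  -- At a pole the convention `0⁻¹ = 0` makes the `L`-factor vanish, so `hL` says exactly that the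
  -- denominator is nonzero.
  · rw [hL1] at hL
    simpa using inv_ne_zero hL
  · have e1 : nonarchEps ψ dx ω (1 - s) = 1 := by rw [nonarchEps, if_pos hω]
    rw [gammaFactor, e1, sub_sub_cancel, hL1, nonarchL, if_pos hω]
    simp only [zero_add, sub_zero, one_mul, div_inv_eq_mul]
    ring
  · intro r κ hr h0 h1
    have hfourier : ∀ y : F, ∫ x, (fracIdeal F 0).indicator 1 x * (ψ (x * y) : ℂ) ∂dx =
        (fracIdeal F 0).indicator 1 y := fun y => by
      rw [integral_fracIdeal_indicator_char hcond, hV]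
      by_cases hy : y ∈ fracIdeal F 0 <;> simp [hy]
    set f₁ : Fˣ → ℂ := fun y => (ω y : ℂ) * (absF y : ℂ) ^ κ * (absF y : ℂ) ^ (1 - s) with hf₁
    set f₂ : Fˣ → ℂ := fun y => ((ω y : ℂ) * (absF y : ℂ) ^ κ)⁻¹ * (absF y : ℂ) ^ s with hf₂
    have hind : ∀ (f : Fˣ → ℂ) (y : Fˣ), (fracIdeal F 0).indicator 1 (y : F) * f y =
        (unitIdeal F 0).indicator f y := by
      intro f y
      by_cases hy : y ∈ unitIdeal F 0
      · rw [Set.indicator_of_mem hy, Set.indicator_of_mem (mem_unitIdeal.1 hy), Pi.one_apply,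
          one_mul]
      · rw [Set.indicator_of_notMem hy, Set.indicator_of_notMem (mt mem_unitIdeal.2 hy), zero_mul]
    have hc₁ : Continuous f₁ :=
      ((continuous_coe_char ω).mul (continuous_absF_cpow κ)).mul (continuous_absF_cpow _)
    have hc₂ : Continuous f₂ :=
      (((continuous_coe_char ω).mul (continuous_absF_cpow κ)).inv₀ fun y =>
        mul_ne_zero (Units.ne_zero _) (absF_cpow_ne_zero _ _)).mul (continuous_absF_cpow _)
    have hi₁ : Integrable ((unitIdeal F 0).indicator f₁) (mulMeasure dx) :=
      integrable_indicator_unitIdeal dx hc₁ (by linarith)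
        (fun x => (norm_zeta_left hr κ s x).le) 0
    have hi₂ : Integrable ((unitIdeal F 0).indicator f₂) (mulMeasure dx) :=
      integrable_indicator_unitIdeal dx hc₂ h0 (fun x => (norm_zeta_right hr κ s x).le) 0
    have hone : ∀ x ∈ shell F 0, ω x = 1 ∧ absF x = 1 := fun x hx => by
      have : valuation F (x : F) = 1 := by simpa using mem_shell.1 hx
      exact ⟨hω x this, absF_of_valuation_eq_one this⟩
    have z₁ := integral_indicator_unitIdeal_mul (dx := dx) (f := f₁)
      (c := (ω (unif F) : ℂ) * (Nat.card 𝓀[F] : ℂ) ^ (-(κ + (1 - s))))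
      (fun x => by
        simp only [hf₁, map_mul, Units.val_mul, absF_mul_cpow]
        rw [neg_add, Complex.cpow_add _ _ hq, ← absF_unif_cpow, ← absF_unif_cpow]
        ring)
      (fun x hx => by simp [hf₁, hone x hx]) hi₁
    have z₂ := integral_indicator_unitIdeal_mul (dx := dx) (f := f₂)
      (c := (ω (unif F) : ℂ)⁻¹ * (Nat.card 𝓀[F] : ℂ) ^ (-(s - κ)))
      (fun x => by
        simp only [hf₂, map_mul, Units.val_mul, absF_mul_cpow]
        rw [← absF_unif_cpow, Complex.cpow_sub _ _ (absF_ne_zero _)]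
        simp only [mul_inv, div_eq_mul_inv]
        ring)
      (fun x hx => by simp [hf₂, hone x hx]) hi₂
    have hVpos : ((mulMeasure dx).real (shell F 0) : ℂ) ≠ 0 := by
      exact_mod_cast (mulMeasure_shell_zero_pos (dx := dx)).ne'
    refine ⟨(fracIdeal F 0).indicator 1, integrable_indicator_fracIdeal 0, ?_⟩
    simp only [hfourier]
    have hr₁ : ∀ y : Fˣ, (fracIdeal F 0).indicator 1 (y : F) *
        ((ω y : ℂ) * (absF y : ℂ) ^ κ) * (absF y : ℂ) ^ (1 - s) =
        (unitIdeal F 0).indicator f₁ y := fun y => by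
      rw [← hind f₁ y]; simp only [hf₁, mul_assoc]
    have hr₂ : ∀ y : Fˣ, (fracIdeal F 0).indicator 1 (y : F) *
        ((ω y : ℂ) * (absF y : ℂ) ^ κ)⁻¹ * (absF y : ℂ) ^ s =
        (unitIdeal F 0).indicator f₂ y := fun y => by
      rw [← hind f₂ y]; simp only [hf₂, mul_assoc]
    simp only [hr₁, hr₂]
    refine ⟨hi₁, hi₂, fun h => ?_, z₂.trans z₁.symm⟩
    rw [h, mul_zero] at z₁
    exact hVpos z₁.symm

/-- Passing from `dx` to `d^×x` raises the exponent by one: `|x|^(s-1) dx = |x|^s d^×x`. -/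
theorem nonarchEps_ramified {ω : Fˣ →ₜ* ℂˣ} (hω : ¬ IsUnramified ω) (s : ℂ) :
    nonarchEps ψ dx ω (1 - s) = ∫ y in shell F (-(condExp ω : ℤ)),
      (ψ (y : F) : ℂ) * ((ω y : ℂ)⁻¹ * (absF y : ℂ) ^ s) ∂(mulMeasure dx) := by
  have hms := (isClopen_shell (F := F) (-(condExp ω : ℤ))).isOpen.measurableSet
  have hset : {x : Fˣ | valuation F (x : F) * valuation F (unif F : F) ^ condExp ω = 1} =
      shell F (-(condExp ω : ℤ)) := by
    ext x
    rw [mem_shell, zpow_neg, zpow_natCast]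
    exact mul_eq_one_iff_eq_inv₀ (pow_ne_zero _ valuation_unif_ne_zero)
  rw [nonarchEps, if_neg hω, hset, ← integral_indicator hms, ← integral_indicator hms,
    integral_mulMeasure]
  refine integral_congr_ae (ae_of_all _ fun x => ?_)
  by_cases hx : x ∈ shell F (-(condExp ω : ℤ))
  · simp only [Set.indicator_of_mem hx, Units.val_inv_eq_inv_val, neg_sub]
    rw [Complex.cpow_sub _ _ (absF_ne_zero _), Complex.cpow_one]
    push_cast
    ring
  · simp only [Set.indicator_of_notMem hx, mul_zero]

/-- With `n` the conductor exponent, `ω` and the absolute value are `1` on `1 + 𝔭ⁿ`, so the zeta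
integral of its indicator is just a volume. The Fourier transform is that volume times `ψ` on `𝔭⁻ⁿ`,
and only the shell of valuation `-n` contributes: this is the `ε`-integral, with `κ` entering
through `q ^ (-nκ)`. -/
theorem hasZetaRatio_ramified (hψ : Continuous ψ) (hcond : HasConductorIntegers ψ) (s : ℂ)
    {ω : Fˣ →ₜ* ℂˣ} (hω : ¬ IsUnramified ω) :
    HasZetaRatio ψ dx s ω 1 (gammaFactor nonarchL (nonarchEps ψ dx) ω (1 - s)) := by
  have : NullSingletonClass dx := IsNonarchimedeanLocalField.nullSingletonClass dx
  have hq := card_residue_ne_zero (F := F)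
  have hγ : gammaFactor nonarchL (nonarchEps ψ dx) ω (1 - s) = nonarchEps ψ dx ω (1 - s) := by
    rw [gammaFactor, nonarchL, if_neg (mt isUnramified_inv.1 hω), nonarchL, if_neg hω]
    simp
  rw [hγ, nonarchEps_ramified hω]
  have hn0 := condExp_pos hω
  obtain ⟨u₀, hu₀, hu₀', hu₀ω⟩ := exists_ne_one_of_condExp hω
  have honeAdd : ∀ y : Fˣ, (y : F) ∈ oneAdd F (condExp ω : ℤ) → ω y = 1 ∧ absF y = 1 := by
    intro y hy
    have := valuation_eq_one_of_sub_one_mem (by exact_mod_cast hn0) hy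
    exact ⟨eq_one_of_condExp ω this hy, absF_of_valuation_eq_one this⟩
  set n : ℤ := (condExp ω : ℤ) with hn
  have hmn := (isClopen_unitIdeal (F := F) (-n)).isOpen.measurableSet
  have hmn1 := (isClopen_unitIdeal (F := F) (-n + 1)).isOpen.measurableSet
  have hms := (isClopen_shell (F := F) (-n)).isOpen.measurableSet
  refine ⟨fun κ => (Nat.card 𝓀[F] : ℂ) ^ (-(n * κ)) * ∫ y in shell F (-n),
      (ψ (y : F) : ℂ) * ((ω y : ℂ)⁻¹ * (absF y : ℂ) ^ s) ∂(mulMeasure dx), fun _ => 1, ?_,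
    differentiable_const _, one_ne_zero, by simp, fun r κ hr h0 h1 => ?_⟩
  · refine Differentiable.mul ?_ (differentiable_const _)
    exact Differentiable.const_cpow (by fun_prop) (Or.inl hq)
  set f : Fˣ → ℂ := fun y => (ψ (y : F) : ℂ) *
    (((ω y : ℂ) * (absF y : ℂ) ^ κ)⁻¹ * (absF y : ℂ) ^ s) with hf
  have hfc : Continuous f :=
    (continuous_circle_coe.comp (hψ.comp Units.continuous_val)).mul
    ((((continuous_coe_char ω).mul (continuous_absF_cpow κ)).inv₀ fun y =>
        mul_ne_zero (Units.ne_zero _) (absF_cpow_ne_zero _ _)).mul (continuous_absF_cpow _))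
  have hi : ∀ k, Integrable ((unitIdeal F k).indicator f) (mulMeasure dx) :=
    integrable_indicator_unitIdeal dx hfc h0 fun x => by
      rw [hf, norm_mul, Circle.norm_coe, one_mul, norm_zeta_right hr κ s x]
  -- By minimality of `n` there is `u₀ ≡ 1` modulo `𝔭ⁿ⁻¹` with `ω(u₀) ≠ 1`. On `𝔭⁻ⁿ⁺¹`
  -- multiplication by `u₀` does not change `ψ`, so the integral equals itself times `ω(u₀)⁻¹`.
  have hvanish : ∫ y in unitIdeal F (-n + 1), f y ∂(mulMeasure dx) = 0 := by
    have hne : ((ω u₀ : ℂ)⁻¹ - 1) ≠ 0 := by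
      rw [sub_ne_zero, Ne, inv_eq_one]
      exact fun h => hu₀ω (Units.ext h)
    have h2 : ∫ y in unitIdeal F (-n + 1), f y ∂(mulMeasure dx) =
        (ω u₀ : ℂ)⁻¹ * ∫ y in unitIdeal F (-n + 1), f y ∂(mulMeasure dx) := by
      rw [← integral_indicator hmn1, ← integral_const_mul]
      conv_lhs => rw [← integral_mul_left_eq_self _ u₀]
      refine integral_congr_ae (ae_of_all _ fun x => ?_)
      have hiff : u₀ * x ∈ unitIdeal F (-n + 1) ↔ x ∈ unitIdeal F (-n + 1) := by
        rw [mul_comm]; exact mul_mem_unitIdeal_iff hu₀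
      by_cases hx : x ∈ unitIdeal F (-n + 1)
      · simp only [Set.indicator_of_mem hx, Set.indicator_of_mem (hiff.2 hx)]
        have h3 : ψ ((u₀ * x : Fˣ) : F) = ψ (x : F) := by
          have h4 : ((u₀ * x : Fˣ) : F) = x + x * ((u₀ : F) - 1) := by push_cast; ring
          have h5 : valuation F ((x : F) * ((u₀ : F) - 1)) ≤ 1 := by
            have := mem_fracIdeal.1 (mul_mem_fracIdeal (mem_unitIdeal.1 hx) hu₀')
            simpa using this
          have h6 := (hcond _).2 h5 1 (by simp)
          rw [mul_one] at h6
          rw [h4, AddChar.map_add_eq_mul, h6, mul_one]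
        simp only [hf, h3]
        simp only [map_mul, Units.val_mul, absF_mul, absF_of_valuation_eq_one hu₀, one_mul,
          mul_inv]
        ring
      · simp only [Set.indicator_of_notMem hx, Set.indicator_of_notMem (mt hiff.1 hx), mul_zero]
    have h3 : ((ω u₀ : ℂ)⁻¹ - 1) * ∫ y in unitIdeal F (-n + 1), f y ∂(mulMeasure dx) = 0 := by
      linear_combination -h2
    exact (mul_eq_zero.1 h3).resolve_left hne
  have hsplit : ∫ y in unitIdeal F (-n), f y ∂(mulMeasure dx) =
      ∫ y in shell F (-n), f y ∂(mulMeasure dx) := by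
    have hI : IntegrableOn f (unitIdeal F (-n)) (mulMeasure dx) :=
      (integrable_indicator_iff hmn).1 (hi _)
    have hsub : unitIdeal F (-n + 1) ⊆ unitIdeal F (-n) := fun x hx =>
      mem_unitIdeal.2 (fracIdeal_anti (by omega) (mem_unitIdeal.1 hx))
    rw [shell_eq_diff, setIntegral_sdiff hmn1 hI hsub, hvanish, sub_zero]
  have hshell : ∫ y in shell F (-n), f y ∂(mulMeasure dx) =
      (Nat.card 𝓀[F] : ℂ) ^ (-(n * κ)) * ∫ y in shell F (-n),
      (ψ (y : F) : ℂ) * ((ω y : ℂ)⁻¹ * (absF y : ℂ) ^ s) ∂(mulMeasure dx) := by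
    rw [← integral_const_mul]
    refine setIntegral_congr_fun hms fun y hy => ?_
    have h2 : (absF y : ℂ) ^ κ = (Nat.card 𝓀[F] : ℂ) ^ (n * κ) := by
      rw [absF_cpow_eq_exp, absF_of_mem_shell hy, neg_neg, Real.log_zpow,
        Complex.cpow_def_of_ne_zero hq, ← Complex.natCast_log]
      push_cast
      ring_nf
    simp only [hf, h2, Complex.cpow_neg, mul_inv]
    ring
  have hVpos : (dx.real (fracIdeal F n) : ℂ) ≠ 0 := by
    exact_mod_cast (dx_real_fracIdeal_pos (dx := dx) n).ne'
  have hr₁ : ∀ y : Fˣ, (oneAdd F n).indicator 1 (y : F) *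
      ((ω y : ℂ) * (absF y : ℂ) ^ κ) * (absF y : ℂ) ^ (1 - s) =
      (absF y : ℂ) * (oneAdd F n).indicator 1 (y : F) := fun y => by
    by_cases hy : (y : F) ∈ oneAdd F n
    · simp [hy, honeAdd y hy]
    · simp [hy]
  have hr₂ : ∀ y : Fˣ, (dx.real (fracIdeal F n) : ℂ) *
      (fracIdeal F (-n)).indicator (fun y => (ψ y : ℂ)) y *
      ((ω y : ℂ) * (absF y : ℂ) ^ κ)⁻¹ * (absF y : ℂ) ^ s =
      (dx.real (fracIdeal F n) : ℂ) * (unitIdeal F (-n)).indicator f y := fun y => by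
    by_cases hy : y ∈ unitIdeal F (-n)
    · rw [Set.indicator_of_mem hy, Set.indicator_of_mem (mem_unitIdeal.1 hy)]
      simp only [hf, mul_assoc]
    · rw [Set.indicator_of_notMem hy, Set.indicator_of_notMem (mt mem_unitIdeal.2 hy)]
      simp
  refine ⟨(oneAdd F n).indicator 1, integrable_indicator_oneAdd n, ?_⟩
  simp only [integral_oneAdd_char hcond]
  simp only [hr₁, hr₂]
  rw [integral_abs_mul dx, integral_oneAdd, integral_const_mul, integral_indicator hmn, hsplit,
    hshell]
  refine ⟨(integrable_abs_mul_iff dx).2 (integrable_indicator_oneAdd n), (hi _).const_mul _, hVpos,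
    by ring⟩

end NonarchRatio

/-! ### Tori over locally compact fields -/

section TorusTopology

variable {F : Type u} {A : Type v} [Field F] [CommRing A] [HopfAlgebra F A]

theorem IsTorus.exists_generators (h : IsTorus F A) :
    ∃ (n : ℕ) (x : Fin n → A), Algebra.adjoin F (Set.range x) = ⊤ := by
  obtain ⟨s, hs⟩ := h.finiteType.out
  refine ⟨s.card, fun i => (s.equivFin.symm i : A), ?_⟩
  rw [← hs]
  congr 1
  ext a
  constructor
  · rintro ⟨i, rfl⟩
    exact (s.equivFin.symm i).2
  · intro ha
    exact ⟨s.equivFin ⟨a, ha⟩, by simp⟩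

variable [TopologicalSpace F] [IsTopologicalRing F] [T2Space F]

theorem IsTorus.locallyCompactSpace [LocallyCompactSpace F] (h : IsTorus F A) :
    LocallyCompactSpace (RatPoints F A) := by
  obtain ⟨n, x, hx⟩ := h.exists_generators
  exact (RatPoints.isClosedEmbedding hx).locallyCompactSpace

theorem IsTorus.secondCountableTopology [SecondCountableTopology F] (h : IsTorus F A) :
    SecondCountableTopology (RatPoints F A) := by
  obtain ⟨n, x, hx⟩ := h.exists_generators
  exact (RatPoints.isClosedEmbedding hx).isEmbedding.secondCountableTopology

/-- No topology is placed on `E`; the norm to `F` is the determinant of a matrix depending linearly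
on values of regular functions, which is continuous. -/
theorem SplitCoords.continuous_norm_z {E : Type*} [Field E] [Algebra F E] [FiniteDimensional F E]
    {n : ℕ} (S : SplitCoords F A E n) (η : Fin n → ℤ) :
    Continuous fun t => Algebra.norm F (S.z η t) := by
  obtain ⟨k, m, a, hz⟩ := S.z_eq η
  let b := Module.finBasis F E
  have hM : ∀ t, Algebra.leftMulMatrix b (S.z η t) =
      ∑ j, t.ofConv (a j) • Algebra.leftMulMatrix b (m j) := fun t => by
    rw [hz t, map_sum]
    refine Finset.sum_congr rfl fun j _ => ?_
    rw [mul_comm, ← Algebra.smul_def, map_smul]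
  simp only [Algebra.norm_eq_matrix_det b, hM]
  refine Continuous.matrix_det (continuous_finsetSum _ fun j _ => ?_)
  exact (RatPoints.continuous_eval (a j)).smul continuous_const

variable [LocallyCompactSpace F] [MeasurableSpace F] [BorelSpace F] [ContinuousInv₀ F]
  [ContinuousAbsF F]

/-- A nontrivial cocharacter pairs nontrivially with a rational character of the torus, whose
logarithmic absolute value is a real additive character. -/
theorem IsTorus.exists_logChar (h : IsTorus F A) (hF : ∃ x : Fˣ, ∀ k : ℤ, x ^ k = 1 → k = 0)
    {lam : A →ₐc[F] AddMonoidAlgebra F ℤ} (hlam : IsNontrivialCochar lam) :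
    ∃ (θ : LogChar (RatPoints F A)) (M : ℝ), M ≠ 0 ∧ (∀ t, (θ.1 t).im = 0) ∧
      ∀ x, θ.1 (cocharPoints lam x) = M * Real.log (absF x) := by
  obtain ⟨E, _, _, _, _, n, ⟨e⟩⟩ := h
  let S := SplitCoords.ofEquiv e
  obtain ⟨η, m, hm, hη⟩ := S.exists_ne_zero_cochar hF hlam
  have hne : ∀ t, Algebra.norm F (S.z η t) ≠ 0 := fun t =>
    Algebra.norm_ne_zero_iff.2 (S.z_ne_zero η t)
  -- The norm of the character `η` is a character `T(F) → Fˣ`, equal to `x ^ (m[E:F])` along `λ`.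
  let c : RatPoints F A → Fˣ := fun t => Units.mk0 _ (hne t)
  have hc : Continuous c := by
    rw [Units.isEmbedding_val₀.continuous_iff]
    exact S.continuous_norm_z η
  have hmul : ∀ a b, c (a * b) = c a * c b := fun a b => by
    ext
    simp [c, S.z_mul]
  refine ⟨⟨fun t => (Real.log (absF (c t)) : ℂ), ?_, fun a b => ?_⟩,
    m * Module.finrank F E, ?_, fun t => Complex.ofReal_im _, fun x => ?_⟩
  · exact Complex.continuous_ofReal.comp
      ((continuous_absF.comp hc).log fun t => (absF_pos _).ne')
  · beta_reduce
    rw [hmul, absF_mul, Real.log_mul (absF_pos _).ne' (absF_pos _).ne', Complex.ofReal_add]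
  · exact mul_ne_zero (by exact_mod_cast hm) (by exact_mod_cast Module.finrank_pos.ne')
  · have hcx : c (cocharPoints lam x) = x ^ (m * Module.finrank F E) := by
      ext
      simp only [c, Units.val_mk0, hη x]
      rw [← map_zpow₀, Algebra.norm_algebraMap, Units.val_zpow_eq_zpow_val, zpow_mul, zpow_natCast]
    have : absF (x ^ (m * (Module.finrank F E : ℤ))) = absF x ^ (m * (Module.finrank F E : ℤ)) := by
      simp [absF, map_zpow]
    change (Real.log (absF (c (cocharPoints lam x))) : ℂ) = _
    rw [hcx, this, Real.log_zpow]
    push_cast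
    ring

end TorusTopology

/-! ### The functional equation over nonarchimedean fields -/

theorem mellinGammaIdentity_nonarch {F : Type u} [Field F] [ValuativeRel F] [TopologicalSpace F]
    [IsNonarchimedeanLocalField F] [MeasurableSpace F] [BorelSpace F]
    {ψ : AddChar F Circle} {dx : Measure F} [dx.IsAddHaarMeasure]
    (hψ : Continuous ψ) (hcond : HasConductorIntegers ψ) (hdual : IsSelfDual ψ dx)
    {A : Type v} [CommRing A] [HopfAlgebra F A] (hT : IsTorus F A)
    {lam : A →ₐc[F] AddMonoidAlgebra F ℤ} (hlam : IsNontrivialCochar lam)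
    (μ : Measure (RatPoints F A)) [μ.IsHaarMeasure] (s : ℂ) {Φ : RatPoints F A → ℂ}
    (hΦ : IsSchwartzNonarch Φ) :
    MellinGammaIdentity nonarchL (nonarchEps ψ dx) ψ dx lam μ s Φ := by
  have := hT.locallyCompactSpace
  have := hT.secondCountableTopology
  have : NullSingletonClass dx := IsNonarchimedeanLocalField.nullSingletonClass dx
  have hlog : Real.log (absF (unif F)) ≠ 0 := by
    rw [absF_unif, Real.log_inv]
    exact neg_ne_zero.2 (Real.log_pos one_lt_card_residue).ne'
  have hF : ∃ x : Fˣ, ∀ k : ℤ, x ^ k = 1 → k = 0 := by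
    refine ⟨unif F, fun k hk => ?_⟩
    have h1 := absF_zpow (unif F) k
    rw [hk, absF_one] at h1
    have h2 := congrArg Real.log h1
    rw [Real.log_one, Real.log_zpow] at h2
    exact_mod_cast (mul_eq_zero.1 h2.symm).resolve_right hlog
  obtain ⟨θ, M, hM, hθ, hθl⟩ := hT.exists_logChar hF hlam
  have hθ₀ : θ.1 (cocharPoints lam (unif F)) ≠ 0 := by
    rw [hθl]
    exact_mod_cast mul_ne_zero hM hlog
  have hconv := fun t => hΦ.integrable_convolution (dx := dx) hψ (cocharPoints lam) hθ₀ s t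
  refine ⟨hconv, fun χ => hΦ.mellinConverges χ, fun χ hL => ?_⟩
  -- The width `1` of the strip is imposed by the zeta integral of the indicator of `𝔬` at `1 - s`,
  -- not by convergence of the transform.
  refine hasMellinValue_equivFourier hψ nonarch_logChar (cocharPoints lam) s Φ hconv
    (fun χ => hΦ.mellinConverges χ) one_pos
    (fun χ r hr h0 _ => hΦ.mellinConverges_equivFourier hψ hcond _ hθ₀ s χ r hr h0) θ hθ
    (unif F) hθ₀ χ ?_
  by_cases hω : IsUnramified (χ.comp (cocharPoints lam))
  · exact hasZetaRatio_unramified hcond hdual s hω hL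
  · exact hasZetaRatio_ramified hψ hcond s hω

/-! ### The multiplicative group of an archimedean field -/

section ArchBasics

variable {F : Type*} [RCLike F] [MeasurableSpace F] [BorelSpace F]

theorem norm_unit_pos (x : Fˣ) : 0 < ‖(x : F)‖ := norm_pos_iff.2 x.ne_zero

-- Multiplication by `x` maps the unit ball to the ball of radius `‖x‖`; compare volumes.
open scoped Pointwise in
theorem absF_eq_norm_pow (x : Fˣ) : absF x = ‖(x : F)‖ ^ Module.finrank ℝ F := by
  let μ : Measure F := Measure.addHaar
  have h1 := addHaar_smul_set μ x (Metric.closedBall 0 1)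
  have h2 : x • Metric.closedBall (0 : F) 1 = Metric.closedBall 0 ‖(x : F)‖ := by
    have := smul_closedBall (x : F) (0 : F) zero_le_one
    rw [smul_zero, mul_one] at this
    exact this
  have h3 := Measure.addHaar_closedBall μ (0 : F) (norm_nonneg (x : F))
  have h4 := Measure.addHaar_closedBall μ (0 : F) zero_le_one
  rw [one_pow, ENNReal.ofReal_one, one_mul] at h4
  rw [h2, h3, h4] at h1
  have h5 := (ENNReal.mul_left_inj (Metric.measure_ball_pos μ (0 : F) one_pos).ne'
    measure_ball_lt_top.ne).1 h1
  exact ((ENNReal.ofReal_eq_ofReal_iff (by positivity) (absF_pos x).le).1 h5).symm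

instance RCLike.instContinuousAbsF : ContinuousAbsF F := by
  refine ⟨?_⟩
  simp only [funext absF_eq_norm_pow]
  exact (Units.continuous_val.norm).pow _

theorem log_absF (x : Fˣ) : Real.log (absF x) = Module.finrank ℝ F * Real.log ‖(x : F)‖ := by
  rw [absF_eq_norm_pow, Real.log_pow]

theorem absF_rpow (x : Fˣ) (r : ℝ) :
    absF x ^ r = ‖(x : F)‖ ^ ((Module.finrank ℝ F : ℝ) * r) := by
  rw [absF_eq_norm_pow, Real.rpow_mul (norm_nonneg _), Real.rpow_natCast]

theorem absF_cpow (x : Fˣ) (s : ℂ) :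
    (absF x : ℂ) ^ s = (‖(x : F)‖ : ℂ) ^ ((Module.finrank ℝ F : ℂ) * s) := by
  rw [absF_cpow_eq_exp, log_absF, Complex.cpow_def_of_ne_zero
    (by exact_mod_cast (norm_unit_pos x).ne'), ← Complex.ofReal_log (norm_nonneg _)]
  push_cast
  ring_nf

theorem finrank_rclike_pos : 0 < (Module.finrank ℝ F : ℝ) := by
  exact_mod_cast Module.finrank_pos

/-- The positive real number `exp t` as a unit of `F`. -/
noncomputable def expUnit (F : Type*) [RCLike F] (t : ℝ) : Fˣ :=
  Units.mk0 ((Real.exp t : ℝ) : F) (by simp [Real.exp_ne_zero])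

theorem coe_expUnit (t : ℝ) : (expUnit F t : F) = (Real.exp t : ℝ) := rfl

theorem norm_expUnit (t : ℝ) : ‖(expUnit F t : F)‖ = Real.exp t := by
  rw [coe_expUnit, RCLike.norm_ofReal, abs_of_pos (Real.exp_pos t)]

theorem expUnit_add (a b : ℝ) : expUnit F (a + b) = expUnit F a * expUnit F b := by
  ext
  simp [coe_expUnit, Real.exp_add]

theorem expUnit_zero : expUnit F 0 = 1 := by
  ext
  simp [coe_expUnit]

theorem continuous_expUnit : Continuous (expUnit F) := by
  rw [Units.isEmbedding_val₀.continuous_iff]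
  exact RCLike.continuous_ofReal.comp Real.continuous_exp

theorem isCompact_norm_unit_le (R : ℝ) : IsCompact {x : Fˣ | |Real.log ‖(x : F)‖| ≤ R} := by
  rw [Units.isEmbedding_val₀.isCompact_iff]
  have : Units.val '' {x : Fˣ | |Real.log ‖(x : F)‖| ≤ R} =
      Metric.closedBall (0 : F) (Real.exp R) ∩ {x | Real.exp (-R) ≤ ‖x‖} := by
    ext x
    constructor
    · rintro ⟨y, hy, rfl⟩
      have h' : |Real.log ‖(y : F)‖| ≤ R := hy
      have h := abs_le.1 h'
      refine ⟨?_, ?_⟩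
      · rw [mem_closedBall_zero_iff, ← Real.log_le_iff_le_exp (norm_unit_pos y)]
        exact h.2
      · exact (Real.le_log_iff_exp_le (norm_unit_pos y)).1 h.1
    · rintro ⟨h1, h2⟩
      have hx : 0 < ‖x‖ := (Real.exp_pos _).trans_le h2
      refine ⟨Units.mk0 x (norm_pos_iff.1 hx), ?_, rfl⟩
      refine (abs_le.2 ⟨?_, ?_⟩ : |Real.log ‖x‖| ≤ R)
      · exact (Real.le_log_iff_exp_le hx).2 h2
      · exact (Real.log_le_iff_le_exp hx).2 (mem_closedBall_zero_iff.1 h1)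
  rw [this]
  exact (isCompact_closedBall _ _).inter_right (isClosed_le continuous_const continuous_norm)

/-- On positive reals a continuous additive map of the logarithm is linear, and the compact group of
elements of norm one is killed. -/
theorem arch_logChar (ν : LogChar Fˣ) : ∃ k : ℂ, ∀ x, ν.1 x = k * Real.log (absF x) := by
  have hd := finrank_rclike_pos (F := F)
  let f : ℝ →+ ℂ := AddMonoidHom.mk' (fun t => ν.1 (expUnit F t)) fun a b => by
    rw [expUnit_add, ν.2.2]
  have hf : Continuous f := ν.2.1.comp continuous_expUnit
  have hlin : ∀ t : ℝ, ν.1 (expUnit F t) = t * ν.1 (expUnit F 1) := by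
    intro t
    have h := (f.toRealLinearMap hf).map_smul t 1
    simp only [smul_eq_mul, mul_one] at h
    exact h.trans (Complex.real_smul)
  refine ⟨ν.1 (expUnit F 1) / Module.finrank ℝ F, fun x => ?_⟩
  have hx : ν.1 (x * (expUnit F (Real.log ‖(x : F)‖))⁻¹) = 0 := by
    refine LogChar.eq_zero_of_pow_mem ν (isCompact_norm_unit_le 0) fun n => ?_
    have : ‖((x * (expUnit F (Real.log ‖(x : F)‖))⁻¹ : Fˣ) : F)‖ = 1 := by
      rw [Units.val_mul, norm_mul, Units.val_inv_eq_inv_val, norm_inv, norm_expUnit,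
        Real.exp_log (norm_unit_pos x), mul_inv_cancel₀ (norm_unit_pos x).ne']
    rw [Set.mem_ofPred_eq, Units.val_pow_eq_pow_val, norm_pow, this]
    simp
  rw [ν.2.2, LogChar.map_inv, hlin] at hx
  rw [log_absF]
  have hd' : (Module.finrank ℝ F : ℂ) ≠ 0 := by exact_mod_cast hd.ne'
  push_cast
  field_simp
  linear_combination hx

theorem exists_unit_infinite_order : ∃ x : Fˣ, ∀ k : ℤ, x ^ k = 1 → k = 0 := by
  refine ⟨expUnit F 1, fun k hk => ?_⟩
  have h := congrArg (fun x : Fˣ => Real.log ‖(x : F)‖) hk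
  simp only [Units.val_zpow_eq_zpow_val, norm_zpow, norm_expUnit, Real.log_zpow, Real.log_exp,
    Units.val_one, norm_one, Real.log_one, mul_one] at h
  exact_mod_cast h

/-! ### Polar coordinates on `Fˣ` -/

section Radial

variable (dx : Measure F) [dx.IsAddHaarMeasure]

/-- The volume of the unit sphere for `d^×x`, relative to `dr / r`. -/
noncomputable def radialConst : ℝ := Module.finrank ℝ F * dx.real (Metric.ball 0 1)

theorem radialConst_pos : 0 < radialConst dx :=
  mul_pos finrank_rclike_pos (ENNReal.toReal_pos (Metric.measure_ball_pos dx (0 : F) one_pos).ne'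
    measure_ball_lt_top.ne)

theorem pow_pred_mul_pow_inv {y : ℝ} (hy : 0 < y) :
    y ^ (Module.finrank ℝ F - 1) * (y ^ Module.finrank ℝ F)⁻¹ = y⁻¹ := by
  obtain ⟨m, hm⟩ := Nat.exists_eq_succ_of_ne_zero (Module.finrank_pos (R := ℝ) (M := F)).ne'
  rw [hm, Nat.succ_sub_one, Nat.succ_eq_add_one, pow_succ]
  field_simp

/-- Polar coordinates, with `r^(d-1) dr / r^d = dr / r`. -/
theorem integral_norm_mulMeasure (f : ℝ → ℂ) :
    ∫ x : Fˣ, f ‖(x : F)‖ ∂(mulMeasure dx) =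
      radialConst dx * ∫ y in Set.Ioi (0 : ℝ), (y : ℂ)⁻¹ * f y := by
  have h1 : ∫ x : Fˣ, f ‖(x : F)‖ ∂(mulMeasure dx) =
      ∫ x : F, ((‖x‖ ^ Module.finrank ℝ F)⁻¹ : ℝ) * f ‖x‖ ∂dx := by
    rw [← integral_abs_mul dx]
    refine integral_congr_ae (ae_of_all _ fun x => ?_)
    have : ((‖(x : F)‖ ^ Module.finrank ℝ F : ℝ) : ℂ) ≠ 0 := by
      exact_mod_cast (pow_pos (norm_unit_pos x) _).ne'
    simp only [absF_eq_norm_pow, Complex.ofReal_inv]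
    field_simp
  rw [h1, integral_fun_norm_addHaar dx (fun y => (((y ^ Module.finrank ℝ F)⁻¹ : ℝ) : ℂ) * f y)]
  simp only [nsmul_eq_mul, Complex.real_smul, radialConst, Complex.ofReal_mul,
    Complex.ofReal_natCast, mul_assoc]
  congr 2
  refine setIntegral_congr_fun measurableSet_Ioi fun y hy => ?_
  rw [← mul_assoc, ← Complex.ofReal_mul, pow_pred_mul_pow_inv hy, Complex.ofReal_inv]

theorem integrable_norm_mulMeasure_iff {f : ℝ → ℂ} :
    Integrable (fun x : Fˣ => f ‖(x : F)‖) (mulMeasure dx) ↔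
      IntegrableOn (fun y : ℝ => (y : ℂ)⁻¹ * f y) (Set.Ioi 0) := by
  have h1 : Integrable (fun x : Fˣ => f ‖(x : F)‖) (mulMeasure dx) ↔
      Integrable (fun x : F => ((‖x‖ ^ Module.finrank ℝ F)⁻¹ : ℝ) * f ‖x‖) dx := by
    rw [← integrable_abs_mul_iff dx]
    refine integrable_congr (ae_of_all _ fun x => ?_)
    have : ((‖(x : F)‖ ^ Module.finrank ℝ F : ℝ) : ℂ) ≠ 0 := by
      exact_mod_cast (pow_pos (norm_unit_pos x) _).ne'
    simp only [absF_eq_norm_pow, Complex.ofReal_inv]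
    field_simp
  rw [h1, integrable_fun_norm_addHaar dx
    (f := fun y => (((y ^ Module.finrank ℝ F)⁻¹ : ℝ) : ℂ) * f y)]
  refine integrableOn_congr_fun (fun y hy => ?_) measurableSet_Ioi
  simp only [Complex.real_smul]
  rw [← mul_assoc, ← Complex.ofReal_mul, pow_pred_mul_pow_inv hy, Complex.ofReal_inv]

theorem integrable_indicator_norm_le {a : ℝ} (ha : 0 < a) (R : ℝ) :
    Integrable (fun x : Fˣ => {x : Fˣ | ‖(x : F)‖ ≤ R}.indicator
      (fun x => ((‖(x : F)‖ ^ a : ℝ) : ℂ)) x) (mulMeasure dx) := by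
  have h := (integrable_norm_mulMeasure_iff dx
    (f := (Set.Iic R).indicator fun y => ((y ^ a : ℝ) : ℂ))).2 ?_
  · exact h
  have h1 : IntegrableOn (fun y : ℝ => ((y ^ (a - 1) : ℝ) : ℂ)) (Set.Ioc 0 R) :=
    IntegrableOn.mono_set (Integrable.ofReal
      ((intervalIntegrable_iff_integrableOn_Ioc_of_le (le_max_right R 0)).1
        (intervalIntegral.intervalIntegrable_rpow' (by linarith))))
      (Set.Ioc_subset_Ioc_right (le_max_left R 0))
  rw [← integrable_indicator_iff measurableSet_Ioc] at h1
  refine h1.integrableOn.congr_fun (fun y hy => ?_) measurableSet_Ioi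
  have hy0 : (0 : ℝ) < y := hy
  by_cases hyR : y ≤ R
  · rw [Set.indicator_of_mem (Set.mem_Ioc.2 ⟨hy0, hyR⟩), Set.indicator_of_mem (Set.mem_Iic.2 hyR),
      Real.rpow_sub_one hy0.ne']
    push_cast
    ring
  · rw [Set.indicator_of_notMem (fun h => hyR h.2), Set.indicator_of_notMem (mt Set.mem_Iic.1 hyR),
      mul_zero]

theorem integrable_indicator_lt_norm {a : ℝ} (ha : a < 0) {R : ℝ} (hR : 0 < R) :
    Integrable (fun x : Fˣ => {x : Fˣ | R < ‖(x : F)‖}.indicator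
      (fun x => ((‖(x : F)‖ ^ a : ℝ) : ℂ)) x) (mulMeasure dx) := by
  have h := (integrable_norm_mulMeasure_iff dx
    (f := (Set.Ioi R).indicator fun y => ((y ^ a : ℝ) : ℂ))).2 ?_
  · exact h
  have h1 : IntegrableOn (fun y : ℝ => ((y ^ (a - 1) : ℝ) : ℂ)) (Set.Ioi R) :=
    Integrable.ofReal (integrableOn_Ioi_rpow_of_lt (by linarith) hR)
  rw [← integrable_indicator_iff measurableSet_Ioi] at h1
  refine h1.integrableOn.congr_fun (fun y hy => ?_) measurableSet_Ioi
  have hy0 : (0 : ℝ) < y := hy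
  by_cases hyR : R < y
  · rw [Set.indicator_of_mem (Set.mem_Ioi.2 hyR), Set.indicator_of_mem (Set.mem_Ioi.2 hyR),
      Real.rpow_sub_one hy0.ne']
    push_cast
    ring
  · rw [Set.indicator_of_notMem (mt Set.mem_Ioi.1 hyR), Set.indicator_of_notMem (mt Set.mem_Ioi.1 hyR),
      mul_zero]

theorem integrable_exp_neg_abs_log {c : ℝ} (hc : 0 < c) :
    Integrable (fun x : Fˣ => Real.exp (-(c * |Real.log ‖(x : F)‖|))) (mulMeasure dx) := by
  have h1 := (integrable_indicator_norm_le dx hc 1).add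
    (integrable_indicator_lt_norm dx (neg_lt_zero.2 hc) one_pos)
  refine h1.re.congr (ae_of_all _ fun x => ?_)
  have hx := norm_unit_pos x
  by_cases h : ‖(x : F)‖ ≤ 1
  · have e1 : x ∈ {x : Fˣ | ‖(x : F)‖ ≤ 1} := h
    have e2 : x ∉ {x : Fˣ | 1 < ‖(x : F)‖} := fun h2 => absurd h (not_le.2 h2)
    simp only [Pi.add_apply, Set.indicator_of_mem e1, Set.indicator_of_notMem e2, add_zero,
      RCLike.re_eq_complex_re, Complex.ofReal_re]
    rw [abs_of_nonpos (Real.log_nonpos hx.le h), Real.rpow_def_of_pos hx]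
    ring_nf
  · have e1 : x ∉ {x : Fˣ | ‖(x : F)‖ ≤ 1} := h
    have e2 : x ∈ {x : Fˣ | 1 < ‖(x : F)‖} := not_le.1 h
    simp only [Pi.add_apply, Set.indicator_of_notMem e1, Set.indicator_of_mem e2, zero_add,
      RCLike.re_eq_complex_re, Complex.ofReal_re]
    rw [abs_of_pos (Real.log_pos (not_le.1 h)), Real.rpow_def_of_pos hx]
    ring_nf

end Radial

end ArchBasics

/-! ### Logarithmic coordinates on a group and Mellin convergence -/

/-- A proper continuous homomorphism to a real vector space with divisible image. -/
structure IsLogMap {T : Type*} [Group T] [TopologicalSpace T] {n : ℕ} (L : T → Fin n → ℝ) :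
    Prop where
  continuous : Continuous L
  map_mul : ∀ a b, L (a * b) = L a + L b
  isCompact : ∀ R, IsCompact {t | ‖L t‖ ≤ R}
  root : ∀ t (m : ℕ), 0 < m → ∃ p, L p = (m : ℝ)⁻¹ • L t

namespace IsLogMap

variable {T : Type*} [Group T] [TopologicalSpace T] {n : ℕ} {L : T → Fin n → ℝ}

theorem map_one (hL : IsLogMap L) : L 1 = 0 := by simpa using hL.map_mul 1 1

theorem map_inv (hL : IsLogMap L) (t : T) : L t⁻¹ = -L t := by
  have h := hL.map_mul t⁻¹ t
  rw [inv_mul_cancel, hL.map_one] at h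
  exact eq_neg_of_add_eq_zero_left h.symm

theorem map_pow (hL : IsLogMap L) (t : T) (m : ℕ) : L (t ^ m) = (m : ℝ) • L t := by
  induction m with
  | zero => simp [hL.map_one]
  | succ m ih => rw [pow_succ, hL.map_mul, ih]; push_cast; module

/-- Divide `t` by `m ≈ ‖L t‖`: the root `p` has `L p` in the unit ball, where `ν` is bounded, and `t
p⁻ᵐ` lies in the compact kernel of `L`. Hence `ν` grows at most linearly. -/
theorem exists_norm_logChar_le (hL : IsLogMap L) (ν : LogChar T) :
    ∃ C, 0 ≤ C ∧ ∀ t, ‖ν.1 t‖ ≤ C * (3 + ‖L t‖) := by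
  obtain ⟨C, hC⟩ := (hL.isCompact 1).exists_bound_of_continuousOn ν.2.1.continuousOn
  have hC' : ∀ t, ‖L t‖ ≤ 1 → ‖ν.1 t‖ ≤ C := fun t ht => hC t ht
  have hC0 : 0 ≤ C := (norm_nonneg _).trans (hC' 1 (by simp [hL.map_one]))
  refine ⟨C, hC0, fun t => ?_⟩
  let m : ℕ := ⌈‖L t‖⌉₊ + 1
  have hm0 : (0 : ℝ) < m := by positivity
  have hm : ‖L t‖ ≤ m := (Nat.le_ceil _).trans (by simp [m])
  have hm' : (m : ℝ) ≤ ‖L t‖ + 2 := by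
    have := Nat.ceil_lt_add_one (norm_nonneg (L t))
    simp only [m, Nat.cast_add, Nat.cast_one]
    linarith
  obtain ⟨p, hp⟩ := hL.root t m (by positivity)
  have hp1 : ‖L p‖ ≤ 1 := by
    rw [hp, norm_smul, norm_inv, Real.norm_natCast, inv_mul_le_iff₀ hm0]
    linarith
  have hk : L (t * (p ^ m)⁻¹) = 0 := by
    rw [hL.map_mul, hL.map_inv, hL.map_pow, hp, smul_smul, mul_inv_cancel₀ hm0.ne', one_smul,
      add_neg_cancel]
  have h1 : ν.1 t = ν.1 (t * (p ^ m)⁻¹) + m * ν.1 p := by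
    rw [← LogChar.map_pow, ← ν.2.2, inv_mul_cancel_right]
  calc ‖ν.1 t‖ ≤ ‖ν.1 (t * (p ^ m)⁻¹)‖ + m * ‖ν.1 p‖ := by
        rw [h1]
        refine (norm_add_le _ _).trans_eq ?_
        rw [norm_mul, Complex.norm_natCast]
    _ ≤ C + m * C := add_le_add (hC' _ (by rw [hk]; simp))
        (mul_le_mul_of_nonneg_left (hC' p hp1) hm0.le)
    _ ≤ C * (3 + ‖L t‖) := by nlinarith

variable [IsTopologicalGroup T] [SecondCountableTopology T] [MeasurableSpace T] [BorelSpace T]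
  {μ : Measure T} [μ.IsMulLeftInvariant] [IsFiniteMeasureOnCompacts μ]

/-- The ball of radius `2` is covered by `D` translates of the unit ball. By divisibility the same
`D` translations bring the ball of radius `N + 2` into the ball of radius `N + 1`, so the volume
grows at most by the factor `D` at each step. -/
theorem exists_measure_le (hL : IsLogMap L) :
    ∃ D : ℕ, ∀ N : ℕ, μ {t | ‖L t‖ ≤ N + 1} ≤ D ^ N * μ {t | ‖L t‖ ≤ 1} := by
  obtain ⟨S, -, hS⟩ := (hL.isCompact 2).elim_nhds_subcover (fun s => {t | ‖L (s⁻¹ * t)‖ ≤ 1})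
    fun s _ => by
      have hc : Continuous fun t => ‖L (s⁻¹ * t)‖ :=
        (hL.continuous.comp (continuous_const_mul _)).norm
      have : {t | ‖L (s⁻¹ * t)‖ < 1} ∈ 𝓝 s :=
        (isOpen_lt hc continuous_const).mem_nhds (by simp [hL.map_one])
      filter_upwards [this] with t ht using le_of_lt ht
  refine ⟨S.card, fun N => ?_⟩
  induction N with
  | zero => simp
  | succ N ih =>
    have hsub : {t | ‖L t‖ ≤ ((N + 1 : ℕ) : ℝ) + 1} ⊆
        ⋃ s ∈ S, (fun t => s⁻¹ * t) ⁻¹' {t | ‖L t‖ ≤ (N : ℝ) + 1} := by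
      intro t ht
      have ht' : ‖L t‖ ≤ (N : ℝ) + 2 := by
        have : ‖L t‖ ≤ ((N + 1 : ℕ) : ℝ) + 1 := ht
        push_cast at this
        linarith
      -- The square `p²` plays the role of `t^(2/(N+2))` and lies in the ball of radius `2`.
      -- Replacing it by a nearby centre `s` leaves norm at most `1 + (1 - 2/(N+2))(N+2) = N + 1`.
      obtain ⟨p, hp⟩ := hL.root t (N + 2) (by omega)
      have hN : (0 : ℝ) < (N : ℝ) + 2 := by positivity
      push_cast at hp
      have hp2 : L (p ^ 2) = (2 * ((N : ℝ) + 2)⁻¹) • L t := by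
        rw [hL.map_pow, hp, smul_smul]
        norm_num
      have hp2' : p ^ 2 ∈ {t | ‖L t‖ ≤ 2} := by
        change ‖L (p ^ 2)‖ ≤ 2
        rw [hp2, norm_smul, Real.norm_of_nonneg (by positivity), mul_assoc]
        have : ((N : ℝ) + 2)⁻¹ * ‖L t‖ ≤ 1 := by
          rw [inv_mul_le_iff₀ hN]; linarith
        linarith
      obtain ⟨s, hs, hsp⟩ := Set.mem_iUnion₂.1 (hS hp2')
      have hsp' : ‖L (s⁻¹ * p ^ 2)‖ ≤ 1 := hsp
      refine Set.mem_iUnion₂.2 ⟨s, hs, ?_⟩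
      change ‖L (s⁻¹ * t)‖ ≤ (N : ℝ) + 1
      have hdec : L (s⁻¹ * t) = L (s⁻¹ * p ^ 2) + (1 - 2 * ((N : ℝ) + 2)⁻¹) • L t := by
        rw [hL.map_mul, hL.map_mul, hp2]
        module
      have hcoef : 0 ≤ 1 - 2 * ((N : ℝ) + 2)⁻¹ := by
        rw [sub_nonneg, ← div_eq_mul_inv, div_le_one hN]
        linarith [(Nat.cast_nonneg N : (0 : ℝ) ≤ N)]
      have h2 : (1 - 2 * ((N : ℝ) + 2)⁻¹) * ‖L t‖ ≤ N := by
        calc _ ≤ (1 - 2 * ((N : ℝ) + 2)⁻¹) * ((N : ℝ) + 2) :=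
              mul_le_mul_of_nonneg_left ht' hcoef
          _ = N := by field_simp; ring
      rw [hdec]
      refine (norm_add_le _ _).trans ?_
      rw [norm_smul, Real.norm_of_nonneg hcoef]
      linarith
    calc μ {t | ‖L t‖ ≤ ((N + 1 : ℕ) : ℝ) + 1}
        ≤ ∑ s ∈ S, μ ((fun t => s⁻¹ * t) ⁻¹' {t | ‖L t‖ ≤ (N : ℝ) + 1}) :=
          (measure_mono hsub).trans (measure_biUnion_finset_le _ _)
      _ = S.card * μ {t | ‖L t‖ ≤ (N : ℝ) + 1} := by
          simp only [measure_preimage_mul, Finset.sum_const, nsmul_eq_mul]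
      _ ≤ S.card * (S.card ^ N * μ {t | ‖L t‖ ≤ 1}) := by gcongr
      _ = _ := by rw [pow_succ']; ring

theorem exists_integrable_exp (hL : IsLogMap L) :
    ∃ k, 0 < k ∧ Integrable (fun t => Real.exp (-(k * ‖L t‖))) μ := by
  obtain ⟨D, hD⟩ := hL.exists_measure_le (μ := μ)
  have hD0 : (0 : ℝ) < 2 * D + 2 := by positivity
  have hk : 0 < Real.log (2 * D + 2) := Real.log_pos (by
    linarith [(Nat.cast_nonneg D : (0 : ℝ) ≤ D)])
  -- With this `k` one has `exp(-k) D ≤ 1/2`, which beats the volume growth; the summand `2` keeps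
  -- `k` positive even for `D = 0`.
  refine ⟨Real.log (2 * D + 2), hk, ?_⟩
  set k := Real.log (2 * D + 2) with hkdef
  have hLc : Continuous fun t => ‖L t‖ := hL.continuous.norm
  have hc : Continuous fun t => Real.exp (-(k * ‖L t‖)) :=
    Real.continuous_exp.comp (continuous_const.mul hLc).neg
  refine ⟨hc.aestronglyMeasurable, ?_⟩
  have hfin : μ {t | ‖L t‖ ≤ 1} < ∞ := (hL.isCompact 1).measure_lt_top
  have hterm : ∀ N : ℕ, ∫⁻ t in {t | (N : ℝ) ≤ ‖L t‖ ∧ ‖L t‖ ≤ N + 1},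
      ‖Real.exp (-(k * ‖L t‖))‖ₑ ∂μ ≤ (ENNReal.ofReal (1 / 2)) ^ N * μ {t | ‖L t‖ ≤ 1} := by
    intro N
    have hms : MeasurableSet {t | (N : ℝ) ≤ ‖L t‖ ∧ ‖L t‖ ≤ N + 1} :=
      (isClosed_le continuous_const hLc).measurableSet.inter
        (isClosed_le hLc continuous_const).measurableSet
    calc ∫⁻ t in {t | (N : ℝ) ≤ ‖L t‖ ∧ ‖L t‖ ≤ N + 1}, ‖Real.exp (-(k * ‖L t‖))‖ₑ ∂μ
        ≤ ∫⁻ _ in {t | (N : ℝ) ≤ ‖L t‖ ∧ ‖L t‖ ≤ N + 1}, ENNReal.ofReal (Real.exp (-(k * N))) ∂μ := by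
          refine setLIntegral_mono' hms fun t ht => ?_
          rw [Real.enorm_of_nonneg (Real.exp_pos _).le]
          refine ENNReal.ofReal_le_ofReal (Real.exp_le_exp.2 (neg_le_neg ?_))
          exact mul_le_mul_of_nonneg_left ht.1 hk.le
      _ = ENNReal.ofReal (Real.exp (-(k * N))) * μ {t | (N : ℝ) ≤ ‖L t‖ ∧ ‖L t‖ ≤ N + 1} := by
          simp
      _ ≤ ENNReal.ofReal (Real.exp (-(k * N))) * (D ^ N * μ {t | ‖L t‖ ≤ 1}) := by
          gcongr
          refine (measure_mono fun t ht => ?_).trans (hD N)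
          exact ht.2
      _ = ENNReal.ofReal ((Real.exp (-k) * D) ^ N) * μ {t | ‖L t‖ ≤ 1} := by
          rw [← mul_assoc, mul_pow, ENNReal.ofReal_mul (by positivity), ← Real.exp_nat_mul,
            ENNReal.ofReal_pow (by positivity), ENNReal.ofReal_natCast]
          congr 4
          ring
      _ ≤ _ := by
          rw [ENNReal.ofReal_pow (by positivity)]
          gcongr
          rw [Real.exp_neg, hkdef, Real.exp_log hD0, inv_mul_le_iff₀ hD0]
          linarith
  calc ∫⁻ t, ‖Real.exp (-(k * ‖L t‖))‖ₑ ∂μ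
      = ∫⁻ t in ⋃ N : ℕ, {t | (N : ℝ) ≤ ‖L t‖ ∧ ‖L t‖ ≤ N + 1},
          ‖Real.exp (-(k * ‖L t‖))‖ₑ ∂μ := by
        have : ⋃ N : ℕ, {t | (N : ℝ) ≤ ‖L t‖ ∧ ‖L t‖ ≤ N + 1} = Set.univ := by
          refine Set.eq_univ_of_forall fun t => Set.mem_iUnion.2 ⟨⌊‖L t‖⌋₊, ?_, ?_⟩
          · exact Nat.floor_le (norm_nonneg _)
          · exact (Nat.lt_floor_add_one _).le
        rw [this, Measure.restrict_univ]
    _ ≤ ∑' N : ℕ, _ := lintegral_iUnion_le _ _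
    _ ≤ ∑' N : ℕ, (ENNReal.ofReal (1 / 2)) ^ N * μ {t | ‖L t‖ ≤ 1} := ENNReal.tsum_le_tsum hterm
    _ = (1 - ENNReal.ofReal (1 / 2))⁻¹ * μ {t | ‖L t‖ ≤ 1} := by
        rw [ENNReal.tsum_mul_right, ENNReal.tsum_geometric]
    _ < ∞ := by
        refine ENNReal.mul_lt_top ?_ hfin
        rw [ENNReal.inv_lt_top, tsub_pos_iff_lt, ENNReal.ofReal_lt_one]
        norm_num

theorem exists_mellinConverges_exp (hL : IsLogMap L) (χ : T →ₜ* ℂˣ) :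
    ∃ k, 0 < k ∧ MellinConverges μ (fun t => (Real.exp (-(k * ‖L t‖)) : ℂ)) χ := by
  obtain ⟨k, hk, hint_g⟩ := hL.exists_integrable_exp (μ := μ)
  obtain ⟨C, hC0, hC⟩ := hL.exists_norm_logChar_le (logAbs χ)
  have hχ : Continuous fun t => (((χ t)⁻¹ : ℂˣ) : ℂ) :=
    Units.continuous_val.comp (map_continuous χ).inv
  have hc : Continuous fun t => (Real.exp (-((k + C) * ‖L t‖)) : ℂ) :=
    Complex.continuous_ofReal.comp
      (Real.continuous_exp.comp (continuous_const.mul hL.continuous.norm).neg)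
  refine ⟨k + C, by positivity, (hint_g.const_mul (Real.exp (3 * C))).mono'
    (hc.mul hχ).aestronglyMeasurable (ae_of_all _ fun t => ?_)⟩
  have h1 := hC t
  have h2 : ‖(((χ t)⁻¹ : ℂˣ) : ℂ)‖ ≤ Real.exp (C * (3 + ‖L t‖)) := by
    rw [Units.val_inv_eq_inv_val, norm_inv, ← Real.exp_log (norm_pos_iff.2 (χ t).ne_zero),
      ← Real.exp_neg]
    refine Real.exp_le_exp.2 ((neg_le_abs _).trans ?_)
    simpa [logAbs, Complex.norm_real] using h1
  rw [norm_mul, Complex.norm_real, Real.norm_of_nonneg (Real.exp_pos _).le]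
  refine (mul_le_mul_of_nonneg_left h2 (Real.exp_pos _).le).trans_eq ?_
  rw [← Real.exp_add, ← Real.exp_add]
  ring_nf

/-- Functions which decay faster than every exponential of the logarithmic coordinates have
everywhere convergent Mellin integrals. -/
theorem mellinConverges (hL : IsLogMap L) {G : T → ℂ} (hG : AEStronglyMeasurable G μ)
    (hdec : ∀ k : ℝ, ∃ C, ∀ t, ‖G t‖ ≤ C * Real.exp (-(k * ‖L t‖))) (χ : T →ₜ* ℂˣ) :
    MellinConverges μ G χ := by
  obtain ⟨k, -, hk⟩ := hL.exists_mellinConverges_exp (μ := μ) χ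
  obtain ⟨C, hC⟩ := hdec k
  have hχ : Continuous fun t => (((χ t)⁻¹ : ℂˣ) : ℂ) :=
    Units.continuous_val.comp (map_continuous χ).inv
  refine (hk.norm.const_mul C).mono' (hG.mul hχ.aestronglyMeasurable) (ae_of_all _ fun t => ?_)
  rw [norm_mul, norm_mul, Complex.norm_real, Real.norm_of_nonneg (Real.exp_pos _).le, ← mul_assoc]
  exact mul_le_mul_of_nonneg_right (hC t) (norm_nonneg _)

section Convolution

variable {F : Type*} [RCLike F] [MeasurableSpace F] [BorelSpace F] {dx : Measure F}
  [dx.IsAddHaarMeasure]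

/-- Along `λ` the logarithmic coordinates grow like `|log‖x‖| ‖M‖`, so the translate of `Ψ` decays
in `x` at rate `k‖M‖`, faster than `K` grows. -/
theorem integrable_mul_translate (hL : IsLogMap L) {l : Fˣ →ₜ* T} {M : Fin n → ℝ}
    (hl : ∀ x : Fˣ, L (l x) = Real.log ‖(x : F)‖ • M) {K : Fˣ → ℂ}
    (hK : AEStronglyMeasurable K (mulMeasure dx)) {a C C' k : ℝ} (hC : 0 ≤ C) (hk : 0 ≤ k)
    (hKb : ∀ x : Fˣ, ‖K x‖ ≤ C * Real.exp (a * |Real.log ‖(x : F)‖|)) {Ψ : T → ℂ}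
    (hΨc : Continuous Ψ) (hΨ : ∀ y, ‖Ψ y‖ ≤ C' * Real.exp (-(k * ‖L y‖))) (hak : a < k * ‖M‖)
    (t : T) : Integrable (fun x => K x * Ψ ((l x)⁻¹ * t)) (mulMeasure dx) := by
  have hlc : Continuous l := map_continuous l
  have hC' : 0 ≤ C' := by
    have h1 := (norm_nonneg _).trans (hΨ 1)
    exact nonneg_of_mul_nonneg_left h1 (Real.exp_pos _)
  refine ((integrable_exp_neg_abs_log dx (sub_pos.2 hak)).const_mul
    (C * C' * Real.exp (k * ‖L t‖))).mono'
    (hK.mul (hΨc.comp (hlc.inv.mul continuous_const)).aestronglyMeasurable)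
    (ae_of_all _ fun x => ?_)
  have h1 : |Real.log ‖(x : F)‖| * ‖M‖ - ‖L t‖ ≤ ‖L ((l x)⁻¹ * t)‖ := by
    rw [hL.map_mul, hL.map_inv, hl, neg_add_eq_sub, norm_sub_rev]
    refine le_trans ?_ (norm_sub_norm_le _ _)
    rw [norm_smul, Real.norm_eq_abs]
  rw [norm_mul]
  calc ‖K x‖ * ‖Ψ ((l x)⁻¹ * t)‖
      ≤ (C * Real.exp (a * |Real.log ‖(x : F)‖|)) *
        (C' * Real.exp (-(k * (|Real.log ‖(x : F)‖| * ‖M‖ - ‖L t‖)))) := by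
        refine mul_le_mul (hKb x) ((hΨ _).trans ?_) (norm_nonneg _) (by positivity)
        gcongr
    _ = _ := by
        rw [show ∀ p q r s : ℝ, p * q * (r * s) = p * r * (q * s) by intros; ring,
          ← Real.exp_add, mul_assoc (C * C'), ← Real.exp_add]
        ring_nf

end Convolution

end IsLogMap

/-! ### Logarithmic coordinates on tori over archimedean fields -/

namespace SplitCoords

section Arch

variable {F A E : Type*} [RCLike F] [CommRing A] [HopfAlgebra F A] [Field E] [Algebra F E] {n : ℕ}
  (S : SplitCoords F A E n) (ι : E →+* ℂ)

/-- The logarithmic absolute values of the coordinates. -/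
noncomputable def logCoords (t : RatPoints F A) (i : Fin n) : ℝ :=
  Real.log ‖ι (S.z (Pi.single i 1) t)‖

theorem norm_z_pos (η : Fin n → ℤ) (t : RatPoints F A) : 0 < ‖ι (S.z η t)‖ :=
  norm_pos_iff.2 ((map_ne_zero ι).2 (S.z_ne_zero η t))

theorem log_norm_z (η : Fin n → ℤ) (t : RatPoints F A) :
    Real.log ‖ι (S.z η t)‖ = ∑ i, η i * S.logCoords ι t i := by
  let f : (Fin n → ℤ) →+ ℝ := AddMonoidHom.mk' (fun η => Real.log ‖ι (S.z η t)‖) fun a b => by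
    rw [S.z_add, map_mul, norm_mul, Real.log_mul (S.norm_z_pos ι a t).ne' (S.norm_z_pos ι b t).ne']
  have h : ∀ i, f (Pi.single i (η i)) = η i * S.logCoords ι t i := by
    intro i
    have h1 : Pi.single i (η i) = η i • (Pi.single i 1 : Fin n → ℤ) := by
      rw [← Pi.single_smul, smul_eq_mul, mul_one]
    rw [h1, map_zsmul, zsmul_eq_mul]
    rfl
  change f η = _
  conv_lhs => rw [← Finset.univ_sum_single η]
  rw [map_sum]
  exact Finset.sum_congr rfl fun i _ => h i

theorem norm_z_le (η : Fin n → ℤ) :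
    ∃ k, 0 ≤ k ∧ ∀ t : RatPoints F A, ‖ι (S.z η t)‖ ≤ Real.exp (k * ‖S.logCoords ι t‖) := by
  refine ⟨∑ i, |(η i : ℝ)|, by positivity, fun t => ?_⟩
  rw [← Real.log_le_iff_le_exp (S.norm_z_pos ι η t), log_norm_z, Finset.sum_mul]
  refine Finset.sum_le_sum fun i _ => ?_
  refine (le_abs_self _).trans ?_
  rw [abs_mul]
  exact mul_le_mul_of_nonneg_left (norm_le_pi_norm (S.logCoords ι t) i) (abs_nonneg _)

theorem logCoords_mul (a b : RatPoints F A) :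
    S.logCoords ι (a * b) = S.logCoords ι a + S.logCoords ι b := by
  funext i
  simp only [logCoords, Pi.add_apply, S.z_mul, map_mul, norm_mul]
  exact Real.log_mul (S.norm_z_pos ι _ a).ne' (S.norm_z_pos ι _ b).ne'

variable {ι} (hι : ∀ x : F, ‖ι (algebraMap F E x)‖ = ‖x‖)

theorem continuous_z (hι : ∀ x : F, ‖ι (algebraMap F E x)‖ = ‖x‖) (η : Fin n → ℤ) :
    Continuous fun t => ι (S.z η t) := by
  have hc : Continuous (ι.comp (algebraMap F E)) :=
    (AddMonoidHomClass.isometry_of_norm (ι.comp (algebraMap F E)) hι).continuous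
  obtain ⟨k, m, a, hz⟩ := S.z_eq η
  simp only [hz, map_sum, map_mul]
  exact continuous_finsetSum _ fun j _ =>
    continuous_const.mul (hc.comp (RatPoints.continuous_eval (a j)))

theorem continuous_logCoords (hι : ∀ x : F, ‖ι (algebraMap F E x)‖ = ‖x‖) :
    Continuous (S.logCoords ι) :=
  continuous_pi fun _ => (S.continuous_z hι _).norm.log fun t => (S.norm_z_pos ι _ t).ne'

/-- Regular functions grow at most exponentially in the logarithmic coordinates. -/
theorem norm_eval_le (hι : ∀ x : F, ‖ι (algebraMap F E x)‖ = ‖x‖) (a : A) :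
    ∃ C k, 0 ≤ C ∧ 0 ≤ k ∧
      ∀ t : RatPoints F A, ‖t.ofConv a‖ ≤ C * Real.exp (k * ‖S.logCoords ι t‖) := by
  choose k hk0 hk using S.norm_z_le ι
  refine ⟨∑ η ∈ (S.expand a).support, ‖ι (S.expand a η)‖, ∑ η ∈ (S.expand a).support, k η,
    by positivity, Finset.sum_nonneg fun η _ => hk0 η, fun t => ?_⟩
  rw [← hι, S.eval_eq, Finsupp.sum, map_sum, Finset.sum_mul]
  refine (norm_sum_le _ _).trans (Finset.sum_le_sum fun η hη => ?_)
  rw [map_mul, norm_mul]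
  refine mul_le_mul_of_nonneg_left ((hk η t).trans (Real.exp_le_exp.2 ?_)) (norm_nonneg _)
  exact mul_le_mul_of_nonneg_right
    (Finset.single_le_sum (fun η _ => hk0 η) hη) (norm_nonneg _)

/-- A bound on the logarithmic coordinates bounds all affine coordinates, and the closed embedding
in affine space is proper. -/
theorem isCompact_logCoords_le (hι : ∀ x : F, ‖ι (algebraMap F E x)‖ = ‖x‖) {m : ℕ}
    {x : Fin m → A} (hx : Algebra.adjoin F (Set.range x) = ⊤) (R : ℝ) :
    IsCompact {t : RatPoints F A | ‖S.logCoords ι t‖ ≤ R} := by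
  choose C k hC hk hb using fun j => S.norm_eval_le hι (x j)
  have hcl : IsClosed {t : RatPoints F A | ‖S.logCoords ι t‖ ≤ R} :=
    isClosed_le (S.continuous_logCoords hι).norm continuous_const
  refine ((RatPoints.isClosedEmbedding hx).isCompact_preimage
    (isCompact_closedBall (0 : Fin m → F) (∑ j, C j * Real.exp (k j * R)))).of_isClosed_subset hcl
    fun t ht => ?_
  have ht' : ‖S.logCoords ι t‖ ≤ R := ht
  rw [Set.mem_preimage, mem_closedBall_zero_iff, pi_norm_le_iff_of_nonneg
    (Finset.sum_nonneg fun j _ => mul_nonneg (hC j) (Real.exp_pos _).le)]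
  intro j
  refine (hb j t).trans (le_trans ?_ (Finset.single_le_sum
    (f := fun j => C j * Real.exp (k j * R))
    (fun j _ => mul_nonneg (hC j) (Real.exp_pos _).le) (Finset.mem_univ j)))
  exact mul_le_mul_of_nonneg_left (Real.exp_le_exp.2 (mul_le_mul_of_nonneg_left ht' (hk j))) (hC j)

theorem isLogMap (hι : ∀ x : F, ‖ι (algebraMap F E x)‖ = ‖x‖)
    (hfin : ∃ (m : ℕ) (x : Fin m → A), Algebra.adjoin F (Set.range x) = ⊤)
    (hroot : ∀ (t : RatPoints F A) (τ : ℝ), ∃ p : RatPoints F A, ∀ η,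
      ‖ι (S.z η p)‖ = ‖ι (S.z η t)‖ ^ τ) : IsLogMap (S.logCoords ι) where
  continuous := S.continuous_logCoords hι
  map_mul := S.logCoords_mul ι
  isCompact R := by
    obtain ⟨m, x, hx⟩ := hfin
    exact S.isCompact_logCoords_le hι hx R
  root t m _ := by
    obtain ⟨p, hp⟩ := hroot t (m : ℝ)⁻¹
    refine ⟨p, funext fun i => ?_⟩
    simp only [logCoords, hp, Pi.smul_apply, smul_eq_mul]
    exact Real.log_rpow (S.norm_z_pos ι _ t) _

theorem norm_eval_le_poly {m : ℕ} {x : Fin m → A} (hx : Algebra.adjoin F (Set.range x) = ⊤)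
    (a : A) : ∃ (C : ℝ) (k : ℕ), 0 ≤ C ∧
      ∀ t : RatPoints F A, ‖t.ofConv a‖ ≤ C * (1 + ‖fun i => t.ofConv (x i)‖) ^ k := by
  have ha : a ∈ Algebra.adjoin F (Set.range x) := hx ▸ Algebra.mem_top
  induction ha using Algebra.adjoin_induction with
  | mem a ha =>
    obtain ⟨i, rfl⟩ := ha
    refine ⟨1, 1, zero_le_one, fun t => ?_⟩
    have := norm_le_pi_norm (fun i => t.ofConv (x i)) i
    rw [one_mul, pow_one]
    linarith
  | algebraMap r =>
    exact ⟨‖r‖, 0, norm_nonneg _, fun t => by simp⟩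
  | add a b _ _ iha ihb =>
    obtain ⟨C, k, hC, h⟩ := iha
    obtain ⟨C', k', hC', h'⟩ := ihb
    refine ⟨C + C', k + k', by positivity, fun t => ?_⟩
    have hu : 1 ≤ 1 + ‖fun i => t.ofConv (x i)‖ := by linarith [norm_nonneg fun i => t.ofConv (x i)]
    rw [map_add, add_mul]
    refine (norm_add_le _ _).trans (add_le_add ((h t).trans ?_) ((h' t).trans ?_))
    · exact mul_le_mul_of_nonneg_left (pow_le_pow_right₀ hu (by omega)) hC
    · exact mul_le_mul_of_nonneg_left (pow_le_pow_right₀ hu (by omega)) hC'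
  | mul a b _ _ iha ihb =>
    obtain ⟨C, k, hC, h⟩ := iha
    obtain ⟨C', k', hC', h'⟩ := ihb
    refine ⟨C * C', k + k', by positivity, fun t => ?_⟩
    rw [map_mul, norm_mul, pow_add]
    refine (mul_le_mul (h t) (h' t) (norm_nonneg _) (by positivity)).trans_eq (by ring)

/-- The logarithmic coordinates grow at most logarithmically in the affine coordinates. -/
theorem exp_logCoords_le (hι : ∀ x : F, ‖ι (algebraMap F E x)‖ = ‖x‖) {m : ℕ}
    {x : Fin m → A} (hx : Algebra.adjoin F (Set.range x) = ⊤) :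
    ∃ (C : ℝ) (k : ℕ), 0 ≤ C ∧ ∀ t : RatPoints F A,
      Real.exp ‖S.logCoords ι t‖ ≤ C * (1 + ‖fun i => t.ofConv (x i)‖) ^ k := by
  have hz : ∀ η, ∃ (C : ℝ) (k : ℕ), 0 ≤ C ∧ ∀ t : RatPoints F A,
      ‖ι (S.z η t)‖ ≤ C * (1 + ‖fun i => t.ofConv (x i)‖) ^ k := by
    intro η
    obtain ⟨k, c, a, hz⟩ := S.z_eq η
    choose C e hC hb using fun j => norm_eval_le_poly hx (a j)
    refine ⟨∑ j, ‖ι (c j)‖ * C j, ∑ j, e j,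
      Finset.sum_nonneg fun j _ => mul_nonneg (norm_nonneg _) (hC j), fun t => ?_⟩
    have hu : 1 ≤ 1 + ‖fun i => t.ofConv (x i)‖ := by linarith [norm_nonneg fun i => t.ofConv (x i)]
    rw [hz t, map_sum, Finset.sum_mul]
    refine (norm_sum_le _ _).trans (Finset.sum_le_sum fun j _ => ?_)
    rw [map_mul, norm_mul, hι, mul_assoc]
    refine mul_le_mul_of_nonneg_left ((hb j t).trans ?_) (norm_nonneg _)
    exact mul_le_mul_of_nonneg_left (pow_le_pow_right₀ hu
      (Finset.single_le_sum (fun _ _ => Nat.zero_le _) (Finset.mem_univ j))) (hC j)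
  choose C e hC hb using hz
  -- A coordinate and its inverse are both of polynomial growth; both are needed to bound the
  -- absolute value of the logarithm.
  let c : Fin n → ℝ := fun i => C (Pi.single i 1) + C (-Pi.single i 1)
  let d : Fin n → ℕ := fun i => e (Pi.single i 1) + e (-Pi.single i 1)
  have hc0 : ∀ i, 0 ≤ c i := fun i => add_nonneg (hC _) (hC _)
  refine ⟨1 + ∑ i, c i, ∑ i, d i, add_nonneg zero_le_one (Finset.sum_nonneg fun i _ => hc0 i),
    fun t => ?_⟩
  have hu : 1 ≤ 1 + ‖fun i => t.ofConv (x i)‖ := by linarith [norm_nonneg fun i => t.ofConv (x i)]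
  set u := 1 + ‖fun i => t.ofConv (x i)‖
  have hpow : 1 ≤ u ^ ∑ i, d i := one_le_pow₀ hu
  have hsum0 : 0 ≤ ∑ i, c i := Finset.sum_nonneg fun i _ => hc0 i
  have hrhs : 1 ≤ (1 + ∑ i, c i) * u ^ ∑ i, d i := by nlinarith
  rw [← Real.le_log_iff_exp_le (by linarith), pi_norm_le_iff_of_nonneg (Real.log_nonneg hrhs)]
  intro i
  rw [Real.norm_eq_abs, Real.le_log_iff_exp_le (by linarith)]
  have hle : ∀ η, C η ≤ ∑ i, c i → e η ≤ ∑ i, d i →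
      ‖ι (S.z η t)‖ ≤ (1 + ∑ i, c i) * u ^ ∑ i, d i := fun η h1 h2 =>
    (hb η t).trans (mul_le_mul (by linarith) (pow_le_pow_right₀ hu h2)
      (by positivity) (by positivity))
  have hci := Finset.single_le_sum (fun i _ => hc0 i) (Finset.mem_univ i)
  have hdi := Finset.single_le_sum (f := d) (fun _ _ => Nat.zero_le _) (Finset.mem_univ i)
  rcases abs_cases (S.logCoords ι t i) with ⟨h, -⟩ | ⟨h, -⟩
  · rw [h, logCoords, Real.exp_log (S.norm_z_pos ι _ t)]
    exact hle _ (le_trans (by simp only [c]; linarith [hC (-Pi.single i 1)]) hci)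
      (le_trans (by simp only [d]; omega) hdi)
  · rw [h, logCoords, Real.exp_neg, Real.exp_log (S.norm_z_pos ι _ t)]
    have hinv : ‖ι (S.z (Pi.single i 1) t)‖⁻¹ = ‖ι (S.z (-Pi.single i 1) t)‖ := by
      refine inv_eq_of_mul_eq_one_right ?_
      rw [← norm_mul, ← map_mul, S.z_mul_neg, map_one, norm_one]
    rw [hinv]
    exact hle _ (le_trans (by simp only [c]; linarith [hC (Pi.single i 1)]) hci)
      (le_trans (by simp only [d]; omega) hdi)

/-- The map `η ↦ |z_η(t)|^τ` is multiplicative in `η`, hence an `E`-valued point; `h` is the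
condition for its descent to `F`. -/
theorem exists_root_of_mem_range (hι : ∀ x : F, ‖ι (algebraMap F E x)‖ = ‖x‖)
    (t : RatPoints F A) (τ : ℝ)
    (h : ∀ a, (S.expand a).sum (fun η c => c * algebraMap F E ((‖ι (S.z η t)‖ ^ τ : ℝ) : F)) ∈
      (algebraMap F E).range) :
    ∃ p : RatPoints F A, ∀ η, ‖ι (S.z η p)‖ = ‖ι (S.z η t)‖ ^ τ := by
  let ζ : Multiplicative (Fin n → ℤ) →* E :=
    { toFun := fun η => algebraMap F E ((‖ι (S.z η.toAdd t)‖ ^ τ : ℝ) : F)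
      map_one' := by simp [S.z_zero]
      map_mul' := fun a b => by
        rw [toAdd_mul, S.z_add, map_mul, norm_mul, Real.mul_rpow (norm_nonneg _) (norm_nonneg _),
          RCLike.ofReal_mul, map_mul] }
  obtain ⟨p, hp⟩ := S.exists_point ζ h
  refine ⟨p, fun η => ?_⟩
  rw [hp]
  change ‖ι (algebraMap F E ((‖ι (S.z η t)‖ ^ τ : ℝ) : F))‖ = _
  rw [hι, RCLike.norm_ofReal, abs_of_nonneg (Real.rpow_nonneg (norm_nonneg _) _)]

theorem z_pow (η : Fin n → ℤ) (t : RatPoints F A) (m : ℕ) : S.z η (t ^ m) = S.z η t ^ m :=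
  map_pow (S.zHom η) t m

end Arch

/-! ### Real powers of points on possibly nonsplit real tori -/

section Real

variable {A E : Type*} [CommRing A] [HopfAlgebra ℝ A] [Field E] [Algebra ℝ E] {n : ℕ}
  (S : SplitCoords ℝ A E n) {ι : E →+* ℂ}

/-- Interpolate `w ↦ |w|^τ` at the finitely many relevant values `z_η(t)` by a polynomial `P`. The
value of a regular function at the desired point becomes a combination of its real values at the
powers `tᵐ`, with the coefficients of `P`. The polynomial with conjugate coefficients serves equally
well, so the value is its own conjugate. -/
theorem exists_root_real (hι : ∀ x : ℝ, ι (algebraMap ℝ E x) = x) (t : RatPoints ℝ A) (τ : ℝ) :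
    ∃ p : RatPoints ℝ A, ∀ η, ‖ι (S.z η p)‖ = ‖ι (S.z η t)‖ ^ τ := by
  classical
  refine S.exists_root_of_mem_range (fun x => by rw [hι, Complex.norm_real]) t τ fun a => ?_
  set y := (S.expand a).sum fun η c => c * algebraMap ℝ E ((‖ι (S.z η t)‖ ^ τ : ℝ)) with hy
  have hιy : ι y = ∑ η ∈ (S.expand a).support, ι (S.expand a η) * ((‖ι (S.z η t)‖ ^ τ : ℝ) : ℂ) := by
    rw [hy, Finsupp.sum, map_sum]
    exact Finset.sum_congr rfl fun η _ => by rw [map_mul, hι]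
  have hpoly : ∀ Q : Polynomial ℂ, (∀ η ∈ (S.expand a).support,
      Q.eval (ι (S.z η t)) = ((‖ι (S.z η t)‖ ^ τ : ℝ) : ℂ)) →
      ι y = Q.sum fun m c => c * (((t ^ m).ofConv a : ℝ) : ℂ) := by
    intro Q hQ
    have h1 : ∀ m : ℕ, (((t ^ m).ofConv a : ℝ) : ℂ) =
        ∑ η ∈ (S.expand a).support, ι (S.expand a η) * ι (S.z η t) ^ m := fun m => by
      rw [← hι, S.eval_eq, Finsupp.sum, map_sum]
      exact Finset.sum_congr rfl fun η _ => by rw [map_mul, z_pow, map_pow]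
    rw [hιy, Polynomial.sum_def]
    simp only [h1, Finset.mul_sum]
    rw [Finset.sum_comm]
    refine Finset.sum_congr rfl fun η hη => ?_
    rw [← hQ η hη, Polynomial.eval_eq_sum, Polynomial.sum_def, Finset.mul_sum]
    exact Finset.sum_congr rfl fun m _ => by ring
  let W₀ : Finset ℂ := (S.expand a).support.image fun η => ι (S.z η t)
  -- Adding the conjugate nodes makes the conjugate polynomial interpolate on `W₀` too, as `|w|^τ`
  -- is real and invariant under conjugation.
  let W : Finset ℂ := W₀ ∪ W₀.image (starRingEnd ℂ)
  let P : Polynomial ℂ := Lagrange.interpolate W id fun w => ((‖w‖ ^ τ : ℝ) : ℂ)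
  have hP : ∀ w ∈ W, P.eval w = ((‖w‖ ^ τ : ℝ) : ℂ) := fun w hw =>
    Lagrange.eval_interpolate_at_node (v := id) (fun w => ((‖w‖ ^ τ : ℝ) : ℂ))
      (Set.injOn_id _) hw
  have hmem : ∀ η ∈ (S.expand a).support, ι (S.z η t) ∈ W₀ := fun η hη =>
    Finset.mem_image_of_mem _ hη
  have e1 := hpoly P fun η hη => hP _ (Finset.mem_union_left _ (hmem η hη))
  have e2 := hpoly (P.map (starRingEnd ℂ)) fun η hη => by
    have h1 := hP _ (Finset.mem_union_right _ (Finset.mem_image_of_mem (starRingEnd ℂ)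
      (hmem η hη)))
    have h2 := congrArg (starRingEnd ℂ) h1
    rw [← Polynomial.eval_map_apply, Complex.conj_conj, Complex.norm_conj, Complex.conj_ofReal]
      at h2
    exact h2
  have e3 : (starRingEnd ℂ) (ι y) = ι y := by
    conv_rhs => rw [e2]
    rw [e1, Polynomial.sum_def, map_sum, Polynomial.sum_def,
      Polynomial.support_map_of_injective _ (starRingEnd ℂ).injective]
    refine Finset.sum_congr rfl fun m _ => ?_
    rw [map_mul, Complex.conj_ofReal, Polynomial.coeff_map]
  obtain ⟨r, hr⟩ := Complex.conj_eq_iff_real.1 e3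
  exact ⟨r, ι.injective ((hι r).trans hr.symm)⟩

end Real

end SplitCoords

/-! ### Convergence of the transform in a strip over archimedean fields -/

theorem exists_norm_cpow_sub_one_le (z : ℂ) :
    ∃ C, 0 ≤ C ∧ ∀ r ∈ Set.Icc (1 / 2 : ℝ) (3 / 2), ‖(r : ℂ) ^ z - 1‖ ≤ C * |r - 1| := by
  have hne : ∀ r ∈ Set.Icc (1 / 2 : ℝ) (3 / 2), r ≠ 0 := fun r hr => by
    have := hr.1
    exact ne_of_gt (by linarith)
  have hderiv : ∀ r ∈ Set.Icc (1 / 2 : ℝ) (3 / 2),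
      HasDerivWithinAt (fun r : ℝ => Complex.exp (z * (Real.log r : ℂ)))
        (Complex.exp (z * (Real.log r : ℂ)) * (z * ((r⁻¹ : ℝ) : ℂ))) (Set.Icc (1 / 2 : ℝ) (3 / 2)) r :=
    fun r hr => (((Real.hasDerivAt_log (hne r hr)).ofReal_comp.const_mul z).cexp).hasDerivWithinAt
  have hcont : ContinuousOn
      (fun r : ℝ => Complex.exp (z * (Real.log r : ℂ)) * (z * ((r⁻¹ : ℝ) : ℂ)))
      (Set.Icc (1 / 2 : ℝ) (3 / 2)) := by
    have h1 : ContinuousOn (fun r : ℝ => Real.log r) (Set.Icc (1 / 2 : ℝ) (3 / 2)) :=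
      continuousOn_id.log hne
    have h2 : ContinuousOn (fun r : ℝ => r⁻¹) (Set.Icc (1 / 2 : ℝ) (3 / 2)) :=
      continuousOn_id.inv₀ hne
    exact (Complex.continuous_exp.comp_continuousOn
      (continuousOn_const.mul (Complex.continuous_ofReal.comp_continuousOn h1))).mul
      (continuousOn_const.mul (Complex.continuous_ofReal.comp_continuousOn h2))
  obtain ⟨C, hC⟩ := isCompact_Icc.exists_bound_of_continuousOn hcont
  have h1m : (1 : ℝ) ∈ Set.Icc (1 / 2 : ℝ) (3 / 2) := by constructor <;> norm_num
  refine ⟨C, (norm_nonneg _).trans (hC 1 h1m), fun r hr => ?_⟩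
  have h := (convex_Icc (1 / 2 : ℝ) (3 / 2)).norm_image_sub_le_of_norm_hasDerivWithin_le
    hderiv hC h1m hr
  have hr0 : (0 : ℝ) < r := lt_of_lt_of_le (by norm_num) hr.1
  rw [Complex.cpow_def_of_ne_zero (by exact_mod_cast hr0.ne'), ← Complex.ofReal_log hr0.le, mul_comm]
  simpa using h

/-! ### Comparison of additive and multiplicative integrals for real-valued functions -/

section RealIntegrals

variable {F : Type*} [Field F] [TopologicalSpace F] [IsTopologicalRing F] [LocallyCompactSpace F]
  [MeasurableSpace F] [BorelSpace F] [ContinuousInv₀ F] [T2Space F] [SecondCountableTopology F]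
  [ContinuousAbsF F] (dx : Measure F) [dx.IsAddHaarMeasure] [NullSingletonClass dx]

theorem integrable_abs_mul_real_iff {G : F → ℝ} :
    Integrable (fun x : Fˣ => absF x * G x) (mulMeasure dx) ↔ Integrable G dx := by
  have h := integrable_abs_mul_iff dx (G := fun x => (G x : ℂ))
  simp only [← Complex.ofReal_mul] at h
  rw [show Integrable (fun x : F => (G x : ℂ)) dx ↔ Integrable G dx from
    ⟨fun h => h.re, fun h => h.ofReal⟩] at h
  exact ⟨fun h1 => h.1 h1.ofReal, fun h1 => (h.2 h1).re⟩

theorem integral_abs_mul_real (G : F → ℝ) :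
    ∫ x : Fˣ, absF x * G x ∂(mulMeasure dx) = ∫ x, G x ∂dx := by
  have h := integral_abs_mul dx fun x => (G x : ℂ)
  simp only [← Complex.ofReal_mul] at h
  rw [integral_complex_ofReal, integral_complex_ofReal] at h
  exact_mod_cast h

end RealIntegrals

namespace IsLogMap

variable {T : Type*} [Group T] [TopologicalSpace T] {n : ℕ} {L : T → Fin n → ℝ}
  [IsTopologicalGroup T] [SecondCountableTopology T] [MeasurableSpace T] [BorelSpace T]

theorem exists_mellinConverges_exp_ge {μ : Measure T} [μ.IsMulLeftInvariant]
    [IsFiniteMeasureOnCompacts μ] (hL : IsLogMap L) (χ : T →ₜ* ℂˣ) (b : ℝ) :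
    ∃ k, 0 < k ∧ b ≤ k ∧ MellinConverges μ (fun t => (Real.exp (-(k * ‖L t‖)) : ℂ)) χ := by
  obtain ⟨k, hk0, hk⟩ := hL.exists_mellinConverges_exp (μ := μ) χ
  refine ⟨max k b, lt_max_of_lt_left hk0, le_max_right _ _, ?_⟩
  have hχ : Continuous fun t => (((χ t)⁻¹ : ℂˣ) : ℂ) :=
    Units.continuous_val.comp (map_continuous χ).inv
  have hc : Continuous fun t => (Real.exp (-(max k b * ‖L t‖)) : ℂ) :=
    Complex.continuous_ofReal.comp
      (Real.continuous_exp.comp (continuous_const.mul hL.continuous.norm).neg)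
  refine hk.mono (hc.mul hχ).aestronglyMeasurable (ae_of_all _ fun t => ?_)
  rw [norm_mul, norm_mul, Complex.norm_real, Complex.norm_real,
    Real.norm_of_nonneg (Real.exp_pos _).le, Real.norm_of_nonneg (Real.exp_pos _).le]
  gcongr
  exact le_max_left _ _

variable {F : Type*} [RCLike F] [MeasurableSpace F] [BorelSpace F] {dx : Measure F}
  [dx.IsAddHaarMeasure] {ψ : AddChar F Circle}

theorem norm_absF_cpow_le (s : ℂ) (x : Fˣ) : ‖(absF x : ℂ) ^ s‖ ≤
    1 * Real.exp (|Module.finrank ℝ F * s.re| * |Real.log ‖(x : F)‖|) := by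
  rw [norm_absF_cpow, absF_rpow, Real.rpow_def_of_pos (norm_unit_pos x), one_mul, ← abs_mul]
  exact Real.exp_le_exp.2 ((le_abs_self _).trans_eq (by rw [mul_comm]))

theorem integrable_convolution_arch (hL : IsLogMap L) (hψ : Continuous ψ) {l : Fˣ →ₜ* T}
    {M : Fin n → ℝ} (hl : ∀ x : Fˣ, L (l x) = Real.log ‖(x : F)‖ • M) (hM : M ≠ 0) {Φ : T → ℂ}
    (hΦ : Continuous Φ) (hdec : ∀ k : ℝ, ∃ C, ∀ t, ‖Φ t‖ ≤ C * Real.exp (-(k * ‖L t‖)))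
    (s : ℂ) (t : T) : Integrable (fun x => kernelD ψ s x * Φ ((l x)⁻¹ * t)) (mulMeasure dx) := by
  have hM0 : 0 < ‖M‖ := norm_pos_iff.2 hM
  -- This rate times `‖M‖` exceeds by one the growth exponent of the kernel.
  obtain ⟨C, hC⟩ := hdec ((|Module.finrank ℝ F * s.re| + 1) / ‖M‖)
  refine hL.integrable_mul_translate hl (continuous_kernelD hψ s).aestronglyMeasurable zero_le_one
    (by positivity) (fun x => ?_) hΦ hC (by rw [div_mul_cancel₀ _ hM0.ne']; linarith) t
  rw [kernelD, norm_mul, Circle.norm_coe, mul_one]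
  exact norm_absF_cpow_le s x

/-- The difference bound for `x ↦ |x|ᶻ Φ(λ(x)⁻¹ y)` near `x = 1`. -/
theorem exists_norm_sub_le {l : Fˣ →ₜ* T} {Φ : T → ℂ}
    (hdec : ∀ k : ℝ, ∃ C, ∀ t, ‖Φ t‖ ≤ C * Real.exp (-(k * ‖L t‖)))
    (hlip : ∀ k : ℝ, ∃ C, ∀ y, ∀ g : Fˣ, ‖(g : F) - 1‖ ≤ 1 / 2 →
      ‖Φ ((l g)⁻¹ * y) - Φ y‖ ≤ C * ‖(g : F) - 1‖ * Real.exp (-(k * ‖L y‖))) (z : ℂ) (k : ℝ) :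
    ∃ C, 0 ≤ C ∧ ∀ y, ∀ g : Fˣ, ‖(g : F) - 1‖ ≤ 1 / 2 →
      ‖Φ y - (absF g : ℂ) ^ z * Φ ((l g)⁻¹ * y)‖ ≤
        C * ‖(g : F) - 1‖ * Real.exp (-(k * ‖L y‖)) := by
  obtain ⟨C₁, hC₁⟩ := hdec k
  obtain ⟨C₂, hC₂⟩ := hlip k
  obtain ⟨C₃, hC₃0, hC₃⟩ := exists_norm_cpow_sub_one_le (Module.finrank ℝ F * z)
  refine ⟨C₃ * (|C₁| + |C₂|) + |C₂|, by positivity, fun y g hg => ?_⟩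
  set δ := ‖(g : F) - 1‖ with hδ
  set ε := Real.exp (-(k * ‖L y‖)) with hε
  have hε0 : 0 < ε := Real.exp_pos _
  have hδ0 : 0 ≤ δ := norm_nonneg _
  have hg1 : |‖(g : F)‖ - 1| ≤ δ := by
    have := abs_norm_sub_norm_le (g : F) 1
    rwa [norm_one] at this
  have hgI : ‖(g : F)‖ ∈ Set.Icc (1 / 2 : ℝ) (3 / 2) := by
    have := abs_le.1 (hg1.trans hg)
    constructor <;> linarith [this.1, this.2]
  have h1 : ‖(absF g : ℂ) ^ z - 1‖ ≤ C₃ * δ := by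
    rw [absF_cpow]
    exact (hC₃ _ hgI).trans (mul_le_mul_of_nonneg_left hg1 hC₃0)
  have h2 : ‖Φ ((l g)⁻¹ * y) - Φ y‖ ≤ |C₂| * δ * ε := (hC₂ y g hg).trans (by
    gcongr
    exact le_abs_self _)
  have h3 : ‖Φ y‖ ≤ |C₁| * ε := (hC₁ y).trans (by
    gcongr
    exact le_abs_self _)
  have h4 : ‖Φ ((l g)⁻¹ * y)‖ ≤ (|C₁| + |C₂|) * ε := by
    have e1 : ‖Φ ((l g)⁻¹ * y)‖ ≤ ‖Φ ((l g)⁻¹ * y) - Φ y‖ + ‖Φ y‖ := by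
      simpa using norm_add_le (Φ ((l g)⁻¹ * y) - Φ y) (Φ y)
    have e2 : |C₂| * δ * ε ≤ |C₂| * ε := by
      have : δ ≤ 1 := by linarith
      have h5 := mul_nonneg (abs_nonneg C₂) hε0.le
      nlinarith
    linarith
  have h5 : Φ y - (absF g : ℂ) ^ z * Φ ((l g)⁻¹ * y) =
      -(((absF g : ℂ) ^ z - 1) * Φ ((l g)⁻¹ * y)) - (Φ ((l g)⁻¹ * y) - Φ y) := by ring
  rw [h5]
  refine (norm_sub_le _ _).trans ?_
  rw [norm_neg, norm_mul]
  have h6 := mul_le_mul h1 h4 (norm_nonneg _) (by positivity)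
  calc _ ≤ C₃ * δ * ((|C₁| + |C₂|) * ε) + |C₂| * δ * ε := add_le_add h6 h2
    _ = _ := by ring

end IsLogMap

/-! ### Decay of the transform from oscillation of `ψ` -/

namespace IsLogMap

variable {T : Type*} [Group T] [TopologicalSpace T] {n : ℕ} {L : T → Fin n → ℝ}
  [IsTopologicalGroup T] [SecondCountableTopology T] [MeasurableSpace T] [BorelSpace T]
  {F : Type*} [RCLike F] [MeasurableSpace F] [BorelSpace F] {dx : Measure F}
  [dx.IsAddHaarMeasure] {ψ : AddChar F Circle}

theorem measurableSet_norm_le (R : ℝ) : MeasurableSet {x : Fˣ | ‖(x : F)‖ ≤ R} :=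
  (isClosed_le Units.continuous_val.norm continuous_const).measurableSet

theorem measurableSet_lt_norm (R : ℝ) : MeasurableSet {x : Fˣ | R < ‖(x : F)‖} :=
  (isOpen_lt continuous_const Units.continuous_val.norm).measurableSet

/-- Oscillation of `ψ` gains one power of `‖x‖` at infinity. -/
theorem norm_equivFourier_le (hL : IsLogMap L) (hψ : Continuous ψ) {w : F} (hw : ψ w = -1)
    {l : Fˣ →ₜ* T} {M : Fin n → ℝ} (hl : ∀ x : Fˣ, L (l x) = Real.log ‖(x : F)‖ • M) (hM : M ≠ 0)
    {Φ : T → ℂ} (hΦ : Continuous Φ)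
    (hdec : ∀ k : ℝ, ∃ C, ∀ t, ‖Φ t‖ ≤ C * Real.exp (-(k * ‖L t‖))) (s : ℂ) {C k : ℝ} (hC0 : 0 ≤ C)
    (hk0 : 0 ≤ k) (hk : |Module.finrank ℝ F * s.re| < k * ‖M‖)
    (hC : ∀ y, ∀ g : Fˣ, ‖(g : F) - 1‖ ≤ 1 / 2 →
      ‖Φ y - (absF g : ℂ) ^ (s - 1) * Φ ((l g)⁻¹ * y)‖ ≤
        C * ‖(g : F) - 1‖ * Real.exp (-(k * ‖L y‖))) (t : T) :
    ‖equivFourier ψ dx l s Φ t‖ ≤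
      ∫ x, ‖{x : Fˣ | ‖(x : F)‖ ≤ 3 * ‖w‖}.indicator (fun x => (absF x : ℂ) ^ s) x‖ *
        ‖Φ ((l x)⁻¹ * t)‖ ∂(mulMeasure dx) +
      ∫ x, ‖{x : Fˣ | 2 * ‖w‖ < ‖(x : F)‖}.indicator
          (fun x => (absF x : ℂ) ^ s * ((C * ‖w‖ / ‖(x : F)‖ : ℝ) : ℂ)) x‖ *
        ‖(Real.exp (-(k * ‖L ((l x)⁻¹ * t)‖)) : ℂ)‖ ∂(mulMeasure dx) := by
  have hw0 : w ≠ 0 := by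
    rintro rfl
    rw [AddChar.map_zero_eq_one] at hw
    have := congrArg (fun z : Circle => (z : ℂ)) hw
    norm_num [Circle.ext_iff] at this
  have hw1 : 0 < ‖w‖ := norm_pos_iff.2 hw0
  have hM0 : 0 < ‖M‖ := norm_pos_iff.2 hM
  have hinj : Function.Injective (Units.val : Fˣ → F) := Units.val_injective
  -- The density with respect to additive measure, extended by `0`; the exponent is `s - 1` because
  -- `d^×x = dx / |x|`.
  set u : F → ℂ := Function.extend Units.val
    (fun x : Fˣ => (absF x : ℂ) ^ (s - 1) * Φ ((l x)⁻¹ * t)) 0 with hu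
  have hux : ∀ x : Fˣ, u x = (absF x : ℂ) ^ (s - 1) * Φ ((l x)⁻¹ * t) := fun x =>
    hinj.extend_apply _ _ x
  have habs : ∀ x : Fˣ, (absF x : ℂ) * u x = (absF x : ℂ) ^ s * Φ ((l x)⁻¹ * t) := fun x => by
    rw [hux, Complex.cpow_sub _ _ (absF_ne_zero x), Complex.cpow_one]
    have := absF_ne_zero x
    field_simp
  have huint : Integrable u dx := by
    rw [← integrable_abs_mul_iff dx]
    simp only [habs]
    obtain ⟨C₁, hC₁⟩ := hdec ((|Module.finrank ℝ F * s.re| + 1) / ‖M‖)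
    exact hL.integrable_mul_translate hl (continuous_absF_cpow s).aestronglyMeasurable zero_le_one
      (by positivity) (norm_absF_cpow_le s) hΦ hC₁
      (by rw [div_mul_cancel₀ _ hM0.ne']; linarith) t
  have hψm : Continuous fun v : F => (ψ v : ℂ) := continuous_circle_coe.comp hψ
  have hψint : ∀ {f : F → ℂ}, Integrable f dx → Integrable (fun v => f v * (ψ v : ℂ)) dx :=
    fun {f} hf => hf.mono (hf.aestronglyMeasurable.mul hψm.aestronglyMeasurable)
      (ae_of_all _ fun v => by rw [norm_mul, Circle.norm_coe, mul_one])
  have heq : equivFourier ψ dx l s Φ t = ∫ v, u v * (ψ v : ℂ) ∂dx := by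
    rw [← integral_abs_mul dx]
    refine integral_congr_ae (ae_of_all _ fun x => ?_)
    beta_reduce
    rw [← mul_assoc, habs, kernelD]
    ring
  have hushift : Integrable (fun v => u (v - w)) dx := huint.comp_sub_right w
  have hshift : ∫ v, u v * (ψ v : ℂ) ∂dx = -∫ v, u (v - w) * (ψ v : ℂ) ∂dx := by
    rw [← integral_sub_right_eq_self _ w, ← integral_neg]
    refine integral_congr_ae (ae_of_all _ fun v => ?_)
    beta_reduce
    rw [AddChar.map_sub_eq_div, hw]
    simp [div_neg]
  -- Translation by `w` changes the sign of `ψ`, so the integral of `uψ` is half that of a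
  -- difference.
  have hhalf : equivFourier ψ dx l s Φ t = 2⁻¹ * ∫ v, (u v - u (v - w)) * (ψ v : ℂ) ∂dx := by
    have : ∫ v, (u v - u (v - w)) * (ψ v : ℂ) ∂dx =
        ∫ v, u v * (ψ v : ℂ) ∂dx - ∫ v, u (v - w) * (ψ v : ℂ) ∂dx := by
      rw [← integral_sub (hψint huint) (hψint hushift)]
      simp only [sub_mul]
    rw [this, heq]
    linear_combination (2⁻¹ : ℂ) * hshift
  -- If `‖v‖ ≤ 2‖w‖`, then `v` and `v - w` both lie in the ball of radius `3‖w‖`, and no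
  -- cancellation is used. Otherwise `g = (v - w)/v` satisfies `‖g - 1‖ = ‖w‖/‖v‖ ≤ 1/2`, and the
  -- difference bound applies, giving `U₂`.
  set U₁ : F → ℝ := (Metric.closedBall (0 : F) (3 * ‖w‖)).indicator fun v => ‖u v‖ with hU₁
  set U₂ : F → ℝ := Function.extend Units.val ({x : Fˣ | 2 * ‖w‖ < ‖(x : F)‖}.indicator
    fun x => absF x ^ (s.re - 1) * (C * ‖w‖ / ‖(x : F)‖) * Real.exp (-(k * ‖L ((l x)⁻¹ * t)‖))) 0
    with hU₂
  have hU₂x : ∀ x : Fˣ, U₂ x = {x : Fˣ | 2 * ‖w‖ < ‖(x : F)‖}.indicator (fun x : Fˣ =>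
      absF x ^ (s.re - 1) * (C * ‖w‖ / ‖(x : F)‖) * Real.exp (-(k * ‖L ((l x)⁻¹ * t)‖))) x :=
    fun x => hinj.extend_apply _ _ x
  have hU₁int : Integrable U₁ dx := huint.norm.indicator Metric.isClosed_closedBall.measurableSet
  have hexpc : Continuous fun y : T => (Real.exp (-(k * ‖L y‖)) : ℂ) :=
    Complex.continuous_ofReal.comp
      (Real.continuous_exp.comp (continuous_const.mul hL.continuous.norm).neg)
  have hU₂abs : ∀ x : Fˣ, absF x * U₂ x = ‖{x : Fˣ | 2 * ‖w‖ < ‖(x : F)‖}.indicator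
      (fun x => (absF x : ℂ) ^ s * ((C * ‖w‖ / ‖(x : F)‖ : ℝ) : ℂ)) x‖ *
        ‖(Real.exp (-(k * ‖L ((l x)⁻¹ * t)‖)) : ℂ)‖ := by
    intro x
    rw [hU₂x]
    by_cases hx : x ∈ {x : Fˣ | 2 * ‖w‖ < ‖(x : F)‖}
    · have hx0 := norm_unit_pos x
      rw [Set.indicator_of_mem hx, Set.indicator_of_mem hx, norm_mul, norm_absF_cpow,
        Complex.norm_real, Complex.norm_real, Real.norm_of_nonneg (by positivity),
        Real.norm_of_nonneg (Real.exp_pos _).le, Real.rpow_sub_one (absF_pos x).ne']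
      have := (absF_pos x).ne'
      field_simp
    · rw [Set.indicator_of_notMem hx, Set.indicator_of_notMem hx]
      simp
  have hU₁abs : ∀ x : Fˣ, absF x * U₁ x =
      ‖{x : Fˣ | ‖(x : F)‖ ≤ 3 * ‖w‖}.indicator (fun x => (absF x : ℂ) ^ s) x‖ *
        ‖Φ ((l x)⁻¹ * t)‖ := by
    intro x
    by_cases hx : ‖(x : F)‖ ≤ 3 * ‖w‖
    · have hx1 : x ∈ {x : Fˣ | ‖(x : F)‖ ≤ 3 * ‖w‖} := hx
      have hx2 : (x : F) ∈ Metric.closedBall (0 : F) (3 * ‖w‖) := by simpa using hx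
      have := congrArg norm (habs x)
      rw [norm_mul, norm_mul, Complex.norm_real, Real.norm_of_nonneg (absF_pos x).le] at this
      rw [Set.indicator_of_mem hx1, hU₁, Set.indicator_of_mem hx2, this]
    · have hx1 : x ∉ {x : Fˣ | ‖(x : F)‖ ≤ 3 * ‖w‖} := hx
      have hx2 : (x : F) ∉ Metric.closedBall (0 : F) (3 * ‖w‖) := by simpa using hx
      rw [Set.indicator_of_notMem hx1, hU₁, Set.indicator_of_notMem hx2]
      simp
  have hU₂int : Integrable U₂ dx := by
    rw [← integrable_abs_mul_real_iff dx]
    simp only [hU₂abs, ← norm_mul]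
    refine Integrable.norm ?_
    refine hL.integrable_mul_translate hl (a := |Module.finrank ℝ F * s.re|) (C := C)
      (C' := 1) (Ψ := fun y => (Real.exp (-(k * ‖L y‖)) : ℂ)) ?_ hC0 hk0 (fun x => ?_) hexpc
      (fun y => ?_) hk t
    · refine AEStronglyMeasurable.indicator (Continuous.aestronglyMeasurable ?_)
        (measurableSet_lt_norm _)
      refine (continuous_absF_cpow s).mul (Complex.continuous_ofReal.comp ?_)
      exact continuous_const.div Units.continuous_val.norm fun x => (norm_unit_pos x).ne'
    · by_cases hx : x ∈ {x : Fˣ | 2 * ‖w‖ < ‖(x : F)‖}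
      · rw [Set.indicator_of_mem hx, norm_mul, Complex.norm_real,
          Real.norm_of_nonneg (by have := norm_unit_pos x; positivity), mul_comm]
        refine mul_le_mul ?_ ((norm_absF_cpow_le s x).trans_eq (one_mul _)) (norm_nonneg _) hC0
        rw [div_le_iff₀ (norm_unit_pos x)]
        have hx' : 2 * ‖w‖ < ‖(x : F)‖ := hx
        exact mul_le_mul_of_nonneg_left (by linarith) hC0
      · rw [Set.indicator_of_notMem hx, norm_zero]
        positivity
    · rw [Complex.norm_real, Real.norm_of_nonneg (Real.exp_pos _).le, one_mul]
  have hpt : ∀ᵐ v ∂dx, ‖(u v - u (v - w)) * (ψ v : ℂ)‖ ≤ U₁ v + U₁ (v - w) + U₂ v := by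
    have h0 : ∀ᵐ v ∂dx, v ≠ 0 := by simp [ae_iff]
    have h1 : ∀ᵐ v ∂dx, v ≠ w := by simp [ae_iff]
    filter_upwards [h0, h1] with v hv0 hvw
    have hU₁0 : ∀ v, 0 ≤ U₁ v := fun v => Set.indicator_nonneg (fun _ _ => norm_nonneg _) v
    rw [norm_mul, Circle.norm_coe, mul_one]
    let x : Fˣ := Units.mk0 v hv0
    have hxv : (x : F) = v := rfl
    by_cases hv : ‖v‖ ≤ 2 * ‖w‖
    · have e1 : U₁ v = ‖u v‖ := Set.indicator_of_mem
        (by rw [mem_closedBall_zero_iff]; linarith) _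
      have e2 : U₁ (v - w) = ‖u (v - w)‖ := Set.indicator_of_mem
        (by rw [mem_closedBall_zero_iff]; linarith [norm_sub_le v w]) _
      have e3 : U₂ v = 0 := by
        have hx : x ∉ {x : Fˣ | 2 * ‖w‖ < ‖(x : F)‖} := fun h => absurd hv (not_le.2 h)
        rw [← hxv, hU₂x, Set.indicator_of_notMem hx]
      rw [e1, e2, e3, add_zero]
      exact norm_sub_le _ _
    · rw [not_le] at hv
      have hx : x ∈ {x : Fˣ | 2 * ‖w‖ < ‖(x : F)‖} := hv
      let x' : Fˣ := Units.mk0 (v - w) (sub_ne_zero.2 hvw)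
      let g : Fˣ := x⁻¹ * x'
      have hx' : x' = x * g := by simp [g]
      have hg : (g : F) - 1 = -(w / v) := by
        simp only [g, x, x', Units.val_mul, Units.val_inv_eq_inv_val, Units.val_mk0]
        field_simp
        ring
      have hgn : ‖(g : F) - 1‖ = ‖w‖ / ‖v‖ := by rw [hg, norm_neg, norm_div]
      have hv0' : 0 < ‖v‖ := norm_pos_iff.2 hv0
      have hg2 : ‖(g : F) - 1‖ ≤ 1 / 2 := by
        rw [hgn, div_le_iff₀ hv0']
        linarith
      have e1 : u v = (absF x : ℂ) ^ (s - 1) * Φ ((l x)⁻¹ * t) := hux x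
      have e2 : u (v - w) = (absF x : ℂ) ^ (s - 1) *
          ((absF g : ℂ) ^ (s - 1) * Φ ((l g)⁻¹ * ((l x)⁻¹ * t))) := by
        have := hux x'
        rw [hx', absF_mul_cpow, _root_.map_mul, mul_inv_rev, mul_assoc, mul_assoc, ← hx'] at this
        exact this
      have e3 : ‖u v - u (v - w)‖ ≤ U₂ v := by
        rw [e1, e2, ← mul_sub, norm_mul, norm_absF_cpow, Complex.sub_re, Complex.one_re, ← hxv,
          hU₂x, Set.indicator_of_mem hx, mul_assoc]
        refine mul_le_mul_of_nonneg_left ((hC _ g hg2).trans_eq ?_)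
          (Real.rpow_nonneg (absF_pos x).le _)
        rw [hgn, hxv]
        ring
      linarith [hU₁0 v, hU₁0 (v - w)]
  have hsum : Integrable (fun v => U₁ v + U₁ (v - w) + U₂ v) dx :=
    (hU₁int.add (hU₁int.comp_sub_right w)).add hU₂int
  have hU₂nn : 0 ≤ ∫ v, U₂ v ∂dx := by
    rw [← integral_abs_mul_real dx]
    refine integral_nonneg fun x => ?_
    beta_reduce
    rw [Pi.zero_apply, hU₂abs]
    positivity
  have hbound : ‖∫ v, (u v - u (v - w)) * (ψ v : ℂ) ∂dx‖ ≤
      2 * ∫ v, U₁ v ∂dx + ∫ v, U₂ v ∂dx := by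
    refine (norm_integral_le_of_norm_le hsum hpt).trans_eq ?_
    rw [integral_add (f := fun v => U₁ v + U₁ (v - w))
        (hU₁int.add (hU₁int.comp_sub_right w)) hU₂int, integral_add hU₁int (hU₁int.comp_sub_right w), integral_sub_right_eq_self U₁ w]
    ring
  simp only [← hU₁abs, ← hU₂abs]
  rw [integral_abs_mul_real dx, integral_abs_mul_real dx, hhalf, norm_mul, norm_inv,
    Complex.norm_two]
  linarith

/-- The part near `0` needs `Re s > r`; at infinity the gained factor `1/‖x‖` has size `|x|^(-1/d)`,
which allows `Re s - r < 1/d`. -/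
theorem mellinConverges_equivFourier {μ : Measure T} [μ.IsMulLeftInvariant] [SigmaFinite μ]
    [IsFiniteMeasureOnCompacts μ] (hL : IsLogMap L) (hψ : Continuous ψ) {w : F} (hw : ψ w = -1)
    {l : Fˣ →ₜ* T} {M : Fin n → ℝ} (hl : ∀ x : Fˣ, L (l x) = Real.log ‖(x : F)‖ • M) (hM : M ≠ 0)
    {Φ : T → ℂ} (hΦ : Continuous Φ)
    (hdec : ∀ k : ℝ, ∃ C, ∀ t, ‖Φ t‖ ≤ C * Real.exp (-(k * ‖L t‖)))
    (hlip : ∀ k : ℝ, ∃ C, ∀ y, ∀ g : Fˣ, ‖(g : F) - 1‖ ≤ 1 / 2 →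
      ‖Φ ((l g)⁻¹ * y) - Φ y‖ ≤ C * ‖(g : F) - 1‖ * Real.exp (-(k * ‖L y‖)))
    (s : ℂ) (χ : T →ₜ* ℂˣ) (r : ℝ) (hr : HasRealExponent (χ.comp l) r) (h0 : 0 < s.re - r)
    (h1 : s.re - r < 1 / Module.finrank ℝ F) :
    MellinConverges μ (equivFourier ψ dx l s Φ) χ := by
  have hd := finrank_rclike_pos (F := F)
  have hlc : Continuous l := map_continuous l
  have hM0 : 0 < ‖M‖ := norm_pos_iff.2 hM
  obtain ⟨k, hk0, hk, hconv⟩ := hL.exists_mellinConverges_exp_ge (μ := μ) χ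
    ((|Module.finrank ℝ F * s.re| + 1) / ‖M‖)
  obtain ⟨C, hC0, hC⟩ := exists_norm_sub_le hdec hlip (s - 1) k
  have hk' : |Module.finrank ℝ F * s.re| < k * ‖M‖ := by
    rw [div_le_iff₀ hM0] at hk
    linarith
  have hχ : Continuous fun x => (((χ (l x))⁻¹ : ℂˣ) : ℂ) :=
    Units.continuous_val.comp ((map_continuous χ).comp hlc).inv
  have hnorm : ∀ x : Fˣ, ‖(absF x : ℂ) ^ s‖ * ‖(((χ (l x))⁻¹ : ℂˣ) : ℂ)‖ =
      ‖(x : F)‖ ^ ((Module.finrank ℝ F : ℝ) * (s.re - r)) := by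
    intro x
    have h2 : ‖(χ (l x) : ℂ)‖ = absF x ^ r := hr x
    rw [norm_absF_cpow, Units.val_inv_eq_inv_val, norm_inv, h2, ← Real.rpow_neg (absF_pos x).le,
      ← Real.rpow_add (absF_pos x), ← sub_eq_add_neg, absF_rpow]
  refine mellinConverges_of_dominated (dx := dx) (l := l)
    (stronglyMeasurable_equivFourier hψ l s hΦ).aestronglyMeasurable (Finset.univ : Finset (Fin 2))
    ![{x : Fˣ | ‖(x : F)‖ ≤ 3 * ‖w‖}.indicator (fun x => (absF x : ℂ) ^ s),
      {x : Fˣ | 2 * ‖w‖ < ‖(x : F)‖}.indicator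
        (fun x => (absF x : ℂ) ^ s * ((C * ‖w‖ / ‖(x : F)‖ : ℝ) : ℂ))]
    ![Φ, fun y => (Real.exp (-(k * ‖L y‖)) : ℂ)] ?_ ?_ fun t => ?_
  · simp only [Finset.mem_univ, forall_const]
    refine Fin.forall_fin_two.2 ⟨?_, ?_⟩
    · refine (integrable_indicator_norm_le dx (mul_pos hd h0) (3 * ‖w‖)).mono ?_
        (ae_of_all _ fun x => ?_)
      · exact ((continuous_absF_cpow s).aestronglyMeasurable.indicator
          (measurableSet_norm_le _)).mul hχ.aestronglyMeasurable
      · change ‖{x : Fˣ | ‖(x : F)‖ ≤ 3 * ‖w‖}.indicator (fun x => (absF x : ℂ) ^ s) x * _‖ ≤ _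
        by_cases hx : x ∈ {x : Fˣ | ‖(x : F)‖ ≤ 3 * ‖w‖}
        · rw [Set.indicator_of_mem hx, Set.indicator_of_mem hx, norm_mul, hnorm, Complex.norm_real,
            Real.norm_of_nonneg (Real.rpow_nonneg (norm_nonneg _) _)]
        · rw [Set.indicator_of_notMem hx, Set.indicator_of_notMem hx, zero_mul]
    · have hneg : (Module.finrank ℝ F : ℝ) * (s.re - r) - 1 < 0 := by
        rw [lt_div_iff₀ hd] at h1
        linarith
      have hw0 : 0 < 2 * ‖w‖ := by
        have : w ≠ 0 := by
          rintro rfl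
          rw [AddChar.map_zero_eq_one] at hw
          have := congrArg (fun z : Circle => (z : ℂ)) hw
          norm_num [Circle.ext_iff] at this
        have := norm_pos_iff.2 this
        linarith
      refine ((integrable_indicator_lt_norm dx hneg hw0).const_mul ((C * ‖w‖ : ℝ) : ℂ)).mono ?_
        (ae_of_all _ fun x => ?_)
      · refine AEStronglyMeasurable.mul (AEStronglyMeasurable.indicator
          (Continuous.aestronglyMeasurable ?_) (measurableSet_lt_norm _)) hχ.aestronglyMeasurable
        refine (continuous_absF_cpow s).mul (Complex.continuous_ofReal.comp ?_)
        exact continuous_const.div Units.continuous_val.norm fun x => (norm_unit_pos x).ne'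
      · change ‖{x : Fˣ | 2 * ‖w‖ < ‖(x : F)‖}.indicator
          (fun x => (absF x : ℂ) ^ s * ((C * ‖w‖ / ‖(x : F)‖ : ℝ) : ℂ)) x * _‖ ≤ _
        by_cases hx : x ∈ {x : Fˣ | 2 * ‖w‖ < ‖(x : F)‖}
        · have hx0 := norm_unit_pos x
          rw [Set.indicator_of_mem hx, Set.indicator_of_mem hx, norm_mul, norm_mul, mul_right_comm,
            hnorm, norm_mul, Complex.norm_real, Complex.norm_real, Complex.norm_real,
            Real.norm_of_nonneg (Real.rpow_nonneg (norm_nonneg _) _),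
            Real.norm_of_nonneg (by positivity), Real.norm_of_nonneg (by positivity),
            Real.rpow_sub_one hx0.ne']
          refine le_of_eq ?_
          ring
        · rw [Set.indicator_of_notMem hx, Set.indicator_of_notMem hx, zero_mul, mul_zero]
  · simp only [Finset.mem_univ, forall_const]
    exact Fin.forall_fin_two.2 ⟨hL.mellinConverges hΦ.aestronglyMeasurable hdec χ, hconv⟩
  · rw [Fin.sum_univ_two]
    exact hL.norm_equivFourier_le hψ hw hl hM hΦ hdec s hC0 hk0.le hk' hC t

end IsLogMap

/-! ### Schwartz functions on tori over archimedean fields -/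

section CocharExpansion

variable {F A : Type*} [Field F] [CommRing A] [HopfAlgebra F A] [TopologicalSpace F]
  [IsTopologicalRing F]

/-- Comultiplication separates the variables, and `λ` turns the first one into Laurent polynomials
in `g`. The resulting expression makes sense along a path in `Fˣ` and can be differentiated. -/
theorem cochar_mul_mem_span (lam : A →ₐc[F] AddMonoidAlgebra F ℤ) (a : A) :
    (fun p : Fˣ × RatPoints F A => ((cocharPoints lam p.1)⁻¹ * p.2).ofConv a) ∈
      Submodule.span F (Set.range fun q : ℤ × A => fun p : Fˣ × RatPoints F A =>
        (p.1 : F) ^ q.1 * p.2.ofConv q.2) := by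
  have h : ∀ p : Fˣ × RatPoints F A, ((cocharPoints lam p.1)⁻¹ * p.2).ofConv a =
      Algebra.TensorProduct.lift (cocharPoints lam p.1⁻¹).ofConv p.2.ofConv (fun _ _ => .all ..)
      (Coalgebra.comul (R := F) a) := fun p => by
    rw [← map_inv, RatPoints.mul_apply]
  simp only [h]
  induction Coalgebra.comul (R := F) a using TensorProduct.induction_on with
  | zero =>
    simp only [map_zero]
    exact Submodule.zero_mem _
  | add x y hx hy =>
    simp only [map_add]
    exact Submodule.add_mem _ hx hy
  | tmul a₁ a₂ =>
    have h2 : ∀ p : Fˣ × RatPoints F A,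
        Algebra.TensorProduct.lift (cocharPoints lam p.1⁻¹).ofConv p.2.ofConv
          (fun _ _ => .all ..) (a₁ ⊗ₜ a₂) = gmPoint p.1⁻¹ (lam a₁) * p.2.ofConv a₂ := fun p => by
      rw [Algebra.TensorProduct.lift_tmul]
      rfl
    simp only [h2]
    induction lam a₁ using AddMonoidAlgebra.induction_linear with
    | zero =>
      simp only [map_zero, zero_mul]
      exact Submodule.zero_mem _
    | add x y hx hy =>
      simp only [map_add, add_mul]
      exact Submodule.add_mem _ hx hy
    | single k c =>
      convert Submodule.smul_mem (Submodule.span F (Set.range fun q : ℤ × A =>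
        fun p : Fˣ × RatPoints F A => (p.1 : F) ^ q.1 * p.2.ofConv q.2)) c
        (Submodule.subset_span ⟨(-k, a₂), rfl⟩) using 1
      funext p
      rw [gmPoint_single]
      simp only [Pi.smul_apply, smul_eq_mul, Units.val_inv_eq_inv_val, inv_zpow', mul_assoc]

theorem exists_cochar_mul_eq (lam : A →ₐc[F] AddMonoidAlgebra F ℤ) (a : A) :
    ∃ c : ℤ × A →₀ F, ∀ (g : Fˣ) (y : RatPoints F A),
      ((cocharPoints lam g)⁻¹ * y).ofConv a =
        ∑ q ∈ c.support, c q * ((g : F) ^ q.1 * y.ofConv q.2) := by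
  obtain ⟨c, hc⟩ := Finsupp.mem_span_range_iff_exists_finsupp.1 (cochar_mul_mem_span lam a)
  refine ⟨c, fun g y => ?_⟩
  have := congrFun hc (g, y)
  rw [← this, Finsupp.sum, Finset.sum_apply]
  rfl

end CocharExpansion

/-! ### Cocharacters and rapid decay in logarithmic coordinates -/

namespace SplitCoords

variable {F A E : Type*} [RCLike F] [CommRing A] [HopfAlgebra F A] [Field E] [Algebra F E] {n : ℕ}
  (S : SplitCoords F A E n) {ι : E →+* ℂ}

/-- The vector `M` consists of the exponents of the basis characters along `λ`; every other exponent
is an integral combination of them, so they cannot all vanish. -/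
theorem logCoords_cochar (hι : ∀ x : F, ‖ι (algebraMap F E x)‖ = ‖x‖)
    {lam : A →ₐc[F] AddMonoidAlgebra F ℤ} (hlam : IsNontrivialCochar lam) :
    ∃ M : Fin n → ℝ, M ≠ 0 ∧
      ∀ x : Fˣ, S.logCoords ι (cocharPoints lam x) = Real.log ‖(x : F)‖ • M := by
  choose m hm using fun i => S.exists_z_cochar lam (Pi.single i 1)
  have hL : ∀ x : Fˣ, S.logCoords ι (cocharPoints lam x) =
      Real.log ‖(x : F)‖ • fun i => (m i : ℝ) := by
    intro x
    funext i
    rw [logCoords, hm i, map_zpow₀, norm_zpow, hι, Real.log_zpow, Pi.smul_apply, smul_eq_mul,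
      mul_comm]
  refine ⟨fun i => m i, fun hM => ?_, hL⟩
  obtain ⟨η, k, hk, hη⟩ := S.exists_ne_zero_cochar exists_unit_infinite_order hlam
  have h := S.log_norm_z ι η (cocharPoints lam (expUnit F 1))
  rw [hη, map_zpow₀, norm_zpow, hι, norm_expUnit, Real.log_zpow, Real.log_exp, hL, hM] at h
  simp only [smul_zero, Pi.zero_apply, mul_zero, Finset.sum_const_zero, mul_one] at h
  exact hk (by exact_mod_cast h)

/-- As `exp‖L t‖` is bounded by a polynomial in the affine coordinates, decay faster than every
polynomial in the latter beats every exponential in `L`. -/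
theorem exists_le_exp_neg_logCoords (hι : ∀ x : F, ‖ι (algebraMap F E x)‖ = ‖x‖) {m : ℕ}
    {x : Fin m → A} (hx : Algebra.adjoin F (Set.range x) = ⊤) {f : (Fin m → F) → ℝ}
    (hf0 : ∀ v, 0 ≤ f v) (hf : ∀ k : ℕ, ∃ C, ∀ v, (1 + ‖v‖) ^ k * f v ≤ C) (k : ℝ) :
    ∃ C, 0 ≤ C ∧ ∀ t : RatPoints F A,
      f (fun i => t.ofConv (x i)) ≤ C * Real.exp (-(k * ‖S.logCoords ι t‖)) := by
  obtain ⟨K, hK⟩ := exists_nat_ge k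
  obtain ⟨C₁, d, hC₁, h₁⟩ := S.exp_logCoords_le hι hx
  obtain ⟨C₂, h₂⟩ := hf (d * K)
  have hC₂ : 0 ≤ C₂ := le_trans (mul_nonneg (by positivity) (hf0 0)) (h₂ 0)
  refine ⟨C₁ ^ K * C₂, by positivity, fun t => ?_⟩
  rw [Real.exp_neg, ← div_eq_mul_inv, le_div_iff₀ (Real.exp_pos _)]
  have h3 : Real.exp (k * ‖S.logCoords ι t‖) ≤
      C₁ ^ K * (1 + ‖fun i => t.ofConv (x i)‖) ^ (d * K) := by
    calc _ ≤ Real.exp (K * ‖S.logCoords ι t‖) := Real.exp_le_exp.2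
          (mul_le_mul_of_nonneg_right hK (norm_nonneg _))
      _ = Real.exp ‖S.logCoords ι t‖ ^ K := by rw [← Real.exp_nat_mul]
      _ ≤ (C₁ * (1 + ‖fun i => t.ofConv (x i)‖) ^ d) ^ K :=
          pow_le_pow_left₀ (Real.exp_pos _).le (h₁ t) K
      _ = _ := by rw [mul_pow, ← pow_mul]
  calc _ ≤ f (fun i => t.ofConv (x i)) * (C₁ ^ K * (1 + ‖fun i => t.ofConv (x i)‖) ^ (d * K)) :=
        mul_le_mul_of_nonneg_left h3 (hf0 _)
    _ = C₁ ^ K * ((1 + ‖fun i => t.ofConv (x i)‖) ^ (d * K) * f (fun i => t.ofConv (x i))) := by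
        ring
    _ ≤ _ := mul_le_mul_of_nonneg_left (h₂ _) (by positivity)

end SplitCoords

theorem SchwartzMap.exists_one_add_pow_mul_norm_le {V W : Type*} [NormedAddCommGroup V]
    [NormedSpace ℝ V] [NormedAddCommGroup W] [NormedSpace ℝ W] (f : 𝓢(V, W)) (k : ℕ) :
    ∃ C, ∀ v, (1 + ‖v‖) ^ k * ‖f v‖ ≤ C := by
  refine ⟨2 ^ k * ((Finset.Iic (k, 0)).sup fun m => SchwartzMap.seminorm ℝ m.1 m.2) f,
    fun v => ?_⟩
  have := SchwartzMap.one_add_le_sup_seminorm_apply (𝕜 := ℝ) (m := (k, 0)) le_rfl le_rfl f v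
  rwa [norm_iteratedFDeriv_zero] at this

theorem norm_zpow_le_two_pow {F : Type*} [RCLike F] {γ : F} (h : ‖γ - 1‖ ≤ 1 / 2) (m : ℤ) :
    ‖γ ^ m‖ ≤ Real.exp (|(m : ℝ)| * Real.log 2) ∧ |Real.log ‖γ‖| ≤ Real.log 2 := by
  have h1 : |‖γ‖ - 1| ≤ 1 / 2 := by
    have := (abs_norm_sub_norm_le γ 1).trans h
    rwa [norm_one] at this
  obtain ⟨h2, h3⟩ := abs_le.1 h1
  have hpos : 0 < ‖γ‖ := by linarith
  have hlog : |Real.log ‖γ‖| ≤ Real.log 2 := by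
    rw [abs_le]
    constructor
    · rw [← Real.log_inv]
      exact Real.log_le_log (by norm_num) (by linarith)
    · exact Real.log_le_log hpos (by linarith)
  refine ⟨?_, hlog⟩
  rw [norm_zpow, ← Real.log_le_iff_le_exp (zpow_pos hpos m), Real.log_zpow]
  refine (le_abs_self _).trans ?_
  rw [abs_mul]
  exact mul_le_mul_of_nonneg_left hlog (abs_nonneg _)

/-! ### Decay and difference bounds for Schwartz functions on a torus -/

namespace IsSchwartzArch

variable {F A E : Type*} [RCLike F] [CommRing A] [HopfAlgebra F A] [Field E] [Algebra F E] {n : ℕ}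
  {S : SplitCoords F A E n} {ι : E →+* ℂ} {Φ : RatPoints F A → ℂ}

theorem continuous (hΦ : IsSchwartzArch Φ) : Continuous Φ := by
  obtain ⟨m, x, hx, h, hh⟩ := hΦ
  rw [funext hh]
  exact h.continuous.comp (continuous_pi fun i => RatPoints.continuous_eval (x i))

theorem exists_norm_le (hΦ : IsSchwartzArch Φ) (hι : ∀ x : F, ‖ι (algebraMap F E x)‖ = ‖x‖)
    (k : ℝ) : ∃ C, ∀ t, ‖Φ t‖ ≤ C * Real.exp (-(k * ‖S.logCoords ι t‖)) := by
  obtain ⟨m, x, hx, h, hh⟩ := hΦ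
  obtain ⟨C, -, hC⟩ := S.exists_le_exp_neg_logCoords hι hx (f := fun v => ‖h v‖)
    (fun _ => norm_nonneg _) h.exists_one_add_pow_mul_norm_le k
  exact ⟨C, fun t => by rw [hh]; exact hC t⟩

-- Mean value inequality along the segment `γ` from `1` to `g`. The affine coordinates of `λ(γ)⁻¹y`
-- are Laurent polynomials in `γ`, with derivative of size `‖g - 1‖` times an exponential in `L y`.
-- The derivative of the Schwartz function decays faster than any exponential, and `L` changes along
-- the path by a bounded amount.
set_option maxHeartbeats 800000 in
theorem exists_norm_sub_le (hΦ : IsSchwartzArch Φ) (hι : ∀ x : F, ‖ι (algebraMap F E x)‖ = ‖x‖)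
    (hL : IsLogMap (S.logCoords ι)) {lam : A →ₐc[F] AddMonoidAlgebra F ℤ}
    {M : Fin n → ℝ} (hl : ∀ x : Fˣ, S.logCoords ι (cocharPoints lam x) = Real.log ‖(x : F)‖ • M)
    (k : ℝ) : ∃ C, ∀ y, ∀ g : Fˣ, ‖(g : F) - 1‖ ≤ 1 / 2 →
      ‖Φ ((cocharPoints lam g)⁻¹ * y) - Φ y‖ ≤
        C * ‖(g : F) - 1‖ * Real.exp (-(k * ‖S.logCoords ι y‖)) := by
  obtain ⟨m, x, hx, h, hh⟩ := hΦ
  choose c hc using fun i => exists_cochar_mul_eq lam (x i)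
  choose B e hB he hb using fun a => S.norm_eval_le hι a
  let k₂ : ℝ := ∑ i, ∑ q ∈ (c i).support, e q.2
  have hk₂ : ∀ i, ∀ q ∈ (c i).support, e q.2 ≤ k₂ := fun i q hq =>
    (Finset.single_le_sum (f := fun q : ℤ × A => e q.2) (fun q _ => he q.2) hq).trans
      (Finset.single_le_sum (f := fun i => ∑ q ∈ (c i).support, e q.2)
        (fun i _ => Finset.sum_nonneg fun q _ => he q.2) (Finset.mem_univ i))
  let D : Fin m → ℝ := fun i => ∑ q ∈ (c i).support,
    ‖c i q‖ * (|(q.1 : ℝ)| * Real.exp (|((q.1 - 1 : ℤ) : ℝ)| * Real.log 2) * B q.2)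
  have hD : ∀ i, 0 ≤ D i := fun i => Finset.sum_nonneg fun q _ =>
    mul_nonneg (norm_nonneg _) (mul_nonneg (by positivity) (hB _))
  -- The rate `k₂` pays for the growth of the coordinates; nonnegativity is needed to transfer the
  -- decay from the points of the path to `y`.
  set k₁ := max (k + k₂) 0 with hk₁
  obtain ⟨C, hC0, hC⟩ := S.exists_le_exp_neg_logCoords hι hx (f := fun v => ‖fderiv ℝ h v‖)
    (fun _ => norm_nonneg _) (fun k => by
      obtain ⟨C, hC⟩ := (SchwartzMap.fderivCLM ℝ _ _ h).exists_one_add_pow_mul_norm_le k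
      exact ⟨C, fun v => by simpa [SchwartzMap.fderivCLM_apply] using hC v⟩) k₁
  refine ⟨C * Real.exp (k₁ * (Real.log 2 * ‖M‖)) * ∑ i, D i, fun y g hg => ?_⟩
  set N := ‖S.logCoords ι y‖ with hN
  have hN0 : 0 ≤ N := norm_nonneg _
  let γ : ℝ → F := fun τ => 1 + τ * ((g : F) - 1)
  have hγ : ∀ τ ∈ Set.Icc (0 : ℝ) 1, ‖γ τ - 1‖ ≤ 1 / 2 := fun τ hτ => by
    simp only [γ, add_sub_cancel_left, norm_mul, RCLike.norm_ofReal, abs_of_nonneg hτ.1]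
    calc _ ≤ 1 * ‖(g : F) - 1‖ := mul_le_mul_of_nonneg_right hτ.2 (norm_nonneg _)
      _ ≤ _ := by rwa [one_mul]
  have hγ0 : ∀ τ ∈ Set.Icc (0 : ℝ) 1, γ τ ≠ 0 := fun τ hτ h0 => by
    have := hγ τ hτ
    rw [h0] at this
    norm_num at this
  have hγd : ∀ τ, HasDerivAt γ ((g : F) - 1) τ := fun τ => by
    have h1 : HasDerivAt (fun τ : ℝ => (τ : F)) 1 τ := by
      simpa using (RCLike.ofRealCLM (K := F)).hasDerivAt (x := τ)
    simpa [γ] using (h1.mul_const ((g : F) - 1)).const_add 1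
  let Y : ℝ → Fin m → F := fun τ i => ∑ q ∈ (c i).support, c i q * (γ τ ^ q.1 * y.ofConv q.2)
  let Y' : ℝ → Fin m → F := fun τ i => ∑ q ∈ (c i).support,
    c i q * (((g : F) - 1) * (q.1 * γ τ ^ (q.1 - 1)) * y.ofConv q.2)
  have hYd : ∀ τ ∈ Set.Icc (0 : ℝ) 1, HasDerivAt Y (Y' τ) τ := fun τ hτ => by
    refine hasDerivAt_pi.2 fun i => HasDerivAt.fun_sum fun q _ => ?_
    exact (((hasDerivAt_zpow q.1 (γ τ) (Or.inl (hγ0 τ hτ))).scomp τ (hγd τ)).mul_const _).const_mul _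
  have hY' : ∀ τ ∈ Set.Icc (0 : ℝ) 1,
      ‖Y' τ‖ ≤ (∑ i, D i) * ‖(g : F) - 1‖ * Real.exp (k₂ * N) := fun τ hτ => by
    refine (pi_norm_le_iff_of_nonneg (mul_nonneg (mul_nonneg (Finset.sum_nonneg fun i _ => hD i)
      (norm_nonneg _)) (Real.exp_pos _).le)).2 fun i => ?_
    refine le_trans ?_ (mul_le_mul_of_nonneg_right (mul_le_mul_of_nonneg_right
      (Finset.single_le_sum (fun i _ => hD i) (Finset.mem_univ i)) (norm_nonneg _))
      (Real.exp_pos _).le)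
    simp only [Y', D, Finset.sum_mul]
    refine (norm_sum_le _ _).trans (Finset.sum_le_sum fun q hq => ?_)
    have e1 := (norm_zpow_le_two_pow (hγ τ hτ) (q.1 - 1)).1
    have e2 : ‖y.ofConv q.2‖ ≤ B q.2 * Real.exp (k₂ * N) := (hb q.2 y).trans
      (mul_le_mul_of_nonneg_left (Real.exp_le_exp.2
        (mul_le_mul_of_nonneg_right (hk₂ i q hq) hN0)) (hB _))
    have e3 : ‖((q.1 : ℤ) : F)‖ = |(q.1 : ℝ)| := by
      rw [← RCLike.ofReal_intCast, RCLike.norm_ofReal]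
    rw [norm_mul, norm_mul, norm_mul, norm_mul, e3]
    calc _ ≤ ‖c i q‖ * (‖(g : F) - 1‖ * (|(q.1 : ℝ)| *
          Real.exp (|((q.1 - 1 : ℤ) : ℝ)| * Real.log 2)) * (B q.2 * Real.exp (k₂ * N))) := by
          gcongr
      _ = _ := by ring
  have hYp : ∀ τ ∈ Set.Icc (0 : ℝ) 1, ‖fderiv ℝ h (Y τ)‖ ≤
      C * (Real.exp (k₁ * (Real.log 2 * ‖M‖)) * Real.exp (-(k₁ * N))) := fun τ hτ => by
    have h1 : Y τ = fun i => ((cocharPoints lam (Units.mk0 _ (hγ0 τ hτ)))⁻¹ * y).ofConv (x i) := by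
      funext i
      rw [hc i, Units.val_mk0]
    rw [h1]
    refine (hC _).trans (mul_le_mul_of_nonneg_left ?_ hC0)
    rw [← Real.exp_add, Real.exp_le_exp]
    have h2 : S.logCoords ι y = S.logCoords ι ((cocharPoints lam (Units.mk0 _ (hγ0 τ hτ)))⁻¹ * y) +
        S.logCoords ι (cocharPoints lam (Units.mk0 _ (hγ0 τ hτ))) := by
      rw [hL.map_mul, hL.map_inv]
      abel
    have h3 : N ≤ ‖S.logCoords ι ((cocharPoints lam (Units.mk0 _ (hγ0 τ hτ)))⁻¹ * y)‖ +
        Real.log 2 * ‖M‖ := by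
      rw [hN, h2]
      refine (norm_add_le _ _).trans (add_le_add_right ?_ _)
      rw [hl, norm_smul, Real.norm_eq_abs]
      exact mul_le_mul_of_nonneg_right (norm_zpow_le_two_pow (hγ τ hτ) 0).2 (norm_nonneg _)
    have h4 : 0 ≤ k₁ := le_max_right _ _
    nlinarith
  have hmain := norm_image_sub_le_of_norm_deriv_le_segment_01' (f := h ∘ Y)
    (f' := fun τ => fderiv ℝ h (Y τ) (Y' τ))
    (C := C * (Real.exp (k₁ * (Real.log 2 * ‖M‖)) * Real.exp (-(k₁ * N))) *
      ((∑ i, D i) * ‖(g : F) - 1‖ * Real.exp (k₂ * N)))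
    (fun τ hτ => (h.differentiableAt.hasFDerivAt).comp_hasDerivWithinAt τ
      (hYd τ hτ).hasDerivWithinAt)
    (fun τ hτ => (ContinuousLinearMap.le_opNorm _ _).trans
      (mul_le_mul (hYp τ ⟨hτ.1, hτ.2.le⟩) (hY' τ ⟨hτ.1, hτ.2.le⟩) (norm_nonneg _)
        (by positivity)))
  have hY1 : (h ∘ Y) 1 = Φ ((cocharPoints lam g)⁻¹ * y) := by
    rw [hh, Function.comp]
    congr 1
    funext i
    rw [hc i g y]
    simp [Y, γ]
  have hY0 : (h ∘ Y) 0 = Φ y := by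
    rw [hh, Function.comp]
    congr 1
    funext i
    have := hc i 1 y
    rw [map_one, inv_one, one_mul] at this
    rw [this]
    simp [Y, γ]
  rw [hY1, hY0] at hmain
  refine hmain.trans ?_
  have h5 : Real.exp (-(k₁ * N)) * Real.exp (k₂ * N) ≤ Real.exp (-(k * N)) := by
    rw [← Real.exp_add, Real.exp_le_exp]
    have : k + k₂ ≤ k₁ := le_max_left _ _
    nlinarith
  calc _ = C * Real.exp (k₁ * (Real.log 2 * ‖M‖)) * (∑ i, D i) * ‖(g : F) - 1‖ *
        (Real.exp (-(k₁ * N)) * Real.exp (k₂ * N)) := by ring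
    _ ≤ _ := mul_le_mul_of_nonneg_left h5 (mul_nonneg (mul_nonneg (by positivity)
      (Finset.sum_nonneg fun i _ => hD i)) (norm_nonneg _))

end IsSchwartzArch

/-! ### Zeta integrals of Gaussians -/

section RadialGaussian

/-- The Gamma integral at `z / 2` after the substitution `y ↦ y²`. -/
theorem integral_cpow_mul_exp_neg_mul_sq_Ioi {A : ℝ} (hA : 0 < A) {z : ℂ} (hz : 0 < z.re) :
    ∫ y in Set.Ioi (0 : ℝ), (y : ℂ)⁻¹ * ((y : ℂ) ^ z * Complex.exp (-A * (y : ℂ) ^ 2)) =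
      1 / 2 * (A : ℂ) ^ (-(z / 2)) * Complex.Gamma (z / 2) := by
  have h1 := Complex.integral_cpow_mul_exp_neg_mul_Ioi (a := z / 2) (r := A)
    (by simpa using hz) (by simpa using hA)
  have h2 : (1 / (A : ℂ)) ^ (z / 2) = (A : ℂ) ^ (-(z / 2)) := by
    rw [one_div, Complex.inv_cpow _ _ (by rw [Complex.arg_ofReal_of_nonneg hA.le]
                                          exact Real.pi_pos.ne), Complex.cpow_neg]
  rw [h2, ← integral_comp_rpow_Ioi_of_pos zero_lt_two] at h1
  rw [mul_assoc, ← h1, ← integral_const_mul]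
  refine setIntegral_congr_fun measurableSet_Ioi fun y hy => ?_
  have hy0 : (0 : ℝ) < y := hy
  have hyc : (y : ℂ) ≠ 0 := by exact_mod_cast hy0.ne'
  have h3 : ((y ^ (2 : ℝ) : ℝ) : ℂ) = (y : ℂ) ^ 2 := by
    rw [Real.rpow_two]
    push_cast
    rfl
  have h4 : ((y : ℂ) ^ 2) ^ (z / 2 - 1) = (y : ℂ) ^ z * ((y : ℂ) ^ 2)⁻¹ := by
    have h5 : ((y : ℂ) ^ 2) ^ (z / 2) = (y : ℂ) ^ z := by
      rw [← Complex.ofReal_pow, Complex.cpow_def_of_ne_zero (by exact_mod_cast (pow_pos hy0 2).ne'),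
        Complex.cpow_def_of_ne_zero hyc, ← Complex.ofReal_log (by positivity),
        ← Complex.ofReal_log hy0.le, Real.log_pow]
      congr 1
      push_cast
      ring
    rw [Complex.cpow_sub _ _ (pow_ne_zero 2 hyc), Complex.cpow_one, h5, div_eq_mul_inv]
  rw [h3, h4, Complex.real_smul]
  norm_num
  field_simp

theorem integrableOn_cpow_mul_exp_neg_mul_sq_Ioi {A : ℝ} (hA : 0 < A) {z : ℂ} (hz : 0 < z.re) :
    IntegrableOn (fun y : ℝ => (y : ℂ)⁻¹ * ((y : ℂ) ^ z * Complex.exp (-A * (y : ℂ) ^ 2)))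
      (Set.Ioi 0) := by
  have h := integrableOn_rpow_mul_exp_neg_mul_sq hA (s := z.re - 1) (by linarith)
  have hm : AEStronglyMeasurable
      (fun y : ℝ => (y : ℂ)⁻¹ * ((y : ℂ) ^ z * Complex.exp (-A * (y : ℂ) ^ 2)))
      (volume.restrict (Set.Ioi 0)) := by
    refine ContinuousOn.aestronglyMeasurable (fun y hy => ?_) measurableSet_Ioi
    have hy0 : (0 : ℝ) < y := hy
    have hyc : (y : ℂ) ≠ 0 := by exact_mod_cast hy0.ne'
    refine ContinuousAt.continuousWithinAt ?_
    refine (Complex.continuous_ofReal.continuousAt.inv₀ hyc).mul (ContinuousAt.mul ?_ ?_)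
    · exact ContinuousAt.comp (f := fun y : ℝ => (y : ℂ)) (g := fun x : ℂ => x ^ z)
        (continuousAt_cpow_const (Or.inl (by simpa using hy0)))
        Complex.continuous_ofReal.continuousAt
    · fun_prop
  refine Integrable.mono' h hm ((ae_restrict_iff' measurableSet_Ioi).2 (ae_of_all _ fun y hy => ?_))
  have hy0 : (0 : ℝ) < y := hy
  rw [norm_mul, norm_mul, norm_inv, Complex.norm_cpow_eq_rpow_re_of_pos hy0, Complex.norm_real,
    Real.norm_of_nonneg hy0.le, Complex.norm_exp, Real.rpow_sub_one hy0.ne']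
  refine le_of_eq ?_
  have : (-(A : ℂ) * (y : ℂ) ^ 2).re = -A * y ^ 2 := by
    rw [← Complex.ofReal_pow, ← Complex.ofReal_neg, ← Complex.ofReal_mul, Complex.ofReal_re]
  rw [this]
  field_simp

variable {F : Type*} [RCLike F] [MeasurableSpace F] [BorelSpace F] (dx : Measure F)
  [dx.IsAddHaarMeasure]

theorem integrable_radial_gaussian {A : ℝ} (hA : 0 < A) {z : ℂ} (hz : 0 < z.re) :
    Integrable (fun y : Fˣ => (‖(y : F)‖ : ℂ) ^ z * Complex.exp (-A * (‖(y : F)‖ : ℂ) ^ 2))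
      (mulMeasure dx) :=
  (integrable_norm_mulMeasure_iff dx
    (f := fun r => (r : ℂ) ^ z * Complex.exp (-A * (r : ℂ) ^ 2))).2
    (integrableOn_cpow_mul_exp_neg_mul_sq_Ioi hA hz)

theorem integral_radial_gaussian {A : ℝ} (hA : 0 < A) {z : ℂ} (hz : 0 < z.re) :
    ∫ y : Fˣ, (‖(y : F)‖ : ℂ) ^ z * Complex.exp (-A * (‖(y : F)‖ : ℂ) ^ 2) ∂(mulMeasure dx) =
      radialConst dx * (1 / 2 * (A : ℂ) ^ (-(z / 2)) * Complex.Gamma (z / 2)) := by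
  rw [← integral_cpow_mul_exp_neg_mul_sq_Ioi hA hz]
  exact integral_norm_mulMeasure dx fun r => (r : ℂ) ^ z * Complex.exp (-A * (r : ℂ) ^ 2)

theorem HasRealExponent.unique {ω : Fˣ →ₜ* ℂˣ} {r r' : ℝ} (h : HasRealExponent ω r)
    (h' : HasRealExponent ω r') : r = r' := by
  have h1 := (h (expUnit F 1)).symm.trans (h' (expUnit F 1))
  have h2 := congrArg Real.log h1
  rw [Real.log_rpow (absF_pos _), Real.log_rpow (absF_pos _), log_absF, norm_expUnit,
    Real.log_exp] at h2
  have := finrank_rclike_pos (F := F)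
  exact mul_right_cancel₀ (by positivity) h2

/-- The zeta ratio of a character from a Gaussian test function, multiplied by a homogeneous
function `P` whose angular part is inverse to that of `ω`. -/
theorem hasZetaRatio_gaussian {dx : Measure F} [dx.IsAddHaarMeasure] {ψ : AddChar F Circle}
    {ω : Fˣ →ₜ* ℂˣ} {w : ℂ}
    {N : ℕ} {A : ℝ} (hA : 0 < A) (hω : HasRealExponent ω w.re) {P P' : F → ℂ}
    (hP : ∀ y : Fˣ, P y * ω y = (‖(y : F)‖ : ℂ) ^ (N + Module.finrank ℝ F * w))
    (hP' : ∀ y : Fˣ, P' y * (ω y : ℂ)⁻¹ = (‖(y : F)‖ : ℂ) ^ (N - Module.finrank ℝ F * w)) {C : ℂ}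
    (hint_g : Integrable (fun x => P x * Complex.exp (-A * (‖x‖ : ℂ) ^ 2)) dx)
    (hFT : ∀ y, ∫ x, P x * Complex.exp (-A * (‖x‖ : ℂ) ^ 2) * (ψ (x * y) : ℂ) ∂dx =
      C * (P' y * Complex.exp (-A * (‖y‖ : ℂ) ^ 2))) (s : ℂ)
    (hΓ : Complex.Gamma ((N + Module.finrank ℝ F * (s - w)) / 2) ≠ 0) :
    HasZetaRatio ψ dx s ω (1 / Module.finrank ℝ F)
      (C * ((A : ℂ) ^ ((N + Module.finrank ℝ F * (w + 1 - s)) / 2) *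
          (Complex.Gamma ((N + Module.finrank ℝ F * (w + 1 - s)) / 2))⁻¹) /
        ((A : ℂ) ^ ((N + Module.finrank ℝ F * (s - w)) / 2) *
          (Complex.Gamma ((N + Module.finrank ℝ F * (s - w)) / 2))⁻¹)) := by
  have hd := finrank_rclike_pos (F := F)
  set d := Module.finrank ℝ F with hd'
  have hAc : (A : ℂ) ≠ 0 := by exact_mod_cast hA.ne'
  have hdiff : ∀ u : ℂ → ℂ, Differentiable ℂ u →
      Differentiable ℂ fun κ => (A : ℂ) ^ (u κ) * (Complex.Gamma (u κ))⁻¹ := fun u hu =>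
    (hu.const_cpow (Or.inl hAc)).mul (Complex.differentiable_one_div_Gamma.comp hu)
  -- Both zeta integrals are Gamma values up to exponentials; as `1/Γ` is entire,
  -- cross-multiplication gives entire `a` and `b`.
  refine ⟨fun κ => C * ((A : ℂ) ^ ((N + d * (w + κ + 1 - s)) / 2) *
      (Complex.Gamma ((N + d * (w + κ + 1 - s)) / 2))⁻¹),
    fun κ => (A : ℂ) ^ ((N + d * (s - w - κ)) / 2) *
      (Complex.Gamma ((N + d * (s - w - κ)) / 2))⁻¹,
    (hdiff _ (by fun_prop)).const_mul C, hdiff _ (by fun_prop), ?_, ?_, ?_⟩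
  · simp only [sub_zero]
    exact mul_ne_zero (by simp [Complex.cpow_eq_zero_iff, hAc]) (inv_ne_zero hΓ)
  · simp only [sub_zero, add_zero]
  intro r κ hr h0 h1
  have hrw : r = w.re := hr.unique hω
  subst hrw
  have hz₂ : 0 < ((N : ℂ) + d * (s - w - κ)).re := by
    have : ((N : ℂ) + d * (s - w - κ)).re = N + d * (s.re - w.re - κ.re) := by simp
    rw [this]
    have : 0 < (d : ℝ) * (s.re - w.re - κ.re) := mul_pos hd h0
    positivity
  have hz₁ : 0 < ((N : ℂ) + d * (w + κ + 1 - s)).re := by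
    have h2 : ((N : ℂ) + d * (w + κ + 1 - s)).re = N + (d - d * (s.re - w.re - κ.re)) := by
      simp
      ring
    have h3 : (d : ℝ) * (s.re - w.re - κ.re) < 1 := by
      rwa [lt_div_iff₀ hd, mul_comm] at h1
    have h4 : (1 : ℝ) ≤ d := by exact_mod_cast Module.finrank_pos (R := ℝ) (M := F)
    have h5 : (0 : ℝ) ≤ N := Nat.cast_nonneg _
    rw [h2]
    linarith
  have hn0 : ∀ y : Fˣ, (‖(y : F)‖ : ℂ) ≠ 0 := fun y => by exact_mod_cast (norm_unit_pos y).ne'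
  have e1 : ∀ y : Fˣ, P y * Complex.exp (-A * (‖(y : F)‖ : ℂ) ^ 2) *
      ((ω y : ℂ) * (absF y : ℂ) ^ κ) * (absF y : ℂ) ^ (1 - s) =
      (‖(y : F)‖ : ℂ) ^ ((N : ℂ) + d * (w + κ + 1 - s)) *
        Complex.exp (-A * (‖(y : F)‖ : ℂ) ^ 2) := fun y => by
    have : (‖(y : F)‖ : ℂ) ^ ((N : ℂ) + d * (w + κ + 1 - s)) =
        P y * ω y * (absF y : ℂ) ^ κ * (absF y : ℂ) ^ (1 - s) := by
      rw [hP, absF_cpow, absF_cpow, ← Complex.cpow_add _ _ (hn0 y), ← Complex.cpow_add _ _ (hn0 y)]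
      congr 1
      ring
    rw [this]
    ring
  have e2 : ∀ y : Fˣ, (∫ x, P x * Complex.exp (-A * (‖x‖ : ℂ) ^ 2) * (ψ (x * y) : ℂ) ∂dx) *
      ((ω y : ℂ) * (absF y : ℂ) ^ κ)⁻¹ * (absF y : ℂ) ^ s =
      C * ((‖(y : F)‖ : ℂ) ^ ((N : ℂ) + d * (s - w - κ)) *
        Complex.exp (-A * (‖(y : F)‖ : ℂ) ^ 2)) := fun y => by
    have : (‖(y : F)‖ : ℂ) ^ ((N : ℂ) + d * (s - w - κ)) =
        P' y * (ω y : ℂ)⁻¹ * ((absF y : ℂ) ^ κ)⁻¹ * (absF y : ℂ) ^ s := by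
      rw [hP', ← Complex.cpow_neg, absF_cpow, absF_cpow, ← Complex.cpow_add _ _ (hn0 y),
        ← Complex.cpow_add _ _ (hn0 y)]
      congr 1
      ring
    rw [hFT, this, mul_inv]
    ring
  have hR : (radialConst dx : ℂ) ≠ 0 := by exact_mod_cast (radialConst_pos dx).ne'
  have hA0 : ∀ z : ℂ, (A : ℂ) ^ z ≠ 0 := fun z => by simp [Complex.cpow_eq_zero_iff, hAc]
  have hG₁ := Complex.Gamma_ne_zero_of_re_pos (s := ((N : ℂ) + d * (w + κ + 1 - s)) / 2)
    (by simpa using hz₁)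
  have hG₂ := Complex.Gamma_ne_zero_of_re_pos (s := ((N : ℂ) + d * (s - w - κ)) / 2)
    (by simpa using hz₂)
  refine ⟨fun x => P x * Complex.exp (-A * (‖x‖ : ℂ) ^ 2), hint_g, ?_, ?_, ?_, ?_⟩
  · simp only [e1]
    exact integrable_radial_gaussian dx hA hz₁
  · simp only [e2]
    exact (integrable_radial_gaussian dx hA hz₂).const_mul C
  · simp only [e1]
    rw [integral_radial_gaussian dx hA hz₁]
    exact mul_ne_zero hR (mul_ne_zero (mul_ne_zero (by norm_num) (hA0 _)) hG₁)
  · simp only [e1, e2]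
    rw [integral_const_mul, integral_radial_gaussian dx hA hz₁, integral_radial_gaussian dx hA hz₂,
      Complex.cpow_neg, Complex.cpow_neg]
    have := hA0 (((N : ℂ) + d * (s - w - κ)) / 2)
    have := hA0 (((N : ℂ) + d * (w + κ + 1 - s)) / 2)
    field_simp

end RadialGaussian

/-! ### Fourier transforms of Gaussians and integration by parts -/

section GaussianFourier

open scoped InnerProductSpace

variable {V : Type*} [NormedAddCommGroup V] [InnerProductSpace ℝ V] [FiniteDimensional ℝ V]
  [MeasurableSpace V] [BorelSpace V] (μ : Measure V) [μ.IsAddHaarMeasure]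

/-- The constant depends on the normalization of `μ` and is left open; self-duality determines it
later. -/
theorem exists_fourier_gaussian {A : ℝ} (hA : 0 < A) : ∃ C : ℝ, 0 < C ∧ ∀ w : V,
    ∫ v, Complex.exp (-A * (‖v‖ : ℂ) ^ 2) * Complex.exp ((2 * Real.pi * ⟪w, v⟫_ℝ : ℝ) * Complex.I) ∂μ =
      C * Complex.exp (-(Real.pi ^ 2 * ‖w‖ ^ 2 / A : ℝ)) := by
  have hμ := Measure.isAddLeftInvariant_eq_smul μ (volume : Measure V)
  set c := Measure.addHaarScalarFactor μ (volume : Measure V) with hc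
  have hc0 : 0 < c := Measure.addHaarScalarFactor_pos_of_isAddHaarMeasure _ _
  refine ⟨c * (Real.pi / A) ^ (Module.finrank ℝ V / 2 : ℝ), by positivity, fun w => ?_⟩
  have h := GaussianFourier.integral_cexp_neg_mul_sq_norm_add (b := (A : ℂ)) (V := V)
    (by simpa using hA) (2 * Real.pi * Complex.I) w
  rw [hμ, integral_smul_nnreal_measure, NNReal.smul_def, Complex.real_smul]
  have h1 : ∀ v : V, Complex.exp (-A * (‖v‖ : ℂ) ^ 2) *
      Complex.exp ((2 * Real.pi * ⟪w, v⟫_ℝ : ℝ) * Complex.I) =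
      Complex.exp (-A * (‖v‖ : ℂ) ^ 2 + 2 * Real.pi * Complex.I * ⟪w, v⟫_ℝ) := fun v => by
    rw [← Complex.exp_add]
    congr 1
    push_cast
    ring
  simp only [h1]
  rw [h]
  have h2 : ((Real.pi : ℂ) / A) ^ ((Module.finrank ℝ V : ℂ) / 2) =
      (((Real.pi / A) ^ (Module.finrank ℝ V / 2 : ℝ) : ℝ) : ℂ) := by
    rw [Complex.ofReal_cpow (by positivity)]
    push_cast
    rfl
  rw [h2]
  have h3 : (2 * Real.pi * Complex.I) ^ 2 * (‖w‖ : ℂ) ^ 2 / (4 * A) =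
      ((-(Real.pi ^ 2 * ‖w‖ ^ 2 / A) : ℝ) : ℂ) := by
    push_cast
    rw [mul_pow, Complex.I_sq]
    have : (A : ℂ) ≠ 0 := by exact_mod_cast hA.ne'
    field_simp
    ring
  rw [h3]
  push_cast
  ring

/-- Half of the Gaussian absorbs the polynomial growth, the other half is integrable. -/
theorem integrable_pow_mul_gaussian {A : ℝ} (hA : 0 < A) (k : ℕ) {f : V → ℂ} (hf : Continuous f)
    {K : ℝ} (hK : ∀ v, ‖f v‖ ≤ K * ‖v‖ ^ k) :
    Integrable (fun v : V => f v * Complex.exp (-A * (‖v‖ : ℂ) ^ 2)) μ := by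
  have hμ := Measure.isAddLeftInvariant_eq_smul μ (volume : Measure V)
  have h := (GaussianFourier.integrable_cexp_neg_mul_sq_norm_add (b := ((A / 2 : ℝ) : ℂ)) (V := V)
    (by simpa using hA) 0 0)
  rw [hμ]
  refine Integrable.smul_measure_nnreal ?_
  refine (h.norm.const_mul (|K| * (1 + k.factorial / (A / 2) ^ k))).mono'
    (Continuous.aestronglyMeasurable (by fun_prop)) (ae_of_all _ fun v => ?_)
  have e1 : (-(A : ℂ) * (‖v‖ : ℂ) ^ 2).re = -(A / 2 * ‖v‖ ^ 2) + -(A / 2 * ‖v‖ ^ 2) := by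
    rw [← Complex.ofReal_pow, ← Complex.ofReal_neg, ← Complex.ofReal_mul, Complex.ofReal_re]
    ring
  have e2 : (-((A / 2 : ℝ) : ℂ) * (‖v‖ : ℂ) ^ 2 + 0 * ((inner ℝ 0 v : ℝ) : ℂ)).re =
      -(A / 2 * ‖v‖ ^ 2) := by
    rw [zero_mul, add_zero, ← Complex.ofReal_pow, ← Complex.ofReal_neg, ← Complex.ofReal_mul,
      Complex.ofReal_re]
    ring
  rw [norm_mul, Complex.norm_exp, Complex.norm_exp, e1, e2, Real.exp_add, ← mul_assoc]
  refine mul_le_mul_of_nonneg_right ?_ (Real.exp_pos _).le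
  have h1 : ‖v‖ ^ k ≤ 1 + (‖v‖ ^ 2) ^ k := by
    rcases le_total ‖v‖ 1 with h | h
    · have := pow_le_one₀ (n := k) (norm_nonneg v) h
      have : 0 ≤ (‖v‖ ^ 2) ^ k := by positivity
      linarith
    · have := pow_le_pow_right₀ h (show k ≤ 2 * k by omega)
      rw [pow_mul] at this
      linarith
  have h2 := Real.pow_div_factorial_le_exp (A / 2 * ‖v‖ ^ 2) (by positivity) k
  have h3 : (‖v‖ ^ 2) ^ k ≤ k.factorial / (A / 2) ^ k * Real.exp (A / 2 * ‖v‖ ^ 2) := by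
    rw [div_le_iff₀ (by positivity), mul_pow] at h2
    rw [div_mul_eq_mul_div, le_div_iff₀ (by positivity)]
    linarith
  have h4 : (1 : ℝ) ≤ Real.exp (A / 2 * ‖v‖ ^ 2) := Real.one_le_exp (by positivity)
  have h5 : ‖f v‖ ≤ |K| * ‖v‖ ^ k := (hK v).trans
    (mul_le_mul_of_nonneg_right (le_abs_self K) (by positivity))
  rw [Real.exp_neg, ← div_eq_mul_inv, div_le_iff₀ (Real.exp_pos _)]
  calc ‖f v‖ ≤ |K| * ‖v‖ ^ k := h5
    _ ≤ |K| * ((1 + k.factorial / (A / 2) ^ k) * Real.exp (A / 2 * ‖v‖ ^ 2)) := by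
        refine mul_le_mul_of_nonneg_left ?_ (abs_nonneg K)
        linarith
    _ = _ := by ring

/-- Integration by parts against a Gaussian. -/
theorem integral_inner_mul_gaussian {A : ℝ} (hA : 0 < A) {p ℓ : V →L[ℝ] ℂ} (hℓ : ∀ v, (ℓ v).re = 0)
    (n : ℕ) (e : V) :
    2 * A * ∫ v, ⟪v, e⟫_ℝ * p v ^ n * Complex.exp (-A * (‖v‖ : ℂ) ^ 2) * Complex.exp (ℓ v) ∂μ =
      ∫ v, (n * p v ^ (n - 1) * p e + p v ^ n * ℓ e) * Complex.exp (-A * (‖v‖ : ℂ) ^ 2) *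
        Complex.exp (ℓ v) ∂μ := by
  let f : V → ℂ := fun v => p v ^ n * Complex.exp (ℓ v)
  let f' : V → ℂ := fun v => (n * p v ^ (n - 1) * p e + p v ^ n * ℓ e) * Complex.exp (ℓ v)
  let g : V → ℂ := fun v => Complex.exp (-A * (‖v‖ : ℂ) ^ 2)
  let g' : V → ℂ := fun v => -(2 * A * ⟪v, e⟫_ℝ) * Complex.exp (-A * (‖v‖ : ℂ) ^ 2)
  have hlin : ∀ q : V →L[ℝ] ℂ, ∀ v, HasDerivAt (fun t : ℝ => q (v + t • e)) (q e) 0 := fun q v => by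
    have h1 : HasDerivAt (fun t : ℝ => v + t • e) e 0 := by
      simpa using ((hasDerivAt_id (0 : ℝ)).smul_const e).const_add v
    exact q.hasFDerivAt.comp_hasDerivAt (0 : ℝ) h1
  have hf : ∀ v, HasLineDerivAt ℝ f (f' v) v e := fun v => by
    refine HasDerivAt.congr_deriv (((hlin p v).pow n).mul (hlin ℓ v).cexp) ?_
    simp only [f', Pi.pow_apply, zero_smul, add_zero]
    ring
  have hg : ∀ v, HasLineDerivAt ℝ g (g' v) v e := fun v => by
    have h1 : HasDerivAt (fun t : ℝ => v + t • e) e 0 := by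
      simpa using ((hasDerivAt_id (0 : ℝ)).smul_const e).const_add v
    have h2 := h1.norm_sq
    simp only [zero_smul, add_zero] at h2
    have h3 := ((h2.ofReal_comp).const_mul (-A : ℂ)).cexp
    simp only [Complex.ofReal_pow] at h3
    refine HasDerivAt.congr_deriv h3 ?_
    simp only [g', zero_smul, add_zero]
    push_cast
    ring
  have hexp : ∀ v, ‖Complex.exp (ℓ v)‖ = 1 := fun v => by rw [Complex.norm_exp, hℓ, Real.exp_zero]
  have hpn : ∀ k v, ‖p v ^ k‖ ≤ ‖p‖ ^ k * ‖v‖ ^ k := fun k v => by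
    rw [norm_pow, ← mul_pow]
    exact pow_le_pow_left₀ (norm_nonneg _) (p.le_opNorm v) k
  have hI : ∀ k, Integrable (fun v => p v ^ k * Complex.exp (ℓ v) * g v) μ := fun k =>
    integrable_pow_mul_gaussian μ hA k (by fun_prop) (K := ‖p‖ ^ k) fun v => by
      rw [norm_mul, hexp, mul_one]
      exact hpn k v
  have hfg : Integrable (fun v => f v * g v) μ := hI n
  have hf'g : Integrable (fun v => f' v * g v) μ := by
    refine (((hI (n - 1)).const_mul (n * p e)).add ((hI n).const_mul (ℓ e))).congr
      (ae_of_all _ fun v => ?_)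
    simp only [Pi.add_apply, f']
    ring
  have hfg' : Integrable (fun v => f v * g' v) μ := by
    have := integrable_pow_mul_gaussian μ hA (n + 1)
      (f := fun v => -(2 * A * ⟪v, e⟫_ℝ) * f v) (by fun_prop) (K := 2 * A * ‖e‖ * ‖p‖ ^ n) fun v => by
      have h1 : ‖(⟪v, e⟫_ℝ : ℂ)‖ ≤ ‖v‖ * ‖e‖ := by
        rw [Complex.norm_real]
        exact norm_inner_le_norm v e
      rw [norm_mul, norm_neg, norm_mul, norm_mul, norm_mul, hexp, mul_one, Complex.norm_two,
        Complex.norm_real, Real.norm_of_nonneg hA.le]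
      calc _ ≤ 2 * A * (‖v‖ * ‖e‖) * (‖p‖ ^ n * ‖v‖ ^ n) := by
            gcongr
            exact hpn n v
        _ = _ := by ring
    refine this.congr (ae_of_all _ fun v => ?_)
    simp only [g']
    ring
  have h := integral_bilinear_hasLineDerivAt_right_eq_neg_left_of_integrable
    (B := ContinuousLinearMap.mul ℝ ℂ) hf'g hfg' hfg (fun v _ => hf v) (fun v _ => hg v)
  simp only [ContinuousLinearMap.mul_apply'] at h
  have e1 : ∫ v, f v * g' v ∂μ = -(2 * A * ∫ v, ⟪v, e⟫_ℝ * p v ^ n *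
      Complex.exp (-A * (‖v‖ : ℂ) ^ 2) * Complex.exp (ℓ v) ∂μ) := by
    rw [← integral_const_mul, ← integral_neg]
    refine integral_congr_ae (ae_of_all _ fun v => ?_)
    simp only [f, g']
    ring
  rw [e1, neg_inj] at h
  rw [h]
  refine integral_congr_ae (ae_of_all _ fun v => ?_)
  simp only [f', g]
  ring

end GaussianFourier

/-- Inversion at `0` gives `C² = 1`, and `C` is positive. -/
theorem IsSelfDual.gaussian_const_eq_one {F : Type*} [RCLike F] [MeasurableSpace F] [BorelSpace F]
    {dx : Measure F} {ψ : AddChar F Circle} (hdual : IsSelfDual ψ dx)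
    {A : ℝ} {C : ℝ} (hC : 0 < C)
    (hint_g : Integrable (fun x : F => Complex.exp (-A * (‖x‖ : ℂ) ^ 2)) dx)
    (h : ∀ y, ∫ x, Complex.exp (-A * (‖x‖ : ℂ) ^ 2) * (ψ (x * y) : ℂ) ∂dx =
      C * Complex.exp (-A * (‖y‖ : ℂ) ^ 2)) : C = 1 := by
  have h1 := hdual (fun x => Complex.exp (-A * (‖x‖ : ℂ) ^ 2)) (by fun_prop) hint_g
    (by simpa only [h] using hint_g.const_mul (C : ℂ)) 0
  have h2 := h 0
  simp only [h, mul_zero, AddChar.map_zero_eq_one, Circle.coe_one, mul_one, neg_zero, norm_zero,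
    Complex.ofReal_zero, ne_eq, OfNat.ofNat_ne_zero, not_false_eq_true, zero_pow,
    Complex.exp_zero] at h1 h2
  rw [integral_const_mul, h2] at h1
  have h3 : C * C = 1 := by exact_mod_cast h1
  nlinarith

/-! ### Characters of archimedean fields -/

section OneParameter

/-- A continuous homomorphism from `ℝ` to the multiplicative group of `ℂ` is an exponential. -/
theorem exists_eq_exp_of_continuous {f : ℝ → ℂ} (hf : Continuous f) (h0 : f 0 = 1)
    (hadd : ∀ a b, f (a + b) = f a * f b) : ∃ c : ℂ, ∀ t : ℝ, f t = Complex.exp (t * c) := by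
  let G : ℝ → ℂ := fun x => ∫ t in (0 : ℝ)..x, f t
  have hG : ∀ x, HasDerivAt G (f x) x := fun x => hf.integral_hasStrictDerivAt 0 x |>.hasDerivAt
  obtain ⟨a, ha⟩ : ∃ a, G a ≠ 0 := by
    by_contra! h
    have h1 : G = fun _ => 0 := funext h
    have h2 := (hG 0).unique (h1 ▸ hasDerivAt_const (0 : ℝ) (0 : ℂ))
    rw [h0] at h2
    exact one_ne_zero h2
  -- Integrating the functional equation expresses `f` through its own primitive, whence `f` is
  -- differentiable.
  have hfG : ∀ x, f x * G a = G (x + a) - G x := fun x => by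
    have h1 : G (x + a) - G x = ∫ t in x..(x + a), f t :=
      intervalIntegral.integral_interval_sub_left (hf.intervalIntegrable _ _)
        (hf.intervalIntegrable _ _)
    have h2 : ∫ t in (0 : ℝ)..a, f (x + t) = ∫ t in x..(x + a), f t := by
      rw [intervalIntegral.integral_comp_add_left, add_zero]
    rw [h1, ← h2, ← intervalIntegral.integral_const_mul]
    simp only [hadd]
  have hfd : ∀ x, HasDerivAt f ((f (x + a) - f x) / G a) x := fun x => by
    have h1 : f = fun x => (G (x + a) - G x) / G a := funext fun x => by
      rw [← hfG, mul_div_cancel_right₀ _ ha]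
    have h2 := ((hG (x + a)).comp_add_const x a).sub (hG x)
    exact (h2.div_const (G a)).congr_of_eventuallyEq (Filter.Eventually.of_forall (congrFun h1))
  set c := (f a - 1) / G a with hc
  have hfd' : ∀ x, HasDerivAt f (f x * c) x := fun x => by
    convert hfd x using 1
    rw [hadd, hc]
    ring
  refine ⟨c, fun t => ?_⟩
  have hE : ∀ x : ℝ, HasDerivAt (fun t : ℝ => f t * Complex.exp (-(t * c))) 0 x := fun x => by
    have h1 : HasDerivAt (fun t : ℝ => -((t : ℂ) * c)) (-c) x := by
      have h2 : HasDerivAt (fun t : ℝ => (t : ℂ) * c) c x := by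
        simpa using (Complex.ofRealCLM.hasDerivAt (x := x)).mul_const c
      exact h2.neg
    refine HasDerivAt.congr_deriv ((hfd' x).mul h1.cexp) ?_
    ring
  have h1 := is_const_of_deriv_eq_zero (fun x => (hE x).differentiableAt) (fun x => (hE x).deriv) t 0
  simp only [h0, Complex.ofReal_zero, zero_mul, neg_zero, Complex.exp_zero, mul_one] at h1
  rw [Complex.exp_neg] at h1
  exact (eq_of_mul_inv_eq_one h1)

theorem eq_of_exp_mul_eq {a b : ℂ} (h : ∀ t : ℝ, Complex.exp (t * a) = Complex.exp (t * b)) :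
    a = b := by
  have hd : ∀ c : ℂ, HasDerivAt (fun t : ℝ => Complex.exp (t * c)) c 0 := fun c => by
    have h1 : HasDerivAt (fun t : ℝ => (t : ℂ) * c) c 0 := by
      simpa using (Complex.ofRealCLM.hasDerivAt (x := (0 : ℝ))).mul_const c
    simpa using h1.cexp
  have h2 := hd b
  rw [← funext h] at h2
  exact (hd a).unique h2

theorem exists_circle_exp {f : ℝ → Circle} (hf : Continuous f) (h0 : f 0 = 1)
    (hadd : ∀ a b, f (a + b) = f a * f b) : ∃ c : ℝ, ∀ t : ℝ, f t = Circle.exp (2 * Real.pi * (c * t)) := by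
  obtain ⟨c, hc⟩ := exists_eq_exp_of_continuous (f := fun t => (f t : ℂ))
    (continuous_circle_coe.comp hf) (by rw [h0, Circle.coe_one])
    (fun a b => by rw [hadd, Circle.coe_mul])
  have hre : c.re = 0 := by
    have h1 := congrArg norm (hc 1)
    rw [Circle.norm_coe, Complex.norm_exp, Complex.ofReal_one, one_mul] at h1
    exact (Real.exp_eq_one_iff _).1 h1.symm
  refine ⟨c.im / (2 * Real.pi), fun t => ?_⟩
  ext
  rw [hc, Circle.coe_exp]
  congr 1
  have : c = c.im * Complex.I := by
    apply Complex.ext <;> simp [hre]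
  have hpi : (Real.pi : ℂ) ≠ 0 := by exact_mod_cast Real.pi_ne_zero
  conv_lhs => rw [this]
  push_cast
  field_simp

end OneParameter

/-! ### Additive and multiplicative characters of `ℝ` -/

section RealCharacters

variable {ψ : AddChar ℝ Circle}

theorem realFreq_spec (hψ : Continuous ψ) (h1 : ψ ≠ 1) (x : ℝ) :
    ψ x = Circle.exp (2 * Real.pi * (realFreq ψ * x)) := by
  have h : ∃ a : ℝˣ, ∀ x : ℝ, ψ x = Circle.exp (2 * Real.pi * (a * x)) := by
    obtain ⟨c, hc⟩ := exists_circle_exp hψ ψ.map_zero_eq_one fun a b => ψ.map_add_eq_mul a b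
    refine ⟨Units.mk0 c fun h0 => h1 ?_, hc⟩
    ext x
    simp [hc, h0]
  exact Classical.epsilon_spec h x

/-- Half a period of `ψ`: the translation on which the decay of the transform rests. -/
theorem exists_real_eq_neg_one (hψ : Continuous ψ) (h1 : ψ ≠ 1) : ∃ w : ℝ, ψ w = -1 := by
  refine ⟨(2 * (realFreq ψ : ℝ))⁻¹, ?_⟩
  rw [realFreq_spec hψ h1]
  have : (realFreq ψ : ℝ) ≠ 0 := Units.ne_zero _
  rw [show 2 * Real.pi * ((realFreq ψ : ℝ) * (2 * (realFreq ψ : ℝ))⁻¹) = Real.pi by field_simp]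
  ext
  simp [Circle.coe_exp]

theorem exists_expUnit_eq {F : Type*} [RCLike F] (ω : Fˣ →ₜ* ℂˣ) :
    ∃ c : ℂ, ∀ t : ℝ, (ω (expUnit F t) : ℂ) = Complex.exp (t * c) :=
  exists_eq_exp_of_continuous
    (Units.continuous_val.comp ((map_continuous ω).comp continuous_expUnit))
    (by rw [expUnit_zero, map_one, Units.val_one])
    (fun a b => by rw [expUnit_add, map_mul, Units.val_mul])

theorem realExponent_spec (ω : ℝˣ →ₜ* ℂˣ) (r : ℝˣ) (hr : 0 < (r : ℝ)) :
    (ω r : ℂ) = ((r : ℝ) : ℂ) ^ realExponent ω := by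
  have h : ∃ w : ℂ, ∀ r : ℝˣ, 0 < (r : ℝ) → (ω r : ℂ) = ((r : ℝ) : ℂ) ^ w := by
    obtain ⟨c, hc⟩ := exists_expUnit_eq ω
    refine ⟨c, fun r hr => ?_⟩
    have h1 : r = expUnit ℝ (Real.log r) := by
      ext
      rw [coe_expUnit, Real.exp_log hr]
      rfl
    rw [Complex.cpow_def_of_ne_zero (by exact_mod_cast hr.ne'), ← Complex.ofReal_log hr.le, ← hc,
      ← h1]
  exact Classical.epsilon_spec h r hr

/-- Exponents are picked by choice, so the identity comes from uniqueness of `w` in `r ↦ r ^ w`. -/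
theorem realExponent_inv (ω : ℝˣ →ₜ* ℂˣ) : realExponent ω⁻¹ = -realExponent ω := by
  refine eq_of_exp_mul_eq fun t => ?_
  have hp : 0 < ((expUnit ℝ t : ℝˣ) : ℝ) := Real.exp_pos t
  have h1 := realExponent_spec ω⁻¹ _ hp
  have h2 := realExponent_spec ω _ hp
  have h3 : ((ω⁻¹ (expUnit ℝ t) : ℂˣ) : ℂ) = (ω (expUnit ℝ t) : ℂ)⁻¹ :=
    Units.val_inv_eq_inv_val _
  rw [Complex.cpow_def_of_ne_zero (by exact_mod_cast hp.ne'), ← Complex.ofReal_log hp.le] at h1 h2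
  have h4 : Real.log ((expUnit ℝ t : ℝˣ) : ℝ) = t := Real.log_exp t
  rw [h4] at h1 h2
  rw [← h1, h3, h2, mul_neg, Complex.exp_neg]

theorem realParity_inv (ω : ℝˣ →ₜ* ℂˣ) : realParity ω⁻¹ = realParity ω := by
  have h : ω⁻¹ (-1) = 1 ↔ ω (-1) = 1 := inv_eq_one
  simp only [realParity, h]

theorem coe_neg_one_eq (ω : ℝˣ →ₜ* ℂˣ) : (ω (-1) : ℂ) = (-1) ^ realParity ω := by
  have h : (ω (-1) : ℂ) ^ 2 = 1 := by
    rw [← Units.val_pow_eq_pow_val, ← map_pow]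
    simp
  rw [realParity]
  split_ifs with h1
  · rw [h1]
    simp
  · rw [pow_one]
    exact (sq_eq_one_iff.1 h).resolve_left fun h2 => h1 (Units.ext h2)

theorem real_char_eq (ω : ℝˣ →ₜ* ℂˣ) (y : ℝˣ) :
    (ω y : ℂ) = ((SignType.sign (y : ℝ) : ℝ) : ℂ) ^ realParity ω *
      (‖(y : ℝ)‖ : ℂ) ^ realExponent ω := by
  rcases lt_or_gt_of_ne y.ne_zero with h | h
  · have h1 : y = -1 * -y := by simp
    have h2 : 0 < ((-y : ℝˣ) : ℝ) := by simpa using h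
    conv_lhs => rw [h1, map_mul, Units.val_mul, coe_neg_one_eq, realExponent_spec ω _ h2]
    rw [sign_neg h, Real.norm_eq_abs, abs_of_neg h]
    simp
  · rw [realExponent_spec ω y h, sign_pos h, Real.norm_eq_abs, abs_of_pos h]
    simp

end RealCharacters

/-! ### Additive and multiplicative characters of `ℂ` -/

section ComplexCharacters

variable {ψ : AddChar ℂ Circle}

theorem complexFreq_spec (hψ : Continuous ψ) (h1 : ψ ≠ 1) (z : ℂ) :
    ψ z = Circle.exp (2 * Real.pi * (2 * (complexFreq ψ * z).re)) := by
  have h : ∃ a : ℂˣ, ∀ z : ℂ, ψ z = Circle.exp (2 * Real.pi * (2 * (a * z).re)) := by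
    obtain ⟨α, hα⟩ := exists_circle_exp (f := fun t => ψ (t : ℂ))
      (hψ.comp Complex.continuous_ofReal) (by simp)
      fun a b => by rw [Complex.ofReal_add, ψ.map_add_eq_mul]
    obtain ⟨β, hβ⟩ := exists_circle_exp (f := fun t => ψ ((t : ℂ) * Complex.I))
      (hψ.comp (Complex.continuous_ofReal.mul continuous_const)) (by simp)
      fun a b => by rw [Complex.ofReal_add, add_mul, ψ.map_add_eq_mul]
    -- With `α`, `β` the frequencies along `1` and `i`, this is the number `b` for which `2 Re(bz) =
    -- α Re z + β Im z`.
    have hz : ∀ z : ℂ, ψ z = Circle.exp (2 * Real.pi * (2 * ((⟨α / 2, -β / 2⟩ : ℂ) * z).re)) := by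
      intro z
      conv_lhs => rw [← Complex.re_add_im z]
      rw [ψ.map_add_eq_mul, hα, hβ, ← Circle.exp_add, Complex.mul_re]
      congr 1
      ring
    refine ⟨Units.mk0 ⟨α / 2, -β / 2⟩ fun h0 => h1 ?_, hz⟩
    ext z
    simp [hz, h0]
  exact Classical.epsilon_spec h z

theorem exists_complex_eq_neg_one (hψ : Continuous ψ) (h1 : ψ ≠ 1) : ∃ w : ℂ, ψ w = -1 := by
  refine ⟨(4 * (complexFreq ψ : ℂ))⁻¹, ?_⟩
  rw [complexFreq_spec hψ h1]
  have h0 : (complexFreq ψ : ℂ) ≠ 0 := Units.ne_zero _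
  have h2 : (complexFreq ψ : ℂ) * (4 * (complexFreq ψ : ℂ))⁻¹ = ((1 / 4 : ℝ) : ℂ) := by
    push_cast
    field_simp
  rw [h2, Complex.ofReal_re, show 2 * Real.pi * (2 * (1 / 4)) = Real.pi by ring]
  ext
  simp [Circle.coe_exp]

theorem sq_cpow_eq_exp {r : ℝ} (hr : 0 < r) (w : ℂ) :
    ((r ^ 2 : ℝ) : ℂ) ^ w = Complex.exp (Real.log r * (2 * w)) := by
  rw [Complex.cpow_def_of_ne_zero (by exact_mod_cast (pow_pos hr 2).ne'),
    ← Complex.ofReal_log (by positivity), Real.log_pow]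
  congr 1
  push_cast
  ring

theorem complexExponent_spec (ω : ℂˣ →ₜ* ℂˣ) (z : ℂˣ) {r : ℝ} (hr : 0 < r) (hz : (z : ℂ) = r) :
    (ω z : ℂ) = ((r ^ 2 : ℝ) : ℂ) ^ complexExponent ω := by
  have h : ∃ w : ℂ, ∀ (z : ℂˣ) (r : ℝ), 0 < r → (z : ℂ) = r →
      (ω z : ℂ) = ((r ^ 2 : ℝ) : ℂ) ^ w := by
    obtain ⟨c, hc⟩ := exists_expUnit_eq ω
    refine ⟨c / 2, fun z r hr hz => ?_⟩
    have h1 : z = expUnit ℂ (Real.log r) := by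
      ext
      rw [coe_expUnit, Real.exp_log hr, hz]
      rfl
    rw [sq_cpow_eq_exp hr, mul_div_cancel₀ _ two_ne_zero, ← hc, ← h1]
  exact Classical.epsilon_spec h z r hr hz

theorem complexExponent_inv (ω : ℂˣ →ₜ* ℂˣ) : complexExponent ω⁻¹ = -complexExponent ω := by
  have h : 2 * complexExponent ω⁻¹ = -(2 * complexExponent ω) := by
    refine eq_of_exp_mul_eq fun t => ?_
    have h1 := complexExponent_spec ω⁻¹ (expUnit ℂ t) (Real.exp_pos t) rfl
    have h2 := complexExponent_spec ω (expUnit ℂ t) (Real.exp_pos t) rfl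
    have h3 : ((ω⁻¹ (expUnit ℂ t) : ℂˣ) : ℂ) = (ω (expUnit ℂ t) : ℂ)⁻¹ :=
      Units.val_inv_eq_inv_val _
    rw [sq_cpow_eq_exp (Real.exp_pos t), Real.log_exp] at h1 h2
    rw [← h1, h3, h2, mul_neg, Complex.exp_neg]
  linear_combination (1 / 2 : ℂ) * h

/-- The unit complex number `exp(it)`. -/
noncomputable def angleUnit (t : ℝ) : ℂˣ := Circle.toUnits (Circle.exp t)

theorem coe_angleUnit (t : ℝ) : (angleUnit t : ℂ) = Complex.exp (t * Complex.I) := rfl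

theorem continuous_angleUnit : Continuous angleUnit := by
  rw [Units.isEmbedding_val₀.continuous_iff]
  change Continuous fun t : ℝ => Complex.exp (t * Complex.I)
  fun_prop

theorem angleUnit_add (a b : ℝ) : angleUnit (a + b) = angleUnit a * angleUnit b := by
  ext
  rw [Units.val_mul, coe_angleUnit, coe_angleUnit, coe_angleUnit, ← Complex.exp_add]
  congr 1
  push_cast
  ring

theorem exists_angleUnit_eq {z : ℂˣ} (hz : ‖(z : ℂ)‖ = 1) : ∃ t, z = angleUnit t := by
  refine ⟨Complex.arg z, ?_⟩
  ext
  rw [coe_angleUnit]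
  conv_lhs => rw [← Complex.norm_mul_exp_arg_mul_I (z : ℂ), hz]
  simp

/-- The map `t ↦ ω(exp(it))` is an exponential of period `2π`, so its exponent is an integral
multiple of `i`. -/
theorem complexWeight_spec (ω : ℂˣ →ₜ* ℂˣ) {z : ℂˣ} (hz : ‖(z : ℂ)‖ = 1) :
    ω z = z ^ complexWeight ω := by
  have h : ∃ n : ℤ, ∀ z : ℂˣ, ‖(z : ℂ)‖ = 1 → ω z = z ^ n := by
    have h00 : angleUnit 0 = 1 := by
      ext
      simp [coe_angleUnit]
    obtain ⟨c, hc⟩ := exists_eq_exp_of_continuous (f := fun t => (ω (angleUnit t) : ℂ))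
      (Units.continuous_val.comp ((map_continuous ω).comp continuous_angleUnit))
      (by rw [h00, map_one, Units.val_one])
      (fun a b => by rw [angleUnit_add, map_mul, Units.val_mul])
    have h2 : angleUnit (2 * Real.pi) = 1 := by
      ext
      rw [coe_angleUnit]
      push_cast
      exact Complex.exp_two_pi_mul_I
    have h3 := hc (2 * Real.pi)
    rw [h2, map_one, Units.val_one, eq_comm, Complex.exp_eq_one_iff] at h3
    obtain ⟨n, hn⟩ := h3
    have hcn : c = n * Complex.I := by
      have hpi : (Real.pi : ℂ) ≠ 0 := by exact_mod_cast Real.pi_ne_zero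
      push_cast at hn
      refine mul_left_cancel₀ (mul_ne_zero two_ne_zero hpi) ?_
      rw [hn]
      ring
    refine ⟨n, fun z hz => ?_⟩
    obtain ⟨t, rfl⟩ := exists_angleUnit_eq hz
    ext
    rw [hc, Units.val_zpow_eq_zpow_val, coe_angleUnit, ← Complex.exp_int_mul, hcn]
    congr 1
    ring
  exact Classical.epsilon_spec h z hz

theorem norm_angleUnit (t : ℝ) : ‖(angleUnit t : ℂ)‖ = 1 := by
  rw [coe_angleUnit, Complex.norm_exp_ofReal_mul_I]

theorem complexWeight_inv (ω : ℂˣ →ₜ* ℂˣ) : complexWeight ω⁻¹ = -complexWeight ω := by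
  have h : ((complexWeight ω⁻¹ : ℤ) : ℂ) * Complex.I = ((-complexWeight ω : ℤ) : ℂ) * Complex.I := by
    refine eq_of_exp_mul_eq fun t => ?_
    have h1 := complexWeight_spec ω⁻¹ (norm_angleUnit t)
    have h2 := complexWeight_spec ω (norm_angleUnit t)
    have h3 : ω⁻¹ (angleUnit t) = (ω (angleUnit t))⁻¹ := rfl
    rw [h3, h2, ← zpow_neg] at h1
    have h4 := congrArg (fun u : ℂˣ => (u : ℂ)) h1
    simp only [Units.val_zpow_eq_zpow_val, coe_angleUnit, ← Complex.exp_int_mul] at h4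
    convert h4.symm using 2 <;> ring
  exact_mod_cast mul_right_cancel₀ Complex.I_ne_zero h

theorem complex_char_eq (ω : ℂˣ →ₜ* ℂˣ) (y : ℂˣ) :
    (ω y : ℂ) = ((y : ℂ) / ‖(y : ℂ)‖) ^ complexWeight ω *
      (‖(y : ℂ)‖ : ℂ) ^ (2 * complexExponent ω) := by
  have hy := norm_unit_pos y
  have hyc : (‖(y : ℂ)‖ : ℂ) ≠ 0 := by exact_mod_cast hy.ne'
  set r : ℂˣ := Units.mk0 (‖(y : ℂ)‖ : ℂ) hyc with hr
  have h1 : y = y / r * r := by simp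
  have h2 : ‖((y / r : ℂˣ) : ℂ)‖ = 1 := by
    rw [Units.val_div_eq_div_val, norm_div, hr, Units.val_mk0, Complex.norm_real, norm_norm,
      div_self hy.ne']
  conv_lhs => rw [h1, map_mul, Units.val_mul, complexWeight_spec ω h2,
    complexExponent_spec ω r hy rfl, Units.val_zpow_eq_zpow_val, Units.val_div_eq_div_val]
  rw [sq_cpow_eq_exp hy, Complex.cpow_def_of_ne_zero hyc, ← Complex.ofReal_log hy.le]
  rfl

end ComplexCharacters

/-! ### The local functional equation over `ℝ` -/

section Real

variable {ψ : AddChar ℝ Circle} {dx : Measure ℝ} [dx.IsAddHaarMeasure]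

theorem hasRealExponent_real (ω : ℝˣ →ₜ* ℂˣ) : HasRealExponent ω (realExponent ω).re := by
  intro y
  have hy := norm_unit_pos y
  have h1 : ‖((SignType.sign (y : ℝ) : ℝ) : ℂ)‖ = 1 := by
    rcases lt_or_gt_of_ne y.ne_zero with h | h
    · simp [sign_neg h]
    · simp [sign_pos h]
  rw [real_char_eq, norm_mul, norm_pow, h1, one_pow, one_mul,
    Complex.norm_cpow_eq_rpow_re_of_pos hy, absF_rpow, Module.finrank_self, Nat.cast_one, one_mul]

/-- The width `π|b|`, for `ψ` of frequency `b`, is the one for which the Gaussian is its own Fourier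
transform. -/
theorem real_fourier_gaussian (hψ : Continuous ψ) (h1 : ψ ≠ 1) (hdual : IsSelfDual ψ dx) (y : ℝ) :
    ∫ x : ℝ, Complex.exp (-(Real.pi * |(realFreq ψ : ℝ)| : ℝ) * (‖x‖ : ℂ) ^ 2) * (ψ (x * y) : ℂ) ∂dx =
      Complex.exp (-(Real.pi * |(realFreq ψ : ℝ)| : ℝ) * (‖y‖ : ℂ) ^ 2) := by
  have hb : 0 < |(realFreq ψ : ℝ)| := abs_pos.2 (Units.ne_zero _)
  set b : ℝ := ((realFreq ψ : ℝˣ) : ℝ) with hb'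
  have hA : 0 < Real.pi * |b| := mul_pos Real.pi_pos hb
  obtain ⟨C, hC, h⟩ := exists_fourier_gaussian dx hA
  have h2 : ∀ y : ℝ, ∫ x : ℝ, Complex.exp (-(Real.pi * |b| : ℝ) * (‖x‖ : ℂ) ^ 2) *
      (ψ (x * y) : ℂ) ∂dx = C * Complex.exp (-(Real.pi * |b| : ℝ) * (‖y‖ : ℂ) ^ 2) := fun y => by
    convert h (b * y) using 1
    · refine integral_congr_ae (ae_of_all _ fun x => ?_)
      beta_reduce
      rw [realFreq_spec hψ h1, Circle.coe_exp, ← hb']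
      congr 4
      simp
      ring
    · congr 2
      rw [norm_mul, Real.norm_eq_abs b, ← Complex.ofReal_pow, ← Complex.ofReal_neg,
        ← Complex.ofReal_mul, ← Complex.ofReal_neg]
      congr 1
      field_simp
  have hint_g : Integrable (fun x : ℝ => Complex.exp (-(Real.pi * |b| : ℝ) * (‖x‖ : ℂ) ^ 2)) dx := by
    simpa using integrable_pow_mul_gaussian dx hA 0 (f := fun _ => 1) continuous_const (K := 1)
      (by simp)
  rw [h2, hdual.gaussian_const_eq_one hC hint_g h2, Complex.ofReal_one, one_mul]

/-- Integration by parts converts the factor `x` into the derivative of `ψ(xy)`; the sign is what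
remains of `b / |b|`. -/
theorem real_fourier_id_mul_gaussian (hψ : Continuous ψ) (h1 : ψ ≠ 1) (hdual : IsSelfDual ψ dx)
    (y : ℝ) :
    ∫ x : ℝ, x * Complex.exp (-(Real.pi * |(realFreq ψ : ℝ)| : ℝ) * (‖x‖ : ℂ) ^ 2) *
        (ψ (x * y) : ℂ) ∂dx =
      Complex.I * (SignType.sign (realFreq ψ : ℝ) : ℝ) *
        (y * Complex.exp (-(Real.pi * |(realFreq ψ : ℝ)| : ℝ) * (‖y‖ : ℂ) ^ 2)) := by
  have hb : 0 < |(realFreq ψ : ℝ)| := abs_pos.2 (Units.ne_zero _)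
  have hG := real_fourier_gaussian hψ h1 hdual y
  have hspec := realFreq_spec hψ h1
  set b : ℝ := ((realFreq ψ : ℝˣ) : ℝ) with hb'
  have hA : 0 < Real.pi * |b| := mul_pos Real.pi_pos hb
  let ℓ : ℝ →L[ℝ] ℂ := (ContinuousLinearMap.id ℝ ℝ).smulRight (2 * Real.pi * (b * y) * Complex.I)
  have hℓ : ∀ x, ℓ x = (2 * Real.pi * (b * (x * y)) : ℝ) * Complex.I := fun x => by
    simp [ℓ]
    ring
  have h2 := integral_inner_mul_gaussian dx hA (p := 0) (ℓ := ℓ)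
    (fun x => by rw [hℓ]; simp) 0 1
  have hE : ∀ x, Complex.exp (ℓ x) = (ψ (x * y) : ℂ) := fun x => by
    rw [hspec, Circle.coe_exp, hℓ]
  simp only [hE, Nat.cast_zero, zero_mul, pow_zero, one_mul, zero_add, mul_one, mul_assoc] at h2
  rw [integral_const_mul, hG] at h2
  have h3 : ∀ x : ℝ, (inner ℝ x 1 : ℝ) = x := fun x => by simp
  simp only [h3] at h2
  simp only [mul_assoc]
  have hA' : (2 * (Real.pi * |b| : ℝ) : ℂ) ≠ 0 := by exact_mod_cast (mul_pos two_pos hA).ne'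
  refine mul_left_cancel₀ hA' ?_
  rw [mul_assoc, h2, hℓ]
  have h4 : ((b : ℝ) : ℂ) = (|b| : ℝ) * (SignType.sign b : ℝ) := by
    rw [← Complex.ofReal_mul, abs_mul_sign]
  push_cast
  rw [h4]
  ring

/-- The factor `x ^ N` gives the Gaussian the parity of `ω`. The Fourier constant `(i sgn b)^N`
supplies `i^N` and the sign of `ω(b)`; the powers of `|b|` in the width supply the rest of `ε`. -/
theorem hasZetaRatio_real (hψ : Continuous ψ) (h1 : ψ ≠ 1) (hdual : IsSelfDual ψ dx) (s : ℂ)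
    (ω : ℝˣ →ₜ* ℂˣ) (hL : realL ω⁻¹ s ≠ 0) :
    HasZetaRatio ψ dx s ω (1 / Module.finrank ℝ ℝ) (gammaFactor realL (realEps ψ) ω (1 - s)) := by
  have hb : 0 < |(realFreq ψ : ℝ)| := abs_pos.2 (Units.ne_zero _)
  have hA : 0 < Real.pi * |(realFreq ψ : ℝ)| := mul_pos Real.pi_pos hb
  have hN : realParity ω = 0 ∨ realParity ω = 1 := by
    rw [realParity]
    split_ifs <;> simp
  have hsgn : ∀ y : ℝˣ, (((y : ℝ) : ℂ)) * ((SignType.sign (y : ℝ) : ℝ) : ℂ) = (‖(y : ℝ)‖ : ℂ) :=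
    fun y => by rw [← Complex.ofReal_mul, self_mul_sign, Real.norm_eq_abs]
  have hsgn' : ∀ y : ℝˣ, ((SignType.sign (y : ℝ) : ℝ) : ℂ)⁻¹ = ((SignType.sign (y : ℝ) : ℝ) : ℂ) := by
    intro y
    rcases lt_or_gt_of_ne y.ne_zero with h | h
    · simp [sign_neg h]
    · simp [sign_pos h]
  have hn0 : ∀ y : ℝˣ, (‖(y : ℝ)‖ : ℂ) ≠ 0 := fun y => by exact_mod_cast (norm_unit_pos y).ne'
  have hπ : (Real.pi : ℂ) ≠ 0 := by exact_mod_cast Real.pi_ne_zero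
  have hbn : ((|(realFreq ψ : ℝ)| : ℝ) : ℂ) ≠ 0 := by exact_mod_cast hb.ne'
  rw [realL, realExponent_inv, realParity_inv, Complex.Gammaℝ_def] at hL
  have key := hasZetaRatio_gaussian (dx := dx) (ψ := ψ) (ω := ω) (w := realExponent ω)
    (N := realParity ω) hA (hasRealExponent_real ω) (P := fun x => (x : ℂ) ^ realParity ω)
    (P' := fun x => (x : ℂ) ^ realParity ω)
    (C := (Complex.I * (SignType.sign (realFreq ψ : ℝ) : ℝ)) ^ realParity ω)
    (fun y => ?_) (fun y => ?_) ?_ (fun y => ?_) s ?_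
  · refine (congrArg (HasZetaRatio ψ dx s ω (1 / Module.finrank ℝ ℝ)) ?_).mpr key
    rw [gammaFactor, realEps, realL, realL, realExponent_inv, realParity_inv, Complex.Gammaℝ_def,
      Complex.Gammaℝ_def, absF_cpow, real_char_eq, Module.finrank_self, Nat.cast_one]
    simp only [one_mul, Complex.ofReal_mul]
    rw [Complex.mul_cpow_ofReal_nonneg Real.pi_pos.le hb.le,
      Complex.mul_cpow_ofReal_nonneg Real.pi_pos.le hb.le, Real.norm_eq_abs]
    set N := realParity ω
    set w := realExponent ω
    set b := ((|(realFreq ψ : ℝ)| : ℝ) : ℂ) with hbc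
    have e1 : b ^ ((N + (w + 1 - s)) / 2) =
        b ^ w * b ^ (1 - s - 1 / 2) * b ^ ((N + (s - w)) / 2) := by
      rw [← Complex.cpow_add _ _ hbn, ← Complex.cpow_add _ _ hbn]
      congr 1
      ring
    have e2 : (Real.pi : ℂ) ^ (-(1 - (1 - s) + -w + N) / 2) =
        ((Real.pi : ℂ) ^ ((N + (s - w)) / 2))⁻¹ := by
      rw [← Complex.cpow_neg]
      congr 1
      ring
    have e3 : (Real.pi : ℂ) ^ (-(1 - s + w + N) / 2) =
        ((Real.pi : ℂ) ^ ((N + (w + 1 - s)) / 2))⁻¹ := by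
      rw [← Complex.cpow_neg]
      congr 1
      ring
    have e4 : (1 - (1 - s) + -w + N) / 2 = (N + (s - w)) / 2 := by ring
    have e5 : (1 - s + w + N) / 2 = (N + (w + 1 - s)) / 2 := by ring
    have hp1 : (Real.pi : ℂ) ^ ((N + (w + 1 - s)) / 2) ≠ 0 := by simp [Complex.cpow_eq_zero_iff, hπ]
    have hp2 : (Real.pi : ℂ) ^ ((N + (s - w)) / 2) ≠ 0 := by simp [Complex.cpow_eq_zero_iff, hπ]
    have hp3 : b ^ ((N + (s - w)) / 2) ≠ 0 := by simp [Complex.cpow_eq_zero_iff, hbn]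
    rw [e1, e2, e3, e4, e5, mul_pow]
    field_simp
  · rw [real_char_eq, ← mul_assoc, ← mul_pow, hsgn, Module.finrank_self, Nat.cast_one, one_mul,
      Complex.cpow_add _ _ (hn0 y), Complex.cpow_natCast]
  · rw [real_char_eq, mul_inv, ← inv_pow, hsgn', ← mul_assoc, ← mul_pow, hsgn, Module.finrank_self,
      Nat.cast_one, one_mul, Complex.cpow_sub _ _ (hn0 y), Complex.cpow_natCast, div_eq_mul_inv]
  · refine integrable_pow_mul_gaussian dx hA (realParity ω) (K := 1) (by fun_prop) fun x => ?_
    rw [norm_pow, Complex.norm_real, one_mul]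
  · rcases hN with hN | hN
    · simp only [hN, pow_zero, one_mul]
      exact real_fourier_gaussian hψ h1 hdual y
    · simp only [hN, pow_one]
      exact real_fourier_id_mul_gaussian hψ h1 hdual y
  · convert right_ne_zero_of_mul hL using 2
    rw [Module.finrank_self]
    push_cast
    ring

end Real

/-! ### The local functional equation over `ℂ` -/

section Complex

variable {ψ : AddChar ℂ Circle} {dx : Measure ℂ} [dx.IsAddHaarMeasure]

theorem hasRealExponent_complex (ω : ℂˣ →ₜ* ℂˣ) : HasRealExponent ω (complexExponent ω).re := by
  intro y
  have hy := norm_unit_pos y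
  have h1 : ‖(y : ℂ) / ‖(y : ℂ)‖‖ = 1 := by
    rw [norm_div, Complex.norm_real, norm_norm, div_self hy.ne']
  rw [complex_char_eq, norm_mul, norm_zpow, h1, one_zpow, one_mul,
    Complex.norm_cpow_eq_rpow_re_of_pos hy, absF_rpow, Complex.finrank_real_complex]
  simp

theorem complex_fourier_gaussian (hψ : Continuous ψ) (h1 : ψ ≠ 1) (hdual : IsSelfDual ψ dx) (y : ℂ) :
    ∫ x : ℂ, Complex.exp (-(2 * Real.pi * ‖(complexFreq ψ : ℂ)‖ : ℝ) * (‖x‖ : ℂ) ^ 2) *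
        (ψ (x * y) : ℂ) ∂dx =
      Complex.exp (-(2 * Real.pi * ‖(complexFreq ψ : ℂ)‖ : ℝ) * (‖y‖ : ℂ) ^ 2) := by
  have hb : 0 < ‖(complexFreq ψ : ℂ)‖ := norm_unit_pos _
  set b : ℂ := ((complexFreq ψ : ℂˣ) : ℂ) with hb'
  have hA : 0 < 2 * Real.pi * ‖b‖ := mul_pos Real.two_pi_pos hb
  obtain ⟨C, hC, h⟩ := exists_fourier_gaussian dx hA
  have h2 : ∀ y : ℂ, ∫ x : ℂ, Complex.exp (-(2 * Real.pi * ‖b‖ : ℝ) * (‖x‖ : ℂ) ^ 2) *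
      (ψ (x * y) : ℂ) ∂dx = C * Complex.exp (-(2 * Real.pi * ‖b‖ : ℝ) * (‖y‖ : ℂ) ^ 2) := fun y => by
    -- The real inner product with this vector is `2 Re(bxy)`, the phase of `ψ(xy)`.
    convert h (2 * (starRingEnd ℂ) (b * y)) using 1
    · refine integral_congr_ae (ae_of_all _ fun x => ?_)
      beta_reduce
      rw [complexFreq_spec hψ h1, Circle.coe_exp, ← hb', Complex.inner]
      congr 4
      simp
      ring
    · congr 2
      rw [norm_mul, RCLike.norm_conj, norm_mul, Complex.norm_two, ← Complex.ofReal_pow,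
        ← Complex.ofReal_neg, ← Complex.ofReal_mul, ← Complex.ofReal_neg]
      congr 1
      field_simp
  have hint_g : Integrable (fun x : ℂ => Complex.exp (-(2 * Real.pi * ‖b‖ : ℝ) * (‖x‖ : ℂ) ^ 2)) dx := by
    simpa using integrable_pow_mul_gaussian dx hA 0 (f := fun _ => 1) continuous_const (K := 1)
      (by simp)
  rw [h2, hdual.gaussian_const_eq_one hC hint_g h2, Complex.ofReal_one, one_mul]

/-- The Fourier transform of `p ^ n` times a Gaussian, where `p` is `z` or its conjugate, and `ε` is
chosen such that the Wirtinger derivation `∂/∂x + ε ∂/∂y` kills `p`. -/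
theorem complex_fourier_pow_mul_gaussian (hψ : Continuous ψ) (h1 : ψ ≠ 1) (hdual : IsSelfDual ψ dx)
    {p : ℂ →L[ℝ] ℂ} {ε : ℂ} (hp : ∀ z, z.re + ε * z.im = p z) (hε : p 1 + ε * p Complex.I = 0)
    (n : ℕ) (y : ℂ) :
    ∫ x : ℂ, p x ^ n * Complex.exp (-(2 * Real.pi * ‖(complexFreq ψ : ℂ)‖ : ℝ) * (‖x‖ : ℂ) ^ 2) *
        (ψ (x * y) : ℂ) ∂dx =
      (Complex.I * ((complexFreq ψ * y).re - ε * (complexFreq ψ * y).im) /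
          ‖(complexFreq ψ : ℂ)‖) ^ n *
        Complex.exp (-(2 * Real.pi * ‖(complexFreq ψ : ℂ)‖ : ℝ) * (‖y‖ : ℂ) ^ 2) := by
  have hb : 0 < ‖(complexFreq ψ : ℂ)‖ := norm_unit_pos _
  have hG := complex_fourier_gaussian hψ h1 hdual y
  have hspec := complexFreq_spec hψ h1
  set b : ℂ := ((complexFreq ψ : ℂˣ) : ℂ) with hb'
  have hA : 0 < 2 * Real.pi * ‖b‖ := mul_pos Real.two_pi_pos hb
  let ℓ : ℂ →L[ℝ] ℂ := (Complex.reCLM.comp ((ContinuousLinearMap.mul ℝ ℂ) (b * y))).smulRight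
    (4 * Real.pi * Complex.I)
  have hℓ : ∀ x, ℓ x = (2 * Real.pi * (2 * (b * (x * y)).re) : ℝ) * Complex.I := fun x => by
    have h2 : ℓ x = ((b * y * x).re : ℝ) • (4 * Real.pi * Complex.I) := rfl
    rw [h2, Complex.real_smul, show b * y * x = b * (x * y) by ring]
    push_cast
    ring
  have hE : ∀ x, Complex.exp (ℓ x) = (ψ (x * y) : ℂ) := fun x => by
    rw [hspec, Circle.coe_exp, hℓ]
  have hℓ0 : ∀ x, (ℓ x).re = 0 := fun x => by rw [hℓ]; simp
  set A := 2 * Real.pi * ‖b‖ with hA'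
  have hpn : ∀ k v, ‖p v ^ k‖ ≤ ‖p‖ ^ k * ‖v‖ ^ k := fun k v => by
    rw [norm_pow, ← mul_pow]
    exact pow_le_pow_left₀ (norm_nonneg _) (p.le_opNorm v) k
  have hexp : ∀ v, ‖Complex.exp (ℓ v)‖ = 1 := fun v => by
    rw [Complex.norm_exp, hℓ0, Real.exp_zero]
  have hI : ∀ (k : ℕ) (q : ℂ → ℂ) (K : ℝ), Continuous q → (∀ v, ‖q v‖ ≤ K * ‖v‖ ^ k) →
      Integrable (fun v => q v * Complex.exp (-A * (‖v‖ : ℂ) ^ 2) * Complex.exp (ℓ v)) dx :=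
    fun k q K hq hK => by
      refine (integrable_pow_mul_gaussian dx hA k (f := fun v => q v * Complex.exp (ℓ v))
        (by fun_prop) (K := K) fun v => ?_).congr (ae_of_all _ fun v => by ring)
      rw [norm_mul, hexp, mul_one]
      exact hK v
  -- Add the integrations by parts in the directions `1` and `i`, the latter weighted by `ε`: by
  -- `hp` the left sides combine to one more factor `p`, and by `hε` the terms from differentiating
  -- `p ^ n` cancel.
  have hrec : ∀ n : ℕ,
      2 * A * ∫ v, p v ^ (n + 1) * Complex.exp (-A * (‖v‖ : ℂ) ^ 2) * Complex.exp (ℓ v) ∂dx =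
      (ℓ 1 + ε * ℓ Complex.I) *
        ∫ v, p v ^ n * Complex.exp (-A * (‖v‖ : ℂ) ^ 2) * Complex.exp (ℓ v) ∂dx := by
    intro n
    have h2 := integral_inner_mul_gaussian dx hA (p := p) hℓ0 n 1
    have h3 := integral_inner_mul_gaussian dx hA (p := p) hℓ0 n Complex.I
    have i1 : ∀ e : ℂ, Integrable (fun v => (inner ℝ v e : ℝ) * p v ^ n *
        Complex.exp (-A * (‖v‖ : ℂ) ^ 2) * Complex.exp (ℓ v)) dx := fun e =>
      hI (n + 1) (fun v => (inner ℝ v e : ℝ) * p v ^ n) (‖e‖ * ‖p‖ ^ n) (by fun_prop) fun v => by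
        rw [norm_mul, Complex.norm_real]
        calc _ ≤ (‖v‖ * ‖e‖) * (‖p‖ ^ n * ‖v‖ ^ n) := by
              gcongr
              · exact norm_inner_le_norm v e
              · exact hpn n v
          _ = _ := by ring
    have i2 : ∀ k, Integrable (fun v => p v ^ k * Complex.exp (-A * (‖v‖ : ℂ) ^ 2) *
        Complex.exp (ℓ v)) dx := fun k => hI k (fun v => p v ^ k) (‖p‖ ^ k) (by fun_prop) (hpn k)
    have i3 : ∀ e : ℂ, Integrable (fun v => (n * p v ^ (n - 1) * p e + p v ^ n * ℓ e) *
        Complex.exp (-A * (‖v‖ : ℂ) ^ 2) * Complex.exp (ℓ v)) dx := fun e => by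
      refine (((i2 (n - 1)).const_mul (n * p e)).add ((i2 n).const_mul (ℓ e))).congr
        (ae_of_all _ fun v => ?_)
      simp only [Pi.add_apply]
      ring
    have e1 : ∫ v, p v ^ (n + 1) * Complex.exp (-A * (‖v‖ : ℂ) ^ 2) * Complex.exp (ℓ v) ∂dx =
        (∫ v, (inner ℝ v (1 : ℂ) : ℝ) * p v ^ n * Complex.exp (-A * (‖v‖ : ℂ) ^ 2) *
          Complex.exp (ℓ v) ∂dx) +
        ε * ∫ v, (inner ℝ v Complex.I : ℝ) * p v ^ n * Complex.exp (-A * (‖v‖ : ℂ) ^ 2) *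
          Complex.exp (ℓ v) ∂dx := by
      rw [← integral_const_mul, ← integral_add (i1 1) ((i1 Complex.I).const_mul ε)]
      refine integral_congr_ae (ae_of_all _ fun v => ?_)
      have h4 : (inner ℝ v (1 : ℂ) : ℝ) = v.re := by simp [Complex.inner]
      have h5 : (inner ℝ v Complex.I : ℝ) = v.im := by simp [Complex.inner]
      beta_reduce
      rw [h4, h5, pow_succ, ← hp v]
      ring
    have e2 : (ℓ 1 + ε * ℓ Complex.I) *
        ∫ v, p v ^ n * Complex.exp (-A * (‖v‖ : ℂ) ^ 2) * Complex.exp (ℓ v) ∂dx =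
        (∫ v, (n * p v ^ (n - 1) * p 1 + p v ^ n * ℓ 1) *
          Complex.exp (-A * (‖v‖ : ℂ) ^ 2) * Complex.exp (ℓ v) ∂dx) +
        ε * ∫ v, (n * p v ^ (n - 1) * p Complex.I + p v ^ n * ℓ Complex.I) *
          Complex.exp (-A * (‖v‖ : ℂ) ^ 2) * Complex.exp (ℓ v) ∂dx := by
      rw [← integral_const_mul, ← integral_const_mul,
        ← integral_add (i3 1) ((i3 Complex.I).const_mul ε)]
      refine integral_congr_ae (ae_of_all _ fun v => ?_)
      beta_reduce
      linear_combination (-(n * p v ^ (n - 1) * Complex.exp (-A * (‖v‖ : ℂ) ^ 2) *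
        Complex.exp (ℓ v))) * hε
    rw [e1, e2, ← h2, ← h3]
    ring
  have hA0 : (2 * A : ℂ) ≠ 0 := by exact_mod_cast (mul_pos two_pos hA).ne'
  have hfac : ℓ 1 + ε * ℓ Complex.I =
      2 * A * (Complex.I * ((b * y).re - ε * (b * y).im) / ‖b‖) := by
    have hbc : (‖b‖ : ℂ) ≠ 0 := by exact_mod_cast hb.ne'
    have h6 : (b * (Complex.I * y)).re = -(b * y).im := by
      simp
      ring
    rw [hℓ, hℓ, h6, hA', one_mul]
    push_cast
    field_simp
    ring
  simp only [← hE] at hG ⊢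
  induction n with
  | zero => simpa only [pow_zero, one_mul] using hG
  | succ n ih =>
    refine mul_left_cancel₀ hA0 ?_
    rw [hrec n, ih, hfac]
    ring

/-- The zeta ratio for a character whose angular part is inverse to `p ^ N / ‖p‖ ^ N`. -/
theorem hasZetaRatio_complex_of_eq (hψ : Continuous ψ) (h1 : ψ ≠ 1) (hdual : IsSelfDual ψ dx) (s : ℂ)
    (ω : ℂˣ →ₜ* ℂˣ) (hL : complexL ω⁻¹ s ≠ 0) {p p' : ℂ →L[ℝ] ℂ} {ε c : ℂ}
    (hp : ∀ z, z.re + ε * z.im = p z) (hε : p 1 + ε * p Complex.I = 0) (hpn : ∀ z, ‖p z‖ = ‖z‖)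
    (hp' : ∀ y : ℂ, (complexFreq ψ * y).re - ε * (complexFreq ψ * y).im = c * p' y)
    (h : ∀ y : ℂˣ, p y ^ (complexWeight ω).natAbs * ((y : ℂ) / ‖(y : ℂ)‖) ^ complexWeight ω =
      (‖(y : ℂ)‖ : ℂ) ^ (complexWeight ω).natAbs)
    (h' : ∀ y : ℂˣ, p' y ^ (complexWeight ω).natAbs * (((y : ℂ) / ‖(y : ℂ)‖) ^ complexWeight ω)⁻¹ =
      (‖(y : ℂ)‖ : ℂ) ^ (complexWeight ω).natAbs)
    (hc : (c / ‖(complexFreq ψ : ℂ)‖) ^ (complexWeight ω).natAbs =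
      ((complexFreq ψ : ℂ) / ‖(complexFreq ψ : ℂ)‖) ^ complexWeight ω) :
    HasZetaRatio ψ dx s ω (1 / Module.finrank ℝ ℂ)
      (gammaFactor complexL (complexEps ψ) ω (1 - s)) := by
  have hb : 0 < ‖(complexFreq ψ : ℂ)‖ := norm_unit_pos _
  have hA : 0 < 2 * Real.pi * ‖(complexFreq ψ : ℂ)‖ := mul_pos Real.two_pi_pos hb
  have hn0 : ∀ y : ℂˣ, (‖(y : ℂ)‖ : ℂ) ≠ 0 := fun y => by exact_mod_cast (norm_unit_pos y).ne'
  have hπ : ((2 * Real.pi : ℝ) : ℂ) ≠ 0 := by exact_mod_cast Real.two_pi_pos.ne'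
  have hbn := hn0 (complexFreq ψ)
  rw [complexL, complexExponent_inv, complexWeight_inv, Int.natAbs_neg, Complex.Gammaℂ_def] at hL
  have key := hasZetaRatio_gaussian (dx := dx) (ψ := ψ) (ω := ω) (w := complexExponent ω)
    (N := (complexWeight ω).natAbs) hA (hasRealExponent_complex ω)
    (P := fun x => p x ^ (complexWeight ω).natAbs)
    (P' := fun x => p' x ^ (complexWeight ω).natAbs)
    (C := (Complex.I * (c / ‖(complexFreq ψ : ℂ)‖)) ^ (complexWeight ω).natAbs)
    (fun y => ?_) (fun y => ?_) ?_ (fun y => ?_) s ?_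
  · refine (congrArg (HasZetaRatio ψ dx s ω (1 / Module.finrank ℝ ℂ)) ?_).mpr key
    rw [gammaFactor, complexEps, complexL, complexL, complexExponent_inv, complexWeight_inv,
      Int.natAbs_neg, Complex.Gammaℂ_def, Complex.Gammaℂ_def, absF_cpow, complex_char_eq,
      Complex.finrank_real_complex, mul_pow Complex.I, hc]
    simp only [Complex.ofReal_mul (2 * Real.pi)]
    rw [Complex.mul_cpow_ofReal_nonneg Real.two_pi_pos.le hb.le,
      Complex.mul_cpow_ofReal_nonneg Real.two_pi_pos.le hb.le]
    have h2π : (2 * Real.pi : ℂ) = ((2 * Real.pi : ℝ) : ℂ) := by push_cast; rfl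
    rw [h2π, Nat.cast_ofNat]
    set N : ℂ := ((complexWeight ω).natAbs : ℂ)
    set w := complexExponent ω
    set b := ((‖(complexFreq ψ : ℂ)‖ : ℝ) : ℂ) with hbc
    set u := ((complexFreq ψ : ℂ) / b) ^ complexWeight ω
    have e1 : b ^ ((N + 2 * (w + 1 - s)) / 2) =
        b ^ (2 * w) * b ^ (2 * (1 - s - 1 / 2)) * b ^ ((N + 2 * (s - w)) / 2) := by
      rw [← Complex.cpow_add _ _ hbn, ← Complex.cpow_add _ _ hbn]
      congr 1
      ring
    have e2 : ((2 * Real.pi : ℝ) : ℂ) ^ (-(1 - (1 - s) + -w + N / 2)) =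
        (((2 * Real.pi : ℝ) : ℂ) ^ ((N + 2 * (s - w)) / 2))⁻¹ := by
      rw [← Complex.cpow_neg]
      congr 1
      ring
    have e3 : ((2 * Real.pi : ℝ) : ℂ) ^ (-(1 - s + w + N / 2)) =
        (((2 * Real.pi : ℝ) : ℂ) ^ ((N + 2 * (w + 1 - s)) / 2))⁻¹ := by
      rw [← Complex.cpow_neg]
      congr 1
      ring
    have e4 : 1 - (1 - s) + -w + N / 2 = (N + 2 * (s - w)) / 2 := by ring
    have e5 : 1 - s + w + N / 2 = (N + 2 * (w + 1 - s)) / 2 := by ring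
    have hp1 : ((2 * Real.pi : ℝ) : ℂ) ^ ((N + 2 * (w + 1 - s)) / 2) ≠ 0 := by
      simp [Complex.cpow_eq_zero_iff, Real.pi_ne_zero]
    have hp2 : ((2 * Real.pi : ℝ) : ℂ) ^ ((N + 2 * (s - w)) / 2) ≠ 0 := by
      simp [Complex.cpow_eq_zero_iff, Real.pi_ne_zero]
    have hp3 : b ^ ((N + 2 * (s - w)) / 2) ≠ 0 := by simp [Complex.cpow_eq_zero_iff, hbn]
    rw [e1, e2, e3, e4, e5]
    field_simp
  · rw [complex_char_eq, ← mul_assoc, h, Complex.finrank_real_complex, Nat.cast_ofNat,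
      Complex.cpow_add _ _ (hn0 y), Complex.cpow_natCast]
  · rw [complex_char_eq, mul_inv, ← mul_assoc, h', Complex.finrank_real_complex, Nat.cast_ofNat,
      Complex.cpow_sub _ _ (hn0 y), Complex.cpow_natCast, div_eq_mul_inv]
  · refine integrable_pow_mul_gaussian dx hA (complexWeight ω).natAbs (K := 1) (by fun_prop)
      fun x => ?_
    rw [norm_pow, hpn, one_mul]
  · rw [complex_fourier_pow_mul_gaussian hψ h1 hdual hp hε, hp', ← mul_assoc (_ ^ _), ← mul_pow]
    congr 2
    ring
  · convert right_ne_zero_of_mul hL using 2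
    rw [Complex.finrank_real_complex]
    push_cast
    ring

/-- The polynomial must cancel the angular part of `ω`, so it is a power of `z̄` or of `z` according
to the sign of the weight; the Fourier transform interchanges the two. -/
theorem hasZetaRatio_complex (hψ : Continuous ψ) (h1 : ψ ≠ 1) (hdual : IsSelfDual ψ dx) (s : ℂ)
    (ω : ℂˣ →ₜ* ℂˣ) (hL : complexL ω⁻¹ s ≠ 0) :
    HasZetaRatio ψ dx s ω (1 / Module.finrank ℝ ℂ)
      (gammaFactor complexL (complexEps ψ) ω (1 - s)) := by
  have hn0 : ∀ y : ℂˣ, (‖(y : ℂ)‖ : ℂ) ≠ 0 := fun y => by exact_mod_cast (norm_unit_pos y).ne'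
  have hconj : ∀ y : ℂˣ, ((y : ℂ) / ‖(y : ℂ)‖)⁻¹ = (starRingEnd ℂ) y / ‖(y : ℂ)‖ := fun y => by
    have h2 := Complex.mul_conj' (y : ℂ)
    have := hn0 y
    have := y.ne_zero
    field_simp
    rw [← h2]
  have hmul : ∀ y : ℂˣ, (y : ℂ) * ((starRingEnd ℂ) y / ‖(y : ℂ)‖) = ‖(y : ℂ)‖ := fun y => by
    have := hn0 y
    rw [← mul_div_assoc, Complex.mul_conj', pow_two, mul_div_assoc, div_self this, mul_one]
  have hmul' : ∀ y : ℂˣ, (starRingEnd ℂ) y * ((y : ℂ) / ‖(y : ℂ)‖) = ‖(y : ℂ)‖ := fun y => by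
    rw [mul_div_left_comm]
    exact hmul y
  rcases Int.natAbs_eq (complexWeight ω) with hn | hn
  · have hz : ∀ u : ℂ, u ^ complexWeight ω = u ^ (complexWeight ω).natAbs := fun u => by
      conv_lhs => rw [hn]
      exact zpow_natCast _ _
    refine hasZetaRatio_complex_of_eq hψ h1 hdual s ω hL (p := Complex.conjCLE)
      (p' := ContinuousLinearMap.id ℝ ℂ) (ε := -Complex.I) (c := complexFreq ψ) (fun z => ?_) ?_
      (fun z => ?_) (fun y => ?_) (fun y => ?_) (fun y => ?_) ?_
    · apply Complex.ext <;> simp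
    · simp
    · simp
    · apply Complex.ext <;> simp
    · rw [hz, ← mul_pow]
      exact congrArg (· ^ _) (hmul' y)
    · rw [hz, ← inv_pow, hconj, ← mul_pow]
      exact congrArg (· ^ _) (hmul y)
    · rw [hz]
  · have hz : ∀ u : ℂ, u ^ complexWeight ω = u⁻¹ ^ (complexWeight ω).natAbs := fun u => by
      conv_lhs => rw [hn]
      rw [zpow_neg, zpow_natCast, inv_pow]
    refine hasZetaRatio_complex_of_eq hψ h1 hdual s ω hL (p := ContinuousLinearMap.id ℝ ℂ)
      (p' := Complex.conjCLE) (ε := Complex.I) (c := (starRingEnd ℂ) (complexFreq ψ)) (fun z => ?_)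
      ?_ (fun z => ?_) (fun y => ?_) (fun y => ?_) (fun y => ?_) ?_
    · apply Complex.ext <;> simp
    · simp
    · simp
    · apply Complex.ext <;> simp
      ring
    · rw [hz, hconj, ← mul_pow]
      exact congrArg (· ^ _) (hmul y)
    · rw [hz, ← inv_pow, inv_inv, ← mul_pow]
      exact congrArg (· ^ _) (hmul' y)
    · rw [hz, hconj]

end Complex

/-! ### The functional equation on tori over archimedean fields -/

section Assembly

/-- The existence of real powers of points is kept as the hypothesis `hroot`: it is automatic over
`ℂ` and needs the interpolation argument over `ℝ`. -/
theorem mellinGammaIdentity_of_hasZetaRatio {F : Type*} [RCLike F] [MeasurableSpace F]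
    [BorelSpace F] {ψ : AddChar F Circle} {dx : Measure F} [dx.IsAddHaarMeasure] (hψ : Continuous ψ)
    {w : F} (hw : ψ w = -1) {A : Type*} [CommRing A] [HopfAlgebra F A] (hT : IsTorus F A)
    {E : Type*} [Field E] [Algebra F E] {n : ℕ} (S : SplitCoords F A E n) {ι : E →+* ℂ}
    (hι : ∀ x : F, ‖ι (algebraMap F E x)‖ = ‖x‖)
    (hroot : ∀ (t : RatPoints F A) (τ : ℝ), ∃ p : RatPoints F A, ∀ η,
      ‖ι (S.z η p)‖ = ‖ι (S.z η t)‖ ^ τ)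
    {lam : A →ₐc[F] AddMonoidAlgebra F ℤ} (hlam : IsNontrivialCochar lam)
    (μ : Measure (RatPoints F A)) [μ.IsHaarMeasure] (s : ℂ) {Φ : RatPoints F A → ℂ}
    (hΦ : IsSchwartzArch Φ) {L ε : (Fˣ →ₜ* ℂˣ) → ℂ → ℂ}
    (hZ : ∀ ω : Fˣ →ₜ* ℂˣ, L ω⁻¹ s ≠ 0 →
      HasZetaRatio ψ dx s ω (1 / Module.finrank ℝ F) (gammaFactor L ε ω (1 - s))) :
    MellinGammaIdentity L ε ψ dx lam μ s Φ := by
  have := hT.locallyCompactSpace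
  have := hT.secondCountableTopology
  have hL := S.isLogMap hι hT.exists_generators hroot
  obtain ⟨M, hM, hl⟩ := S.logCoords_cochar hι hlam
  have hdec := hΦ.exists_norm_le (S := S) hι
  have hlip := hΦ.exists_norm_sub_le hι hL hl
  obtain ⟨θ, m, hm, hθ, hθl⟩ := hT.exists_logChar exists_unit_infinite_order hlam
  have hθ₀ : θ.1 (cocharPoints lam (expUnit F 1)) ≠ 0 := by
    rw [hθl, log_absF, norm_expUnit, Real.log_exp, mul_one]
    exact_mod_cast mul_ne_zero hm (finrank_rclike_pos (F := F)).ne'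
  have hconv := fun t => hL.integrable_convolution_arch (dx := dx) hψ hl hM hΦ.continuous hdec s t
  have hmel : ∀ χ, MellinConverges μ Φ χ := fun χ =>
    hL.mellinConverges hΦ.continuous.aestronglyMeasurable hdec χ
  refine ⟨hconv, hmel, fun χ hχ => ?_⟩
  exact hasMellinValue_equivFourier hψ arch_logChar (cocharPoints lam) s Φ hconv hmel
    (one_div_pos.2 finrank_rclike_pos)
    (fun χ r hr h0 h1 => hL.mellinConverges_equivFourier hψ hw hl hM hΦ.continuous hdec hlip s χ r
      hr h0 h1) θ hθ (expUnit F 1) hθ₀ χ (hZ _ hχ)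

theorem mellinGammaIdentity_real {ψ : AddChar ℝ Circle} {dx : Measure ℝ} [dx.IsAddHaarMeasure]
    (hψ : Continuous ψ) (h1 : ψ ≠ 1) (hdual : IsSelfDual ψ dx)
    {A : Type v} [CommRing A] [HopfAlgebra ℝ A] (hT : IsTorus ℝ A)
    {lam : A →ₐc[ℝ] AddMonoidAlgebra ℝ ℤ} (hlam : IsNontrivialCochar lam)
    (μ : Measure (RatPoints ℝ A)) [μ.IsHaarMeasure] (s : ℂ) {Φ : RatPoints ℝ A → ℂ}
    (hΦ : IsSchwartzArch Φ) : MellinGammaIdentity realL (realEps ψ) ψ dx lam μ s Φ := by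
  obtain ⟨E, _, _, _, _, n, ⟨e⟩⟩ := id hT
  obtain ⟨w, hw⟩ := exists_real_eq_neg_one hψ h1
  -- The splitting field comes without an absolute value; an embedding in `ℂ` provides one.
  let ι : E →ₐ[ℝ] ℂ := IsAlgClosed.lift
  have hι : ∀ x : ℝ, (ι : E →+* ℂ) (algebraMap ℝ E x) = x := fun x => ι.commutes x
  exact mellinGammaIdentity_of_hasZetaRatio hψ hw hT (SplitCoords.ofEquiv e) (ι := ι)
    (fun x => by rw [hι, Complex.norm_real])
    (SplitCoords.exists_root_real _ hι) hlam μ s hΦ fun ω hω =>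
      hasZetaRatio_real hψ h1 hdual s ω hω

theorem mellinGammaIdentity_complex {ψ : AddChar ℂ Circle} {dx : Measure ℂ} [dx.IsAddHaarMeasure]
    (hψ : Continuous ψ) (h1 : ψ ≠ 1) (hdual : IsSelfDual ψ dx)
    {A : Type v} [CommRing A] [HopfAlgebra ℂ A] (hT : IsTorus ℂ A)
    {lam : A →ₐc[ℂ] AddMonoidAlgebra ℂ ℤ} (hlam : IsNontrivialCochar lam)
    (μ : Measure (RatPoints ℂ A)) [μ.IsHaarMeasure] (s : ℂ) {Φ : RatPoints ℂ A → ℂ}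
    (hΦ : IsSchwartzArch Φ) : MellinGammaIdentity complexL (complexEps ψ) ψ dx lam μ s Φ := by
  obtain ⟨E, _, _, _, _, n, ⟨e⟩⟩ := id hT
  obtain ⟨w, hw⟩ := exists_complex_eq_neg_one hψ h1
  let ι : E →ₐ[ℂ] ℂ := IsAlgClosed.lift
  have hι : ∀ x : ℂ, ‖(ι : E →+* ℂ) (algebraMap ℂ E x)‖ = ‖x‖ := fun x =>
    congrArg norm (ι.commutes x)
  exact mellinGammaIdentity_of_hasZetaRatio hψ hw hT (SplitCoords.ofEquiv e) (ι := ι) hι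
    -- A finite extension of `ℂ` is `ℂ` itself, so the descent condition is vacuous.
    (fun t τ => SplitCoords.exists_root_of_mem_range _ hι t τ fun a =>
      IsAlgClosed.algebraMap_bijective_of_isIntegral.2 _) hlam μ s hΦ fun ω hω =>
      hasZetaRatio_complex hψ h1 hdual s ω hω

end Assembly

theorem mainTheorem7 :
    -- nonarchimedean local fields
    (∀ (F : Type u) [Field F] [ValuativeRel F] [TopologicalSpace F] [IsNonarchimedeanLocalField F]
      [MeasurableSpace F] [BorelSpace F]
      (ψ : AddChar F Circle) (dx : Measure F) [dx.IsAddHaarMeasure],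
      Continuous ψ → HasConductorIntegers ψ → IsSelfDual ψ dx →
      ∀ (A : Type v) [CommRing A] [HopfAlgebra F A], IsTorus F A →
      ∀ (lam : A →ₐc[F] AddMonoidAlgebra F ℤ), IsNontrivialCochar lam →
      ∀ (μ : Measure (RatPoints F A)) [μ.IsHaarMeasure] (s : ℂ) (Φ : RatPoints F A → ℂ),
        IsSchwartzNonarch Φ →
        MellinGammaIdentity nonarchL (nonarchEps ψ dx) ψ dx lam μ s Φ) ∧
    -- the field of real numbers
    (∀ (ψ : AddChar ℝ Circle) (dx : Measure ℝ) [dx.IsAddHaarMeasure],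
      Continuous ψ → ψ ≠ 1 → IsSelfDual ψ dx →
      ∀ (A : Type v) [CommRing A] [HopfAlgebra ℝ A], IsTorus ℝ A →
      ∀ (lam : A →ₐc[ℝ] AddMonoidAlgebra ℝ ℤ), IsNontrivialCochar lam →
      ∀ (μ : Measure (RatPoints ℝ A)) [μ.IsHaarMeasure] (s : ℂ) (Φ : RatPoints ℝ A → ℂ),
        IsSchwartzArch Φ →
        MellinGammaIdentity realL (realEps ψ) ψ dx lam μ s Φ) ∧
    -- the field of complex numbers
    (∀ (ψ : AddChar ℂ Circle) (dx : Measure ℂ) [dx.IsAddHaarMeasure],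
      Continuous ψ → ψ ≠ 1 → IsSelfDual ψ dx →
      ∀ (A : Type v) [CommRing A] [HopfAlgebra ℂ A], IsTorus ℂ A →
      ∀ (lam : A →ₐc[ℂ] AddMonoidAlgebra ℂ ℤ), IsNontrivialCochar lam →
      ∀ (μ : Measure (RatPoints ℂ A)) [μ.IsHaarMeasure] (s : ℂ) (Φ : RatPoints ℂ A → ℂ),
        IsSchwartzArch Φ →
        MellinGammaIdentity complexL (complexEps ψ) ψ dx lam μ s Φ) := by
  refine ⟨?_, ?_, ?_⟩
  · intro F _ _ _ _ _ _ ψ dx _ hψ hcond hdual A _ _ hT lam hlam μ _ s Φ hΦ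
    exact mellinGammaIdentity_nonarch hψ hcond hdual hT hlam μ s hΦ
  · intro ψ dx _ hψ h1 hdual A _ _ hT lam hlam μ _ s Φ hΦ
    exact mellinGammaIdentity_real hψ h1 hdual hT hlam μ s hΦ
  · intro ψ dx _ hψ h1 hdual A _ _ hT lam hlam μ _ s Φ hΦ
    exact mellinGammaIdentity_complex hψ h1 hdual hT hlam μ s hΦ
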